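/- Let $k$ be a perfect field of characteristic $p>2$. All gradings are by nonnegative integers and $k$ is ungraded. Let $\mathrm{Alg}_k$ be the category of graded-commutative $k$-algebras (with degree-preserving homomorphisms) and $\mathrm{alg}_k$ its full subcategory of finite-dimensional algebras. An affine group is a representable functor $\mathrm{Alg}_k\to\mathrm{Ab}$; it is represented by a graded bicommutative Hopf algebra $H$. Let $\mathrm{AbSch}_k$ be the category of affine groups and natural transformations, and $\mathrm{AbSch}_k^p$ the full subcategory of affine groups with values in abelian pro-$p$-groups, i.e. of cofiltered limits of affine groups all of whose values are abelian $p$-groups (not necessarily finite). A formal group is an ind-representable functor $\mathrm{alg}_k\to\mathrm{Ab}$; let $\mathrm{FGps}_k$ be the category of formal groups. A formal group $G$ is represented by a pro-finite-dimensional complete Hopf algebra $\mathcal O_G$; its Cartier dual $G^*$ is the affine group represented by the continuous dual Hopf algebra $\mathrm{Hom}(\mathcal O_G,k)$. A graded Hopf algebra $H$ is unipotent if every $x\in H$ has, for some $n\geq 1$, zero image under the iterated comultiplication $H\to H^{\otimes n}\to (H/k\cdot 1)^{\otimes n}$. It is of multiplicative type if, for some algebraic field extension $K/k$, the Hopf algebra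 $K\otimes_k H$ is isomorphic to the group algebra $K[\Gamma]$ of an abelian group $\Gamma$. An affine group is unipotent, of multiplicative type, evenly graded or ungraded if its representing Hopf algebra is unipotent, of multiplicative type, concentrated in even degrees, or concentrated in degree $0$. A formal group is connected (resp. étale, evenly graded, ungraded) if its Cartier dual is unipotent (resp. of multiplicative type, evenly graded, ungraded). Consider the following full subcategories. - $\mathrm{AbSch}_k^{\mathrm{odd}}$: affine groups represented by an exterior algebra on primitive generators of odd degree; - $\mathrm{AbSch}_k^{u}$: evenly graded unipotent affine groups; - $\mathrm{AbSch}_k^{m}$: ungraded affine groups of multiplicative type, and $\mathrm{AbSch}_k^{m,p}=\mathrm{AbSch}_k^{m}\cap\mathrm{AbSch}_k^{p}$; - $\mathrm{FGps}_k^{\mathrm{odd}}$: formal groups represented by an exterior pro-algebra on primitive generators of odd degree, i.e. filtered colimits of formal groups each represented by a finite-dimensional exterior Hopf algebra on primitive generators of odd degree; - $\mathrm{FGps}_k^{c}$: evenly graded connected formal groups; - $\mathrm{FGps}_k^{e}$: ungraded étale formal groups. Then $\mathrm{AbSch}_k^{\mathrm{odd}}$ and $\mathrm{AbSch}_k^u$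 are contained in $\mathrm{AbSch}_k^p$, and there are equivalences of categories $$\mathrm{AbSch}_k\simeq \mathrm{AbSch}_k^{\mathrm{odd}}\times \mathrm{AbSch}_k^{u}\times \mathrm{AbSch}_k^{m},\qquad \mathrm{AbSch}_k^p\simeq \mathrm{AbSch}_k^{\mathrm{odd}}\times \mathrm{AbSch}_k^{u}\times \mathrm{AbSch}_k^{m,p},$$ $$\mathrm{FGps}_k\simeq \mathrm{FGps}_k^{\mathrm{odd}}\times \mathrm{FGps}_k^{c}\times \mathrm{FGps}_k^{e},$$ in each case with inverse the product functor $(G_1,G_2,G_3)\mapsto G_1\times G_2\times G_3$. -/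

import Mathlib

open CategoryTheory CategoryTheory.Limits
open scoped TensorProduct

universe u

noncomputable section

/-! ## Graded-commutative algebras -/

/-- A nonnegatively graded, graded-commutative algebra over the (ungraded) field `k`. -/
structure GrAlg (k : Type u) [Field k] where
  carrier : Type u
  [ring : Ring carrier]
  [algebra : Algebra k carrier]
  grading : ℕ → Submodule k carrier
  [graded : GradedAlgebra grading]
  graded_comm : ∀ (i j : ℕ) (a b : carrier), a ∈ grading i → b ∈ grading j →
    a * b = (-1) ^ (i * j) * (b * a)

attribute [instance] GrAlg.ring GrAlg.algebra GrAlg.graded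

namespace GrAlg

variable {k : Type u} [Field k]

/-- Morphisms: algebra homomorphisms which preserve the degree. -/
@[ext]
structure Hom (A B : GrAlg k) where
  toAlgHom : A.carrier →ₐ[k] B.carrier
  map_mem : ∀ (n : ℕ) (a : A.carrier), a ∈ A.grading n → toAlgHom a ∈ B.grading n

instance : Category.{u} (GrAlg k) where
  Hom A B := Hom A B
  id A := ⟨AlgHom.id k A.carrier, fun _ _ h => h⟩
  comp f g := ⟨g.toAlgHom.comp f.toAlgHom, fun n a h => g.map_mem n _ (f.map_mem n a h)⟩

end GrAlg

/-- The graded-commutative algebras which are finite-dimensional over `k`, as a property. -/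
def isFiniteGrAlg (k : Type u) [Field k] : ObjectProperty (GrAlg k) :=
  fun A => Module.Finite k A.carrier

/-- The category of finite-dimensional graded-commutative `k`-algebras. -/
abbrev FinGrAlg (k : Type u) [Field k] := (isFiniteGrAlg k).FullSubcategory

instance (k : Type u) [Field k] (R : FinGrAlg k) : Module.Finite k R.obj.carrier := R.property

/-! ## Graded Hopf algebras -/

/-- A graded, graded-commutative and graded-cocommutative Hopf algebra over `k`.  The tensor square
of a graded algebra carries the multiplication with Koszul signs
`(a ⊗ b) (a' ⊗ b') = (-1) ^ (|b| |a'|) (a a' ⊗ b b')`, which is Mathlib's graded tensor product,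
and `GradedTensorProduct.comm` is the symmetry `a ⊗ b ↦ (-1) ^ (|a| |b|) (b ⊗ a)`. -/
structure GrHopf (k : Type u) [Field k] extends GrAlg k where
  [coalgebra : Coalgebra k carrier]
  comul_mem : ∀ (n : ℕ) (a : carrier), a ∈ grading n →
    (Coalgebra.comul a : carrier ⊗[k] carrier) ∈
      ⨆ (i : ℕ) (j : ℕ) (_ : i + j = n),
        LinearMap.range (TensorProduct.map (grading i).subtype (grading j).subtype)
  counit_eq_zero : ∀ (n : ℕ) (a : carrier), a ∈ grading n → n ≠ 0 →
    (Coalgebra.counit a : k) = 0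
  comul_one : (Coalgebra.comul (1 : carrier) : carrier ⊗[k] carrier) = 1 ⊗ₜ[k] 1
  comul_mul : ∀ a b : carrier,
    GradedTensorProduct.of k grading grading (Coalgebra.comul (a * b)) =
      GradedTensorProduct.of k grading grading (Coalgebra.comul a) *
        GradedTensorProduct.of k grading grading (Coalgebra.comul b)
  counit_one : (Coalgebra.counit (1 : carrier) : k) = 1
  counit_mul : ∀ a b : carrier,
    (Coalgebra.counit (a * b) : k) = Coalgebra.counit a * Coalgebra.counit b
  graded_cocomm : ∀ a : carrier,
    GradedTensorProduct.comm grading grading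
        (GradedTensorProduct.of k grading grading (Coalgebra.comul a)) =
      GradedTensorProduct.of k grading grading (Coalgebra.comul a)
  antipode : carrier →ₗ[k] carrier
  antipode_mem : ∀ (n : ℕ) (a : carrier), a ∈ grading n → antipode a ∈ grading n
  mul_antipode_left : ∀ a : carrier,
    LinearMap.mul' k carrier (TensorProduct.map antipode LinearMap.id (Coalgebra.comul a)) =
      algebraMap k carrier (Coalgebra.counit a)
  mul_antipode_right : ∀ a : carrier,
    LinearMap.mul' k carrier (TensorProduct.map LinearMap.id antipode (Coalgebra.comul a)) =
      algebraMap k carrier (Coalgebra.counit a)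

attribute [instance] GrHopf.coalgebra

namespace GrHopf

variable {k : Type u} [Field k]

/-- The underlying graded algebra is concentrated in even degrees. -/
def IsEven (H : GrHopf k) : Prop := ∀ n : ℕ, Odd n → H.grading n = ⊥

/-- The underlying graded algebra is concentrated in degree zero ("ungraded"). -/
def IsUngraded (H : GrHopf k) : Prop := ∀ n : ℕ, n ≠ 0 → H.grading n = ⊥

/-- The cokernel `H / k·1` of the unit map. -/
abbrev UnitCoker (H : GrHopf k) : Type u := H.carrier ⧸ Submodule.span k {(1 : H.carrier)}

/-- The `(n-1)`-fold iterated comultiplication followed by the projection to the `n`-th tensor power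
of the cokernel of the unit map; the tensor power is regarded as the degree `n` part of the tensor
algebra, where it sits as a direct summand. -/
def iteratedReducedComul (H : GrHopf k) : ℕ → H.carrier →ₗ[k] TensorAlgebra k H.UnitCoker
  | 0 => Algebra.linearMap k (TensorAlgebra k H.UnitCoker) ∘ₗ Coalgebra.counit
  | n + 1 =>
      LinearMap.mul' k (TensorAlgebra k H.UnitCoker) ∘ₗ
        TensorProduct.map
          (TensorAlgebra.ι k ∘ₗ (Submodule.span k {(1 : H.carrier)}).mkQ)
          (iteratedReducedComul H n) ∘ₗ
        Coalgebra.comul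

/-- Conilpotency (unipotency): every element is annihilated by some iterate of the reduced
comultiplication. -/
def IsConilpotent (H : GrHopf k) : Prop :=
  ∀ x : H.carrier, ∃ n : ℕ, H.iteratedReducedComul (n + 1) x = 0

/-- After some algebraic extension of the base field, the Hopf algebra becomes isomorphic to the
group algebra of an abelian group. -/
def IsMultiplicative (H : GrHopf k) : Prop :=
  ∃ (K : Type u) (_ : Field K) (_ : Algebra k K) (_ : Algebra.IsAlgebraic k K)
    (Γ : Type u) (_ : CommGroup Γ)
    (e : (K ⊗[k] H.carrier) ≃ₗc[K] MonoidAlgebra K Γ),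
    e 1 = 1 ∧ ∀ x y, e (x * y) = e x * e y

/-- The Hopf algebra is a primitively generated exterior algebra on generators of odd degree: there
is a subspace `V`, spanned by elements of odd degree and consisting of primitive elements, such that
the inclusion of `V` extends to an isomorphism from the exterior algebra of `V`. -/
def IsOddExterior (H : GrHopf k) : Prop :=
  ∃ V : Submodule k H.carrier,
    (V ≤ ⨆ (n : ℕ) (_ : Odd n), V ⊓ H.grading n) ∧
    (∀ v ∈ V, (Coalgebra.comul v : H.carrier ⊗[k] H.carrier) = v ⊗ₜ[k] 1 + 1 ⊗ₜ[k] v) ∧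
    ∃ hV : ∀ v : V, V.subtype v * V.subtype v = 0,
      Function.Bijective (ExteriorAlgebra.lift k ⟨V.subtype, hV⟩)

/-- The abelian-group-valued functor `G`, defined on a category of graded algebras, is represented
by the Hopf algebra `H`: naturally `G(R) = Hom(H, R)`, and addition in `G(R)` is the convolution
`f + g = mult ∘ (f ⊗ g) ∘ Δ`. -/
def Represents {E : Type*} [Category.{u} E] (ι : E ⥤ GrAlg k) (H : GrHopf k)
    (G : E ⥤ AddCommGrpCat.{u}) : Prop :=
  ∃ e : ∀ R : E, G.obj R ≃ (H.toGrAlg ⟶ ι.obj R),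
    (∀ (R S : E) (f : R ⟶ S) (x : G.obj R), e S (G.map f x) = e R x ≫ ι.map f) ∧
    ∀ (R : E) (x y : G.obj R) (h : H.carrier),
      (e R (x + y)).toAlgHom h =
        LinearMap.mul' k (ι.obj R).carrier
          (TensorProduct.map (e R x).toAlgHom.toLinearMap (e R y).toAlgHom.toLinearMap
            (Coalgebra.comul h))

end GrHopf

/-! ## Affine groups -/

section Affine

variable (k : Type u) [Field k]

/-- Affine groups: abelian-group-valued functors on graded-commutative algebras which are
representable. -/
def isAffineGroup : ObjectProperty (GrAlg k ⥤ AddCommGrpCat.{u}) :=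
  fun G => (G ⋙ forget AddCommGrpCat.{u}).IsCorepresentable

/-- Affine groups with values in abelian pro-`p`-groups: cofiltered limits of affine groups all of
whose values are abelian `p`-groups (not necessarily finite). -/
def isPAdicAffineGroup (p : ℕ) : ObjectProperty (GrAlg k ⥤ AddCommGrpCat.{u}) :=
  fun G => isAffineGroup k G ∧
    ∃ (J : Type u) (_ : SmallCategory J) (_ : IsCofiltered J)
      (D : J ⥤ GrAlg k ⥤ AddCommGrpCat.{u}) (c : Cone D),
      (∀ j, isAffineGroup k (D.obj j)) ∧
      (∀ (j : J) (R : GrAlg k) (x : (D.obj j).obj R), ∃ n : ℕ, p ^ n • x = 0) ∧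
      Nonempty (IsLimit c) ∧ Nonempty (c.pt ≅ G)

/-- Odd affine groups. -/
def isOddAffine : ObjectProperty (GrAlg k ⥤ AddCommGrpCat.{u}) :=
  fun G => isAffineGroup k G ∧
    ∃ H : GrHopf k, H.Represents (𝟭 (GrAlg k)) G ∧ H.IsOddExterior

/-- Evenly graded, unipotent affine groups. -/
def isUnipotentAffine : ObjectProperty (GrAlg k ⥤ AddCommGrpCat.{u}) :=
  fun G => isAffineGroup k G ∧
    ∃ H : GrHopf k, H.Represents (𝟭 (GrAlg k)) G ∧ H.IsEven ∧ H.IsConilpotent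

/-- Ungraded affine groups of multiplicative type. -/
def isMultiplicativeAffine : ObjectProperty (GrAlg k ⥤ AddCommGrpCat.{u}) :=
  fun G => isAffineGroup k G ∧
    ∃ H : GrHopf k, H.Represents (𝟭 (GrAlg k)) G ∧ H.IsUngraded ∧ H.IsMultiplicative

/-- Ungraded affine groups of multiplicative type which are `p`-adic. -/
def isPAdicMultiplicativeAffine (p : ℕ) : ObjectProperty (GrAlg k ⥤ AddCommGrpCat.{u}) :=
  fun G => isMultiplicativeAffine k G ∧ isPAdicAffineGroup k p G

end Affine

/-! ## Formal groups -/

section Formal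

variable {k : Type u} [Field k]

/-- The comultiplication on the dual of a finite-dimensional algebra: the transpose of the
multiplication. -/
def dualComul (R : Type u) [Ring R] [Algebra k R] [Module.Finite k R] :
    Module.Dual k R →ₗ[k] Module.Dual k R ⊗[k] Module.Dual k R :=
  (TensorProduct.dualDistribEquiv k R R).symm.toLinearMap ∘ₗ (LinearMap.mul' k R).dualMap

/-- Homomorphisms of graded coalgebras from the dual `R^∨` of a finite-dimensional graded algebra to
a graded Hopf algebra `C`.  These are the transposes of the continuous homomorphisms of graded
algebras from the pro-finite-dimensional algebra `C^∨` to `R`. -/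
@[ext]
structure DualCoalgHom (R : FinGrAlg k) (C : GrHopf k) where
  toLin : Module.Dual k R.obj.carrier →ₗ[k] C.carrier
  map_mem : ∀ (n : ℕ) (ξ : Module.Dual k R.obj.carrier),
    (∀ m : ℕ, m ≠ n → ∀ r ∈ R.obj.grading m, ξ r = 0) → toLin ξ ∈ C.grading n
  comul_apply : ∀ ξ : Module.Dual k R.obj.carrier,
    (Coalgebra.comul (toLin ξ) : C.carrier ⊗[k] C.carrier) =
      TensorProduct.map toLin toLin (dualComul R.obj.carrier ξ)
  counit_apply : ∀ ξ : Module.Dual k R.obj.carrier, (Coalgebra.counit (toLin ξ) : k) = ξ 1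

/-- `C` is the Hopf algebra representing the Cartier dual of `G`, i.e. the continuous dual of the
complete Hopf algebra representing `G`: the functor `G` is represented by the pro-finite-dimensional
algebra `C^∨`, so that `G(R)` is the set of continuous graded algebra homomorphisms `C^∨ → R`, i.e.
of graded coalgebra homomorphisms `R^∨ → C`, and the group structure comes from the comultiplication
of `C^∨`, i.e. from the multiplication of `C`. -/
def IsCartierDual (G : FinGrAlg k ⥤ AddCommGrpCat.{u}) (C : GrHopf k) : Prop :=
  ∃ e : ∀ R : FinGrAlg k, G.obj R ≃ DualCoalgHom R C,
    (∀ (R S : FinGrAlg k) (f : R ⟶ S) (x : G.obj R),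
      (e S (G.map f x)).toLin = (e R x).toLin ∘ₗ f.hom.toAlgHom.toLinearMap.dualMap) ∧
    ∀ (R : FinGrAlg k) (x y : G.obj R) (ξ : Module.Dual k R.obj.carrier),
      (e R (x + y)).toLin ξ =
        LinearMap.mul' k C.carrier
          (TensorProduct.map (e R x).toLin (e R y).toLin (dualComul R.obj.carrier ξ))

variable (k)

/-- Formal groups: abelian-group-valued functors on finite-dimensional graded-commutative algebras
which are ind-representable, i.e. filtered colimits of representable set-valued functors. -/
def isFormalGroup : ObjectProperty (FinGrAlg k ⥤ AddCommGrpCat.{u}) :=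
  fun G => IsIndObject (C := (FinGrAlg k)ᵒᵖ)
    (unopUnop (FinGrAlg k) ⋙ G ⋙ forget AddCommGrpCat.{u})

/-- Odd formal groups: those represented by a pro-object of finite-dimensional Hopf algebras that
are primitively generated exterior algebras on generators of odd degree. -/
def isOddFormal : ObjectProperty (FinGrAlg k ⥤ AddCommGrpCat.{u}) :=
  fun G => isFormalGroup k G ∧
    ∃ (J : Type u) (_ : SmallCategory J) (_ : IsFiltered J)
      (D : J ⥤ FinGrAlg k ⥤ AddCommGrpCat.{u}) (c : Cocone D),
      (∀ j, ∃ H : GrHopf k, Module.Finite k H.carrier ∧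
        H.Represents (isFiniteGrAlg k).ι (D.obj j) ∧ H.IsOddExterior) ∧
      Nonempty (IsColimit c) ∧ Nonempty (c.pt ≅ G)

/-- Evenly graded, connected formal groups: the Cartier dual is evenly graded and unipotent. -/
def isConnectedFormal : ObjectProperty (FinGrAlg k ⥤ AddCommGrpCat.{u}) :=
  fun G => isFormalGroup k G ∧
    ∃ C : GrHopf k, IsCartierDual G C ∧ C.IsEven ∧ C.IsConilpotent

/-- Ungraded, étale formal groups: the Cartier dual is ungraded and of multiplicative type. -/
def isEtaleFormal : ObjectProperty (FinGrAlg k ⥤ AddCommGrpCat.{u}) :=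
  fun G => isFormalGroup k G ∧
    ∃ C : GrHopf k, IsCartierDual G C ∧ C.IsUngraded ∧ C.IsMultiplicative

end Formal

/-- The functor `(X, Y, Z) ↦ X × (Y × Z)` on a product of three full subcategories. -/
def tripleProduct {D : Type*} [Category D] [HasBinaryProducts D] (P Q R : ObjectProperty D) :
    P.FullSubcategory × Q.FullSubcategory × R.FullSubcategory ⥤ D where
  obj X := X.1.obj ⨯ (X.2.1.obj ⨯ X.2.2.obj)
  map f := prod.map f.1.hom (prod.map f.2.1.hom f.2.2.hom)

/-- The category `A` splits as the product of its full subcategories `P`, `Q`, `R`: there is an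
equivalence from `A` to the product category, whose inverse is `(X, Y, Z) ↦ X × Y × Z`. -/
def SplitsAs {D : Type*} [Category D] [HasBinaryProducts D] (A P Q R : ObjectProperty D) : Prop :=
  P ≤ A ∧ Q ≤ A ∧ R ≤ A ∧
  ∃ e : A.FullSubcategory ≌ P.FullSubcategory × Q.FullSubcategory × R.FullSubcategory,
    Nonempty (e.inverse ⋙ A.ι ≅ tripleProduct P Q R)

end

/-! All three splittings are instances of one formal statement, `splitsAs_of_idempotent`. Functors
with values in abelian groups form an additive, idempotent complete category. Suppose that its
objects carry a natural involution τ and, on the full subcategory in question, a natural idempotent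
E with Eτ = E, and that 2 is invertible on every object with E = 0. Then each object is the sum of
its E-part and a complement, and on the complement (1 ± τ)/2 separate two eigenparts. Naturality of
E and τ forbids nonzero morphisms between the three kinds of parts. What has to be done is to find E
and τ, and to recognise the parts.

The involution is induced by the sign automorphism a ↦ (-1)^|a| a of graded algebras. The idempotent
comes from finite-dimensional algebras: in a finite-dimensional commutative algebra over a perfect
field of characteristic p, the elements with p^n-th roots for all n form a subalgebra complementary
to the nilradical, and the projection to it is natural. Composed with the projection R → R_0 this
gives a natural idempotent `GrAlg.red` of every finite-dimensional graded-commutative R, whose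
kernel is nilpotent (`GrAlg.isNilpotent_ker_red`). For a formal group G, take E = G(red). For an
affine group, the representing Hopf algebra H is the union of its finite-dimensional graded
subcoalgebras, and these are the images of injective coalgebra homomorphisms R^∨ → H
(`GrHopf.exists_dualCoalgHom`). Restricting such homomorphisms along red therefore defines an
idempotent endomorphism `GrHopf.redHom` of the Hopf algebra H, which induces E.

In both settings the parts are recognised by one dictionary for a graded Hopf algebra C. A linear
map R^∨ → C is an element of R ⊗ C, and convolution is multiplication there (`elem_dconv`). C is
conilpotent exactly when red makes all homomorphisms R^∨ → C trivial
(`GrHopf.isConilpotent_iff_redTrivial`). If red makes them trivial, the corresponding elements are 1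
plus a nilpotent, and the iterated reduced coproducts are powers of nilpotents. Conversely, a
functional vanishing on 1 pairs the restricted homomorphism with an element of the reduced perfect
part whose powers are eventually zero. C is ungraded and of multiplicative type exactly when red
fixes all homomorphisms (`GrHopf.isUngraded_isMultiplicative_iff_redFixed`). The coefficients of a
group algebra give idempotents, which cannot change modulo nilpotents; conversely, over the
algebraic closure functionals on the perfect part are combinations of points, and points give
grouplike elements, which then span.

If E = 0, every point is unipotent, so it is killed by a power of p, and 2 is invertible because p
is odd. If τ = -1 and 2 is invertible, the degree zero part of the Hopf algebra is k and the sign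
automorphism is the antipode; contractions with odd functionals then show that the Hopf algebra is
an exterior algebra on its odd primitive elements (`GrHopf.isOddExterior_of_conv_tau`).

For pro-p-groups the criterion is that every element of H is trivialised by multiplication by some
p^n (`GrHopf.IsPrimary`). For formal groups one needs the Cartier dual: it is the filtered colimit
of the duals R_i^∨ over an ind-presentation, and its Hopf structure is forced by the group structure
on points (`FormalDual.isCartierDual`). -/

noncomputable section

/-! ## Graded algebras: projections, sign automorphism, tensor products -/

/-- A family of submodules which spans and is separated by linear projections grades the algebra. -/
@[reducible] def gradedAlgebraOfProj {k A : Type*} [Field k] [Ring A] [Algebra k A] (𝒢 : ℕ → Submodule k A)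
    (one : (1 : A) ∈ 𝒢 0) (mul : ∀ i j a b, a ∈ 𝒢 i → b ∈ 𝒢 j → a * b ∈ 𝒢 (i + j))
    (pr : ℕ → A →ₗ[k] A) (h1 : ∀ n, ∀ a ∈ 𝒢 n, pr n a = a)
    (h2 : ∀ m n, ∀ a ∈ 𝒢 n, m ≠ n → pr m a = 0) (h3 : ∀ a, a ∈ ⨆ n, 𝒢 n) :
    GradedAlgebra 𝒢 :=
  haveI : SetLike.GradedMonoid 𝒢 := { one_mem := one, mul_mem := fun i j a b ha hb => mul i j a b ha hb }
  have hI : DirectSum.IsInternal 𝒢 := by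
    refine DirectSum.isInternal_submodule_of_iSupIndep_of_iSup_eq_top ?_
      (eq_top_iff.2 fun a _ => h3 a)
    intro n
    rw [Submodule.disjoint_def]
    intro a ha hb
    have : (⨆ (j) (_ : j ≠ n), 𝒢 j) ≤ LinearMap.ker (pr n) :=
      iSup₂_le fun j hj b hb => h2 n j b hb hj.symm
    rw [← h1 n a ha]
    exact this hb
  { toDecomposition := hI.chooseDecomposition }

namespace GrAlg

variable {k : Type u} [Field k]

/-- Writing the sign as a scalar of `k` lets it pass through linear maps and tensor products. -/
lemma comm_of_mem (A : GrAlg k) {i j : ℕ} {a b : A.carrier} (ha : a ∈ A.grading i)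
    (hb : b ∈ A.grading j) : a * b = (-1 : k) ^ (i * j) • (b * a) := by
  rw [A.graded_comm i j a b ha hb, Algebra.smul_def]
  simp

lemma one_mem (A : GrAlg k) : (1 : A.carrier) ∈ A.grading 0 := SetLike.GradedOne.one_mem

lemma mul_mem (A : GrAlg k) {i j : ℕ} {a b : A.carrier} (ha : a ∈ A.grading i)
    (hb : b ∈ A.grading j) : a * b ∈ A.grading (i + j) := SetLike.GradedMul.mul_mem ha hb

/-- A linear map assembled from its restrictions to the homogeneous parts. -/
def ofHomogeneous (A : GrAlg k) {M : Type*} [AddCommGroup M] [Module k M]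
    (φ : ∀ n, A.grading n →ₗ[k] M) : A.carrier →ₗ[k] M :=
  DirectSum.toModule k ℕ M φ ∘ₗ (DirectSum.decomposeLinearEquiv A.grading).toLinearMap

lemma ofHomogeneous_apply (A : GrAlg k) {M : Type*} [AddCommGroup M] [Module k M]
    (φ : ∀ n, A.grading n →ₗ[k] M) {n : ℕ} {a : A.carrier} (ha : a ∈ A.grading n) :
    A.ofHomogeneous φ a = φ n ⟨a, ha⟩ := by
  lift a to A.grading n using ha
  simp only [ofHomogeneous, LinearMap.comp_apply, LinearEquiv.coe_coe,
    DirectSum.decomposeLinearEquiv_apply_coe]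
  erw [DirectSum.toModule_lof]

lemma homogeneous_induction (A : GrAlg k) (S : Submodule k A.carrier)
    (h : ∀ n, ∀ a ∈ A.grading n, a ∈ S) (a : A.carrier) : a ∈ S := by
  induction a using DirectSum.Decomposition.inductionOn A.grading with
  | zero => exact S.zero_mem
  | homogeneous a => exact h _ _ a.2
  | add a b ha hb => exact S.add_mem ha hb

lemma hom_ext_homogeneous (A : GrAlg k) {M : Type*} [AddCommGroup M] [Module k M]
    {f g : A.carrier →ₗ[k] M} (h : ∀ n, ∀ a ∈ A.grading n, f a = g a) : f = g := by
  ext a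
  exact A.homogeneous_induction (LinearMap.eqLocus f g) h a

/-- The projection to the part of degree `n`. -/
def proj (A : GrAlg k) (n : ℕ) : A.carrier →ₗ[k] A.carrier :=
  A.ofHomogeneous fun m => if m = n then (A.grading m).subtype else 0

lemma proj_of_mem (A : GrAlg k) {n : ℕ} {a : A.carrier} (ha : a ∈ A.grading n) :
    A.proj n a = a := by
  rw [proj, A.ofHomogeneous_apply _ ha]; simp

lemma proj_of_mem_ne (A : GrAlg k) {m n : ℕ} {a : A.carrier} (ha : a ∈ A.grading n)
    (h : m ≠ n) : A.proj m a = 0 := by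
  rw [proj, A.ofHomogeneous_apply _ ha, if_neg h.symm]; simp

lemma proj_mem (A : GrAlg k) (n : ℕ) (a : A.carrier) : A.proj n a ∈ A.grading n := by
  refine A.homogeneous_induction ((A.grading n).comap (A.proj n)) (fun m a ha => ?_) a
  rw [Submodule.mem_comap]
  by_cases h : n = m
  · subst h; rwa [A.proj_of_mem ha]
  · rw [A.proj_of_mem_ne ha h]; exact Submodule.zero_mem _

lemma mem_iSup_of_forall (A : GrAlg k) {S : Submodule k A.carrier} {a : A.carrier}
    (h : ∀ n, A.proj n a ∈ S) : a ∈ S := by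
  classical
  have key : ∀ a : A.carrier, a ∈ Submodule.span k (Set.range fun n => A.proj n a) := by
    intro a
    rw [← DirectSum.sum_support_decompose A.grading a]
    refine Submodule.sum_mem _ fun i _ => Submodule.subset_span ⟨i, ?_⟩
    change A.proj i _ = _
    rw [map_sum]
    by_cases hi : i ∈ DFinsupp.support (DirectSum.decompose A.grading a)
    · rw [Finset.sum_eq_single i, A.proj_of_mem (SetLike.coe_mem _)]
      · intro j _ hj; exact A.proj_of_mem_ne (SetLike.coe_mem _) hj.symm
      · intro h; exact absurd hi h
    · rw [Finset.sum_eq_zero]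
      · simp only [DFinsupp.mem_support_toFun, ne_eq, not_not] at hi
        rw [hi]; rfl
      · intro j hj
        exact A.proj_of_mem_ne (SetLike.coe_mem _) (by rintro rfl; exact hi hj)
  exact Submodule.span_le.2 (by rintro _ ⟨n, rfl⟩; exact h n) (key a)

lemma eq_zero_of_mem_of_mem (A : GrAlg k) {m n : ℕ} (h : m ≠ n) {a : A.carrier}
    (ha : a ∈ A.grading m) (hb : a ∈ A.grading n) : a = 0 := by
  rw [← A.proj_of_mem ha, A.proj_of_mem_ne hb h]

lemma hom_ext' {A B : GrAlg k} {f g : A ⟶ B} (h : ∀ a, f.toAlgHom a = g.toAlgHom a) : f = g :=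
  Hom.ext (AlgHom.ext h)

@[simp] lemma id_apply (A : GrAlg k) (a : A.carrier) : Hom.toAlgHom (𝟙 A) a = a := rfl

@[simp] lemma comp_apply {A B C : GrAlg k} (f : A ⟶ B) (g : B ⟶ C) (a : A.carrier) :
    Hom.toAlgHom (f ≫ g) a = g.toAlgHom (f.toAlgHom a) := rfl

lemma hom_proj {A B : GrAlg k} (f : A ⟶ B) (n : ℕ) (a : A.carrier) :
    B.proj n (f.toAlgHom a) = f.toAlgHom (A.proj n a) := by
  have : B.proj n ∘ₗ f.toAlgHom.toLinearMap = f.toAlgHom.toLinearMap ∘ₗ A.proj n := by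
    refine A.hom_ext_homogeneous fun m a ha => ?_
    simp only [LinearMap.comp_apply, AlgHom.toLinearMap_apply]
    by_cases h : n = m
    · subst h; rw [A.proj_of_mem ha, B.proj_of_mem (f.map_mem _ _ ha)]
    · rw [A.proj_of_mem_ne ha h, B.proj_of_mem_ne (f.map_mem _ _ ha) h, map_zero]
  exact LinearMap.congr_fun this a

/-- An endomorphism of a graded algebra assembled from linear maps on the homogeneous parts. -/
def endOfHomogeneous (A : GrAlg k) (c : ℕ → k) (h0 : c 0 = 1)
    (h : ∀ i j, c (i + j) = c i * c j) : A ⟶ A where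
  toAlgHom := AlgHom.ofLinearMap (A.ofHomogeneous fun n => c n • (A.grading n).subtype)
    (by
      rw [A.ofHomogeneous_apply _ A.one_mem]
      exact (by rw [h0, one_smul] : c 0 • (1 : A.carrier) = 1))
    (by
      intro a b
      have key : ∀ i, ∀ a ∈ A.grading i, ∀ b,
          (A.ofHomogeneous fun n => c n • (A.grading n).subtype) (a * b) =
          (A.ofHomogeneous fun n => c n • (A.grading n).subtype) a *
          (A.ofHomogeneous fun n => c n • (A.grading n).subtype) b := by
        intro i a ha
        suffices (A.ofHomogeneous fun n => c n • (A.grading n).subtype) ∘ₗ LinearMap.mulLeft k a =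
          LinearMap.mulLeft k ((A.ofHomogeneous fun n => c n • (A.grading n).subtype) a) ∘ₗ
          (A.ofHomogeneous fun n => c n • (A.grading n).subtype) by
          intro b; simpa using LinearMap.congr_fun this b
        refine A.hom_ext_homogeneous fun j b hb => ?_
        simp only [LinearMap.comp_apply, LinearMap.mulLeft_apply]
        rw [A.ofHomogeneous_apply _ ha, A.ofHomogeneous_apply _ hb,
          A.ofHomogeneous_apply _ (A.mul_mem ha hb)]
        exact (by rw [h, smul_mul_smul_comm] :
          c (i + j) • (a * b) = (c i • a) * (c j • b))
      suffices (A.ofHomogeneous fun n => c n • (A.grading n).subtype) ∘ₗ LinearMap.mulRight k b =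
          LinearMap.mulRight k ((A.ofHomogeneous fun n => c n • (A.grading n).subtype) b) ∘ₗ
          (A.ofHomogeneous fun n => c n • (A.grading n).subtype) by
        simpa using LinearMap.congr_fun this a
      refine A.hom_ext_homogeneous fun i a ha => ?_
      simpa using key i a ha b)
  map_mem n a ha := by
    change A.ofHomogeneous (fun n => c n • (A.grading n).subtype) a ∈ _
    rw [A.ofHomogeneous_apply _ ha]
    exact Submodule.smul_mem _ _ ha

lemma endOfHomogeneous_apply (A : GrAlg k) {c : ℕ → k} (h0 : c 0 = 1)
    (h : ∀ i j, c (i + j) = c i * c j) {n : ℕ} {a : A.carrier} (ha : a ∈ A.grading n) :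
    (A.endOfHomogeneous c h0 h).toAlgHom a = c n • a := by
  exact A.ofHomogeneous_apply _ ha

/-- The sign automorphism `a ↦ (-1) ^ |a| a`. -/
def tau (A : GrAlg k) : A ⟶ A := A.endOfHomogeneous (fun n => (-1) ^ n) (by simp) (by simp [pow_add])

lemma tau_apply (A : GrAlg k) {n : ℕ} {a : A.carrier} (ha : a ∈ A.grading n) :
    A.tau.toAlgHom a = (-1 : k) ^ n • a := A.endOfHomogeneous_apply _ _ ha

/-- The projection to degree zero, as an endomorphism of the graded algebra. -/
def deg0 (A : GrAlg k) : A ⟶ A :=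
  A.endOfHomogeneous (fun n => if n = 0 then 1 else 0) (if_pos rfl)
    (by intro i j; by_cases hi : i = 0 <;> by_cases hj : j = 0 <;> simp [hi, hj])

lemma deg0_of_mem (A : GrAlg k) {n : ℕ} {a : A.carrier} (ha : a ∈ A.grading n) :
    A.deg0.toAlgHom a = (if n = 0 then 1 else 0 : k) • a := A.endOfHomogeneous_apply _ _ ha

lemma deg0_apply (A : GrAlg k) (a : A.carrier) : A.deg0.toAlgHom a = A.proj 0 a := by
  have : A.deg0.toAlgHom.toLinearMap = A.proj 0 := by
    refine A.hom_ext_homogeneous fun n a ha => ?_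
    refine (A.deg0_of_mem ha).trans ?_
    by_cases h : n = 0
    · subst h; simp [A.proj_of_mem ha]
    · rw [A.proj_of_mem_ne ha (Ne.symm h)]; simp [h]
  exact LinearMap.congr_fun this a

lemma tau_naturality {A B : GrAlg k} (f : A ⟶ B) : f ≫ B.tau = A.tau ≫ f := by
  refine hom_ext' fun a => ?_
  have : B.tau.toAlgHom.toLinearMap ∘ₗ f.toAlgHom.toLinearMap =
      f.toAlgHom.toLinearMap ∘ₗ A.tau.toAlgHom.toLinearMap := by
    refine A.hom_ext_homogeneous fun n a ha => ?_
    simp [A.tau_apply ha, B.tau_apply (f.map_mem _ _ ha)]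
  exact LinearMap.congr_fun this a

lemma tau_tau (A : GrAlg k) : A.tau ≫ A.tau = 𝟙 A := by
  refine hom_ext' fun a => ?_
  have : A.tau.toAlgHom.toLinearMap ∘ₗ A.tau.toAlgHom.toLinearMap = LinearMap.id := by
    refine A.hom_ext_homogeneous fun n a ha => ?_
    simp [A.tau_apply ha, smul_smul, ← mul_pow]
  exact LinearMap.congr_fun this a

/-- The part of degree `n` of a tensor product. -/
def tensorGrading (A B : GrAlg k) (n : ℕ) : Submodule k (A.carrier ⊗[k] B.carrier) :=
  ⨆ (i : ℕ) (j : ℕ) (_ : i + j = n),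
    LinearMap.range (TensorProduct.map (A.grading i).subtype (B.grading j).subtype)

lemma tmul_mem_tensorGrading (A B : GrAlg k) {i j : ℕ} {a : A.carrier} {b : B.carrier}
    (ha : a ∈ A.grading i) (hb : b ∈ B.grading j) : a ⊗ₜ[k] b ∈ tensorGrading A B (i + j) := by
  refine Submodule.mem_iSup_of_mem i (Submodule.mem_iSup_of_mem j
    (Submodule.mem_iSup_of_mem rfl ⟨⟨a, ha⟩ ⊗ₜ ⟨b, hb⟩, rfl⟩))

lemma tensorGrading_le (A B : GrAlg k) {n : ℕ} {S : Submodule k (A.carrier ⊗[k] B.carrier)}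
    (h : ∀ i j, i + j = n → ∀ a ∈ A.grading i, ∀ b ∈ B.grading j, a ⊗ₜ[k] b ∈ S) :
    tensorGrading A B n ≤ S := by
  refine iSup_le fun i => iSup_le fun j => iSup_le fun hij => ?_
  rintro _ ⟨x, rfl⟩
  induction x with
  | zero => simp
  | add x y hx hy => rw [map_add]; exact S.add_mem hx hy
  | tmul a b => exact h i j hij _ a.2 _ b.2

lemma tensor_induction (A B : GrAlg k) (S : Submodule k (A.carrier ⊗[k] B.carrier))
    (h : ∀ i j, ∀ a ∈ A.grading i, ∀ b ∈ B.grading j, a ⊗ₜ[k] b ∈ S)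
    (x : A.carrier ⊗[k] B.carrier) : x ∈ S := by
  induction x with
  | zero => exact S.zero_mem
  | add x y hx hy => exact S.add_mem hx hy
  | tmul a b =>
    refine A.homogeneous_induction (S.comap ((TensorProduct.mk k _ _).flip b)) (fun i a ha => ?_) a
    exact B.homogeneous_induction (S.comap ((TensorProduct.mk k _ _) a)) (fun j b hb => h i j a ha b hb) b

lemma tensor_hom_ext (A B : GrAlg k) {M : Type*} [AddCommGroup M] [Module k M]
    {f g : A.carrier ⊗[k] B.carrier →ₗ[k] M}
    (h : ∀ i j, ∀ a ∈ A.grading i, ∀ b ∈ B.grading j, f (a ⊗ₜ b) = g (a ⊗ₜ b)) : f = g := by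
  ext1; ext a b
  exact A.tensor_induction B (LinearMap.eqLocus f g) h (a ⊗ₜ b)

/-- The projection of a tensor product to the part of degree `n`. -/
def tensorProj (A B : GrAlg k) (n : ℕ) : A.carrier ⊗[k] B.carrier →ₗ[k] A.carrier ⊗[k] B.carrier :=
  ∑ ij ∈ Finset.HasAntidiagonal.antidiagonal n, TensorProduct.map (A.proj ij.1) (B.proj ij.2)

lemma tensorProj_tmul (A B : GrAlg k) (n : ℕ) {i j : ℕ} {a : A.carrier} {b : B.carrier}
    (ha : a ∈ A.grading i) (hb : b ∈ B.grading j) :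
    tensorProj A B n (a ⊗ₜ b) = if i + j = n then a ⊗ₜ b else 0 := by
  simp only [tensorProj, LinearMap.sum_apply, TensorProduct.map_tmul]
  split_ifs with h
  · rw [Finset.sum_eq_single (i, j), A.proj_of_mem ha, B.proj_of_mem hb]
    · rintro ⟨i', j'⟩ _ hne
      by_cases hi : i' = i
      · subst hi
        rw [B.proj_of_mem_ne hb (by rintro rfl; exact hne rfl), TensorProduct.tmul_zero]
      · rw [A.proj_of_mem_ne ha hi, TensorProduct.zero_tmul]
    · simp [h]
  · refine Finset.sum_eq_zero ?_
    rintro ⟨i', j'⟩ hij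
    rw [Finset.HasAntidiagonal.mem_antidiagonal] at hij
    dsimp only at hij ⊢
    by_cases hi : i' = i
    · rw [B.proj_of_mem_ne hb (by rintro rfl; exact h (hi ▸ hij)), TensorProduct.tmul_zero]
    · rw [A.proj_of_mem_ne ha hi, TensorProduct.zero_tmul]

lemma gradedTensor_mul (A B : GrAlg k) {i j : ℕ} (a : A.carrier) {b : B.carrier} {a' : A.carrier}
    (b' : B.carrier) (hb : b ∈ B.grading j) (ha' : a' ∈ A.grading i) :
    (GradedTensorProduct.of k A.grading B.grading (a ⊗ₜ b)) *
      (GradedTensorProduct.of k A.grading B.grading (a' ⊗ₜ b')) =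
    (-1 : k) ^ (j * i) • GradedTensorProduct.of k A.grading B.grading ((a * a') ⊗ₜ (b * b')) := by
  have := GradedTensorProduct.tmul_coe_mul_coe_tmul (R := k) A.grading B.grading a ⟨b, hb⟩ ⟨a', ha'⟩ b'
  refine this.trans ?_
  rcases Nat.even_or_odd (j * i) with h | h <;> simp [h.neg_one_pow]

lemma gradedTensor_comm (A : GrAlg k) {i j : ℕ} {a b : A.carrier} (ha : a ∈ A.grading i)
    (hb : b ∈ A.grading j) :
    GradedTensorProduct.comm A.grading A.grading
      (GradedTensorProduct.of k A.grading A.grading (a ⊗ₜ b)) =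
    (-1 : k) ^ (j * i) • GradedTensorProduct.of k A.grading A.grading (b ⊗ₜ a) := by
  have := GradedTensorProduct.comm_coe_tmul_coe (R := k) A.grading A.grading ⟨a, ha⟩ ⟨b, hb⟩
  refine this.trans ?_
  rcases Nat.even_or_odd (j * i) with h | h <;> simp [h.neg_one_pow]

/-- The linear identification of the tensor product with the graded tensor product. -/
abbrev tensorOf (A B : GrAlg k) :
    A.carrier ⊗[k] B.carrier →ₗ[k] GradedTensorProduct k A.grading B.grading :=
  (GradedTensorProduct.of k A.grading B.grading).toLinearMap

lemma tensorOf_mul (A B : GrAlg k) {i j : ℕ} (a : A.carrier) {b : B.carrier} {a' : A.carrier}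
    (b' : B.carrier) (hb : b ∈ B.grading j) (ha' : a' ∈ A.grading i) :
    tensorOf A B (a ⊗ₜ b) * tensorOf A B (a' ⊗ₜ b') =
    (-1 : k) ^ (j * i) • tensorOf A B ((a * a') ⊗ₜ (b * b')) := gradedTensor_mul A B a b' hb ha'

lemma tensorOf_mul_mem (A B : GrAlg k) {m n : ℕ} {x y : A.carrier ⊗[k] B.carrier}
    (hx : x ∈ tensorGrading A B m) (hy : y ∈ tensorGrading A B n) :
    tensorOf A B x * tensorOf A B y ∈ (tensorGrading A B (m + n)).map (tensorOf A B) := by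
  suffices tensorGrading A B m ≤ ((tensorGrading A B (m + n)).map (tensorOf A B)).comap
    ((LinearMap.mulRight k (tensorOf A B y)) ∘ₗ tensorOf A B) from this hx
  refine tensorGrading_le A B fun i j hij a ha b hb => ?_
  suffices tensorGrading A B n ≤ ((tensorGrading A B (m + n)).map (tensorOf A B)).comap
    ((LinearMap.mulLeft k (tensorOf A B (a ⊗ₜ b))) ∘ₗ tensorOf A B) from this hy
  refine tensorGrading_le A B fun i' j' hij' a' ha' b' hb' => ?_
  simp only [Submodule.mem_comap, LinearMap.comp_apply, LinearMap.mulLeft_apply]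
  rw [tensorOf_mul A B a b' hb ha']
  refine Submodule.smul_mem _ _ (Submodule.mem_map_of_mem ?_)
  have := tmul_mem_tensorGrading A B (A.mul_mem ha ha') (B.mul_mem hb hb')
  rwa [show i + i' + (j + j') = m + n by omega] at this

lemma tensorOf_mul_comm (A B : GrAlg k) {m n : ℕ} {x y : A.carrier ⊗[k] B.carrier}
    (hx : x ∈ tensorGrading A B m) (hy : y ∈ tensorGrading A B n) :
    tensorOf A B x * tensorOf A B y = (-1 : k) ^ (m * n) • (tensorOf A B y * tensorOf A B x) := by
  suffices tensorGrading A B m ≤ LinearMap.eqLocus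
    ((LinearMap.mulRight k (tensorOf A B y)) ∘ₗ tensorOf A B)
    ((-1 : k) ^ (m * n) • ((LinearMap.mulLeft k (tensorOf A B y)) ∘ₗ tensorOf A B)) from this hx
  refine tensorGrading_le A B fun i j hij a ha b hb => ?_
  suffices tensorGrading A B n ≤ LinearMap.eqLocus
    ((LinearMap.mulLeft k (tensorOf A B (a ⊗ₜ b))) ∘ₗ tensorOf A B)
    ((-1 : k) ^ (m * n) • ((LinearMap.mulRight k (tensorOf A B (a ⊗ₜ b))) ∘ₗ tensorOf A B)) from
    this hy
  refine tensorGrading_le A B fun i' j' hij' a' ha' b' hb' => ?_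
  rw [LinearMap.mem_eqLocus]
  simp only [LinearMap.comp_apply, LinearMap.mulLeft_apply, LinearMap.smul_apply,
    LinearMap.mulRight_apply]
  rw [tensorOf_mul A B a b' hb ha', tensorOf_mul A B a' b hb' ha,
    A.comm_of_mem ha ha', B.comm_of_mem hb hb', ← TensorProduct.smul_tmul',
    TensorProduct.tmul_smul, map_smul, map_smul, smul_smul, smul_smul, smul_smul]
  congr 1
  rw [← pow_add, ← pow_add, ← pow_add, ← hij, ← hij']
  refine neg_one_pow_congr ?_
  -- The two exponents of `-1` add up to an even number, so they have the same parity.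
  have : (j * i' + (i * i' + j * j')) + ((i + j) * (i' + j') + j' * i) =
    2 * (j * i' + i * i' + j * j' + j' * i) := by ring
  have h2 := even_two_mul (j * i' + i * i' + j * j' + j' * i)
  rw [← this, Nat.even_add] at h2
  simpa only [Nat.mul_comm, add_comm, add_left_comm, add_assoc] using h2

/-- The grading of the tensor product by total degree. -/
def tensorDeg (A B : GrAlg k) (n : ℕ) : Submodule k (GradedTensorProduct k A.grading B.grading) :=
  (tensorGrading A B n).map (tensorOf A B)

lemma mem_iSup_tensorDeg (A B : GrAlg k) (x : GradedTensorProduct k A.grading B.grading) :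
    x ∈ ⨆ n, tensorDeg A B n := by
  refine A.tensor_induction B (Submodule.comap (tensorOf A B) (⨆ n, tensorDeg A B n))
    (fun i j a ha b hb => ?_) ((GradedTensorProduct.of k A.grading B.grading).symm x)
  have h : tensorOf A B (a ⊗ₜ b) ∈ tensorDeg A B (i + j) :=
    Submodule.mem_map_of_mem (tmul_mem_tensorGrading A B ha hb)
  exact le_iSup (tensorDeg A B) (i + j) h

lemma tensorProj_of_mem (A B : GrAlg k) {n : ℕ} {x : A.carrier ⊗[k] B.carrier}
    (hx : x ∈ tensorGrading A B n) : tensorProj A B n x = x :=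
  tensorGrading_le A B (S := LinearMap.eqLocus (tensorProj A B n) LinearMap.id)
    (fun _ _ hij _ ha _ hb => (tensorProj_tmul A B n ha hb).trans (if_pos hij)) hx

lemma tensorProj_of_mem_ne (A B : GrAlg k) {m n : ℕ} {x : A.carrier ⊗[k] B.carrier}
    (hx : x ∈ tensorGrading A B n) (h : m ≠ n) : tensorProj A B m x = 0 :=
  tensorGrading_le A B (S := LinearMap.ker (tensorProj A B m))
    (fun _ _ hij _ ha _ hb => (tensorProj_tmul A B m ha hb).trans
      (if_neg fun h' => h (h'.symm.trans hij))) hx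

/-- The projections of the graded tensor product. -/
def tensorDegProj (A B : GrAlg k) (n : ℕ) :
    GradedTensorProduct k A.grading B.grading →ₗ[k] GradedTensorProduct k A.grading B.grading :=
  tensorOf A B ∘ₗ tensorProj A B n ∘ₗ (GradedTensorProduct.of k A.grading B.grading).symm.toLinearMap

lemma tensorDegProj_of_mem (A B : GrAlg k) {n : ℕ} {x : GradedTensorProduct k A.grading B.grading}
    (hx : x ∈ tensorDeg A B n) : tensorDegProj A B n x = x := by
  obtain ⟨x, hx, rfl⟩ := hx
  exact congrArg (tensorOf A B) (tensorProj_of_mem A B hx)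

lemma tensorDegProj_of_mem_ne (A B : GrAlg k) {m n : ℕ}
    {x : GradedTensorProduct k A.grading B.grading}
    (hx : x ∈ tensorDeg A B n) (h : m ≠ n) : tensorDegProj A B m x = 0 := by
  obtain ⟨x, hx, rfl⟩ := hx
  exact (congrArg (tensorOf A B) (tensorProj_of_mem_ne A B hx h)).trans (map_zero _)

lemma tensorOf_one_tmul_one (A B : GrAlg k) :
    tensorOf A B ((1 : A.carrier) ⊗ₜ[k] (1 : B.carrier)) = 1 :=
  GradedTensorProduct.of_one A.grading B.grading

lemma one_mem_tensorDeg (A B : GrAlg k) :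
    (1 : GradedTensorProduct k A.grading B.grading) ∈ tensorDeg A B 0 := by
  rw [← tensorOf_one_tmul_one]
  exact Submodule.mem_map_of_mem (tmul_mem_tensorGrading A B (i := 0) (j := 0) A.one_mem B.one_mem)

lemma mul_mem_tensorDeg (A B : GrAlg k) (i j : ℕ)
    (x y : GradedTensorProduct k A.grading B.grading)
    (hx : x ∈ tensorDeg A B i) (hy : y ∈ tensorDeg A B j) : x * y ∈ tensorDeg A B (i + j) := by
  obtain ⟨x, hx, rfl⟩ := hx
  obtain ⟨y, hy, rfl⟩ := hy
  exact tensorOf_mul_mem A B hx hy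

instance tensorGraded (A B : GrAlg k) : GradedAlgebra (tensorDeg A B) :=
  gradedAlgebraOfProj (tensorDeg A B) (one_mem_tensorDeg A B) (mul_mem_tensorDeg A B)
    (tensorDegProj A B) (fun _ _ => tensorDegProj_of_mem A B)
    (fun _ _ _ hx h => tensorDegProj_of_mem_ne A B hx h) (mem_iSup_tensorDeg A B)

/-- The tensor product of graded-commutative algebras, with Koszul signs. -/
def tensor (A B : GrAlg k) : GrAlg k where
  carrier := GradedTensorProduct k A.grading B.grading
  grading := tensorDeg A B
  graded := tensorGraded A B
  graded_comm := by
    rintro m n _ _ ⟨x, hx, rfl⟩ ⟨y, hy, rfl⟩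
    refine (tensorOf_mul_comm A B hx hy).trans ?_
    rcases Nat.even_or_odd (m * n) with h | h <;> simp [h.neg_one_pow]

end GrAlg

end

/-! ### Tensor products of graded-commutative algebras as coproducts -/

noncomputable section

namespace GrAlg

variable {k : Type u} [Field k]

/-- The linear identification of the tensor product of vector spaces with the underlying space of
the tensor product of graded algebras. -/
def tmk (A B : GrAlg k) : A.carrier ⊗[k] B.carrier →ₗ[k] (tensor A B).carrier where
  toFun x := tensorOf A B x
  map_add' x y := (tensorOf A B).map_add x y
  map_smul' c x := (tensorOf A B).map_smul c x

lemma tmk_surjective (A B : GrAlg k) : Function.Surjective (tmk A B) :=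
  (GradedTensorProduct.of k A.grading B.grading).surjective

lemma tmk_injective (A B : GrAlg k) : Function.Injective (tmk A B) :=
  (GradedTensorProduct.of k A.grading B.grading).injective

lemma tmk_mem (A B : GrAlg k) {n : ℕ} {x : A.carrier ⊗[k] B.carrier} :
    tmk A B x ∈ (tensor A B).grading n ↔ x ∈ tensorGrading A B n :=
  ⟨fun ⟨_, hy, h⟩ => tmk_injective A B h ▸ hy, fun h =>
    (Submodule.mem_map_of_mem h : tensorOf A B x ∈ tensorDeg A B n)⟩

lemma tmk_tmul_mem (A B : GrAlg k) {i j : ℕ} {a : A.carrier} {b : B.carrier}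
    (ha : a ∈ A.grading i) (hb : b ∈ B.grading j) :
    tmk A B (a ⊗ₜ b) ∈ (tensor A B).grading (i + j) :=
  (tmk_mem A B).2 (tmul_mem_tensorGrading A B ha hb)

lemma tmk_one (A B : GrAlg k) : tmk A B ((1 : A.carrier) ⊗ₜ[k] (1 : B.carrier)) = 1 :=
  GradedTensorProduct.of_one A.grading B.grading

lemma tmk_mul (A B : GrAlg k) {i j : ℕ} (a : A.carrier) {b : B.carrier} {a' : A.carrier}
    (b' : B.carrier) (hb : b ∈ B.grading j) (ha' : a' ∈ A.grading i) :
    tmk A B (a ⊗ₜ b) * tmk A B (a' ⊗ₜ b') =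
    (-1 : k) ^ (j * i) • tmk A B ((a * a') ⊗ₜ (b * b')) := gradedTensor_mul A B a b' hb ha'

/-- The inclusion of the first factor of a tensor product. -/
def tensorInl (A B : GrAlg k) : A ⟶ tensor A B where
  toAlgHom := GradedTensorProduct.includeLeft A.grading B.grading
  map_mem n _ ha := (tmk_tmul_mem A B ha B.one_mem : _ ∈ (tensor A B).grading (n + 0))

/-- The inclusion of the second factor of a tensor product. -/
def tensorInr (A B : GrAlg k) : B ⟶ tensor A B where
  toAlgHom := GradedTensorProduct.includeRight A.grading B.grading
  map_mem n b hb := by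
    have := tmk_tmul_mem A B A.one_mem hb
    rw [zero_add] at this
    exact this

lemma tensorInl_apply (A B : GrAlg k) (a : A.carrier) :
    (tensorInl A B).toAlgHom a = tmk A B (a ⊗ₜ 1) := rfl

lemma tensorInr_apply (A B : GrAlg k) (b : B.carrier) :
    (tensorInr A B).toAlgHom b = tmk A B (1 ⊗ₜ b) := rfl

lemma tensorInl_mul_tensorInr (A B : GrAlg k) (a : A.carrier) (b : B.carrier) :
    (tensorInl A B).toAlgHom a * (tensorInr A B).toAlgHom b = tmk A B (a ⊗ₜ b) :=
  GradedTensorProduct.tmul_one_mul_one_tmul A.grading B.grading a b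

/-- The algebra homomorphism out of a tensor product given by a pair of morphisms. -/
def tensorDescAlgHom {A B C : GrAlg k} (f : A ⟶ C) (g : B ⟶ C) :
    (tensor A B).carrier →ₐ[k] C.carrier :=
  GradedTensorProduct.lift A.grading B.grading f.toAlgHom g.toAlgHom (by
    intro i j a b
    rw [C.graded_comm i j _ _ (f.map_mem _ _ a.2) (g.map_mem _ _ b.2), mul_comm j i]
    rcases Nat.even_or_odd (i * j) with h | h <;> simp [h.neg_one_pow])

/-- The morphism out of a tensor product given by a pair of morphisms. -/
def tensorDesc {A B C : GrAlg k} (f : A ⟶ C) (g : B ⟶ C) : tensor A B ⟶ C where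
  toAlgHom := tensorDescAlgHom f g
  map_mem n x hx := by
    obtain ⟨x, rfl⟩ := tmk_surjective A B x
    replace hx := (tmk_mem A B).1 hx
    refine tensorGrading_le A B (S := (C.grading n).comap
      ((tensorDescAlgHom f g).toLinearMap ∘ₗ tmk A B)) (fun i j hij a ha b hb => ?_) hx
    subst hij
    exact C.mul_mem (f.map_mem _ _ ha) (g.map_mem _ _ hb)

lemma tensorDesc_tmul {A B C : GrAlg k} (f : A ⟶ C) (g : B ⟶ C) (a : A.carrier) (b : B.carrier) :
    (tensorDesc f g).toAlgHom (tmk A B (a ⊗ₜ b)) = f.toAlgHom a * g.toAlgHom b := rfl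

lemma tensorDesc_apply {A B C : GrAlg k} (f : A ⟶ C) (g : B ⟶ C) (x : A.carrier ⊗[k] B.carrier) :
    (tensorDesc f g).toAlgHom (tmk A B x) =
      LinearMap.mul' k C.carrier
        (TensorProduct.map f.toAlgHom.toLinearMap g.toAlgHom.toLinearMap x) := rfl

@[simp] lemma tensorInl_desc {A B C : GrAlg k} (f : A ⟶ C) (g : B ⟶ C) :
    tensorInl A B ≫ tensorDesc f g = f :=
  hom_ext' fun a => by
    rw [comp_apply, tensorInl_apply, tensorDesc_tmul, map_one, mul_one]

@[simp] lemma tensorInr_desc {A B C : GrAlg k} (f : A ⟶ C) (g : B ⟶ C) :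
    tensorInr A B ≫ tensorDesc f g = g :=
  hom_ext' fun a => by
    rw [comp_apply, tensorInr_apply, tensorDesc_tmul, map_one, one_mul]

lemma tensor_hom_ext' {A B C : GrAlg k} {f g : tensor A B ⟶ C}
    (h1 : tensorInl A B ≫ f = tensorInl A B ≫ g) (h2 : tensorInr A B ≫ f = tensorInr A B ≫ g) :
    f = g := by
  refine hom_ext' fun x => ?_
  obtain ⟨x, rfl⟩ := tmk_surjective A B x
  suffices f.toAlgHom.toLinearMap ∘ₗ tmk A B = g.toAlgHom.toLinearMap ∘ₗ tmk A B from
    LinearMap.congr_fun this x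
  ext1
  ext a b
  have e1 : f.toAlgHom ((tensorInl A B).toAlgHom a) = g.toAlgHom ((tensorInl A B).toAlgHom a) :=
    congrArg (fun φ : A ⟶ C => φ.toAlgHom a) h1
  have e2 : f.toAlgHom ((tensorInr A B).toAlgHom b) = g.toAlgHom ((tensorInr A B).toAlgHom b) :=
    congrArg (fun φ : B ⟶ C => φ.toAlgHom b) h2
  change f.toAlgHom (tmk A B (a ⊗ₜ b)) = g.toAlgHom (tmk A B (a ⊗ₜ b))
  rw [← tensorInl_mul_tensorInr]
  exact (map_mul f.toAlgHom _ _).trans ((congrArg₂ (· * ·) e1 e2).trans (map_mul g.toAlgHom _ _).symm)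

lemma tensorDesc_comp {A B C D : GrAlg k} (f : A ⟶ C) (g : B ⟶ C) (h : C ⟶ D) :
    tensorDesc f g ≫ h = tensorDesc (f ≫ h) (g ≫ h) :=
  tensor_hom_ext' (by rw [← Category.assoc]; simp) (by rw [← Category.assoc]; simp)

variable (k) in
/-- The ground field as a graded algebra. -/
def unitAlg : GrAlg k where
  carrier := k
  grading n := if n = 0 then ⊤ else ⊥
  graded := gradedAlgebraOfProj _ (by simp)
    (by
      intro i j a b ha hb
      by_cases hi : i = 0
      · by_cases hj : j = 0
        · simp [hi, hj]
        · rw [if_neg hj, Submodule.mem_bot] at hb; subst hb; rw [mul_zero]; exact Submodule.zero_mem _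
      · rw [if_neg hi, Submodule.mem_bot] at ha; subst ha; rw [zero_mul]; exact Submodule.zero_mem _)
    (fun n => if n = 0 then LinearMap.id else 0)
    (by
      intro n a ha
      by_cases h : n = 0
      · simp [h]
      · rw [if_neg h, Submodule.mem_bot] at ha; subst ha; rw [map_zero])
    (by
      intro m n a ha h
      by_cases hn : n = 0
      · simp [show m ≠ 0 by omega]
      · rw [if_neg hn, Submodule.mem_bot] at ha; subst ha; rw [map_zero])
    (fun a => Submodule.mem_iSup_of_mem 0 (by simp))
  graded_comm := by
    intro i j a b ha hb
    by_cases hi : i = 0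
    · simp [hi, mul_comm]
    · rw [if_neg hi, Submodule.mem_bot] at ha; subst ha; simp

lemma mem_unitAlg_grading (a : k) : a ∈ (unitAlg k).grading 0 := by
  change a ∈ (if 0 = 0 then ⊤ else ⊥ : Submodule k k)
  rw [if_pos rfl]; trivial

lemma eq_zero_of_mem_unitAlg {n : ℕ} (hn : n ≠ 0) {a : k} (h : a ∈ (unitAlg k).grading n) :
    a = 0 := by
  have : a ∈ (if n = 0 then ⊤ else ⊥ : Submodule k k) := h
  rwa [if_neg hn] at this

lemma algebraMap_mem (A : GrAlg k) (c : k) : algebraMap k A.carrier c ∈ A.grading 0 := by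
  rw [Algebra.algebraMap_eq_smul_one]
  exact Submodule.smul_mem _ _ A.one_mem

/-- The structure morphism of a graded algebra. -/
def unitHom (A : GrAlg k) : unitAlg k ⟶ A where
  toAlgHom := Algebra.ofId k A.carrier
  map_mem n a ha := by
    by_cases hn : n = 0
    · subst hn
      exact A.algebraMap_mem a
    · exact (congrArg (algebraMap k A.carrier) (eq_zero_of_mem_unitAlg hn ha)).trans
        (map_zero _) ▸ Submodule.zero_mem _

lemma unitHom_ext {A : GrAlg k} (f g : unitAlg k ⟶ A) : f = g :=
  Hom.ext (Subsingleton.elim (α := k →ₐ[k] A.carrier) _ _)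

end GrAlg

namespace FinGrAlg

variable {k : Type u} [Field k]

/-- The tensor product of finite-dimensional graded-commutative algebras. -/
def tensor (R S : FinGrAlg k) : FinGrAlg k :=
  ⟨GrAlg.tensor R.obj S.obj, inferInstanceAs (Module.Finite k (R.obj.carrier ⊗[k] S.obj.carrier))⟩

variable (k) in
/-- The ground field as a finite-dimensional graded algebra. -/
def unitAlg : FinGrAlg k := ⟨GrAlg.unitAlg k, inferInstanceAs (Module.Finite k k)⟩

end FinGrAlg

end

noncomputable section

/-! ## Splitting a category by natural idempotents -/

section Splitting

variable {D : Type*} [Category D] [Preadditive D] [HasBinaryProducts D]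

/-- A complete system of three orthogonal split idempotents decomposes an object as a product. -/
def prodIsoOfOrthogonal {X Y₁ Y₂ Y₃ : D} (i₁ : Y₁ ⟶ X) (i₂ : Y₂ ⟶ X) (i₃ : Y₃ ⟶ X)
    (r₁ : X ⟶ Y₁) (r₂ : X ⟶ Y₂) (r₃ : X ⟶ Y₃)
    (h₁₁ : i₁ ≫ r₁ = 𝟙 _) (h₁₂ : i₁ ≫ r₂ = 0) (h₁₃ : i₁ ≫ r₃ = 0)
    (h₂₁ : i₂ ≫ r₁ = 0) (h₂₂ : i₂ ≫ r₂ = 𝟙 _) (h₂₃ : i₂ ≫ r₃ = 0)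
    (h₃₁ : i₃ ≫ r₁ = 0) (h₃₂ : i₃ ≫ r₂ = 0) (h₃₃ : i₃ ≫ r₃ = 𝟙 _)
    (hs : r₁ ≫ i₁ + r₂ ≫ i₂ + r₃ ≫ i₃ = 𝟙 X) : X ≅ Y₁ ⨯ (Y₂ ⨯ Y₃) where
  hom := prod.lift r₁ (prod.lift r₂ r₃)
  inv := prod.fst ≫ i₁ + prod.snd ≫ prod.fst ≫ i₂ + prod.snd ≫ prod.snd ≫ i₃
  hom_inv_id := by simp [Preadditive.comp_add, hs, prod.lift_fst, prod.lift_snd, prod.lift_fst_assoc, prod.lift_snd_assoc]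
  inv_hom_id := by
    refine Limits.prod.hom_ext ?_ (Limits.prod.hom_ext ?_ ?_) <;>
      simp [-prod.comp_lift, Preadditive.add_comp, h₁₁, h₁₂, h₁₃, h₂₁, h₂₂, h₂₃, h₃₁, h₃₂, h₃₃,
        prod.lift_fst, prod.lift_snd, prod.lift_fst_assoc, prod.lift_snd_assoc]

lemma prod_id_eq_sum (X₁ X₂ X₃ : D) :
    𝟙 (X₁ ⨯ (X₂ ⨯ X₃)) = prod.fst ≫ prod.lift (𝟙 _) 0 +
      prod.snd ≫ prod.fst ≫ prod.lift 0 (prod.lift (𝟙 _) 0) +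
      prod.snd ≫ prod.snd ≫ prod.lift 0 (prod.lift 0 (𝟙 _)) := by
  refine Limits.prod.hom_ext ?_ (Limits.prod.hom_ext ?_ ?_) <;>
    simp [-prod.comp_lift, Preadditive.add_comp, prod.lift_fst, prod.lift_snd, prod.lift_fst_assoc, prod.lift_snd_assoc]

/-- Orthogonality makes every morphism between triple products diagonal, so the product functor is
fully faithful; the decompositions `hdec` make it essentially surjective. -/
theorem splitsAs_of_orthogonal (A P Q R : ObjectProperty D) (hP : P ≤ A) (hQ : Q ≤ A) (hR : R ≤ A)
    (hprod : ∀ X Y, A X → A Y → A (X ⨯ Y))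
    (hPQ : ∀ X Y (f : X ⟶ Y), P X → Q Y → f = 0) (hPR : ∀ X Y (f : X ⟶ Y), P X → R Y → f = 0)
    (hQP : ∀ X Y (f : X ⟶ Y), Q X → P Y → f = 0) (hQR : ∀ X Y (f : X ⟶ Y), Q X → R Y → f = 0)
    (hRP : ∀ X Y (f : X ⟶ Y), R X → P Y → f = 0) (hRQ : ∀ X Y (f : X ⟶ Y), R X → Q Y → f = 0)
    (hdec : ∀ X, A X → ∃ Y₁ Y₂ Y₃, P Y₁ ∧ Q Y₂ ∧ R Y₃ ∧ Nonempty (X ≅ Y₁ ⨯ (Y₂ ⨯ Y₃))) :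
    SplitsAs A P Q R := by
  refine ⟨hP, hQ, hR, ?_⟩
  let F : P.FullSubcategory × Q.FullSubcategory × R.FullSubcategory ⥤ A.FullSubcategory :=
    A.lift (tripleProduct P Q R) fun X =>
      hprod _ _ (hP _ X.1.property) (hprod _ _ (hQ _ X.2.1.property) (hR _ X.2.2.property))
  have hF : ∀ {X Y} (f : X ⟶ Y), (F.map f).hom =
      prod.map f.1.hom (prod.map f.2.1.hom f.2.2.hom) := fun f => rfl
  haveI : F.Faithful := by
    refine ⟨fun {X Y} f g h => ?_⟩
    have h' : prod.map f.1.hom (prod.map f.2.1.hom f.2.2.hom) =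
      prod.map g.1.hom (prod.map g.2.1.hom g.2.2.hom) := by
      rw [← hF, ← hF, h]
    refine Prod.ext ?_ (Prod.ext ?_ ?_) <;> apply ObjectProperty.hom_ext
    · have := congrArg (fun φ => prod.lift (𝟙 _) 0 ≫ φ ≫ prod.fst) h'
      simpa [prod.lift_fst, prod.lift_snd, prod.lift_fst_assoc, prod.lift_snd_assoc] using this
    · have := congrArg (fun φ => prod.lift 0 (prod.lift (𝟙 _) 0) ≫ φ ≫ prod.snd ≫ prod.fst) h'
      simpa [prod.lift_fst, prod.lift_snd, prod.lift_fst_assoc, prod.lift_snd_assoc] using this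
    · have := congrArg (fun φ => prod.lift 0 (prod.lift 0 (𝟙 _)) ≫ φ ≫ prod.snd ≫ prod.snd) h'
      simpa [prod.lift_fst, prod.lift_snd, prod.lift_fst_assoc, prod.lift_snd_assoc] using this
  haveI : F.Full := by
    refine ⟨fun {X Y} g => ?_⟩
    let φ : X.1.obj ⨯ (X.2.1.obj ⨯ X.2.2.obj) ⟶ Y.1.obj ⨯ (Y.2.1.obj ⨯ Y.2.2.obj) := g.hom
    refine ⟨⟨ObjectProperty.homMk (prod.lift (𝟙 _) 0 ≫ φ ≫ prod.fst),
      ObjectProperty.homMk (prod.lift 0 (prod.lift (𝟙 _) 0) ≫ φ ≫ prod.snd ≫ prod.fst),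
      ObjectProperty.homMk (prod.lift 0 (prod.lift 0 (𝟙 _)) ≫ φ ≫ prod.snd ≫ prod.snd)⟩, ?_⟩
    apply ObjectProperty.hom_ext
    rw [hF]
    change _ = φ
    conv_rhs => rw [← Category.id_comp φ, prod_id_eq_sum]
    -- The six off-diagonal entries of the matrix of `φ` vanish.
    have z12 := hPQ _ _ (prod.lift (𝟙 _) 0 ≫ φ ≫ prod.snd ≫ prod.fst) X.1.property Y.2.1.property
    have z13 := hPR _ _ (prod.lift (𝟙 _) 0 ≫ φ ≫ prod.snd ≫ prod.snd) X.1.property Y.2.2.property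
    have z21 := hQP _ _ (prod.lift 0 (prod.lift (𝟙 _) 0) ≫ φ ≫ prod.fst)
      X.2.1.property Y.1.property
    have z23 := hQR _ _ (prod.lift 0 (prod.lift (𝟙 _) 0) ≫ φ ≫ prod.snd ≫ prod.snd)
      X.2.1.property Y.2.2.property
    have z31 := hRP _ _ (prod.lift 0 (prod.lift 0 (𝟙 _)) ≫ φ ≫ prod.fst)
      X.2.2.property Y.1.property
    have z32 := hRQ _ _ (prod.lift 0 (prod.lift 0 (𝟙 _)) ≫ φ ≫ prod.snd ≫ prod.fst)
      X.2.2.property Y.2.1.property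
    refine Limits.prod.hom_ext ?_ (Limits.prod.hom_ext ?_ ?_) <;>
      simp [-prod.comp_lift, prod.lift_fst, prod.lift_snd, prod.lift_fst_assoc, prod.lift_snd_assoc,
        Preadditive.add_comp, z12, z13, z21, z23, z31, z32]
  haveI : F.EssSurj := by
    refine ⟨fun X => ?_⟩
    obtain ⟨Y₁, Y₂, Y₃, h₁, h₂, h₃, ⟨e⟩⟩ := hdec X.obj X.property
    exact ⟨⟨⟨Y₁, h₁⟩, ⟨Y₂, h₂⟩, ⟨Y₃, h₃⟩⟩, ⟨A.isoMk e.symm⟩⟩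
  haveI : F.IsEquivalence := {}
  exact ⟨F.asEquivalence.symm, ⟨A.liftCompιIso _ _⟩⟩

/-- A full subcategory whose objects carry a natural idempotent `E` and a natural involution `τ`,
such that `2` is invertible wherever `E` vanishes, splits into the parts where `τ = -1`, where
`E = 0` and `τ = 1`, and where `E = 1`. -/
theorem splitsAs_of_idempotent [IsIdempotentComplete D] (A P Q R : ObjectProperty D)
    (E τ : ∀ X : D, X ⟶ X)
    (hE : ∀ X Y (f : X ⟶ Y), A X → A Y → E X ≫ f = f ≫ E Y)
    (hτ : ∀ X Y (f : X ⟶ Y), τ X ≫ f = f ≫ τ Y)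
    (hEE : ∀ X, A X → E X ≫ E X = E X) (hττ : ∀ X, τ X ≫ τ X = 𝟙 X)
    (hEτ : ∀ X, A X → E X ≫ τ X = E X)
    (hP : ∀ X, P X ↔ A X ∧ τ X = -𝟙 X ∧ IsIso (𝟙 X + 𝟙 X))
    (hQ : ∀ X, Q X ↔ A X ∧ E X = 0 ∧ τ X = 𝟙 X) (hR : ∀ X, R X ↔ A X ∧ E X = 𝟙 X)
    (h2 : ∀ X, A X → E X = 0 → IsIso (𝟙 X + 𝟙 X))
    (hret : ∀ X Y (i : Y ⟶ X) (r : X ⟶ Y), i ≫ r = 𝟙 Y → A X → A Y)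
    (hprod : ∀ X Y, A X → A Y → A (X ⨯ Y)) : SplitsAs A P Q R := by
  have hRτ : ∀ X, R X → τ X = 𝟙 X := fun X hX => by
    have := hEτ X ((hR X).1 hX).1
    rwa [((hR X).1 hX).2, Category.id_comp] at this
  -- Since τ is -1 on the source and 1 on the target, naturality gives 2f = 0, and 2 is invertible
  -- on the source.
  have hleft : ∀ X Y (f : X ⟶ Y), P X → τ Y = 𝟙 Y → f = 0 := fun X Y f hX hY => by
    obtain ⟨_, h1, h3⟩ := (hP X).1 hX
    have h := hτ X Y f
    rw [h1, hY, Category.comp_id, Preadditive.neg_comp, Category.id_comp] at h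
    have h4 : (𝟙 X + 𝟙 X) ≫ f = 0 := by
      rw [Preadditive.add_comp, Category.id_comp]; nth_rewrite 1 [← h]; simp
    exact (cancel_epi (𝟙 X + 𝟙 X)).1 (h4.trans comp_zero.symm)
  have hright : ∀ X Y (f : X ⟶ Y), P Y → τ X = 𝟙 X → f = 0 := fun X Y f hY hX => by
    obtain ⟨_, h1, h3⟩ := (hP Y).1 hY
    have h := hτ X Y f
    rw [h1, hX, Category.id_comp, Preadditive.comp_neg, Category.comp_id] at h
    have h4 : f ≫ (𝟙 Y + 𝟙 Y) = 0 := by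
      rw [Preadditive.comp_add, Category.comp_id]; nth_rewrite 1 [h]; simp
    exact (cancel_mono (𝟙 Y + 𝟙 Y)).1 (h4.trans zero_comp.symm)
  refine splitsAs_of_orthogonal A P Q R (fun X h => ((hP X).1 h).1) (fun X h => ((hQ X).1 h).1)
    (fun X h => ((hR X).1 h).1) hprod
    (fun X Y f hX hY => hleft X Y f hX ((hQ Y).1 hY).2.2)
    (fun X Y f hX hY => hleft X Y f hX (hRτ Y hY))
    (fun X Y f hX hY => hright X Y f hY ((hQ X).1 hX).2.2)
    (fun X Y f hX hY => ?_)
    (fun X Y f hX hY => hright X Y f hY (hRτ X hX))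
    (fun X Y f hX hY => ?_)
    (fun X hX => ?_)
  · have := hE X Y f ((hQ X).1 hX).1 ((hR Y).1 hY).1
    rw [((hQ X).1 hX).2.1, ((hR Y).1 hY).2, zero_comp, Category.comp_id] at this
    exact this.symm
  · have := hE X Y f ((hR X).1 hX).1 ((hQ Y).1 hY).1
    rw [((hQ Y).1 hY).2.1, ((hR X).1 hX).2, comp_zero, Category.id_comp] at this
    exact this
  -- The image `Y₃` of E is split off; on the complement `Y` one has E = 0, so 2 is invertible there
  -- by `h2`.
  · obtain ⟨Y₃, i₃, r₃, h₃, h₃'⟩ := IsIdempotentComplete.idempotents_split X (E X) (hEE X hX)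
    obtain ⟨Y, i, r, h, h'⟩ := IsIdempotentComplete.idempotents_split X (𝟙 X - E X)
      (Idempotents.idem_of_id_sub_idem _ (hEE X hX))
    have A₃ := hret X Y₃ i₃ r₃ h₃ hX
    have AY := hret X Y i r h hX
    have hir₃ : i ≫ r₃ = 0 := by
      calc i ≫ r₃ = i ≫ (r ≫ i) ≫ r₃ := by rw [Category.assoc, reassoc_of% h]
        _ = 0 := by
          rw [h', Preadditive.sub_comp, Category.id_comp, ← h₃', Category.assoc, h₃,
            Category.comp_id, sub_self, comp_zero]
    have hir : i₃ ≫ r = 0 := by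
      calc i₃ ≫ r = i₃ ≫ (r₃ ≫ i₃) ≫ r := by rw [Category.assoc, reassoc_of% h₃]
        _ = i₃ ≫ (𝟙 X - r ≫ i) ≫ r := by rw [h₃', h']; simp
        _ = 0 := by
          rw [Preadditive.sub_comp, Category.id_comp, Category.assoc, h,
            Category.comp_id, sub_self, comp_zero]
    have E₃ : E Y₃ = 𝟙 Y₃ := by
      calc E Y₃ = E Y₃ ≫ i₃ ≫ r₃ := by rw [h₃, Category.comp_id]
        _ = i₃ ≫ (r₃ ≫ i₃) ≫ r₃ := by rw [← Category.assoc, hE _ _ i₃ A₃ hX, h₃', Category.assoc]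
        _ = 𝟙 _ := by simp [reassoc_of% h₃, h₃]
    have EY : E Y = 0 := by
      calc E Y = E Y ≫ i ≫ r := by rw [h, Category.comp_id]
        _ = i ≫ (r₃ ≫ i₃) ≫ r := by rw [← Category.assoc, hE _ _ i AY hX, h₃', Category.assoc]
        _ = 0 := by rw [Category.assoc, reassoc_of% hir₃, zero_comp]
    haveI := h2 Y AY EY
    obtain ⟨g, hg1, hg2⟩ := (h2 Y AY EY).out
    rw [Preadditive.add_comp, Category.id_comp] at hg1
    -- As `g` is the inverse of 2, this is (1 - τ)/2, the projection to the part where τ = -1.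
    let p : Y ⟶ Y := (𝟙 Y - τ Y) ≫ g
    have hp2 : p + p = 𝟙 Y - τ Y := by
      change (𝟙 Y - τ Y) ≫ g + (𝟙 Y - τ Y) ≫ g = _
      rw [← Preadditive.comp_add, hg1, Category.comp_id]
    have hτp : τ Y = 𝟙 Y - (p + p) := by rw [hp2]; abel
    have hpp : p ≫ p = p := by
      have e1 : p ≫ p + p ≫ p = p + p := by
        have h3 : τ Y ≫ p = -p := by
          change τ Y ≫ (𝟙 Y - τ Y) ≫ g = -((𝟙 Y - τ Y) ≫ g)
          have : τ Y ≫ (𝟙 Y - τ Y) = -(𝟙 Y - τ Y) := by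
            rw [Preadditive.comp_sub, hττ, Category.comp_id]; abel
          rw [← Category.assoc, this, Preadditive.neg_comp]
        have h4 : p ≫ (p + p) = p + p := by
          calc p ≫ (p + p) = p ≫ (𝟙 Y - τ Y) := by rw [hp2]
            _ = p + p := by
              rw [Preadditive.comp_sub, Category.comp_id, ← hτ Y Y p, h3, sub_neg_eq_add]
        rw [← Preadditive.comp_add, h4]
      have e2 : ∀ a : Y ⟶ Y, a = (a + a) ≫ g := fun a => by
        rw [Preadditive.add_comp, ← Preadditive.comp_add, hg1, Category.comp_id]
      rw [e2 (p ≫ p), e1, ← e2]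
    obtain ⟨Y₁, i₁, r₁, h₁, h₁'⟩ := IsIdempotentComplete.idempotents_split Y p hpp
    obtain ⟨Y₂, i₂, r₂, h₂, h₂'⟩ := IsIdempotentComplete.idempotents_split Y (𝟙 Y - p)
      (Idempotents.idem_of_id_sub_idem _ hpp)
    have h12 : i₁ ≫ r₂ = 0 := by
      calc i₁ ≫ r₂ = i₁ ≫ (r₁ ≫ i₁) ≫ r₂ := by rw [Category.assoc, reassoc_of% h₁]
        _ = i₁ ≫ (𝟙 Y - r₂ ≫ i₂) ≫ r₂ := by rw [h₁', h₂']; simp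
        _ = 0 := by
          rw [Preadditive.sub_comp, Category.id_comp, Category.assoc, h₂,
            Category.comp_id, sub_self, comp_zero]
    have h21 : i₂ ≫ r₁ = 0 := by
      calc i₂ ≫ r₁ = i₂ ≫ (r₂ ≫ i₂) ≫ r₁ := by rw [Category.assoc, reassoc_of% h₂]
        _ = i₂ ≫ (𝟙 Y - r₁ ≫ i₁) ≫ r₁ := by rw [h₁', h₂']
        _ = 0 := by
          rw [Preadditive.sub_comp, Category.id_comp, Category.assoc, h₁,
            Category.comp_id, sub_self, comp_zero]
    have hi₁p : i₁ ≫ p = i₁ := by rw [← h₁', reassoc_of% h₁]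
    have hi₂p : i₂ ≫ p = 0 := by rw [← h₁', reassoc_of% h21, zero_comp]
    have A₁ := hret Y Y₁ i₁ r₁ h₁ AY
    have A₂ := hret Y Y₂ i₂ r₂ h₂ AY
    have τ₁ : τ Y₁ = -𝟙 Y₁ := by
      calc τ Y₁ = τ Y₁ ≫ i₁ ≫ r₁ := by rw [h₁, Category.comp_id]
        _ = (i₁ ≫ τ Y) ≫ r₁ := by rw [← hτ, Category.assoc]
        _ = _ := by
          rw [hτp, Preadditive.comp_sub, Preadditive.comp_add, hi₁p, Category.comp_id,
            Preadditive.sub_comp, Preadditive.add_comp, h₁]; abel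
    have τ₂ : τ Y₂ = 𝟙 Y₂ := by
      calc τ Y₂ = τ Y₂ ≫ i₂ ≫ r₂ := by rw [h₂, Category.comp_id]
        _ = (i₂ ≫ τ Y) ≫ r₂ := by rw [← hτ, Category.assoc]
        _ = _ := by
          rw [hτp, Preadditive.comp_sub, Preadditive.comp_add, hi₂p, Category.comp_id, add_zero,
            sub_zero, h₂]
    have E₂ : E Y₂ = 0 := by
      calc E Y₂ = E Y₂ ≫ i₂ ≫ r₂ := by rw [h₂, Category.comp_id]
        _ = 0 := by rw [← Category.assoc, hE _ _ i₂ A₂ AY, EY, comp_zero, zero_comp]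
    -- Division by 2 on `Y` compresses to the retract `Y₁`.
    have iso₁ : IsIso (𝟙 Y₁ + 𝟙 Y₁) := by
      have e : i₁ ≫ g ≫ r₁ + i₁ ≫ g ≫ r₁ = 𝟙 Y₁ := by
        rw [← Preadditive.comp_add, ← Preadditive.add_comp, hg1, Category.id_comp, h₁]
      exact ⟨i₁ ≫ g ≫ r₁, by rw [Preadditive.add_comp, Category.id_comp, e],
        by rw [Preadditive.comp_add, Category.comp_id, e]⟩
    refine ⟨Y₁, Y₂, Y₃, (hP _).2 ⟨A₁, τ₁, iso₁⟩, (hQ _).2 ⟨A₂, E₂, τ₂⟩, (hR _).2 ⟨A₃, E₃⟩,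
      ⟨prodIsoOfOrthogonal (i₁ ≫ i) (i₂ ≫ i) i₃ (r ≫ r₁) (r ≫ r₂) r₃ ?_ ?_ ?_ ?_ ?_ ?_ ?_ ?_ h₃ ?_⟩⟩
    · simp [reassoc_of% h, h₁]
    · simp [reassoc_of% h, h12]
    · simp [hir₃]
    · simp [reassoc_of% h, h21]
    · simp [reassoc_of% h, h₂]
    · simp [hir₃]
    · simp [reassoc_of% hir]
    · simp [reassoc_of% hir]
    · have : r₁ ≫ i₁ + r₂ ≫ i₂ = 𝟙 Y := by rw [h₁', h₂']; abel
      calc (r ≫ r₁) ≫ i₁ ≫ i + (r ≫ r₂) ≫ i₂ ≫ i + r₃ ≫ i₃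
          = r ≫ (r₁ ≫ i₁ + r₂ ≫ i₂) ≫ i + r₃ ≫ i₃ := by
            simp [Preadditive.comp_add, Preadditive.add_comp]
        _ = 𝟙 X := by rw [this, Category.id_comp, h', h₃']; abel

end Splitting

end

/-! ### Cogroup objects among the graded algebras satisfying a predicate, and their Hopf algebras -/

noncomputable section

namespace GrAlg

variable {k : Type u} [Field k]

/-- `tmk` as a linear equivalence. -/
def tmkEquiv (A B : GrAlg k) : A.carrier ⊗[k] B.carrier ≃ₗ[k] (tensor A B).carrier :=
  LinearEquiv.ofBijective (tmk A B) ⟨tmk_injective A B, tmk_surjective A B⟩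

lemma tmk_tmkEquiv_symm (A B : GrAlg k) (x : (tensor A B).carrier) :
    tmk A B ((tmkEquiv A B).symm x) = x := (tmkEquiv A B).apply_symm_apply x

/-- The graded swap exchanges the two coproduct inclusions, so cocommutativity becomes commutativity
of the sum of two universal points. -/
lemma comm_of_eq_desc (A : GrAlg k) (x : A.carrier ⊗[k] A.carrier) :
    GradedTensorProduct.comm A.grading A.grading
      (GradedTensorProduct.of k A.grading A.grading x) =
    (tensorDesc (tensorInr A A) (tensorInl A A)).toAlgHom (tmk A A x) := by
  have : (GradedTensorProduct.comm A.grading A.grading).toLinearMap ∘ₗ tensorOf A A =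
      (tensorDesc (tensorInr A A) (tensorInl A A)).toAlgHom.toLinearMap ∘ₗ tmk A A := by
    refine A.tensor_hom_ext A fun i j a ha b hb => ?_
    refine (gradedTensor_comm A ha hb).trans ?_
    refine Eq.trans ?_ (tensorDesc_tmul (tensorInr A A) (tensorInl A A) a b).symm
    rw [tensorInr_apply, tensorInl_apply]
    refine Eq.trans ?_ (tmk_mul A A 1 1 ha hb).symm
    rw [one_mul, mul_one, mul_comm j i]
    rfl
  exact LinearMap.congr_fun this x

lemma id_toLinearMap (A : GrAlg k) : (Hom.toAlgHom (𝟙 A)).toLinearMap = LinearMap.id := rfl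

section Cogroup

variable (A : GrAlg k) (P : GrAlg k → Prop) (hA : P A) (hU : P (unitAlg k))
  (hT : ∀ B C, P B → P C → P (tensor B C)) (inst : ∀ B, P B → AddCommGroup (A ⟶ B))
  (nat : ∀ B C (hB : P B) (hC : P C) (f : B ⟶ C) (x y : A ⟶ B),
    (inst B hB).add x y ≫ f = (inst C hC).add (x ≫ f) (y ≫ f))

/-- The comultiplication morphism of a cogroup structure. -/
def cogroupComul : A ⟶ tensor A A :=
  (inst _ (hT A A hA hA)).add (tensorInl A A) (tensorInr A A)

include nat

/-- Yoneda: any pair of points is the image, under `tensorDesc f g`, of the universal pair of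
inclusions into `A ⊗ A`. -/
lemma cogroup_add {B : GrAlg k} (hB : P B) (f g : A ⟶ B) :
    (inst B hB).add f g = cogroupComul A P hA hT inst ≫ tensorDesc f g := by
  rw [cogroupComul, nat _ _ _ hB, tensorInl_desc, tensorInr_desc]

/-- Naturality is assumed for addition only. The image of zero equals its own double, and in a group
this forces it to be zero. -/
lemma cogroup_zero_natural {B C : GrAlg k} (hB : P B) (hC : P C) (f : B ⟶ C) :
    (inst B hB).zero ≫ f = (inst C hC).zero := by
  letI := inst B hB
  letI := inst C hC
  have h : ((0 : A ⟶ B) + 0) ≫ f = ((0 : A ⟶ B) ≫ f) + ((0 : A ⟶ B) ≫ f) := nat B C hB hC f 0 0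
  rw [add_zero] at h
  exact left_eq_add.1 h

lemma cogroup_zero {B : GrAlg k} (hB : P B) :
    (inst B hB).zero = (inst _ hU).zero ≫ unitHom B :=
  (cogroup_zero_natural A P inst nat hU hB (unitHom B)).symm

lemma cogroup_add_apply {B : GrAlg k} (hB : P B) (f g : A ⟶ B) (a : A.carrier) :
    ((inst B hB).add f g).toAlgHom a = LinearMap.mul' k B.carrier
      (TensorProduct.map f.toAlgHom.toLinearMap g.toAlgHom.toLinearMap
        ((tmkEquiv A A).symm ((cogroupComul A P hA hT inst).toAlgHom a))) := by
  rw [cogroup_add A P hA hT inst nat hB, comp_apply, ← tensorDesc_apply, tmk_tmkEquiv_symm]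

lemma cogroup_add_toLinearMap {B : GrAlg k} (hB : P B) (f g : A ⟶ B) :
    ((inst B hB).add f g).toAlgHom.toLinearMap = LinearMap.mul' k B.carrier ∘ₗ
      (TensorProduct.map f.toAlgHom.toLinearMap g.toAlgHom.toLinearMap) ∘ₗ
        ((tmkEquiv A A).symm.toLinearMap ∘ₗ (cogroupComul A P hA hT inst).toAlgHom.toLinearMap) :=
  LinearMap.ext fun a => cogroup_add_apply A P hA hT inst nat hB f g a

omit nat in
lemma tensor_triple (A B C : GrAlg k) :
    LinearMap.mul' k (tensor A (tensor B C)).carrier ∘ₗ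
      TensorProduct.map (tensorInl A (tensor B C)).toAlgHom.toLinearMap
        (LinearMap.mul' k (tensor A (tensor B C)).carrier ∘ₗ TensorProduct.map
          (tensorInl B C ≫ tensorInr A (tensor B C)).toAlgHom.toLinearMap
          (tensorInr B C ≫ tensorInr A (tensor B C)).toAlgHom.toLinearMap) =
    tmk A (tensor B C) ∘ₗ (tmk B C).lTensor A.carrier := by
  ext a b c
  change (tensorInl A (tensor B C)).toAlgHom a *
    ((tensorInr A (tensor B C)).toAlgHom ((tensorInl B C).toAlgHom b) *
      (tensorInr A (tensor B C)).toAlgHom ((tensorInr B C).toAlgHom c)) =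
    tmk A (tensor B C) (a ⊗ₜ tmk B C (b ⊗ₜ c))
  rw [← tensorInl_mul_tensorInr, ← tensorInl_mul_tensorInr B C, map_mul]

/-- The coalgebra structure of a cogroup. -/
@[reducible] def cogroupCoalgebra : Coalgebra k A.carrier where
  comul := (tmkEquiv A A).symm.toLinearMap ∘ₗ (cogroupComul A P hA hT inst).toAlgHom.toLinearMap
  counit := (show A ⟶ unitAlg k from (inst _ hU).zero).toAlgHom.toLinearMap
  coassoc := by
    set D := (tmkEquiv A A).symm.toLinearMap ∘ₗ (cogroupComul A P hA hT inst).toAlgHom.toLinearMap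
    let T := tensor A (tensor A A)
    have hTT : P T := hT _ _ hA (hT _ _ hA hA)
    let i1 : A ⟶ T := tensorInl A (tensor A A)
    let i2 : A ⟶ T := tensorInl A A ≫ tensorInr A (tensor A A)
    let i3 : A ⟶ T := tensorInr A A ≫ tensorInr A (tensor A A)
    letI := inst T hTT
    -- Coassociativity is the associative law for the three universal points of `A` with values in
    -- `A ⊗ (A ⊗ A)`.
    have key : (inst T hTT).add ((inst T hTT).add i1 i2) i3 =
      (inst T hTT).add i1 ((inst T hTT).add i2 i3) := add_assoc i1 i2 i3
    have k2 := congrArg (fun f : A ⟶ T => f.toAlgHom.toLinearMap) key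
    simp only [cogroup_add_toLinearMap A P hA hT inst nat] at k2
    have inj : Function.Injective (tmk A (tensor A A) ∘ₗ (tmk A A).lTensor A.carrier) :=
      (tmk_injective _ _).comp (Module.Flat.lTensor_preserves_injective_linearMap _
        (tmk_injective A A))
    have tri := tensor_triple A A A
    have tri2 : LinearMap.mul' k T.carrier ∘ₗ TensorProduct.map (LinearMap.mul' k T.carrier ∘ₗ
        TensorProduct.map i1.toAlgHom.toLinearMap i2.toAlgHom.toLinearMap)
        i3.toAlgHom.toLinearMap = (tmk A (tensor A A) ∘ₗ (tmk A A).lTensor A.carrier) ∘ₗ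
        (TensorProduct.assoc k A.carrier A.carrier A.carrier).toLinearMap := by
      rw [← tri]
      ext a b c
      exact mul_assoc (i1.toAlgHom a) (i2.toAlgHom b) (i3.toAlgHom c)
    refine LinearMap.ext fun a => inj ?_
    have k3 := LinearMap.congr_fun k2 a
    have e1 : ∀ x : A.carrier ⊗[k] A.carrier, TensorProduct.map (LinearMap.mul' k T.carrier ∘ₗ
        TensorProduct.map i1.toAlgHom.toLinearMap i2.toAlgHom.toLinearMap ∘ₗ D)
        i3.toAlgHom.toLinearMap x = TensorProduct.map (LinearMap.mul' k T.carrier ∘ₗ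
        TensorProduct.map i1.toAlgHom.toLinearMap i2.toAlgHom.toLinearMap)
        i3.toAlgHom.toLinearMap (D.rTensor _ x) := fun x => by
      rw [LinearMap.rTensor, ← LinearMap.comp_apply, ← TensorProduct.map_comp]; rfl
    have e2 : ∀ x : A.carrier ⊗[k] A.carrier, TensorProduct.map i1.toAlgHom.toLinearMap
        (LinearMap.mul' k T.carrier ∘ₗ
        TensorProduct.map i2.toAlgHom.toLinearMap i3.toAlgHom.toLinearMap ∘ₗ D) x =
        TensorProduct.map i1.toAlgHom.toLinearMap (LinearMap.mul' k T.carrier ∘ₗ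
        TensorProduct.map i2.toAlgHom.toLinearMap i3.toAlgHom.toLinearMap) (D.lTensor _ x) :=
      fun x => by
      rw [LinearMap.lTensor, ← LinearMap.comp_apply, ← TensorProduct.map_comp]; rfl
    have e3 := LinearMap.congr_fun tri2 (D.rTensor _ (D a))
    have e4 := LinearMap.congr_fun tri (D.lTensor _ (D a))
    refine e3.symm.trans (Eq.trans ?_ e4)
    refine (congrArg (LinearMap.mul' k T.carrier) (e1 (D a))).symm.trans (k3.trans ?_)
    exact congrArg (LinearMap.mul' k T.carrier) (e2 (D a))
  rTensor_counit_comp_comul := by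
    letI := inst A hA
    have key : (inst A hA).add ((inst _ hU).zero ≫ unitHom A) (𝟙 A) = 𝟙 A := by
      rw [← cogroup_zero A P hU inst nat hA]; exact zero_add (𝟙 A)
    have k2 := congrArg (fun f : A ⟶ A => f.toAlgHom.toLinearMap) key
    simp only [cogroup_add_toLinearMap A P hA hT inst nat] at k2
    set D := (tmkEquiv A A).symm.toLinearMap ∘ₗ (cogroupComul A P hA hT inst).toAlgHom.toLinearMap
    refine LinearMap.ext fun a => (TensorProduct.lid k A.carrier).injective ?_
    have k3 := LinearMap.congr_fun k2 a
    refine Eq.trans ?_ (k3.trans (one_smul k a).symm)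
    have : (TensorProduct.lid k A.carrier).toLinearMap ∘ₗ
        LinearMap.rTensor A.carrier (show A ⟶ unitAlg k from (inst _ hU).zero).toAlgHom.toLinearMap =
        LinearMap.mul' k A.carrier ∘ₗ TensorProduct.map
          (show A ⟶ A from (inst _ hU).zero ≫ unitHom A).toAlgHom.toLinearMap
          (Hom.toAlgHom (𝟙 A)).toLinearMap := by
      ext a b
      exact Algebra.smul_def _ _
    exact LinearMap.congr_fun this (D a)
  lTensor_counit_comp_comul := by
    letI := inst A hA
    have key : (inst A hA).add (𝟙 A) ((inst _ hU).zero ≫ unitHom A) = 𝟙 A := by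
      rw [← cogroup_zero A P hU inst nat hA]; exact add_zero (𝟙 A)
    have k2 := congrArg (fun f : A ⟶ A => f.toAlgHom.toLinearMap) key
    simp only [cogroup_add_toLinearMap A P hA hT inst nat] at k2
    set D := (tmkEquiv A A).symm.toLinearMap ∘ₗ (cogroupComul A P hA hT inst).toAlgHom.toLinearMap
    refine LinearMap.ext fun a => (TensorProduct.rid k A.carrier).injective ?_
    have k3 := LinearMap.congr_fun k2 a
    refine Eq.trans ?_ (k3.trans (one_smul k a).symm)
    have : (TensorProduct.rid k A.carrier).toLinearMap ∘ₗ
        LinearMap.lTensor A.carrier (show A ⟶ unitAlg k from (inst _ hU).zero).toAlgHom.toLinearMap =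
        LinearMap.mul' k A.carrier ∘ₗ TensorProduct.map
          (Hom.toAlgHom (𝟙 A)).toLinearMap
          (show A ⟶ A from (inst _ hU).zero ≫ unitHom A).toAlgHom.toLinearMap := by
      ext a b
      exact (Algebra.smul_def _ _).trans (Algebra.commutes _ _)
    exact LinearMap.congr_fun this (D a)

lemma cogroup_comm (a : A.carrier) :
    GradedTensorProduct.comm A.grading A.grading
      (GradedTensorProduct.of k A.grading A.grading
        ((tmkEquiv A A).symm ((cogroupComul A P hA hT inst).toAlgHom a))) =
    GradedTensorProduct.of k A.grading A.grading
      ((tmkEquiv A A).symm ((cogroupComul A P hA hT inst).toAlgHom a)) := by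
  refine (comm_of_eq_desc A _).trans (Eq.trans ?_ (tmk_tmkEquiv_symm A A _).symm)
  rw [tmk_tmkEquiv_symm]
  letI := inst _ (hT A A hA hA)
  have h : (inst _ (hT A A hA hA)).add (tensorInr A A) (tensorInl A A) =
    (inst _ (hT A A hA hA)).add (tensorInl A A) (tensorInr A A) :=
      add_comm (tensorInr A A) (tensorInl A A)
  rw [cogroup_add A P hA hT inst nat] at h
  exact congrArg (fun f : A ⟶ tensor A A => f.toAlgHom a) h

lemma cogroup_neg_left (a : A.carrier) :
    LinearMap.mul' k A.carrier (TensorProduct.map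
      (show A ⟶ A from (inst A hA).neg (𝟙 A)).toAlgHom.toLinearMap LinearMap.id
        ((tmkEquiv A A).symm ((cogroupComul A P hA hT inst).toAlgHom a))) =
      algebraMap k A.carrier ((show A ⟶ unitAlg k from (inst _ hU).zero).toAlgHom a) := by
  letI := inst A hA
  have h : (inst A hA).add ((inst A hA).neg (𝟙 A)) (𝟙 A) = (inst A hA).zero :=
    neg_add_cancel (𝟙 A)
  rw [cogroup_zero A P hU inst nat hA] at h
  have h3 := cogroup_add_apply A P hA hT inst nat hA ((inst A hA).neg (𝟙 A)) (𝟙 A) a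
  rw [id_toLinearMap] at h3
  refine h3.symm.trans ?_
  rw [h, comp_apply]
  rfl

lemma cogroup_neg_right (a : A.carrier) :
    LinearMap.mul' k A.carrier (TensorProduct.map LinearMap.id
      (show A ⟶ A from (inst A hA).neg (𝟙 A)).toAlgHom.toLinearMap
        ((tmkEquiv A A).symm ((cogroupComul A P hA hT inst).toAlgHom a))) =
      algebraMap k A.carrier ((show A ⟶ unitAlg k from (inst _ hU).zero).toAlgHom a) := by
  letI := inst A hA
  have h : (inst A hA).add (𝟙 A) ((inst A hA).neg (𝟙 A)) = (inst A hA).zero :=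
    add_neg_cancel (𝟙 A)
  rw [cogroup_zero A P hU inst nat hA] at h
  have h3 := cogroup_add_apply A P hA hT inst nat hA (𝟙 A) ((inst A hA).neg (𝟙 A)) a
  rw [id_toLinearMap] at h3
  refine h3.symm.trans ?_
  rw [h, comp_apply]
  rfl

/-- The graded Hopf algebra of a graded algebra which represents a group-valued functor on a class
of graded algebras. -/
def hopfOfCogroup : GrHopf k :=
  letI := cogroupCoalgebra A P hA hU hT inst nat
  have hof : ∀ a : A.carrier, tmk A A (Coalgebra.comul a) =
      (cogroupComul A P hA hT inst).toAlgHom a := fun a => tmk_tmkEquiv_symm A A _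
  { A with
    comul_mem := fun n a ha => (tmk_mem A A).1
      ((hof a).symm ▸ (cogroupComul A P hA hT inst).map_mem n a ha)
    counit_eq_zero := fun n a ha hn => eq_zero_of_mem_unitAlg hn
      ((show A ⟶ unitAlg k from (inst _ hU).zero).map_mem n a ha)
    comul_one := tmk_injective A A ((hof 1).trans ((map_one _).trans (tmk_one A A).symm))
    comul_mul := fun a b => (hof (a * b)).trans ((map_mul _ _ _).trans
      (congrArg₂ (· * ·) (hof a).symm (hof b).symm))
    counit_one := map_one (show A ⟶ unitAlg k from (inst _ hU).zero).toAlgHom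
    counit_mul := map_mul (show A ⟶ unitAlg k from (inst _ hU).zero).toAlgHom
    graded_cocomm := cogroup_comm A P hA hT inst nat
    antipode := (show A ⟶ A from (inst A hA).neg (𝟙 A)).toAlgHom.toLinearMap
    antipode_mem := (show A ⟶ A from (inst A hA).neg (𝟙 A)).map_mem
    mul_antipode_left := cogroup_neg_left A P hA hU hT inst nat
    mul_antipode_right := cogroup_neg_right A P hA hU hT inst nat }

lemma hopfOfCogroup_add_apply {B : GrAlg k} (hB : P B) (f g : A ⟶ B) (a : A.carrier) :
    ((inst B hB).add f g).toAlgHom a = LinearMap.mul' k B.carrier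
      (TensorProduct.map f.toAlgHom.toLinearMap g.toAlgHom.toLinearMap
        (Coalgebra.comul (R := k) (A := (hopfOfCogroup A P hA hU hT inst nat).carrier) a)) :=
  cogroup_add_apply A P hA hT inst nat hB f g a

end Cogroup

end GrAlg

end

/-! ### Split idempotents of graded algebras; convolution of points of a Hopf algebra -/

noncomputable section

namespace GrAlg

variable {k : Type u} [Field k]

section Sub

variable (A : GrAlg k) (S : Subalgebra k A.carrier) (hS : ∀ n, ∀ a ∈ S, A.proj n a ∈ S)

/-- The graded algebra underlying a homogeneous subalgebra. -/
def sub : GrAlg k where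
  carrier := S
  grading n := (A.grading n).comap S.val.toLinearMap
  graded := gradedAlgebraOfProj _ A.one_mem (fun _ _ _ _ ha hb => A.mul_mem ha hb)
    (fun n => LinearMap.codRestrict (Subalgebra.toSubmodule S)
      (A.proj n ∘ₗ S.val.toLinearMap) (fun a => hS n _ a.2))
    (fun n a ha => Subtype.ext (A.proj_of_mem ha))
    (fun m n a ha h => Subtype.ext (A.proj_of_mem_ne ha h))
    (fun a => by
      have h : (a : A.carrier) ∈
          (⨆ n, (A.grading n).comap S.val.toLinearMap).map S.val.toLinearMap :=
        A.mem_iSup_of_forall fun n => ⟨⟨A.proj n a, hS n _ a.2⟩,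
          (le_iSup (fun n => (A.grading n).comap S.val.toLinearMap) n :) (A.proj_mem n a), rfl⟩
      obtain ⟨b, hb, h⟩ := h
      rwa [Subtype.ext h] at hb)
  graded_comm i j a b ha hb := Subtype.ext (by
    refine (A.graded_comm i j _ _ ha hb).trans ?_
    rcases Nat.even_or_odd (i * j) with h | h <;> simp [h.neg_one_pow])

/-- The inclusion of a homogeneous subalgebra. -/
def subIncl : sub A S hS ⟶ A where
  toAlgHom := S.val
  map_mem _ _ h := h

lemma subIncl_injective : Function.Injective (subIncl A S hS).toAlgHom := Subtype.val_injective

lemma subIncl_mem (a : (sub A S hS).carrier) : (subIncl A S hS).toAlgHom a ∈ S := a.2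

/-- Restriction of the codomain of a morphism to a homogeneous subalgebra. -/
def subLift {B : GrAlg k} (f : B ⟶ A) (h : ∀ b, f.toAlgHom b ∈ S) : B ⟶ sub A S hS where
  toAlgHom := f.toAlgHom.codRestrict S h
  map_mem n b hb := f.map_mem n b hb

end Sub

/-- The image of an idempotent is its subalgebra of fixed elements, which is homogeneous because
morphisms commute with the projections to degrees. -/
lemma exists_split {A : GrAlg k} (q : A ⟶ A) (hq : q ≫ q = q) :
    ∃ (B : GrAlg k) (i : B ⟶ A) (r : A ⟶ B), i ≫ r = 𝟙 B ∧ r ≫ i = q := by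
  have hqq : ∀ a, q.toAlgHom (q.toAlgHom a) = q.toAlgHom a := fun a =>
    congrArg (fun f : A ⟶ A => f.toAlgHom a) hq
  let S : Subalgebra k A.carrier := AlgHom.equalizer q.toAlgHom (AlgHom.id k A.carrier)
  have hS : ∀ n, ∀ a ∈ S, A.proj n a ∈ S := fun n a ha => by
    change q.toAlgHom (A.proj n a) = A.proj n a
    rw [← hom_proj]
    exact congrArg _ ha
  refine ⟨sub A S hS, subIncl A S hS, subLift A S hS q hqq, ?_, rfl⟩
  exact hom_ext' fun a => Subtype.ext a.2

section Points

variable (A : GrAlg k) (P : GrAlg k → Prop) (hA : P A) (hU : P (unitAlg k))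
  (hT : ∀ B C, P B → P C → P (tensor B C)) (X : ∀ B, P B → Type u)
  (inst : ∀ B hB, AddCommGroup (X B hB)) (e : ∀ B hB, X B hB ≃ (A ⟶ B))
  (map : ∀ B C (hB : P B) (hC : P C), (B ⟶ C) → X B hB → X C hC)
  (map_add : ∀ B C hB hC f x y, map B C hB hC f ((inst B hB).add x y) =
    (inst C hC).add (map B C hB hC f x) (map B C hB hC f y))
  (nat : ∀ B C hB hC f x, e C hC (map B C hB hC f x) = e B hB x ≫ f)

include hA hU hT map_add nat

/-- The group structures are transported along `e`, and the resulting cogroup `A` is a Hopf algebra.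
The predicate `P` allows all test algebras (affine groups) or only finite-dimensional ones (pieces
of formal groups). -/
lemma exists_hopf_of_points : ∃ H : GrHopf k, ∃ h : H.toGrAlg = A, ∀ B hB (x y : X B hB)
    (a : H.carrier), (eqToHom h ≫ e B hB ((inst B hB).add x y)).toAlgHom a =
      LinearMap.mul' k B.carrier (TensorProduct.map
        (eqToHom h ≫ e B hB x).toAlgHom.toLinearMap (eqToHom h ≫ e B hB y).toAlgHom.toLinearMap
          (Coalgebra.comul a)) := by
  let inst' : ∀ B, P B → AddCommGroup (A ⟶ B) := fun B hB => (e B hB).symm.addCommGroup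
  have hadd : ∀ B hB x y, (inst' B hB).add x y =
    e B hB ((inst B hB).add ((e B hB).symm x) ((e B hB).symm y)) := fun B hB x y => rfl
  have nat' : ∀ B C (hB : P B) (hC : P C) (f : B ⟶ C) (x y : A ⟶ B),
      (inst' B hB).add x y ≫ f = (inst' C hC).add (x ≫ f) (y ≫ f) := fun B C hB hC f x y => by
    rw [hadd, hadd, ← nat B C hB hC, map_add]
    congr 2
    · rw [Equiv.eq_symm_apply, nat, Equiv.apply_symm_apply]
    · rw [Equiv.eq_symm_apply, nat, Equiv.apply_symm_apply]
  refine ⟨hopfOfCogroup A P hA hU hT inst' nat', rfl, fun B hB x y a => ?_⟩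
  have h := hopfOfCogroup_add_apply A P hA hU hT inst' nat' hB (e B hB x) (e B hB y) a
  rw [hadd, Equiv.symm_apply_apply, Equiv.symm_apply_apply] at h
  exact h

end Points

end GrAlg

open GrAlg

namespace GrHopf

variable {k : Type u} [Field k] (H : GrHopf k)

/-- The comultiplication as a morphism of graded algebras. -/
def comulHom : H.toGrAlg ⟶ tensor H.toGrAlg H.toGrAlg where
  toAlgHom := AlgHom.ofLinearMap (tmk H.toGrAlg H.toGrAlg ∘ₗ Coalgebra.comul)
    ((congrArg (tmk H.toGrAlg H.toGrAlg) H.comul_one).trans (tmk_one _ _)) H.comul_mul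
  map_mem n a ha := (tmk_mem _ _).2 (H.comul_mem n a ha)

lemma comulHom_apply (a : H.carrier) :
    H.comulHom.toAlgHom a = tmk H.toGrAlg H.toGrAlg (Coalgebra.comul a) := rfl

/-- The counit as a morphism of graded algebras. -/
def counitHom : H.toGrAlg ⟶ unitAlg k where
  toAlgHom := (AlgHom.ofLinearMap (Coalgebra.counit : H.carrier →ₗ[k] k) H.counit_one
    H.counit_mul : H.carrier →ₐ[k] k)
  map_mem n a ha := by
    by_cases hn : n = 0
    · subst hn; exact mem_unitAlg_grading (k := k) (Coalgebra.counit a : k)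
    · have h : (Coalgebra.counit a : k) = 0 := H.counit_eq_zero n a ha hn
      exact (h ▸ Submodule.zero_mem _ : (Coalgebra.counit a : k) ∈ (unitAlg k).grading n)

/-- The convolution product of morphisms out of a Hopf algebra. -/
def conv {H : GrHopf k} {B : GrAlg k} (f g : H.toGrAlg ⟶ B) : H.toGrAlg ⟶ B :=
  H.comulHom ≫ tensorDesc f g

/-- The trivial morphism out of a Hopf algebra. -/
def triv (B : GrAlg k) : H.toGrAlg ⟶ B := H.counitHom ≫ unitHom B

lemma triv_apply (B : GrAlg k) (a : H.carrier) :
    (H.triv B).toAlgHom a = algebraMap k B.carrier (Coalgebra.counit a) := rfl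

lemma conv_apply {H : GrHopf k} {B : GrAlg k} (f g : H.toGrAlg ⟶ B) (a : H.carrier) :
    (conv f g).toAlgHom a = LinearMap.mul' k B.carrier (TensorProduct.map f.toAlgHom.toLinearMap
      g.toAlgHom.toLinearMap (Coalgebra.comul a)) := rfl

lemma conv_comp {H : GrHopf k} {B C : GrAlg k} (f g : H.toGrAlg ⟶ B) (h : B ⟶ C) :
    conv f g ≫ h = conv (f ≫ h) (g ≫ h) := by
  rw [conv, conv, Category.assoc, tensorDesc_comp]

lemma triv_comp {B C : GrAlg k} (h : B ⟶ C) : H.triv B ≫ h = H.triv C := by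
  rw [triv, triv, Category.assoc, unitHom_ext (unitHom B ≫ h) (unitHom C)]

lemma conv_triv {H : GrHopf k} {B : GrAlg k} (f : H.toGrAlg ⟶ B) : conv f (H.triv B) = f := by
  refine hom_ext' fun a => ?_
  rw [conv_apply]
  have h2 : LinearMap.mul' k B.carrier ∘ₗ TensorProduct.map f.toAlgHom.toLinearMap
      (H.triv B).toAlgHom.toLinearMap = f.toAlgHom.toLinearMap ∘ₗ
      (TensorProduct.rid k H.carrier).toLinearMap ∘ₗ Coalgebra.counit.lTensor H.carrier := by
    ext a b
    refine (Algebra.commutes (R := k) (A := B.carrier) _ _).symm.trans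
      ((Algebra.smul_def (R := k) (A := B.carrier) _ _).symm.trans ?_)
    exact (map_smul f.toAlgHom _ a).symm
  refine (LinearMap.congr_fun h2 (Coalgebra.comul a)).trans ?_
  simp

lemma triv_conv {H : GrHopf k} {B : GrAlg k} (f : H.toGrAlg ⟶ B) : conv (H.triv B) f = f := by
  refine hom_ext' fun a => ?_
  rw [conv_apply]
  have h2 : LinearMap.mul' k B.carrier ∘ₗ TensorProduct.map (H.triv B).toAlgHom.toLinearMap
      f.toAlgHom.toLinearMap = f.toAlgHom.toLinearMap ∘ₗ
      (TensorProduct.lid k H.carrier).toLinearMap ∘ₗ Coalgebra.counit.rTensor H.carrier := by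
    ext a b
    exact (Algebra.smul_def (R := k) (A := B.carrier) _ _).symm.trans (map_smul f.toAlgHom _ b).symm
  refine (LinearMap.congr_fun h2 (Coalgebra.comul a)).trans ?_
  simp

/-- A morphism of graded algebras between Hopf algebras which respects the comultiplication. -/
def IsComulHom {H H' : GrHopf k} (h : H.toGrAlg ⟶ H'.toGrAlg) : Prop :=
  ∀ a, (Coalgebra.comul (h.toAlgHom a) : H'.carrier ⊗[k] H'.carrier) =
    TensorProduct.map h.toAlgHom.toLinearMap h.toAlgHom.toLinearMap (Coalgebra.comul a)

/-- An equation between elements becomes an equation between morphisms, which can be obtained from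
Yoneda and composed. -/
lemma isComulHom_iff {H H' : GrHopf k} (h : H.toGrAlg ⟶ H'.toGrAlg) :
    IsComulHom h ↔ h ≫ H'.comulHom =
      conv (h ≫ tensorInl _ _) (h ≫ tensorInr _ _) := by
  have key : ∀ x, (tensorDesc (h ≫ tensorInl H'.toGrAlg H'.toGrAlg)
      (h ≫ tensorInr H'.toGrAlg H'.toGrAlg)).toAlgHom (tmk _ _ x) =
      tmk H'.toGrAlg H'.toGrAlg
        (TensorProduct.map h.toAlgHom.toLinearMap h.toAlgHom.toLinearMap x) := by
    intro x
    have : (tensorDesc (h ≫ tensorInl H'.toGrAlg H'.toGrAlg)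
      (h ≫ tensorInr H'.toGrAlg H'.toGrAlg)).toAlgHom.toLinearMap ∘ₗ tmk _ _ =
      tmk H'.toGrAlg H'.toGrAlg ∘ₗ
        (TensorProduct.map h.toAlgHom.toLinearMap h.toAlgHom.toLinearMap) := by
      ext a b
      exact tensorInl_mul_tensorInr _ _ _ _
    exact LinearMap.congr_fun this x
  constructor
  · intro hh
    refine hom_ext' fun a => ?_
    exact (congrArg (tmk _ _) (hh a)).trans (key _).symm
  · intro hh a
    refine tmk_injective _ _ (Eq.trans ?_ (key _))
    exact congrArg (fun f : H.toGrAlg ⟶ tensor H'.toGrAlg H'.toGrAlg => f.toAlgHom a) hh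

lemma IsComulHom.comp_conv {H H' : GrHopf k} {h : H.toGrAlg ⟶ H'.toGrAlg} (hh : IsComulHom h)
    {B : GrAlg k} (f g : H'.toGrAlg ⟶ B) : h ≫ conv f g = conv (h ≫ f) (h ≫ g) := by
  rw [conv, ← Category.assoc, (isComulHom_iff h).1 hh, conv_comp]
  simp

end GrHopf

end

/-! ### Representing Hopf algebras of affine groups; retracts and products -/

noncomputable section

open GrAlg

namespace GrHopf

variable {k : Type u} [Field k]

section Rep

variable {E : Type*} [Category.{u} E] {ι : E ⥤ GrAlg k} {H : GrHopf k} {G : E ⥤ AddCommGrpCat.{u}}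
  (e : ∀ R : E, G.obj R ≃ (H.toGrAlg ⟶ ι.obj R))

/-- The bijections `e` exhibit the functor `G` as represented by the Hopf algebra `H`. -/
structure RepBy : Prop where
  natural : ∀ (R S : E) (f : R ⟶ S) (x : G.obj R), e S (G.map f x) = e R x ≫ ι.map f
  add : ∀ (R : E) (x y : G.obj R), e R (x + y) = conv (e R x) (e R y)

lemma represents_iff : H.Represents ι G ↔ ∃ e : ∀ R : E, G.obj R ≃ (H.toGrAlg ⟶ ι.obj R),
    RepBy e :=
  exists_congr fun _ => ⟨fun h => ⟨h.1, fun R x y => hom_ext' fun a => h.2 R x y a⟩,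
    fun h => ⟨h.natural, fun R x y a => congrArg (fun f : H.toGrAlg ⟶ ι.obj R => f.toAlgHom a)
      (h.add R x y)⟩⟩

variable {e}

lemma RepBy.zero (h : RepBy e) (R : E) : e R 0 = H.triv (ι.obj R) := by
  rw [← triv_conv (e R 0)]
  obtain ⟨y, hy⟩ := (e R).surjective (H.triv (ι.obj R))
  rw [← hy, ← h.add, add_zero]

lemma RepBy.symm_comp (h : RepBy e) {R S : E} (f : R ⟶ S) (x : H.toGrAlg ⟶ ι.obj R) :
    (e S).symm (x ≫ ι.map f) = G.map f ((e R).symm x) := by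
  rw [Equiv.symm_apply_eq, h.natural, Equiv.apply_symm_apply]

lemma RepBy.symm_conv (h : RepBy e) {R : E} (x y : H.toGrAlg ⟶ ι.obj R) :
    (e R).symm (conv x y) = (e R).symm x + (e R).symm y := by
  rw [Equiv.symm_apply_eq, h.add, Equiv.apply_symm_apply, Equiv.apply_symm_apply]

end Rep

/-- The endomorphism of a represented functor induced by an endomorphism of the Hopf algebra. -/
def RepBy.endo {E : Type*} [Category.{u} E] {ι : E ⥤ GrAlg k} {H : GrHopf k}
    {G : E ⥤ AddCommGrpCat.{u}} {e : ∀ R : E, G.obj R ≃ (H.toGrAlg ⟶ ι.obj R)} (he : RepBy e)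
    (h : H.toGrAlg ⟶ H.toGrAlg) (hh : IsComulHom h) : G ⟶ G where
  app R := AddCommGrpCat.ofHom
    { toFun x := (e R).symm (h ≫ e R x)
      map_zero' := by
        rw [he.zero]
        have h1 := hh.comp_conv (H.triv (ι.obj R)) (H.triv (ι.obj R))
        rw [conv_triv] at h1
        have h2 : (e R).symm (h ≫ H.triv (ι.obj R)) = (e R).symm (h ≫ H.triv (ι.obj R)) +
            (e R).symm (h ≫ H.triv (ι.obj R)) := by
          rw [← he.symm_conv, ← h1]
        exact left_eq_add.1 h2
      map_add' x y := by rw [he.add, hh.comp_conv, he.symm_conv] }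
  naturality R S f := by
    ext x
    change (e S).symm (h ≫ e S (G.map f x)) = G.map f ((e R).symm (h ≫ e R x))
    rw [he.natural, ← Category.assoc, he.symm_comp]

lemma RepBy.endo_apply {E : Type*} [Category.{u} E] {ι : E ⥤ GrAlg k} {H : GrHopf k}
    {G : E ⥤ AddCommGrpCat.{u}} {e : ∀ R : E, G.obj R ≃ (H.toGrAlg ⟶ ι.obj R)} (he : RepBy e)
    (h : H.toGrAlg ⟶ H.toGrAlg) (hh : IsComulHom h) (R : E) (x : G.obj R) :
    (he.endo h hh).app R x = (e R).symm (h ≫ e R x) := rfl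

/-- The coproduct is the sum of the two universal points of `H` in `H ⊗ H`. -/
lemma conv_inl_inr (H : GrHopf k) :
    conv (tensorInl H.toGrAlg H.toGrAlg) (tensorInr H.toGrAlg H.toGrAlg) = H.comulHom := by
  have h : tensorDesc (tensorInl H.toGrAlg H.toGrAlg) (tensorInr H.toGrAlg H.toGrAlg) = 𝟙 _ :=
    tensor_hom_ext' (by simp) (by simp)
  rw [conv, h, Category.comp_id]

section Affine

variable {G G' : GrAlg k ⥤ AddCommGrpCat.{u}}

theorem exists_represents (hG : isAffineGroup k G) : ∃ H : GrHopf k, H.Represents (𝟭 _) G := by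
  obtain ⟨A, ⟨c⟩⟩ := hG.has_corepresentation
  obtain ⟨H, rfl, h⟩ := exists_hopf_of_points A (fun _ => True) trivial trivial
    (fun _ _ _ _ => trivial) (fun B _ => G.obj B) (fun B _ => inferInstance)
    (fun B _ => c.homEquiv.symm) (fun B C _ _ f x => G.map f x)
    (fun B C _ _ f x y => map_add (G.map f).hom x y)
    (fun B C _ _ f x => (c.homEquiv_symm_comp x f).symm)
  refine ⟨H, fun R => c.homEquiv.symm, fun R S f x => (c.homEquiv_symm_comp x f).symm,
    fun R x y a => ?_⟩
  exact h R trivial x y a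

theorem exists_repBy (hG : isAffineGroup k G) : ∃ (H : GrHopf k)
    (e : ∀ R : GrAlg k, G.obj R ≃ (H.toGrAlg ⟶ (𝟭 (GrAlg k)).obj R)), RepBy e := by
  obtain ⟨H, h⟩ := exists_represents hG
  exact ⟨H, represents_iff.1 h⟩

lemma Represents.isAffine {H : GrHopf k} (h : H.Represents (𝟭 _) G) : isAffineGroup k G := by
  obtain ⟨e, he⟩ := represents_iff.1 h
  exact ⟨H.toGrAlg, ⟨⟨fun {R} => (e R).symm, fun f x => he.symm_comp f x⟩⟩⟩

/-- A natural transformation of represented functors comes from a map of Hopf algebras. -/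
lemma RepBy.exists_hom {H H' : GrHopf k}
    {e : ∀ R : GrAlg k, G.obj R ≃ (H.toGrAlg ⟶ (𝟭 (GrAlg k)).obj R)} (he : RepBy e)
    {e' : ∀ R : GrAlg k, G'.obj R ≃ (H'.toGrAlg ⟶ (𝟭 (GrAlg k)).obj R)} (he' : RepBy e')
    (φ : G ⟶ G') : ∃ h : H'.toGrAlg ⟶ H.toGrAlg, IsComulHom h ∧
      ∀ R x, e' R (φ.app R x) = h ≫ e R x := by
  -- By Yoneda, `h` is the image of the universal point of `G`.
  let h : H'.toGrAlg ⟶ H.toGrAlg := e' H.toGrAlg (φ.app _ ((e H.toGrAlg).symm (𝟙 _)))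
  have key : ∀ R x, e' R (φ.app R x) = h ≫ e R x := fun R x => by
    have h1 := he'.natural _ _ (e R x : H.toGrAlg ⟶ R) (φ.app _ ((e H.toGrAlg).symm (𝟙 _)))
    refine Eq.trans ?_ h1
    have h2 := congrArg (fun f => f.hom ((e H.toGrAlg).symm (𝟙 _)))
      (φ.naturality (e R x : H.toGrAlg ⟶ R))
    refine congrArg (e' R) (Eq.trans ?_ h2)
    have h3 := he.symm_comp (e R x : H.toGrAlg ⟶ R) (𝟙 _)
    rw [Category.id_comp] at h3
    refine congrArg (φ.app R) (Eq.trans ?_ h3)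
    exact ((e R).symm_apply_apply x).symm
  refine ⟨h, ?_, key⟩
  -- Compatibility with the coproducts is additivity of `φ` on the two universal points with values
  -- in `H ⊗ H`.
  let T := tensor H.toGrAlg H.toGrAlg
  obtain ⟨x, hx⟩ := (e T).surjective (tensorInl H.toGrAlg H.toGrAlg)
  obtain ⟨y, hy⟩ := (e T).surjective (tensorInr H.toGrAlg H.toGrAlg)
  have h1 : e' T (φ.app T x) = h ≫ tensorInl _ _ := (key T x).trans (congrArg _ hx)
  have h2 : e' T (φ.app T y) = h ≫ tensorInr _ _ := (key T y).trans (congrArg _ hy)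
  have h3 : e T (x + y) = H.comulHom :=
    (he.add T x y).trans ((congrArg₂ conv hx hy).trans (conv_inl_inr H))
  rw [isComulHom_iff]
  refine ((congrArg (h ≫ ·) h3).symm.trans (key T (x + y)).symm).trans ?_
  refine (congrArg (e' T) (map_add (φ.app T).hom x y)).trans ?_
  exact (he'.add T _ _).trans (congrArg₂ conv h1 h2)

/-- The idempotent `r ≫ i` comes from an idempotent `q` of the representing algebra, and the image
of `q` represents the retract. -/
lemma isAffineGroup_of_retract (i : G' ⟶ G) (r : G ⟶ G') (hir : i ≫ r = 𝟙 G')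
    (hG : isAffineGroup k G) : isAffineGroup k G' := by
  obtain ⟨H, e, he⟩ := exists_repBy hG
  obtain ⟨q, -, hq⟩ := he.exists_hom he (r ≫ i)
  have hi : ∀ R x, r.app R (i.app R x) = x := fun R x =>
    congrArg (fun f : G' ⟶ G' => f.app R x) hir
  have hqq : q ≫ q = q := by
    obtain ⟨x, hx⟩ := (e H.toGrAlg).surjective (𝟙 _)
    have h1 := hq _ x
    have h2 := hq _ ((r ≫ i).app _ x)
    rw [hx, Category.comp_id] at h1
    rw [h1] at h2
    refine h2.symm.trans (Eq.trans ?_ h1)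
    exact congrArg (fun y => e H.toGrAlg (i.app _ y)) (hi _ _)
  obtain ⟨B, j, s, hjs, hsj⟩ := exists_split q hqq
  have hsq : q ≫ s = s := by rw [← hsj, Category.assoc, hjs, Category.comp_id]
  have h1 : ∀ (R : GrAlg k) (f : H.toGrAlg ⟶ R), q ≫ f = f →
      e R (i.app R (r.app R ((e R).symm f))) = f := fun R f hf =>
    (hq R _).trans ((congrArg (q ≫ ·) ((e R).apply_symm_apply f)).trans hf)
  have h2 : ∀ (R : GrAlg k) x, q ≫ (e R (i.app R x) : H.toGrAlg ⟶ R) = e R (i.app R x) :=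
    fun R x => (hq R _).symm.trans (congrArg (fun y => e R (i.app R y)) (hi R x))
  refine ⟨B, ⟨⟨fun {R} =>
    { toFun := fun f => r.app R ((e R).symm (s ≫ f))
      invFun := fun x => j ≫ e R (i.app R x)
      left_inv := fun f => by
        refine (congrArg (j ≫ ·) (h1 R (s ≫ f) (by rw [← Category.assoc, hsq]))).trans ?_
        change j ≫ s ≫ f = f
        rw [← Category.assoc, hjs, Category.id_comp]
      right_inv := fun x => by
        have h3 : s ≫ j ≫ (e R (i.app R x) : H.toGrAlg ⟶ R) = e R (i.app R x) := by
          rw [← Category.assoc, hsj, h2]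
        refine Eq.trans ?_ (hi R x)
        exact congrArg (r.app R) ((congrArg (e R).symm h3).trans ((e R).symm_apply_apply _)) },
    fun {R S} f x => ?_⟩⟩⟩
  have h3 := he.symm_comp f (s ≫ x)
  refine (congrArg (r.app S) ((congrArg (e S).symm (Category.assoc _ _ _).symm).trans h3)).trans ?_
  exact congrArg (fun g => g.hom ((e R).symm (s ≫ x))) (r.naturality f)

end Affine

/-- Elements of a product of functors. -/
def prodPoints {E : Type*} [Category E] (X Y : E ⥤ AddCommGrpCat.{u}) (R : E) :
    (X ⨯ Y).obj R ≃ X.obj R × Y.obj R where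
  toFun x := ((prod.fst : X ⨯ Y ⟶ X).app R x, (prod.snd : X ⨯ Y ⟶ Y).app R x)
  invFun x := (prod.lift (𝟙 X) 0 : X ⟶ X ⨯ Y).app R x.1 + (prod.lift 0 (𝟙 Y) : Y ⟶ X ⨯ Y).app R x.2
  left_inv x := by
    have h : (prod.fst : X ⨯ Y ⟶ X) ≫ prod.lift (𝟙 X) 0 + (prod.snd : X ⨯ Y ⟶ Y) ≫ prod.lift 0 (𝟙 Y) =
        𝟙 (X ⨯ Y) := by
      refine Limits.prod.hom_ext ?_ ?_ <;>
      simp [-prod.comp_lift, Preadditive.add_comp, prod.lift_fst, prod.lift_snd]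
    exact congrArg (fun f : X ⨯ Y ⟶ X ⨯ Y => f.app R x) h
  right_inv x := by
    obtain ⟨x, y⟩ := x
    have h1 : (prod.lift (𝟙 X) 0 : X ⟶ X ⨯ Y) ≫ prod.fst = 𝟙 X := prod.lift_fst _ _
    have h2 : (prod.lift (𝟙 X) 0 : X ⟶ X ⨯ Y) ≫ prod.snd = 0 := prod.lift_snd _ _
    have h3 : (prod.lift 0 (𝟙 Y) : Y ⟶ X ⨯ Y) ≫ prod.fst = 0 := prod.lift_fst _ _
    have h4 : (prod.lift 0 (𝟙 Y) : Y ⟶ X ⨯ Y) ≫ prod.snd = 𝟙 Y := prod.lift_snd _ _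
    refine Prod.ext ?_ ?_
    · refine (map_add ((prod.fst : X ⨯ Y ⟶ X).app R).hom _ _).trans ?_
      refine (congrArg₂ (· + ·) (congrArg (fun f : X ⟶ X => f.app R x) h1)
        (congrArg (fun f : Y ⟶ X => f.app R y) h3)).trans (add_zero x)
    · refine (map_add ((prod.snd : X ⨯ Y ⟶ Y).app R).hom _ _).trans ?_
      refine (congrArg₂ (· + ·) (congrArg (fun f : X ⟶ Y => f.app R x) h2)
        (congrArg (fun f : Y ⟶ Y => f.app R y) h4)).trans (zero_add y)

lemma prodPoints_map {E : Type*} [Category E] (X Y : E ⥤ AddCommGrpCat.{u}) {R S : E} (f : R ⟶ S)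
    (x : (X ⨯ Y).obj R) : prodPoints X Y S ((X ⨯ Y).map f x) =
      (X.map f (prodPoints X Y R x).1, Y.map f (prodPoints X Y R x).2) :=
  Prod.ext (congrArg (fun g => g.hom x) ((prod.fst : X ⨯ Y ⟶ X).naturality f))
    (congrArg (fun g => g.hom x) ((prod.snd : X ⨯ Y ⟶ Y).naturality f))

/-- The tensor product of the representing algebras is their coproduct, so it represents the
product. -/
lemma isAffineGroup_prod {G G' : GrAlg k ⥤ AddCommGrpCat.{u}} (hG : isAffineGroup k G)
    (hG' : isAffineGroup k G') : isAffineGroup k (G ⨯ G') := by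
  obtain ⟨A, ⟨c⟩⟩ := hG.has_corepresentation
  obtain ⟨B, ⟨d⟩⟩ := hG'.has_corepresentation
  refine ⟨tensor A B, ⟨⟨fun {R} => Equiv.trans ?_ (prodPoints G G' R).symm, ?_⟩⟩⟩
  · exact
    { toFun := fun f => (c.homEquiv (tensorInl A B ≫ f), d.homEquiv (tensorInr A B ≫ f))
      invFun := fun x => tensorDesc (c.homEquiv.symm x.1) (d.homEquiv.symm x.2)
      left_inv := fun f => tensor_hom_ext' (by simp) (by simp)
      right_inv := fun x => by simp }
  · intro R S f x
    rw [Equiv.trans_apply, Equiv.symm_apply_eq]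
    refine Eq.trans ?_ (prodPoints_map G G' f _).symm
    rw [Equiv.trans_apply, Equiv.apply_symm_apply]
    refine Prod.ext ?_ ?_
    · exact (congrArg c.homEquiv (Category.assoc _ _ _).symm).trans (c.homEquiv_comp f _)
    · exact (congrArg d.homEquiv (Category.assoc _ _ _).symm).trans (d.homEquiv_comp f _)

end GrHopf

end

noncomputable section

/-! ## Contractions of tensors -/

section Contraction

variable {k V W V' W' : Type*} [Field k] [AddCommGroup V] [Module k V] [AddCommGroup W] [Module k W]
  [AddCommGroup V'] [Module k V'] [AddCommGroup W'] [Module k W']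

/-- Contraction of the first factor of a tensor with a functional. -/
def lcontr (φ : V →ₗ[k] k) : V ⊗[k] W →ₗ[k] W :=
  (TensorProduct.lid k W).toLinearMap ∘ₗ φ.rTensor W

/-- Contraction of the second factor of a tensor with a functional. -/
def rcontr (ψ : W →ₗ[k] k) : V ⊗[k] W →ₗ[k] V :=
  (TensorProduct.rid k V).toLinearMap ∘ₗ ψ.lTensor V

@[simp] lemma lcontr_tmul (φ : V →ₗ[k] k) (v : V) (w : W) : lcontr φ (v ⊗ₜ[k] w) = φ v • w := by
  simp [lcontr]

@[simp] lemma rcontr_tmul (ψ : W →ₗ[k] k) (v : V) (w : W) : rcontr ψ (v ⊗ₜ[k] w) = ψ w • v := by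
  simp [rcontr]

lemma lcontr_map (φ : V' →ₗ[k] k) (f : V →ₗ[k] V') (g : W →ₗ[k] W') (z : V ⊗[k] W) :
    lcontr φ (TensorProduct.map f g z) = g (lcontr (φ ∘ₗ f) z) := by
  induction z with
  | zero => simp
  | add x y hx hy => simp [hx, hy]
  | tmul v w => simp

lemma rcontr_map (ψ : W' →ₗ[k] k) (f : V →ₗ[k] V') (g : W →ₗ[k] W') (z : V ⊗[k] W) :
    rcontr ψ (TensorProduct.map f g z) = f (rcontr (ψ ∘ₗ g) z) := by
  induction z with
  | zero => simp
  | add x y hx hy => simp [hx, hy]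
  | tmul v w => simp

lemma rcontr_lcontr (φ : V →ₗ[k] k) (ψ : W →ₗ[k] k) (z : V ⊗[k] W) :
    φ (rcontr ψ z) = ψ (lcontr φ z) := by
  induction z with
  | zero => simp
  | add x y hx hy => simp [hx, hy]
  | tmul v w => simp [mul_comm]

lemma mul'_map_eq (φ : V →ₗ[k] k) (ψ : W →ₗ[k] k) (z : V ⊗[k] W) :
    LinearMap.mul' k k (TensorProduct.map φ ψ z) = ψ (lcontr φ z) := by
  induction z with
  | zero => simp
  | add x y hx hy => simp [hx, hy]
  | tmul v w => simp

lemma eq_zero_of_lcontr {z : V ⊗[k] W} (h : ∀ φ : V →ₗ[k] k, lcontr φ z = 0) : z = 0 := by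
  let b := Module.Free.chooseBasis k V
  apply (TensorProduct.equivFinsuppOfBasisLeft b).injective
  ext i
  rw [map_zero, TensorProduct.equivFinsuppOfBasisLeft_apply]
  exact h (b.coord i)

lemma eq_zero_of_rcontr {z : V ⊗[k] W} (h : ∀ ψ : W →ₗ[k] k, rcontr ψ z = 0) : z = 0 :=
  eq_zero_of_lcontr fun φ => by
    rw [← Module.forall_dual_apply_eq_zero_iff k]
    intro ψ
    rw [← rcontr_lcontr, h, map_zero]

lemma eq_of_mul'_map {z z' : V ⊗[k] W} (h : ∀ (φ : V →ₗ[k] k) (ψ : W →ₗ[k] k),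
    LinearMap.mul' k k (TensorProduct.map φ ψ z) = LinearMap.mul' k k (TensorProduct.map φ ψ z')) :
    z = z' := by
  rw [← sub_eq_zero]
  refine eq_zero_of_lcontr fun φ => ?_
  rw [← Module.forall_dual_apply_eq_zero_iff k]
  intro ψ
  have := h φ ψ
  rw [mul'_map_eq, mul'_map_eq] at this
  rw [map_sub, map_sub, this, sub_self]

/-- By exactness, `z` lies in V ⊗ E if and only if its image in V ⊗ (W/E) vanishes, and contractions
detect vanishing. -/
lemma mem_range_lTensor {E : Submodule k W} {z : V ⊗[k] W} (h : ∀ φ : V →ₗ[k] k, lcontr φ z ∈ E) :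
    z ∈ LinearMap.range (E.subtype.lTensor V) := by
  have hex := lTensor_exact V (f := E.subtype) (g := E.mkQ)
    (LinearMap.exact_subtype_mkQ E) (Submodule.mkQ_surjective E)
  refine (hex z).1 (eq_zero_of_lcontr fun φ => ?_)
  have := lcontr_map φ LinearMap.id E.mkQ z
  rw [LinearMap.lTensor, this, LinearMap.comp_id]
  simpa using h φ

lemma mem_range_rTensor {E : Submodule k V} {z : V ⊗[k] W} (h : ∀ φ : W →ₗ[k] k, rcontr φ z ∈ E) :
    z ∈ LinearMap.range (E.subtype.rTensor W) := by
  have hex := rTensor_exact W (f := E.subtype) (g := E.mkQ)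
    (LinearMap.exact_subtype_mkQ E) (Submodule.mkQ_surjective E)
  refine (hex z).1 (eq_zero_of_rcontr fun φ => ?_)
  have := rcontr_map φ E.mkQ LinearMap.id z
  rw [LinearMap.rTensor, this, LinearMap.comp_id]
  simpa using h φ

lemma mem_range_map {D : Submodule k V} {E : Submodule k W} {z : V ⊗[k] W}
    (h1 : ∀ φ : V →ₗ[k] k, lcontr φ z ∈ E) (h2 : ∀ φ : W →ₗ[k] k, rcontr φ z ∈ D) :
    z ∈ LinearMap.range (TensorProduct.map D.subtype E.subtype) := by
  obtain ⟨w, rfl⟩ := mem_range_lTensor h1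
  have : w ∈ LinearMap.range (D.subtype.rTensor E) := mem_range_rTensor fun φ => by
    -- Here `φ` lives only on `E`; extending it to the whole space makes the hypothesis on `z`
    -- applicable.
    obtain ⟨φ', rfl⟩ := φ.exists_extend
    have := h2 φ'
    rwa [LinearMap.lTensor, rcontr_map] at this
  obtain ⟨w, rfl⟩ := this
  exact ⟨w, by rw [← LinearMap.comp_apply, LinearMap.lTensor, LinearMap.rTensor,
    ← TensorProduct.map_comp, LinearMap.id_comp, LinearMap.comp_id]⟩

/-- The span of the second components of a tensor. -/
def lspan (z : V ⊗[k] W) : Submodule k W :=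
  LinearMap.range ((LinearMap.applyₗ z ∘ₗ (TensorProduct.lid k W).toLinearMap.compRight k) ∘ₗ
    LinearMap.rTensorHom (R := k) (N := V) (P := k) W)

lemma mem_lspan {z : V ⊗[k] W} {w : W} : w ∈ lspan z ↔ ∃ φ : V →ₗ[k] k, lcontr φ z = w := Iff.rfl

instance lspan_finite (z : V ⊗[k] W) : Module.Finite k (lspan z) := by
  classical
  obtain ⟨s, rfl⟩ := TensorProduct.exists_finset z
  have : lspan (∑ i ∈ s, i.1 ⊗ₜ[k] i.2) ≤ Submodule.span k (s.image Prod.snd : Finset W) := by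
    intro w hw
    obtain ⟨φ, rfl⟩ := mem_lspan.1 hw
    rw [map_sum]
    refine Submodule.sum_mem _ fun i hi => ?_
    rw [lcontr_tmul]
    exact Submodule.smul_mem _ _ (Submodule.subset_span (by simpa using ⟨i.1, hi⟩))
  exact Submodule.finiteDimensional_of_le this

end Contraction

/-! ## Duals of finite-dimensional algebras -/

section Dual

variable {k : Type u} [Field k]

lemma dualComul_apply {R : Type u} [Ring R] [Algebra k R] [Module.Finite k R]
    (ξ : Module.Dual k R) (a b : R) :
    LinearMap.mul' k k (TensorProduct.map (Module.Dual.eval k R a) (Module.Dual.eval k R b)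
      (dualComul R ξ)) = ξ (a * b) := by
  have h : TensorProduct.dualDistribEquiv k R R (dualComul R ξ) =
      (LinearMap.mul' k R).dualMap ξ := LinearEquiv.apply_symm_apply _ _
  have h2 := LinearMap.congr_fun h (a ⊗ₜ b)
  refine Eq.trans ?_ h2
  generalize dualComul R ξ = y
  have : LinearMap.mul' k k ∘ₗ TensorProduct.map (Module.Dual.eval k R a) (Module.Dual.eval k R b) =
      LinearMap.applyₗ (a ⊗ₜ[k] b) ∘ₗ (TensorProduct.dualDistrib k R R) := by
    ext ξ η; simp
  exact LinearMap.congr_fun this y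

/-- Functionals on the dual of a finite-dimensional space are evaluations, so the pairings with all
`a` and `b` determine a tensor of functionals. -/
lemma eq_dualComul {R : Type u} [Ring R] [Algebra k R] [Module.Finite k R]
    (ξ : Module.Dual k R) (y : Module.Dual k R ⊗[k] Module.Dual k R)
    (h : ∀ a b, LinearMap.mul' k k (TensorProduct.map (Module.Dual.eval k R a)
      (Module.Dual.eval k R b) y) = ξ (a * b)) : y = dualComul R ξ := by
  refine eq_of_mul'_map fun φ ψ => ?_
  obtain ⟨a, rfl⟩ := (Module.evalEquiv k R).surjective φ
  obtain ⟨b, rfl⟩ := (Module.evalEquiv k R).surjective ψ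
  exact (h a b).trans (dualComul_apply ξ a b).symm

lemma map_dualComul {R S : Type u} [Ring R] [Algebra k R] [Module.Finite k R] [Ring S] [Algebra k S]
    [Module.Finite k S] (f : R →ₐ[k] S) (ξ : Module.Dual k S) :
    TensorProduct.map f.toLinearMap.dualMap f.toLinearMap.dualMap (dualComul S ξ) =
      dualComul R (f.toLinearMap.dualMap ξ) := by
  refine eq_dualComul _ _ fun a b => ?_
  rw [← LinearMap.comp_apply (TensorProduct.map _ _), ← TensorProduct.map_comp]
  refine (dualComul_apply ξ (f a) (f b)).trans ?_
  simp

end Dual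

end

/-! ### Finite-dimensional graded subcoalgebras -/

noncomputable section

open GrAlg

namespace GrHopf

variable {k : Type u} [Field k] (C : GrHopf k)

/-- Homogeneous subspaces which are stable under the comultiplication. -/
structure IsSubcoalg (D : Submodule k C.carrier) : Prop where
  left : ∀ x ∈ D, ∀ φ : C.carrier →ₗ[k] k, lcontr φ (Coalgebra.comul x : C.carrier ⊗[k] C.carrier) ∈ D
  right : ∀ x ∈ D, ∀ φ : C.carrier →ₗ[k] k, rcontr φ (Coalgebra.comul x : C.carrier ⊗[k] C.carrier) ∈ D
  proj : ∀ n, ∀ x ∈ D, C.toGrAlg.proj n x ∈ D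

variable {C}

lemma IsSubcoalg.comul_mem {D : Submodule k C.carrier} (h : C.IsSubcoalg D) {x : C.carrier}
    (hx : x ∈ D) : (Coalgebra.comul x : C.carrier ⊗[k] C.carrier) ∈
      LinearMap.range (TensorProduct.map D.subtype D.subtype) :=
  mem_range_map (h.left x hx) (h.right x hx)

lemma IsSubcoalg.sup {D D' : Submodule k C.carrier} (h : C.IsSubcoalg D) (h' : C.IsSubcoalg D') :
    C.IsSubcoalg (D ⊔ D') where
  left x hx φ := by
    obtain ⟨y, hy, z, hz, rfl⟩ := Submodule.mem_sup.1 hx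
    rw [map_add, map_add]
    exact Submodule.add_mem_sup (h.left y hy φ) (h'.left z hz φ)
  right x hx φ := by
    obtain ⟨y, hy, z, hz, rfl⟩ := Submodule.mem_sup.1 hx
    rw [map_add, map_add]
    exact Submodule.add_mem_sup (h.right y hy φ) (h'.right z hz φ)
  proj n x hx := by
    obtain ⟨y, hy, z, hz, rfl⟩ := Submodule.mem_sup.1 hx
    rw [map_add]
    exact Submodule.add_mem_sup (h.proj n y hy) (h'.proj n z hz)

variable (C) in
/-- The comultiplication of the coalgebra commutes with the projections. -/
lemma comul_proj (n : ℕ) (x : C.carrier) :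
    (Coalgebra.comul (C.toGrAlg.proj n x) : C.carrier ⊗[k] C.carrier) =
      tensorProj C.toGrAlg C.toGrAlg n (Coalgebra.comul x) := by
  have : Coalgebra.comul ∘ₗ C.toGrAlg.proj n =
      tensorProj C.toGrAlg C.toGrAlg n ∘ₗ (Coalgebra.comul : C.carrier →ₗ[k] _) := by
    refine C.toGrAlg.hom_ext_homogeneous fun m a ha => ?_
    simp only [LinearMap.comp_apply]
    by_cases h : n = m
    · subst h; rw [C.toGrAlg.proj_of_mem ha, tensorProj_of_mem _ _ (C.comul_mem n a ha)]
    · rw [C.toGrAlg.proj_of_mem_ne ha h, tensorProj_of_mem_ne _ _ (C.comul_mem m a ha) h, map_zero]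
  exact LinearMap.congr_fun this x

variable (C) in
-- Coassociativity, read through functionals: contracting twice is contracting once with the
-- convolution product. Hence the contractions of a single coproduct form a space stable under
-- further contraction.
lemma lcontr_coassoc (φ χ : C.carrier →ₗ[k] k) (x : C.carrier) :
    lcontr χ (Coalgebra.comul (lcontr φ (Coalgebra.comul x : C.carrier ⊗[k] C.carrier)) :
      C.carrier ⊗[k] C.carrier) =
    lcontr (LinearMap.mul' k k ∘ₗ TensorProduct.map φ χ ∘ₗ Coalgebra.comul)
      (Coalgebra.comul x : C.carrier ⊗[k] C.carrier) := by
  have h1 : ∀ z : C.carrier ⊗[k] C.carrier,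
      (Coalgebra.comul (lcontr φ z) : C.carrier ⊗[k] C.carrier) =
      lcontr φ (Coalgebra.comul.lTensor C.carrier z) := fun z => by
    rw [LinearMap.lTensor, lcontr_map]; rfl
  have h2 : ∀ z : (C.carrier ⊗[k] C.carrier) ⊗[k] C.carrier,
      lcontr χ (lcontr φ (TensorProduct.assoc k _ _ _ z)) =
      lcontr (LinearMap.mul' k k ∘ₗ TensorProduct.map φ χ) z := fun z => by
    have : lcontr χ ∘ₗ lcontr φ ∘ₗ (TensorProduct.assoc k C.carrier C.carrier C.carrier).toLinearMap
        = lcontr (LinearMap.mul' k k ∘ₗ TensorProduct.map φ χ) := by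
      ext a b c; simp [smul_smul, mul_comm]
    exact LinearMap.congr_fun this z
  rw [h1, ← Coalgebra.coassoc_apply, h2, LinearMap.rTensor, lcontr_map]
  rfl

/-- Graded cocommutativity exchanges the two kinds of contraction. Homogeneity of `D` is needed
because the signs of the swap depend on degrees. -/
lemma rcontr_comm {D : Submodule k C.carrier} (hD : ∀ n, ∀ x ∈ D, C.toGrAlg.proj n x ∈ D)
    {z : C.carrier ⊗[k] C.carrier} (h : ∀ φ : C.carrier →ₗ[k] k, lcontr φ z ∈ D)
    (hz : GradedTensorProduct.comm C.grading C.grading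
        (GradedTensorProduct.of k C.grading C.grading z) =
      GradedTensorProduct.of k C.grading C.grading z)
    (ψ : C.carrier →ₗ[k] k) : rcontr ψ z ∈ D := by
  let sw : C.carrier ⊗[k] C.carrier →ₗ[k] C.carrier ⊗[k] C.carrier :=
    (GradedTensorProduct.of k C.grading C.grading).symm.toLinearMap ∘ₗ
      (GradedTensorProduct.comm C.grading C.grading).toLinearMap ∘ₗ
        (GradedTensorProduct.of k C.grading C.grading).toLinearMap
  have hsw : ∀ i j a b, a ∈ C.grading i → b ∈ C.grading j →
      sw (a ⊗ₜ b) = (-1 : k) ^ (j * i) • b ⊗ₜ a := fun i j a b ha hb => by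
    refine (congrArg (GradedTensorProduct.of k C.grading C.grading).symm
      (gradedTensor_comm C.toGrAlg ha hb)).trans ?_
    rw [map_smul]; rfl
  have hzz : sw z = z := congrArg (GradedTensorProduct.of k C.grading C.grading).symm hz
  rw [← hzz]
  obtain ⟨w, rfl⟩ := mem_range_lTensor h
  clear hz hzz h
  induction w with
  | zero => simp
  | add x y hx hy => rw [map_add, map_add, map_add]; exact D.add_mem hx hy
  | tmul c d =>
    obtain ⟨d, hd⟩ := d
    rw [LinearMap.lTensor_tmul, Submodule.subtype_apply]
    refine C.toGrAlg.homogeneous_induction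
      (D.comap (rcontr ψ ∘ₗ sw ∘ₗ (TensorProduct.mk k _ _).flip d)) (fun i c hc => ?_) c
    refine C.toGrAlg.mem_iSup_of_forall
      (S := D.comap (rcontr ψ ∘ₗ sw ∘ₗ TensorProduct.mk k _ _ c)) (a := d) fun j => ?_
    change rcontr ψ (sw (c ⊗ₜ C.toGrAlg.proj j d)) ∈ D
    rw [hsw i j _ _ hc (C.toGrAlg.proj_mem j d), map_smul, rcontr_tmul]
    exact D.smul_mem _ (D.smul_mem _ (hD j d hd))

/-- Every element of a graded Hopf algebra lies in a finite-dimensional graded subcoalgebra. -/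
theorem exists_isSubcoalg (x : C.carrier) :
    ∃ D : Submodule k C.carrier, C.IsSubcoalg D ∧ Module.Finite k D ∧ x ∈ D := by
  let S : Submodule k C.carrier :=
    { carrier := {x | ∃ D : Submodule k C.carrier, C.IsSubcoalg D ∧ Module.Finite k D ∧ x ∈ D}
      zero_mem' := ⟨⊥, ⟨by simp, by simp, by simp⟩, inferInstance, Submodule.zero_mem _⟩
      add_mem' := by
        rintro x y ⟨D, hD, _, hx⟩ ⟨D', hD', _, hy⟩
        exact ⟨D ⊔ D', hD.sup hD', inferInstance, Submodule.add_mem_sup hx hy⟩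
      smul_mem' := by
        rintro c x ⟨D, hD, hf, hx⟩
        exact ⟨D, hD, hf, D.smul_mem c hx⟩ }
  -- The elements contained in such a subcoalgebra form a subspace, so `x` may be taken homogeneous.
  -- The span of the second tensor factors of its coproduct is then the required subcoalgebra.
  refine C.toGrAlg.homogeneous_induction S (fun n x hx => ?_) x
  have hleft : ∀ y ∈ lspan (Coalgebra.comul x : C.carrier ⊗[k] C.carrier),
      ∀ φ : C.carrier →ₗ[k] k, lcontr φ (Coalgebra.comul y : C.carrier ⊗[k] C.carrier) ∈
        lspan (Coalgebra.comul x : C.carrier ⊗[k] C.carrier) := fun y hy φ => by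
    obtain ⟨χ, rfl⟩ := mem_lspan.1 hy
    rw [lcontr_coassoc]
    exact mem_lspan.2 ⟨_, rfl⟩
  have hproj : ∀ m, ∀ y ∈ lspan (Coalgebra.comul x : C.carrier ⊗[k] C.carrier),
      C.toGrAlg.proj m y ∈ lspan (Coalgebra.comul x : C.carrier ⊗[k] C.carrier) := fun m y hy => by
    obtain ⟨φ, rfl⟩ := mem_lspan.1 hy
    -- In total degree `n`, a second factor of degree `m` sits next to a first factor of degree `n -
    -- m`, so projecting a contraction amounts to changing the functional.
    have key : ∀ z ∈ tensorGrading C.toGrAlg C.toGrAlg n, C.toGrAlg.proj m (lcontr φ z) =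
        lcontr (if m ≤ n then φ ∘ₗ C.toGrAlg.proj (n - m) else 0) z := fun z hz => by
      refine tensorGrading_le C.toGrAlg C.toGrAlg (S := LinearMap.eqLocus
        (C.toGrAlg.proj m ∘ₗ lcontr φ)
          (lcontr (if m ≤ n then φ ∘ₗ C.toGrAlg.proj (n - m) else 0))) ?_ hz
      intro i j hij a ha b hb
      change C.toGrAlg.proj m (lcontr φ (a ⊗ₜ b)) = lcontr _ (a ⊗ₜ b)
      rw [lcontr_tmul, lcontr_tmul, map_smul]
      by_cases h : m = j
      · subst h
        rw [C.toGrAlg.proj_of_mem hb, if_pos (by omega), LinearMap.comp_apply,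
          show n - m = i by omega, C.toGrAlg.proj_of_mem ha]
      · rw [C.toGrAlg.proj_of_mem_ne hb h, smul_zero]
        split_ifs with hmn
        · rw [LinearMap.comp_apply, C.toGrAlg.proj_of_mem_ne ha (by omega), map_zero, zero_smul]
        · rw [LinearMap.zero_apply, zero_smul]
    exact mem_lspan.2 ⟨_, (key _ (C.comul_mem n x hx)).symm⟩
  exact ⟨lspan (Coalgebra.comul x : C.carrier ⊗[k] C.carrier),
    ⟨hleft, fun y hy => rcontr_comm hproj (hleft y hy) (C.graded_cocomm y), hproj⟩, inferInstance,
    mem_lspan.2 ⟨Coalgebra.counit, by simp [lcontr]⟩⟩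

section SubCoalgebra

variable {D : Submodule k C.carrier} (hD : C.IsSubcoalg D)

lemma map_subtype_injective (D : Submodule k C.carrier) :
    Function.Injective (TensorProduct.map D.subtype D.subtype) :=
  TensorProduct.map_injective_of_flat_flat _ _ D.subtype_injective D.subtype_injective

/-- The comultiplication of a subcoalgebra. -/
def subComul : D →ₗ[k] D ⊗[k] D :=
  (LinearEquiv.ofInjective _ (map_subtype_injective D)).symm.toLinearMap ∘ₗ
    LinearMap.codRestrict _ (Coalgebra.comul ∘ₗ D.subtype) (fun x => hD.comul_mem x.2)

lemma map_subComul (x : D) : TensorProduct.map D.subtype D.subtype (subComul hD x) =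
    (Coalgebra.comul (x : C.carrier) : C.carrier ⊗[k] C.carrier) :=
  congrArg Subtype.val ((LinearEquiv.ofInjective _ (map_subtype_injective D)).apply_symm_apply _)

/-- The coalgebra structure of a subcoalgebra. -/
@[reducible] def subCoalgebra : Coalgebra k D where
  comul := subComul hD
  counit := Coalgebra.counit ∘ₗ D.subtype
  coassoc := by
    have inj : Function.Injective (TensorProduct.map D.subtype
        (TensorProduct.map D.subtype D.subtype)) :=
      TensorProduct.map_injective_of_flat_flat _ _ D.subtype_injective (map_subtype_injective D)
    refine LinearMap.ext fun x => inj ?_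
    have h1 : TensorProduct.map D.subtype D.subtype ∘ₗ subComul hD = Coalgebra.comul ∘ₗ D.subtype :=
      LinearMap.ext (map_subComul hD)
    have e1 : TensorProduct.map D.subtype (TensorProduct.map D.subtype D.subtype) ∘ₗ
        (TensorProduct.assoc k D D D).toLinearMap ∘ₗ (subComul hD).rTensor D =
        (TensorProduct.assoc k C.carrier C.carrier C.carrier).toLinearMap ∘ₗ
        (Coalgebra.comul.rTensor C.carrier) ∘ₗ TensorProduct.map D.subtype D.subtype := by
      rw [LinearMap.rTensor, LinearMap.rTensor, ← TensorProduct.map_comp, ← h1, LinearMap.id_comp,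
        ← LinearMap.comp_assoc]
      have : TensorProduct.map D.subtype (TensorProduct.map D.subtype D.subtype) ∘ₗ
        (TensorProduct.assoc k D D D).toLinearMap =
        (TensorProduct.assoc k C.carrier C.carrier C.carrier).toLinearMap ∘ₗ
        TensorProduct.map (TensorProduct.map D.subtype D.subtype) D.subtype := by
        ext; simp
      rw [this, LinearMap.comp_assoc, ← TensorProduct.map_comp, LinearMap.comp_id]
    have e2 : TensorProduct.map D.subtype (TensorProduct.map D.subtype D.subtype) ∘ₗ
        (subComul hD).lTensor D =
        (Coalgebra.comul.lTensor C.carrier) ∘ₗ TensorProduct.map D.subtype D.subtype := by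
      rw [LinearMap.lTensor, LinearMap.lTensor, ← TensorProduct.map_comp, ← TensorProduct.map_comp,
        ← h1, LinearMap.id_comp, LinearMap.comp_id]
    refine (LinearMap.congr_fun e1 (subComul hD x)).trans (Eq.trans ?_
      (LinearMap.congr_fun e2 (subComul hD x)).symm)
    simp only [LinearMap.comp_apply, map_subComul]
    exact Coalgebra.coassoc_apply _
  rTensor_counit_comp_comul := by
    refine LinearMap.ext fun x => (TensorProduct.lid k D).injective (Subtype.ext ?_)
    have : D.subtype ∘ₗ (TensorProduct.lid k D).toLinearMap ∘ₗ
        (Coalgebra.counit ∘ₗ D.subtype).rTensor D = (TensorProduct.lid k C.carrier).toLinearMap ∘ₗ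
        (Coalgebra.counit.rTensor C.carrier) ∘ₗ TensorProduct.map D.subtype D.subtype := by
      ext; simp
    refine (LinearMap.congr_fun this (subComul hD x)).trans ?_
    simp only [LinearMap.comp_apply, map_subComul]
    simp
  lTensor_counit_comp_comul := by
    refine LinearMap.ext fun x => (TensorProduct.rid k D).injective (Subtype.ext ?_)
    have : D.subtype ∘ₗ (TensorProduct.rid k D).toLinearMap ∘ₗ
        (Coalgebra.counit ∘ₗ D.subtype).lTensor D = (TensorProduct.rid k C.carrier).toLinearMap ∘ₗ
        (Coalgebra.counit.lTensor C.carrier) ∘ₗ TensorProduct.map D.subtype D.subtype := by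
      ext; simp
    refine (LinearMap.congr_fun this (subComul hD x)).trans ?_
    simp only [LinearMap.comp_apply, map_subComul]
    simp

end SubCoalgebra

end GrHopf

end

/-! ### Finite subcoalgebras as duals of finite-dimensional graded algebras -/

noncomputable section

open GrAlg

namespace GrAlg

variable {k : Type u} [Field k]

/-- The identity is kept for all larger ranges so that the bounds of several elements can be merged
by a maximum. -/
lemma exists_sum_proj (A : GrAlg k) (a : A.carrier) :
    ∃ N, ∀ M ≥ N, ∑ n ∈ Finset.range M, A.proj n a = a := by
  let S : Submodule k A.carrier :=
    { carrier := {a | ∃ N, ∀ M ≥ N, ∑ n ∈ Finset.range M, A.proj n a = a}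
      zero_mem' := ⟨0, by simp⟩
      add_mem' := by
        rintro a b ⟨N, hN⟩ ⟨N', hN'⟩
        refine ⟨max N N', fun M hM => ?_⟩
        simp only [map_add, Finset.sum_add_distrib]
        rw [hN M (le_of_max_le_left hM), hN' M (le_of_max_le_right hM)]
      smul_mem' := by
        rintro c a ⟨N, hN⟩
        refine ⟨N, fun M hM => ?_⟩
        simp only [map_smul, ← Finset.smul_sum]
        rw [hN M hM] }
  refine A.homogeneous_induction S (fun n a ha => ⟨n + 1, fun M hM => ?_⟩) a
  rw [Finset.sum_eq_single n (fun m _ h => A.proj_of_mem_ne ha h), A.proj_of_mem ha]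
  intro h
  exact absurd (Finset.mem_range.2 hM) h

lemma exists_forall_sum_proj (A : GrAlg k) (D : Submodule k A.carrier) [Module.Finite k D] :
    ∃ N, ∀ M ≥ N, ∀ a ∈ D, ∑ n ∈ Finset.range M, A.proj n a = a := by
  classical
  obtain ⟨s, hs⟩ : D.FG := (Submodule.fg_top _).1 (Module.finite_def.1 inferInstance)
  choose N hN using A.exists_sum_proj
  refine ⟨s.sup N, fun M hM a ha => ?_⟩
  have : D ≤ LinearMap.eqLocus (∑ n ∈ Finset.range M, A.proj n) LinearMap.id := by
    rw [← hs, Submodule.span_le]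
    intro b hb
    change (∑ n ∈ Finset.range M, A.proj n) b = b
    rw [LinearMap.sum_apply]
    exact hN b M (le_trans (Finset.le_sup (f := N) hb) hM)
  have h := this ha
  rwa [LinearMap.mem_eqLocus, LinearMap.sum_apply] at h

lemma proj_proj (A : GrAlg k) (m n : ℕ) (a : A.carrier) :
    A.proj m (A.proj n a) = if m = n then A.proj n a else 0 := by
  split_ifs with h
  · rw [h, A.proj_of_mem (A.proj_mem n a)]
  · exact A.proj_of_mem_ne (A.proj_mem n a) h

lemma mem_iff_proj (A : GrAlg k) {n : ℕ} {a : A.carrier} : a ∈ A.grading n ↔ A.proj n a = a :=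
  ⟨A.proj_of_mem, fun h => h ▸ A.proj_mem n a⟩

end GrAlg

namespace DualCoalgHom

variable {k : Type u} [Field k] {R : FinGrAlg k} {C : GrHopf k}

/-- Preservation of degrees becomes commutation with projections once `ξ` is expanded into
homogeneous parts, of which there are finitely many because `R` is finite-dimensional. -/
lemma proj_apply (f : DualCoalgHom R C) (n : ℕ) (ξ : Module.Dual k R.obj.carrier) :
    C.toGrAlg.proj n (f.toLin ξ) = f.toLin (ξ ∘ₗ R.obj.proj n) := by
  haveI : Module.Finite k (⊤ : Submodule k R.obj.carrier) := inferInstance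
  obtain ⟨N, hN⟩ := R.obj.exists_forall_sum_proj ⊤
  -- The bound `n + 1` ensures that the index `n` itself occurs in the sum.
  have h1 : ξ = ∑ m ∈ Finset.range (max N (n + 1)), ξ ∘ₗ R.obj.proj m := by
    ext a
    rw [LinearMap.sum_apply]
    conv_lhs => rw [← hN _ (le_max_left N (n + 1)) a trivial, map_sum]
    rfl
  have h2 : ∀ m, f.toLin (ξ ∘ₗ R.obj.proj m) ∈ C.grading m := fun m =>
    f.map_mem m _ fun l hl r hr => by
      rw [LinearMap.comp_apply, R.obj.proj_of_mem_ne hr hl.symm, map_zero]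
  conv_lhs => rw [h1, map_sum, map_sum]
  rw [Finset.sum_eq_single n, C.toGrAlg.proj_of_mem (h2 n)]
  · intro m _ hm
    exact C.toGrAlg.proj_of_mem_ne (h2 m) hm.symm
  · intro h
    exact absurd (Finset.mem_range.2 (lt_of_lt_of_le (Nat.lt_succ_self n) (le_max_right _ _))) h

/-- Constructor for homomorphisms of graded coalgebras in terms of projections. -/
def mk' (f : Module.Dual k R.obj.carrier →ₗ[k] C.carrier)
    (h1 : ∀ n ξ, C.toGrAlg.proj n (f ξ) = f (ξ ∘ₗ R.obj.proj n))
    (h2 : ∀ ξ, (Coalgebra.comul (f ξ) : C.carrier ⊗[k] C.carrier) =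
      TensorProduct.map f f (dualComul R.obj.carrier ξ))
    (h3 : ∀ ξ, (Coalgebra.counit (f ξ) : k) = ξ 1) : DualCoalgHom R C where
  toLin := f
  map_mem n ξ hξ := by
    rw [C.toGrAlg.mem_iff_proj, h1]
    congr 1
    refine R.obj.hom_ext_homogeneous fun m r hr => ?_
    rw [LinearMap.comp_apply]
    by_cases h : n = m
    · subst h; rw [R.obj.proj_of_mem hr]
    · rw [R.obj.proj_of_mem_ne hr h, map_zero, hξ m (Ne.symm h) r hr]
  comul_apply := h2
  counit_apply := h3

/-- Precomposition with the transpose of a morphism. -/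
def map {S : FinGrAlg k} (f : DualCoalgHom R C) (h : R ⟶ S) : DualCoalgHom S C :=
  mk' (f.toLin ∘ₗ h.hom.toAlgHom.toLinearMap.dualMap)
    (fun n ξ => by
      rw [LinearMap.comp_apply, f.proj_apply, LinearMap.comp_apply]
      congr 1
      ext a
      exact congrArg ξ (hom_proj h.hom n a).symm)
    (fun ξ => by
      rw [LinearMap.comp_apply, f.comul_apply, TensorProduct.map_comp, LinearMap.comp_apply,
        map_dualComul h.hom.toAlgHom])
    (fun ξ => by
      rw [LinearMap.comp_apply, f.counit_apply]
      exact congrArg ξ (map_one h.hom.toAlgHom))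

lemma map_apply {S : FinGrAlg k} (f : DualCoalgHom R C) (h : R ⟶ S)
    (ξ : Module.Dual k S.obj.carrier) :
    (f.map h).toLin ξ = f.toLin (ξ ∘ₗ h.hom.toAlgHom.toLinearMap) := rfl

lemma isSubcoalg_range (f : DualCoalgHom R C) : C.IsSubcoalg (LinearMap.range f.toLin) where
  left := by
    rintro _ ⟨ξ, rfl⟩ φ
    rw [f.comul_apply, lcontr_map]
    exact ⟨_, rfl⟩
  right := by
    rintro _ ⟨ξ, rfl⟩ φ
    rw [f.comul_apply, rcontr_map]
    exact ⟨_, rfl⟩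
  proj := by
    rintro n _ ⟨ξ, rfl⟩
    rw [f.proj_apply]
    exact ⟨_, rfl⟩

/-- A homomorphism of coalgebras factors through an injective one with larger range. -/
theorem exists_factor {A : FinGrAlg k} (g : DualCoalgHom A C) (hg : Function.Injective g.toLin)
    (f : DualCoalgHom R C) (h : LinearMap.range f.toLin ≤ LinearMap.range g.toLin) :
    ∃ φ : A ⟶ R, f = g.map φ := by
  let T : Module.Dual k R.obj.carrier →ₗ[k] Module.Dual k A.obj.carrier :=
    (LinearEquiv.ofInjective g.toLin hg).symm.toLinearMap ∘ₗ
      LinearMap.codRestrict _ f.toLin (fun ξ => h ⟨ξ, rfl⟩)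
  have hT : ∀ ξ, g.toLin (T ξ) = f.toLin ξ := fun ξ =>
    congrArg Subtype.val ((LinearEquiv.ofInjective g.toLin hg).apply_symm_apply _)
  -- The factorisation `T` of dual spaces is transposed by means of biduality; injectivity of `g`
  -- forces `T` to respect coproducts, so its transpose is multiplicative.
  let φ : A.obj.carrier →ₗ[k] R.obj.carrier :=
    (Module.evalEquiv k R.obj.carrier).symm.toLinearMap ∘ₗ T.dualMap ∘ₗ
      Module.Dual.eval k A.obj.carrier
  have hφ : ∀ ξ a, ξ (φ a) = T ξ a := fun ξ a => by
    simp [φ]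
  have ext : ∀ {a b : R.obj.carrier}, (∀ ξ : Module.Dual k R.obj.carrier, ξ a = ξ b) → a = b :=
    fun h => by
      rw [← sub_eq_zero, ← Module.forall_dual_apply_eq_zero_iff k]
      intro ξ; rw [map_sub, h, sub_self]
  have hTc : ∀ ξ, TensorProduct.map T T (dualComul R.obj.carrier ξ) =
      dualComul A.obj.carrier (T ξ) := fun ξ => by
    have inj : Function.Injective (TensorProduct.map g.toLin g.toLin) :=
      TensorProduct.map_injective_of_flat_flat _ _ hg hg
    apply inj
    rw [← LinearMap.comp_apply (TensorProduct.map _ _), ← TensorProduct.map_comp, ← g.comul_apply,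
      hT, f.comul_apply, show g.toLin ∘ₗ T = f.toLin from LinearMap.ext hT]
  have h1 : φ 1 = 1 := ext fun ξ => by
    rw [hφ, ← g.counit_apply, hT, f.counit_apply]
  have hm : ∀ a b, φ (a * b) = φ a * φ b := fun a b => ext fun ξ => by
    rw [hφ, ← dualComul_apply, ← dualComul_apply, ← hTc, ← LinearMap.comp_apply
      (TensorProduct.map _ _), ← TensorProduct.map_comp]
    congr 3 <;> (ext ξ; simp [hφ])
  have hp : ∀ n a, R.obj.proj n (φ a) = φ (A.obj.proj n a) := fun n a => ext fun ξ => by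
    rw [hφ]
    have : T (ξ ∘ₗ R.obj.proj n) = T ξ ∘ₗ A.obj.proj n := by
      apply hg
      rw [hT, ← f.proj_apply, ← g.proj_apply, hT]
    rw [← LinearMap.comp_apply, hφ, this, LinearMap.comp_apply]
  refine ⟨ObjectProperty.homMk ⟨AlgHom.ofLinearMap φ h1 hm, fun n a ha => ?_⟩, ?_⟩
  · change φ a ∈ _
    rw [R.obj.mem_iff_proj, hp, A.obj.proj_of_mem ha]
  · refine DualCoalgHom.ext (LinearMap.ext fun ξ => ?_)
    rw [map_apply, ← hT]
    congr 1
    ext a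
    exact (hφ ξ a).symm

end DualCoalgHom

namespace GrHopf

variable {k : Type u} [Field k] {C : GrHopf k} {D : Submodule k C.carrier} (hD : C.IsSubcoalg D)

/-- The projections of a graded subcoalgebra. -/
def subProj (n : ℕ) : D →ₗ[k] D :=
  LinearMap.codRestrict D (C.toGrAlg.proj n ∘ₗ D.subtype) (fun x => hD.proj n x x.2)

lemma subProj_subProj (m n : ℕ) (x : D) :
    subProj hD m (subProj hD n x) = if m = n then subProj hD n x else 0 := by
  apply Subtype.ext
  refine (C.toGrAlg.proj_proj m n x).trans ?_
  split_ifs <;> rfl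

/-- The dual space of a subcoalgebra, with the convolution product. -/
def SubDual (_ : C.IsSubcoalg D) : Type u := WithConv (D →ₗ[k] k)

instance : Ring (SubDual hD) :=
  letI := subCoalgebra hD
  (inferInstance : Ring (WithConv (D →ₗ[k] k)))

instance : Algebra k (SubDual hD) :=
  letI := subCoalgebra hD
  (inferInstance : Algebra k (WithConv (D →ₗ[k] k)))

/-- Functionals as elements of the dual algebra. -/
def SubDual.of : (D →ₗ[k] k) ≃ₗ[k] SubDual hD where
  toFun φ := (WithConv.toConv φ :)
  invFun φ := WithConv.ofConv (show WithConv (D →ₗ[k] k) from φ)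
  map_add' _ _ := rfl
  map_smul' _ _ := rfl
  left_inv _ := rfl
  right_inv _ := rfl

lemma subDual_mul (φ ψ : D →ₗ[k] k) : SubDual.of hD φ * SubDual.of hD ψ =
    SubDual.of hD (LinearMap.mul' k k ∘ₗ TensorProduct.map φ ψ ∘ₗ subComul hD) := rfl

lemma subDual_one : (1 : SubDual hD) = SubDual.of hD (Coalgebra.counit ∘ₗ D.subtype) := rfl

lemma subDual_mul_apply (φ ψ : C.carrier →ₗ[k] k) (x : D) :
    (SubDual.of hD).symm (SubDual.of hD (φ ∘ₗ D.subtype) * SubDual.of hD (ψ ∘ₗ D.subtype)) x =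
    LinearMap.mul' k k (TensorProduct.map φ ψ (Coalgebra.comul (x : C.carrier))) := by
  rw [subDual_mul, LinearEquiv.symm_apply_apply, ← map_subComul hD, TensorProduct.map_comp]
  rfl

/-- The homogeneous parts of the dual algebra. -/
def subDualDeg (n : ℕ) : Submodule k (SubDual hD) :=
  (LinearMap.eqLocus ((subProj hD n).lcomp k k) LinearMap.id).map (SubDual.of hD).toLinearMap

lemma exists_of_mem_subDualDeg {n : ℕ} {φ : SubDual hD} (h : φ ∈ subDualDeg hD n) :
    ∃ ψ : C.carrier →ₗ[k] k, φ = SubDual.of hD (ψ ∘ₗ D.subtype) ∧ ψ ∘ₗ C.toGrAlg.proj n = ψ := by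
  obtain ⟨φ, hφ, rfl⟩ := h
  obtain ⟨ψ, rfl⟩ := φ.exists_extend
  refine ⟨ψ ∘ₗ C.toGrAlg.proj n, congrArg (SubDual.of hD) hφ.symm, ?_⟩
  ext a
  simp [proj_proj]

lemma of_mem_subDualDeg {n : ℕ} {φ : D →ₗ[k] k} :
    SubDual.of hD φ ∈ subDualDeg hD n ↔ φ ∘ₗ subProj hD n = φ :=
  ⟨fun ⟨_, hψ, h⟩ => (SubDual.of hD).injective h ▸ hψ, fun h => ⟨φ, h, rfl⟩⟩

variable (C) in
-- The coproduct preserves total degree, so the convolution of functionals concentrated in degrees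
-- `i` and `j` is concentrated in degree `i + j`.
lemma mul'_map_comul_eq_zero {i j n : ℕ} {φ ψ : C.carrier →ₗ[k] k}
    (hφ : φ ∘ₗ C.toGrAlg.proj i = φ) (hψ : ψ ∘ₗ C.toGrAlg.proj j = ψ) (h : n ≠ i + j) (x : C.carrier) :
    LinearMap.mul' k k (TensorProduct.map φ ψ (Coalgebra.comul (C.toGrAlg.proj n x))) = 0 := by
  refine tensorGrading_le C.toGrAlg C.toGrAlg
    (S := LinearMap.ker (LinearMap.mul' k k ∘ₗ TensorProduct.map φ ψ)) ?_
    (C.comul_mem n _ (C.toGrAlg.proj_mem n x))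
  intro a b hab x hx y hy
  change φ x * ψ y = 0
  by_cases hi : i = a
  · have hj : j ≠ b := by omega
    rw [← hψ, LinearMap.comp_apply, C.toGrAlg.proj_of_mem_ne hy hj, map_zero, mul_zero]
  · rw [← hφ, LinearMap.comp_apply, C.toGrAlg.proj_of_mem_ne hx hi, map_zero, zero_mul]

variable (C) in
-- Graded cocommutativity dualises to graded commutativity of the convolution product.
lemma mul'_map_comul_comm {i j : ℕ} {φ ψ : C.carrier →ₗ[k] k}
    (hφ : φ ∘ₗ C.toGrAlg.proj i = φ) (hψ : ψ ∘ₗ C.toGrAlg.proj j = ψ) (x : C.carrier) :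
    LinearMap.mul' k k (TensorProduct.map φ ψ (Coalgebra.comul x)) =
      (-1 : k) ^ (i * j) * LinearMap.mul' k k (TensorProduct.map ψ φ (Coalgebra.comul x)) := by
  have key : ∀ z : C.carrier ⊗[k] C.carrier,
      LinearMap.mul' k k (TensorProduct.map φ ψ ((GradedTensorProduct.of k C.grading C.grading).symm
        (GradedTensorProduct.comm C.grading C.grading
          (GradedTensorProduct.of k C.grading C.grading z)))) =
      (-1 : k) ^ (i * j) * LinearMap.mul' k k (TensorProduct.map ψ φ z) := fun z => by
    have : LinearMap.mul' k k ∘ₗ TensorProduct.map φ ψ ∘ₗ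
        (GradedTensorProduct.of k C.grading C.grading).symm.toLinearMap ∘ₗ
        (GradedTensorProduct.comm C.grading C.grading).toLinearMap ∘ₗ
        (GradedTensorProduct.of k C.grading C.grading).toLinearMap =
        (-1 : k) ^ (i * j) • (LinearMap.mul' k k ∘ₗ TensorProduct.map ψ φ) := by
      refine C.toGrAlg.tensor_hom_ext C.toGrAlg fun a b x hx y hy => ?_
      refine (congrArg (fun w => LinearMap.mul' k k (TensorProduct.map φ ψ
        ((GradedTensorProduct.of k C.grading C.grading).symm w)))
        (gradedTensor_comm C.toGrAlg hx hy)).trans ?_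
      rw [map_smul, map_smul, map_smul, LinearEquiv.symm_apply_apply, LinearMap.smul_apply,
        LinearMap.comp_apply, TensorProduct.map_tmul, TensorProduct.map_tmul, LinearMap.mul'_apply,
        LinearMap.mul'_apply]
      by_cases hi : i = b
      · by_cases hj : j = a
        · subst hi hj; rw [mul_comm (φ y)]
        · rw [← hψ, LinearMap.comp_apply, C.toGrAlg.proj_of_mem_ne hx hj]; simp
      · rw [← hφ, LinearMap.comp_apply, C.toGrAlg.proj_of_mem_ne hy hi]; simp
    exact LinearMap.congr_fun this z
  rw [← key, C.graded_cocomm, LinearEquiv.symm_apply_apply]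

lemma subDual_mul_mem (i j : ℕ) (φ ψ : SubDual hD) (hφ : φ ∈ subDualDeg hD i)
    (hψ : ψ ∈ subDualDeg hD j) : φ * ψ ∈ subDualDeg hD (i + j) := by
  obtain ⟨φ, rfl, hφ'⟩ := exists_of_mem_subDualDeg hD hφ
  obtain ⟨ψ, rfl, hψ'⟩ := exists_of_mem_subDualDeg hD hψ
  rw [← (SubDual.of hD).apply_symm_apply (_ * _), of_mem_subDualDeg]
  refine LinearMap.ext fun x => ?_
  haveI : Module.Finite k (Submodule.span k {(x : C.carrier)}) := inferInstance
  obtain ⟨N, hN⟩ := C.toGrAlg.exists_sum_proj x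
  have hx := hN (max N (i + j + 1)) (le_max_left _ _)
  rw [LinearMap.comp_apply, subDual_mul_apply, subDual_mul_apply]
  conv_rhs => rw [← hx, map_sum, map_sum, map_sum]
  rw [Finset.sum_eq_single (i + j)]
  · rfl
  · exact fun n _ hn => mul'_map_comul_eq_zero C hφ' hψ' hn x
  · intro h
    exact absurd (Finset.mem_range.2 (lt_of_lt_of_le (Nat.lt_succ_self _) (le_max_right _ _))) h

/-- The dual algebra of a finite-dimensional graded subcoalgebra. -/
def subDualAlg [Module.Finite k D] : GrAlg k where
  carrier := SubDual hD
  grading := subDualDeg hD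
  graded := gradedAlgebraOfProj _
    (by
      rw [subDual_one, of_mem_subDualDeg]
      have h : (Coalgebra.counit : C.carrier →ₗ[k] k) ∘ₗ C.toGrAlg.proj 0 = Coalgebra.counit := by
        refine C.toGrAlg.hom_ext_homogeneous fun n a ha => ?_
        rw [LinearMap.comp_apply]
        by_cases hn : 0 = n
        · subst hn; rw [C.toGrAlg.proj_of_mem ha]
        · rw [C.toGrAlg.proj_of_mem_ne ha hn, map_zero, C.counit_eq_zero n a ha (Ne.symm hn)]
      exact congrArg (· ∘ₗ D.subtype) h)
    (subDual_mul_mem hD)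
    (fun n => (SubDual.of hD).toLinearMap ∘ₗ (subProj hD n).lcomp k k ∘ₗ
      (SubDual.of hD).symm.toLinearMap)
    (by rintro n _ ⟨φ, hφ, rfl⟩; exact congrArg (SubDual.of hD) hφ)
    (by
      rintro m n _ ⟨φ, hφ, rfl⟩ h
      replace hφ : φ ∘ₗ subProj hD n = φ := hφ
      change SubDual.of hD (φ ∘ₗ subProj hD m) = 0
      rw [← hφ, ← (SubDual.of hD).map_zero]
      congr 1
      ext x
      simp [subProj_subProj, Ne.symm h])
    (by
      intro φ
      obtain ⟨φ, rfl⟩ := (SubDual.of hD).surjective φ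
      obtain ⟨N, hN⟩ := C.toGrAlg.exists_forall_sum_proj D
      have : φ = ∑ n ∈ Finset.range N, φ ∘ₗ subProj hD n := by
        ext x
        have hx : x = ∑ n ∈ Finset.range N, subProj hD n x := Subtype.ext (by
          rw [AddSubmonoidClass.coe_finsetSum]; exact (hN N le_rfl x x.2).symm)
        rw [LinearMap.sum_apply]
        conv_lhs => rw [hx, map_sum]
        rfl
      rw [this, map_sum]
      refine Submodule.sum_mem _ fun n _ => Submodule.mem_iSup_of_mem n ?_
      rw [of_mem_subDualDeg]
      ext x
      simp [subProj_subProj])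
  graded_comm := by
    intro i j φ ψ hφ hψ
    obtain ⟨φ, rfl, hφ'⟩ := exists_of_mem_subDualDeg hD hφ
    obtain ⟨ψ, rfl, hψ'⟩ := exists_of_mem_subDualDeg hD hψ
    have : SubDual.of hD (φ ∘ₗ D.subtype) * SubDual.of hD (ψ ∘ₗ D.subtype) = (-1 : k) ^ (i * j) •
        (SubDual.of hD (ψ ∘ₗ D.subtype) * SubDual.of hD (φ ∘ₗ D.subtype)) := by
      apply (SubDual.of hD).symm.injective
      ext x
      rw [subDual_mul_apply, map_smul, LinearMap.smul_apply, subDual_mul_apply,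
        mul'_map_comul_comm C hφ' hψ']
      rfl
    rw [this]
    rcases Nat.even_or_odd (i * j) with h | h
    · simp [h.neg_one_pow]
    · rw [h.neg_one_pow, h.neg_one_pow]
      rw [Algebra.smul_def, map_neg, map_one]

/-- A finite-dimensional graded subcoalgebra is the range of an injective homomorphism from the dual
of a finite-dimensional graded algebra. -/
theorem exists_dualCoalgHom_range (hD : C.IsSubcoalg D) [Module.Finite k D] :
    ∃ (A : FinGrAlg k) (f : DualCoalgHom A C),
      Function.Injective f.toLin ∧ LinearMap.range f.toLin = D := by
  haveI : Module.Finite k (SubDual hD) := Module.Finite.equiv (SubDual.of hD)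
  -- Biduality identifies `D` with the dual of its dual algebra; the homomorphism sought is the
  -- inverse identification followed by the inclusion of `D`.
  let ev : D ≃ₗ[k] Module.Dual k (SubDual hD) :=
    (Module.evalEquiv k D).trans (SubDual.of hD).symm.dualMap
  have hev : ∀ (x : D) (φ : D →ₗ[k] k), ev x (SubDual.of hD φ) = φ x := fun x φ => rfl
  refine ⟨⟨subDualAlg hD, ‹_›⟩, DualCoalgHom.mk' (D.subtype ∘ₗ ev.symm.toLinearMap) ?_ ?_ ?_, ?_, ?_⟩
  · intro n ξ
    obtain ⟨x, rfl⟩ := ev.surjective ξ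
    have this : ∀ m, ∀ φ ∈ (subDualAlg hD).grading m,
        ev x ((subDualAlg hD).proj n φ) = ev (subProj hD n x) φ := by
      intro m φ hφ
      obtain ⟨φ, hφ', rfl⟩ := id hφ
      replace hφ' : φ ∘ₗ subProj hD m = φ := hφ'
      refine Eq.trans ?_ (hev (subProj hD n x) φ).symm
      by_cases h : n = m
      · subst h
        refine (congrArg (ev x) ((subDualAlg hD).proj_of_mem hφ)).trans ?_
        exact (LinearMap.congr_fun hφ' x).symm
      · refine (congrArg (ev x) ((subDualAlg hD).proj_of_mem_ne hφ h)).trans ?_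
        refine (map_zero (ev x)).trans ?_
        rw [← hφ', LinearMap.comp_apply, subProj_subProj, if_neg (Ne.symm h), map_zero]
    have this2 : (show (subDualAlg hD).carrier →ₗ[k] k from ev x) ∘ₗ (subDualAlg hD).proj n =
      (show (subDualAlg hD).carrier →ₗ[k] k from ev (subProj hD n x)) :=
      (subDualAlg hD).hom_ext_homogeneous this
    refine Eq.trans ?_ (congrArg (fun η : Module.Dual k (SubDual hD) => (ev.symm η : C.carrier))
      this2).symm
    change C.toGrAlg.proj n (ev.symm (ev x) : D) = (ev.symm (ev (subProj hD n x)) : D)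
    rw [LinearEquiv.symm_apply_apply, LinearEquiv.symm_apply_apply]
    rfl
  · intro ξ
    obtain ⟨x, rfl⟩ := ev.surjective ξ
    have : dualComul (SubDual hD) (ev x) = TensorProduct.map ev.toLinearMap ev.toLinearMap
        (subComul hD x) := by
      refine (eq_dualComul _ _ fun a b => ?_).symm
      rw [← LinearMap.comp_apply (TensorProduct.map _ _), ← TensorProduct.map_comp]
      rfl
    change (Coalgebra.comul ((ev.symm (ev x) : D) : C.carrier) : C.carrier ⊗[k] C.carrier) =
      TensorProduct.map (D.subtype ∘ₗ ev.symm.toLinearMap) (D.subtype ∘ₗ ev.symm.toLinearMap)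
        (dualComul (SubDual hD) (ev x))
    rw [this, LinearEquiv.symm_apply_apply, ← LinearMap.comp_apply (TensorProduct.map _ _),
      ← TensorProduct.map_comp, ← map_subComul hD]
    congr 2 <;> (ext y; simp)
  · intro ξ
    obtain ⟨x, rfl⟩ := ev.surjective ξ
    change (Coalgebra.counit ((ev.symm (ev x) : D) : C.carrier) : k) = ev x 1
    rw [LinearEquiv.symm_apply_apply]
    rfl
  · exact D.subtype_injective.comp ev.symm.injective
  · change LinearMap.range (D.subtype ∘ₗ ev.symm.toLinearMap) = D
    rw [LinearMap.range_comp, LinearEquiv.range, Submodule.map_top, Submodule.range_subtype]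
-- This reduces statements about elements of a Hopf algebra to values of coalgebra homomorphisms out
-- of duals of finite-dimensional algebras, on which endomorphisms of those algebras act.
theorem exists_dualCoalgHom (x : C.carrier) : ∃ (A : FinGrAlg k) (f : DualCoalgHom A C),
    Function.Injective f.toLin ∧ x ∈ LinearMap.range f.toLin := by
  obtain ⟨D, hD, _, hx⟩ := exists_isSubcoalg x
  obtain ⟨A, f, hf, h⟩ := exists_dualCoalgHom_range hD
  exact ⟨A, f, hf, h ▸ hx⟩

end GrHopf

end

noncomputable section

open GrAlg

/-! ## The perfect part of a finite-dimensional algebra -/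

section PerfectPart

variable {k : Type*} [Field k] (p : ℕ) [Fact p.Prime] [CharP k p]

include k in
variable (k) in
-- Only commutation of the two elements is required, because the identity is used in tensor products
-- R ⊗ C that need not be commutative.
lemma add_pow_char_pow_of_algebra {A : Type*} [Ring A] [Algebra k A] (n : ℕ) {a b : A}
    (h : Commute a b) : (a + b) ^ p ^ n = a ^ p ^ n + b ^ p ^ n := by
  cases subsingleton_or_nontrivial A
  · exact Subsingleton.elim _ _
  · haveI := charP_of_injective_algebraMap (algebraMap k A).injective p
    exact add_pow_char_pow_of_commute p n h

variable [PerfectField k]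

lemma exists_pow_char_pow_eq (n : ℕ) (c : k) : ∃ d : k, d ^ p ^ n = c := by
  haveI : ExpChar k p := ExpChar.prime Fact.out
  exact (bijective_iterateFrobenius k p n).2 c

variable {A : Type*} [CommRing A] [Algebra k A]

variable (k A) in
/-- The space of `p ^ n`-th powers. -/
def powSubmodule (n : ℕ) : Submodule k A where
  carrier := Set.range fun a : A => a ^ p ^ n
  zero_mem' := ⟨0, by simp [(Fact.out : p.Prime).ne_zero]⟩
  add_mem' := by
    rintro _ _ ⟨a, rfl⟩ ⟨b, rfl⟩
    exact ⟨a + b, add_pow_char_pow_of_algebra k p n (Commute.all a b)⟩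
  smul_mem' := by
    rintro c _ ⟨a, rfl⟩
    -- Perfectness of `k` enters here: scalars have `p ^ n`-th roots, so the `p ^ n`-th powers form
    -- a subspace and not merely a subgroup.
    obtain ⟨d, rfl⟩ := exists_pow_char_pow_eq p n c
    exact ⟨d • a, smul_pow d a _⟩

variable (k A) in
/-- The subalgebra of elements which are `p ^ n`-th powers for all `n`. -/
def perfectPart : Subalgebra k A where
  carrier := {b | ∀ n, ∃ a : A, a ^ p ^ n = b}
  mul_mem' ha hb n := by
    obtain ⟨a, rfl⟩ := ha n
    obtain ⟨b, rfl⟩ := hb n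
    exact ⟨a * b, mul_pow a b _⟩
  add_mem' ha hb n := (powSubmodule k p A n).add_mem (ha n) (hb n)
  algebraMap_mem' c n := by
    obtain ⟨d, rfl⟩ := exists_pow_char_pow_eq p n c
    exact ⟨algebraMap k A d, (map_pow _ _ _).symm⟩

lemma map_mem_perfectPart {B : Type*} [CommRing B] [Algebra k B] (f : A →ₐ[k] B) {a : A}
    (h : a ∈ perfectPart k p A) : f a ∈ perfectPart k p B := fun n => by
  obtain ⟨b, rfl⟩ := h n
  exact ⟨f b, (map_pow f b _).symm⟩

variable [Module.Finite k A]

include k in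
-- A `p ^ N`-th root of a nilpotent element is nilpotent. If the `N`-th power of the nilradical is
-- zero, the `p ^ N`-th power of that root vanishes.
lemma eq_zero_of_mem_perfectPart {b : A} (hb : b ∈ perfectPart k p A) (h : IsNilpotent b) :
    b = 0 := by
  haveI : IsNoetherianRing A := isNoetherian_of_tower k inferInstance
  obtain ⟨N, hN⟩ := IsNoetherianRing.isNilpotent_nilradical A
  obtain ⟨c, rfl⟩ := hb N
  have hc : c ∈ nilradical A :=
    mem_nilradical.2 (h.elim fun m hm => ⟨p ^ N * m, (pow_mul c _ _).trans hm⟩)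
  have h1 : c ^ N = 0 := by
    have := Ideal.pow_mem_pow hc N
    rwa [hN] at this
  exact pow_eq_zero_of_le (Nat.lt_pow_self (Fact.out : p.Prime).one_lt).le h1

/-- The spaces of `p ^ n`-th powers decrease and become stationary at some `n`. Then a^(p^n) =
c^(p^(2n)) for some c, and additivity of Frobenius shows that a - c^(p^n) is nilpotent. -/
lemma exists_mem_perfectPart (a : A) : ∃ b ∈ perfectPart k p A, IsNilpotent (a - b) := by
  have anti : Antitone (powSubmodule k p A) := by
    intro m n hmn
    rintro _ ⟨a, rfl⟩
    exact ⟨a ^ p ^ (n - m), by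
      change (a ^ p ^ (n - m)) ^ p ^ m = a ^ p ^ n
      rw [← pow_mul, ← pow_add, Nat.sub_add_cancel hmn]⟩
  obtain ⟨n, hn⟩ := IsArtinian.monotone_stabilizes
    (⟨fun n => OrderDual.toDual (powSubmodule k p A n), anti⟩ : ℕ →o (Submodule k A)ᵒᵈ)
  replace hn : ∀ m, n ≤ m → powSubmodule k p A n = powSubmodule k p A m := hn
  have hmem : ∀ x ∈ powSubmodule k p A n, x ∈ perfectPart k p A := fun x hx m => by
    rcases le_total n m with h | h
    · rw [hn m h] at hx; exact hx
    · exact anti h hx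
  have h1 : a ^ p ^ n ∈ powSubmodule k p A (n + n) := hn (n + n) (by omega) ▸ ⟨a, rfl⟩
  obtain ⟨c, hc⟩ := h1
  refine ⟨c ^ p ^ n, hmem _ ⟨c, rfl⟩, p ^ n, ?_⟩
  have h2 := add_pow_char_pow_of_algebra k p n (Commute.all (a - c ^ p ^ n) (c ^ p ^ n))
  rw [sub_add_cancel, ← pow_mul, ← pow_add] at h2
  rw [← add_right_cancel_iff (a := c ^ p ^ (n + n)), ← h2, zero_add]
  exact hc.symm

lemma perfectPart_unique {a b c : A} (hb : b ∈ perfectPart k p A) (hc : c ∈ perfectPart k p A)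
    (h : IsNilpotent (a - b)) (h' : IsNilpotent (a - c)) : b = c := by
  rw [← sub_eq_zero]
  refine eq_zero_of_mem_perfectPart (k := k) p (Subalgebra.sub_mem _ hb hc) ?_
  have := (Commute.all (a - c) (a - b)).isNilpotent_sub h' h
  rwa [sub_sub_sub_cancel_left] at this

variable (k A) in
/-- The projection to the perfect part along the nilradical. -/
def perfectProj : A →ₐ[k] A :=
  have h : ∀ a, (exists_mem_perfectPart (k := k) p a).choose ∈ perfectPart k p A ∧
    IsNilpotent (a - (exists_mem_perfectPart (k := k) p a).choose) := fun a =>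
      (exists_mem_perfectPart (k := k) p a).choose_spec
  -- Choosing is harmless: the element is unique, so each axiom only asks for some element of the
  -- perfect part in the right class modulo nilpotents.
  { toFun a := (exists_mem_perfectPart (k := k) p a).choose
    map_one' := perfectPart_unique p (a := 1) (h 1).1 (Subalgebra.one_mem _) (h 1).2 (by simp)
    map_zero' := perfectPart_unique p (a := 0) (h 0).1 (Subalgebra.zero_mem _) (h 0).2 (by simp)
    map_mul' a b := perfectPart_unique p (a := a * b) (h _).1
      (Subalgebra.mul_mem _ (h a).1 (h b).1) (h _).2 (by
        have : a * b - (exists_mem_perfectPart (k := k) p a).choose *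
          (exists_mem_perfectPart (k := k) p b).choose =
            (a - (exists_mem_perfectPart (k := k) p a).choose) * b +
            (exists_mem_perfectPart (k := k) p a).choose *
              (b - (exists_mem_perfectPart (k := k) p b).choose) := by ring
        rw [this]
        exact (Commute.all _ _).isNilpotent_add ((Commute.all _ _).isNilpotent_mul_right (h a).2)
          ((Commute.all _ _).isNilpotent_mul_left (h b).2))
    map_add' a b := perfectPart_unique p (a := a + b) (h _).1
      (Subalgebra.add_mem _ (h a).1 (h b).1) (h _).2 (by
        rw [add_sub_add_comm]
        exact (Commute.all _ _).isNilpotent_add (h a).2 (h b).2)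
    commutes' c := perfectPart_unique p (a := algebraMap k A c) (h _).1
      (Subalgebra.algebraMap_mem _ c) (h _).2 (by simp) }

lemma perfectProj_mem (a : A) : perfectProj k p A a ∈ perfectPart k p A :=
  (exists_mem_perfectPart (k := k) p a).choose_spec.1

lemma isNilpotent_sub_perfectProj (a : A) : IsNilpotent (a - perfectProj k p A a) :=
  (exists_mem_perfectPart (k := k) p a).choose_spec.2

lemma perfectProj_eq {a b : A} (hb : b ∈ perfectPart k p A) (h : IsNilpotent (a - b)) :
    perfectProj k p A a = b :=
  perfectPart_unique p (perfectProj_mem p a) hb (isNilpotent_sub_perfectProj p a) h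

lemma perfectProj_of_mem {b : A} (hb : b ∈ perfectPart k p A) : perfectProj k p A b = b :=
  perfectProj_eq p hb (by simp)

/-- Algebra homomorphisms preserve iterated `p`-th roots as well as nilpotents. -/
lemma map_perfectProj {B : Type*} [CommRing B] [Algebra k B] [Module.Finite k B] (f : A →ₐ[k] B)
    (a : A) : f (perfectProj k p A a) = perfectProj k p B (f a) :=
  (perfectProj_eq p (map_mem_perfectPart p f (perfectProj_mem p a))
    (by rw [← map_sub]; exact (isNilpotent_sub_perfectProj p a).map f)).symm

end PerfectPart

namespace GrAlg

variable {k : Type u} [Field k]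

/-- The part of degree zero, as a subalgebra. -/
def zeroPart (A : GrAlg k) : Subalgebra k A.carrier where
  carrier := A.grading 0
  mul_mem' ha hb := A.mul_mem ha hb
  add_mem' ha hb := (A.grading 0).add_mem ha hb
  algebraMap_mem' c := A.algebraMap_mem c

instance (A : GrAlg k) : CommRing A.zeroPart :=
  { (inferInstance : Ring A.zeroPart) with
    mul_comm a b := Subtype.ext (by
      have := A.graded_comm 0 0 a b a.2 b.2
      rw [Nat.zero_mul, pow_zero, one_mul] at this
      exact this) }

instance (A : GrAlg k) : Algebra k A.zeroPart := inferInstance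

/-- The projection to degree zero. -/
def toZeroPart (A : GrAlg k) : A.carrier →ₐ[k] A.zeroPart :=
  A.deg0.toAlgHom.codRestrict A.zeroPart fun a => by
    rw [deg0_apply]; exact A.proj_mem 0 a

lemma toZeroPart_apply (A : GrAlg k) (a : A.carrier) : (A.toZeroPart a : A.carrier) = A.proj 0 a :=
  A.deg0_apply a

/-- The map induced on the parts of degree zero. -/
def zeroPartMap {A B : GrAlg k} (f : A ⟶ B) : A.zeroPart →ₐ[k] B.zeroPart :=
  (f.toAlgHom.comp A.zeroPart.val).codRestrict B.zeroPart fun a => f.map_mem 0 a a.2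

variable (p : ℕ) [Fact p.Prime] [CharP k p] [PerfectField k]

/-- The projection of a finite-dimensional graded algebra to the perfect part of its part of
degree zero. -/
def red (R : GrAlg k) [Module.Finite k R.carrier] : R ⟶ R where
  toAlgHom := (R.zeroPart.val.comp (perfectProj k p R.zeroPart)).comp R.toZeroPart
  map_mem n a ha := by
    change ((perfectProj k p R.zeroPart (R.toZeroPart a) : R.zeroPart) : R.carrier) ∈ _
    by_cases hn : n = 0
    · subst hn; exact Subtype.prop (perfectProj k p R.zeroPart (R.toZeroPart a))
    · have : R.toZeroPart a = 0 := Subtype.ext (by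
        rw [toZeroPart_apply, R.proj_of_mem_ne ha (Ne.symm hn)]; rfl)
      rw [this, map_zero]
      exact Submodule.zero_mem _

section

variable (R : GrAlg k) [Module.Finite k R.carrier]

lemma red_apply (a : R.carrier) : (R.red p).toAlgHom a =
    (perfectProj k p R.zeroPart (R.toZeroPart a) : R.carrier) := rfl

lemma red_mem (a : R.carrier) : (R.red p).toAlgHom a ∈ R.grading 0 :=
  Subtype.prop (perfectProj k p R.zeroPart (R.toZeroPart a))

lemma red_of_mem {n : ℕ} (hn : n ≠ 0) {a : R.carrier} (ha : a ∈ R.grading n) :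
    (R.red p).toAlgHom a = 0 :=
  R.eq_zero_of_mem_of_mem hn ((R.red p).map_mem n a ha) (R.red_mem p a)

lemma toZeroPart_red (a : R.carrier) : R.toZeroPart ((R.red p).toAlgHom a) =
    perfectProj k p R.zeroPart (R.toZeroPart a) := by
  apply Subtype.ext
  rw [toZeroPart_apply, R.proj_of_mem (R.red_mem p a), red_apply]

lemma red_red : R.red p ≫ R.red p = R.red p := by
  refine hom_ext' fun a => ?_
  rw [comp_apply, red_apply p R ((R.red p).toAlgHom a), toZeroPart_red,
    perfectProj_of_mem p (perfectProj_mem p _), red_apply]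

lemma red_natural {R S : GrAlg k} [Module.Finite k R.carrier] [Module.Finite k S.carrier]
    (f : R ⟶ S) : R.red p ≫ f = f ≫ S.red p := by
  refine hom_ext' fun a => ?_
  rw [comp_apply, comp_apply, red_apply, red_apply]
  have h := map_perfectProj p (zeroPartMap f) (R.toZeroPart a)
  refine (congrArg Subtype.val h).trans ?_
  congr 2
  apply Subtype.ext
  rw [toZeroPart_apply, hom_proj, ← toZeroPart_apply]
  rfl

lemma tau_red : R.tau ≫ R.red p = R.red p := by
  refine hom_ext' fun a => ?_
  have : (R.red p).toAlgHom.toLinearMap ∘ₗ R.tau.toAlgHom.toLinearMap =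
      (R.red p).toAlgHom.toLinearMap := by
    refine R.hom_ext_homogeneous fun n a ha => ?_
    change (R.red p).toAlgHom (R.tau.toAlgHom a) = (R.red p).toAlgHom a
    rw [R.tau_apply ha, map_smul]
    by_cases hn : n = 0
    · subst hn; simp
    · rw [R.red_of_mem p hn ha, smul_zero]
  exact LinearMap.congr_fun this a

lemma red_tau : R.red p ≫ R.tau = R.red p := by rw [tau_naturality, tau_red]

lemma exists_grading_eq_bot : ∃ N, ∀ n ≥ N, R.grading n = ⊥ := by
  haveI : Module.Finite k (⊤ : Submodule k R.carrier) := inferInstance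
  obtain ⟨N, hN⟩ := R.exists_forall_sum_proj ⊤
  refine ⟨N, fun n hn => (Submodule.eq_bot_iff _).2 fun a ha => ?_⟩
  rw [← hN N le_rfl a trivial]
  exact Finset.sum_eq_zero fun m hm =>
    R.proj_of_mem_ne ha (by have := Finset.mem_range.1 hm; omega)

/-- In degree zero an element differs from its perfect part by a nilpotent; in positive degree, high
powers leave the finitely many nonzero degrees. -/
lemma isNilpotent_of_red_eq_zero {n : ℕ} {a : R.carrier} (ha : a ∈ R.grading n)
    (h : (R.red p).toAlgHom a = 0) : IsNilpotent a := by
  by_cases hn : n = 0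
  · subst hn
    have h1 := isNilpotent_sub_perfectProj (k := k) p (R.toZeroPart a)
    have h2 : perfectProj k p R.zeroPart (R.toZeroPart a) = 0 := Subtype.ext h
    rw [h2, sub_zero] at h1
    have h3 := h1.map R.zeroPart.val
    have h4 : R.zeroPart.val (R.toZeroPart a) = a := (R.toZeroPart_apply a).trans (R.proj_of_mem ha)
    rwa [h4] at h3
  · obtain ⟨N, hN⟩ := R.exists_grading_eq_bot
    refine ⟨N, ?_⟩
    have : a ^ N ∈ R.grading (N • n) := SetLike.pow_mem_graded N ha
    rw [hN _ (by rw [smul_eq_mul]; exact Nat.le_mul_of_pos_right N (by omega))] at this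
    exact (Submodule.mem_bot k).1 this

/-- Signs disappear in the lines spanned by homogeneous elements, so these lines commute in the
semiring of submodules and sums of nilpotent lines are nilpotent. -/
lemma commute_span_of_mem (A : GrAlg k) {i j : ℕ} {a b : A.carrier} (ha : a ∈ A.grading i)
    (hb : b ∈ A.grading j) : Commute (Submodule.span k {a}) (Submodule.span k {b}) := by
  change _ * _ = _ * _
  rw [Submodule.span_mul_span, Submodule.span_mul_span, Set.singleton_mul_singleton,
    Set.singleton_mul_singleton, A.comm_of_mem ha hb]
  exact Submodule.span_singleton_smul_eq ((isUnit_one.neg).pow _) _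

/-- The kernel of the projection to the perfect part is nilpotent. -/
lemma isNilpotent_ker_red : IsNilpotent (LinearMap.ker (R.red p).toAlgHom.toLinearMap) := by
  classical
  obtain ⟨s, hs⟩ := IsNoetherian.noetherian (LinearMap.ker (R.red p).toAlgHom.toLinearMap)
  haveI : Module.Finite k (⊤ : Submodule k R.carrier) := inferInstance
  obtain ⟨N, hN⟩ := R.exists_forall_sum_proj ⊤
  -- `T` is the sum of the lines spanned by the homogeneous components of finitely many generators
  -- of the kernel.
  let T := ∑ x ∈ s ×ˢ Finset.range N, Submodule.span k {R.proj x.2 x.1}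
  have hT : IsNilpotent T := by
    refine Commute.isNilpotent_sum (fun x hx => ?_) fun x y _ _ =>
      R.commute_span_of_mem (R.proj_mem _ _) (R.proj_mem _ _)
    have h1 : (R.red p).toAlgHom (R.proj x.2 x.1) = 0 := by
      rw [← hom_proj]
      have : x.1 ∈ LinearMap.ker (R.red p).toAlgHom.toLinearMap := by
        rw [← hs]; exact Submodule.subset_span (Finset.mem_product.1 hx).1
      exact (congrArg (R.proj x.2) this).trans (map_zero _)
    obtain ⟨m, hm⟩ := R.isNilpotent_of_red_eq_zero p (R.proj_mem _ _) h1
    exact ⟨m, by rw [Submodule.span_pow, Set.singleton_pow, hm, Submodule.span_zero_singleton]; rfl⟩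
  have hle : LinearMap.ker (R.red p).toAlgHom.toLinearMap ≤ T := by
    rw [← hs, Submodule.span_le]
    intro a ha
    rw [← hN N le_rfl a trivial]
    refine Submodule.sum_mem _ fun n hn => ?_
    have h1 : Submodule.span k {R.proj n a} ≤ T := by
      have hx : (a, n) ∈ s ×ˢ Finset.range N := Finset.mem_product.2 ⟨ha, hn⟩
      have h2 := Finset.add_sum_erase (s ×ˢ Finset.range N)
        (fun x : R.carrier × ℕ => Submodule.span k {R.proj x.2 x.1}) hx
      change _ = T at h2
      rw [← h2, Submodule.add_eq_sup]
      exact le_sup_left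
    exact h1 (Submodule.mem_span_singleton_self _)
  obtain ⟨m, hm⟩ := hT
  exact ⟨m, le_bot_iff.1 ((pow_le_pow_left' hle m).trans hm.le)⟩

end

end GrAlg

end

noncomputable section

open GrAlg

/-! ## Linear maps out of the dual of a finite-dimensional algebra as tensors -/

section Elem

variable {k : Type u} [Field k] {R : Type u} [Ring R] [Algebra k R] [Module.Finite k R]
  {B : Type*} [Ring B] [Algebra k B]

/-- The tensor which represents a linear map out of a dual space. -/
def elem (f : Module.Dual k R →ₗ[k] B) : R ⊗[k] B :=
  ∑ i, Module.finBasis k R i ⊗ₜ f ((Module.finBasis k R).coord i)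

lemma lcontr_elem (f : Module.Dual k R →ₗ[k] B) (ξ : Module.Dual k R) :
    lcontr ξ (elem f) = f ξ := by
  rw [elem, map_sum]
  simp only [lcontr_tmul]
  simp only [← map_smul, ← map_sum]
  congr 1
  exact (Module.finBasis k R).sum_dual_apply_smul_coord ξ

lemma eq_elem {f : Module.Dual k R →ₗ[k] B} {x : R ⊗[k] B} (h : ∀ ξ, lcontr ξ x = f ξ) :
    x = elem f := by
  rw [← sub_eq_zero]
  refine eq_zero_of_lcontr fun ξ => ?_
  rw [map_sub, h, lcontr_elem, sub_self]

lemma elem_injective : Function.Injective (elem : (Module.Dual k R →ₗ[k] B) → R ⊗[k] B) :=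
  fun f g h => LinearMap.ext fun ξ => by rw [← lcontr_elem, h, lcontr_elem]

/-- The convolution product of linear maps out of the dual of a finite-dimensional algebra. -/
def dconv (f g : Module.Dual k R →ₗ[k] B) : Module.Dual k R →ₗ[k] B :=
  LinearMap.mul' k B ∘ₗ TensorProduct.map f g ∘ₗ dualComul R

/-- The coproduct of R^∨ is the transpose of the multiplication of R, so convolution becomes
multiplication in the ordinary tensor product without Koszul signs. Group-theoretic questions about
points thereby turn into questions about powers, idempotents and nilpotents in a ring. -/
lemma elem_dconv (f g : Module.Dual k R →ₗ[k] B) : elem (dconv f g) = elem f * elem g := by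
  refine (eq_elem fun ξ => ?_).symm
  have key : ∀ x y : R ⊗[k] B, lcontr ξ (x * y) = LinearMap.mul' k B
      (TensorProduct.map (LinearMap.applyₗ x ∘ₗ (TensorProduct.lid k B).toLinearMap.compRight k ∘ₗ
        LinearMap.rTensorHom (R := k) (N := R) (P := k) B)
        (LinearMap.applyₗ y ∘ₗ (TensorProduct.lid k B).toLinearMap.compRight k ∘ₗ
        LinearMap.rTensorHom (R := k) (N := R) (P := k) B) (dualComul R ξ)) := by
    intro x y
    induction x with
    | zero => simp [TensorProduct.map_zero_left]
    | add x x' hx hx' =>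
      rw [add_mul, map_add, hx, hx', map_add, LinearMap.add_comp, TensorProduct.map_add_left,
        LinearMap.add_apply, map_add]
    | tmul r b =>
      induction y with
      | zero => simp [TensorProduct.map_zero_right]
      | add y y' hy hy' =>
        rw [mul_add, map_add, hy, hy', map_add, LinearMap.add_comp, TensorProduct.map_add_right,
          LinearMap.add_apply, map_add]
      | tmul s c =>
        rw [Algebra.TensorProduct.tmul_mul_tmul, lcontr_tmul, ← dualComul_apply]
        generalize dualComul R ξ = z
        induction z with
        | zero => simp
        | add z z' hz hz' => simp only [map_add, add_smul, hz, hz']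
        | tmul η ζ =>
          have h1 : ∀ (η : Module.Dual k R) (r : R) (b : B), (LinearMap.applyₗ (r ⊗ₜ[k] b) ∘ₗ
            (TensorProduct.lid k B).toLinearMap.compRight k ∘ₗ
            LinearMap.rTensorHom (R := k) (N := R) (P := k) B) η = η r • b := fun η r b =>
              lcontr_tmul η r b
          rw [TensorProduct.map_tmul, TensorProduct.map_tmul, LinearMap.mul'_apply,
            LinearMap.mul'_apply, h1, h1, smul_mul_smul_comm]
          rfl
  rw [key]
  have h2 : ∀ f : Module.Dual k R →ₗ[k] B, LinearMap.applyₗ (elem f) ∘ₗ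
      (TensorProduct.lid k B).toLinearMap.compRight k ∘ₗ
        LinearMap.rTensorHom (R := k) (N := R) (P := k) B = f := fun f =>
    LinearMap.ext fun ξ => lcontr_elem f ξ
  rw [h2, h2]
  rfl

variable (k R B) in
/-- The unit of the convolution product. -/
def dunit : Module.Dual k R →ₗ[k] B := (LinearMap.toSpanSingleton k B 1) ∘ₗ LinearMap.applyₗ 1

lemma dunit_apply (ξ : Module.Dual k R) : dunit k R B ξ = ξ 1 • (1 : B) := rfl

lemma elem_dunit : elem (dunit k R B) = 1 :=
  (eq_elem fun ξ => by rw [Algebra.TensorProduct.one_def, lcontr_tmul, dunit_apply]).symm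

lemma elem_comp_dualMap {S : Type u} [Ring S] [Algebra k S] [Module.Finite k S]
    (f : Module.Dual k R →ₗ[k] B) (h : R →ₗ[k] S) :
    elem (f ∘ₗ h.dualMap) = TensorProduct.map h LinearMap.id (elem f) :=
  (eq_elem fun ξ => by
    rw [lcontr_map, lcontr_elem]; rfl).symm

lemma elem_comp {B' : Type*} [Ring B'] [Algebra k B'] (T : B →ₗ[k] B')
    (f : Module.Dual k R →ₗ[k] B) : elem (T ∘ₗ f) = TensorProduct.map LinearMap.id T (elem f) :=
  (eq_elem fun ξ => by
    rw [lcontr_map, LinearMap.comp_id, lcontr_elem]; rfl).symm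

omit [Module.Finite k R] in
lemma rcontr_mul_mem {I J : Submodule k R} {x y : R ⊗[k] B}
    (hx : ∀ φ : B →ₗ[k] k, rcontr φ x ∈ I) (hy : ∀ φ : B →ₗ[k] k, rcontr φ y ∈ J)
    (φ : B →ₗ[k] k) : rcontr φ (x * y) ∈ I * J := by
  obtain ⟨x, rfl⟩ := mem_range_rTensor hx
  obtain ⟨y, rfl⟩ := mem_range_rTensor hy
  clear hx hy
  induction x with
  | zero => simp
  | add x x' hx hx' => rw [map_add, add_mul, map_add]; exact Submodule.add_mem _ hx hx'
  | tmul r b =>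
    induction y with
    | zero => simp
    | add y y' hy hy' => rw [map_add, mul_add, map_add]; exact Submodule.add_mem _ hy hy'
    | tmul s c =>
      rw [LinearMap.rTensor_tmul, LinearMap.rTensor_tmul, Algebra.TensorProduct.tmul_mul_tmul,
        rcontr_tmul]
      exact Submodule.smul_mem _ _ (Submodule.mul_mem_mul r.2 s.2)

omit [Module.Finite k R] in
-- The hypothesis places `x` in I ⊗ B, so powers of `x` lie in the corresponding I^n ⊗ B.
lemma isNilpotent_of_rcontr {I : Submodule k R} (hI : IsNilpotent I) {x : R ⊗[k] B}
    (hx : ∀ φ : B →ₗ[k] k, rcontr φ x ∈ I) : IsNilpotent x := by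
  obtain ⟨N, hN⟩ := hI
  have : ∀ n, ∀ φ : B →ₗ[k] k, rcontr φ (x ^ (n + 1)) ∈ I ^ (n + 1) := by
    intro n
    induction n with
    | zero => simpa using hx
    | succ n ih => rw [pow_succ, pow_succ I]; exact rcontr_mul_mem ih hx
  refine ⟨N + 1, eq_zero_of_rcontr fun φ => ?_⟩
  have h := this N φ
  rw [pow_succ, hN, zero_mul] at h
  exact (Submodule.mem_bot k).1 h

end Elem

section Red

variable {k : Type u} [Field k] (p : ℕ) [Fact p.Prime] [CharP k p] [PerfectField k]
  {B : Type*} [Ring B] [Algebra k B]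

lemma isNilpotent_of_map_red (R : GrAlg k) [Module.Finite k R.carrier] {x : R.carrier ⊗[k] B}
    (hx : TensorProduct.map (R.red p).toAlgHom.toLinearMap LinearMap.id x = 0) : IsNilpotent x := by
  refine isNilpotent_of_rcontr (R.isNilpotent_ker_red p) fun φ => ?_
  have := rcontr_map φ (R.red p).toAlgHom.toLinearMap LinearMap.id x
  rw [hx, map_zero, LinearMap.comp_id] at this
  exact this.symm

/-- The projection to the perfect part as a morphism of `FinGrAlg`. -/
def FinGrAlg.red (R : FinGrAlg k) : R ⟶ R := ObjectProperty.homMk (R.obj.red p)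

end Red

namespace DualCoalgHom

variable {k : Type u} [Field k] {R : FinGrAlg k} {C : GrHopf k}

lemma comp_dconv {B : Type*} [Ring B] [Algebra k B] (f : DualCoalgHom R C) (φ ψ : C.carrier →ₗ[k] B) :
    (LinearMap.mul' k B ∘ₗ TensorProduct.map φ ψ ∘ₗ Coalgebra.comul) ∘ₗ f.toLin =
      dconv (φ ∘ₗ f.toLin) (ψ ∘ₗ f.toLin) := by
  refine LinearMap.ext fun ξ => ?_
  simp only [LinearMap.comp_apply, f.comul_apply, dconv, TensorProduct.map_comp]

variable (p : ℕ) [Fact p.Prime] [CharP k p] [PerfectField k]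

/-- The homomorphism is trivial on the perfect part of the algebra. -/
def RedTrivial (f : DualCoalgHom R C) : Prop :=
  ∀ ξ, (f.map (R.red p)).toLin ξ = ξ 1 • (1 : C.carrier)

/-- The homomorphism only depends on the perfect part of the algebra. -/
def RedFixed (f : DualCoalgHom R C) : Prop := f.map (R.red p) = f

variable {p}

lemma map_red_elem (f : DualCoalgHom R C) : TensorProduct.map (R.obj.red p).toAlgHom.toLinearMap
    LinearMap.id (elem f.toLin) = elem (f.map (R.red p)).toLin := by
  rw [← elem_comp_dualMap]; rfl

lemma RedTrivial.elem_eq {f : DualCoalgHom R C} (h : f.RedTrivial p) :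
    TensorProduct.map (R.obj.red p).toAlgHom.toLinearMap LinearMap.id (elem f.toLin) = 1 := by
  rw [map_red_elem, ← elem_dunit]
  congr 1
  exact LinearMap.ext h

lemma RedTrivial.isNilpotent_sub_one {f : DualCoalgHom R C} (h : f.RedTrivial p) :
    IsNilpotent (elem f.toLin - 1) := by
  refine isNilpotent_of_map_red p R.obj ?_
  rw [map_sub, h.elem_eq, Algebra.TensorProduct.one_def, TensorProduct.map_tmul]
  simp

/-- The element is 1 plus a nilpotent, and `p ^ N`-th powers are additive. This torsion is what
makes 2 invertible away from the multiplicative part. -/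
lemma RedTrivial.exists_pow_eq_one {f : DualCoalgHom R C} (h : f.RedTrivial p) :
    ∃ n, elem f.toLin ^ p ^ n = 1 := by
  obtain ⟨N, hN⟩ := h.isNilpotent_sub_one
  refine ⟨N, ?_⟩
  have h2 := add_pow_char_pow_of_algebra k p N (Commute.one_right (elem f.toLin - 1))
  rw [sub_add_cancel, one_pow, pow_eq_zero_of_le (Nat.lt_pow_self (Fact.out : p.Prime).one_lt).le hN,
    zero_add] at h2
  exact h2

end DualCoalgHom

namespace GrHopf

variable {k : Type u} [Field k] {C : GrHopf k}

/-- An algebra map out of the tensor algebra turns iterated reduced coproducts into iterated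
convolutions, which can be computed in any convenient algebra. -/
lemma lift_iteratedReducedComul {B : Type*} [Ring B] [Algebra k B] (θ : C.UnitCoker →ₗ[k] B) (n : ℕ) :
    (TensorAlgebra.lift k θ).toLinearMap ∘ₗ C.iteratedReducedComul (n + 1) =
      LinearMap.mul' k B ∘ₗ TensorProduct.map (θ ∘ₗ (Submodule.span k {(1 : C.carrier)}).mkQ)
        ((TensorAlgebra.lift k θ).toLinearMap ∘ₗ C.iteratedReducedComul n) ∘ₗ Coalgebra.comul := by
  have : (TensorAlgebra.lift k θ).toLinearMap ∘ₗ LinearMap.mul' k _ =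
      LinearMap.mul' k B ∘ₗ TensorProduct.map (TensorAlgebra.lift k θ).toLinearMap
        (TensorAlgebra.lift k θ).toLinearMap := by
    ext; simp
  have e2 : TensorProduct.map (θ ∘ₗ (Submodule.span k {(1 : C.carrier)}).mkQ)
      ((TensorAlgebra.lift k θ).toLinearMap ∘ₗ C.iteratedReducedComul n) =
      TensorProduct.map (TensorAlgebra.lift k θ).toLinearMap (TensorAlgebra.lift k θ).toLinearMap ∘ₗ
      TensorProduct.map (TensorAlgebra.ι k ∘ₗ (Submodule.span k {(1 : C.carrier)}).mkQ)
        (C.iteratedReducedComul n) := by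
    rw [← TensorProduct.map_comp]
    congr 1
    ext x
    simp
  rw [iteratedReducedComul, ← LinearMap.comp_assoc, this, e2]
  rfl

lemma lift_iteratedReducedComul_zero {B : Type*} [Ring B] [Algebra k B] (θ : C.UnitCoker →ₗ[k] B) :
    (TensorAlgebra.lift k θ).toLinearMap ∘ₗ C.iteratedReducedComul 0 =
      Algebra.linearMap k B ∘ₗ Coalgebra.counit := by
  ext x
  simp [iteratedReducedComul]

variable (p : ℕ) [Fact p.Prime] [CharP k p] [PerfectField k]

/-- Composed with f : R^∨ → C, the `n`-fold reduced coproduct is the `n`-th power, in R ⊗ T(C/k), of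
the image of `elem f`. That image is nilpotent: red sends `elem f` to 1, and 1 dies in C/k. -/
theorem isConilpotent_of_redTrivial
    (h : ∀ (R : FinGrAlg k) (f : DualCoalgHom R C), f.RedTrivial p) : C.IsConilpotent := by
  intro x
  obtain ⟨R, f, -, ξ, rfl⟩ := exists_dualCoalgHom x
  let π : C.carrier →ₗ[k] TensorAlgebra k C.UnitCoker :=
    TensorAlgebra.ι k ∘ₗ (Submodule.span k {(1 : C.carrier)}).mkQ
  have hπ : π 1 = 0 := by
    have : (Submodule.span k {(1 : C.carrier)}).mkQ 1 = 0 :=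
      (Submodule.Quotient.mk_eq_zero _).2 (Submodule.mem_span_singleton_self _)
    rw [LinearMap.comp_apply, this, map_zero]
  have h1 : ∀ n, elem (C.iteratedReducedComul n ∘ₗ f.toLin) = elem (π ∘ₗ f.toLin) ^ n := by
    intro n
    induction n with
    | zero =>
      rw [pow_zero, ← elem_dunit]
      congr 1
      ext ξ
      simp [iteratedReducedComul, f.counit_apply, dunit_apply, Algebra.algebraMap_eq_smul_one]
    | succ n ih =>
      rw [pow_succ', ← ih, ← elem_dconv, ← f.comp_dconv]
      rfl
  have h2 : IsNilpotent (elem (π ∘ₗ f.toLin)) := by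
    refine isNilpotent_of_map_red p R.obj ?_
    rw [elem_comp, ← LinearMap.comp_apply, ← TensorProduct.map_comp, LinearMap.comp_id,
      LinearMap.id_comp]
    have := congrArg (TensorProduct.map LinearMap.id π) (h R f).elem_eq
    rw [← LinearMap.comp_apply, ← TensorProduct.map_comp, LinearMap.comp_id,
      LinearMap.id_comp] at this
    rw [this, Algebra.TensorProduct.one_def, TensorProduct.map_tmul, hπ, TensorProduct.tmul_zero]
  obtain ⟨N, hN⟩ := h2
  refine ⟨N, ?_⟩
  have h3 := lcontr_elem (C.iteratedReducedComul (N + 1) ∘ₗ f.toLin) ξ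
  rw [h1, pow_succ, hN, zero_mul, map_zero] at h3
  exact h3.symm

omit [PerfectField k] [CharP k p] [Fact p.Prime] in
/-- Convolution powers of a functional which vanishes on `1` are locally eventually zero. -/
lemma IsConilpotent.exists_pow (hC : C.IsConilpotent) (l : C.carrier →ₗ[k] k) (hl : l 1 = 0)
    (x : C.carrier) : ∃ n, ∀ m ≥ n, ((WithConv.toConv l : WithConv (C.carrier →ₗ[k] k)) ^ m) x = 0 := by
  obtain ⟨n, hn⟩ := hC x
  refine ⟨n + 1, fun m hm => ?_⟩
  let L : WithConv (C.carrier →ₗ[k] k) := WithConv.toConv l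
  -- Since `m > n`, this is a positive convolution power of `l`, so it kills 1 and factors through
  -- the cokernel of the unit.
  let M : WithConv (C.carrier →ₗ[k] k) := L ^ (m - n)
  have hM : M.ofConv 1 = 0 := by
    have : ∀ j, (L ^ (j + 1)).ofConv 1 = 0 := by
      intro j
      rw [pow_succ', LinearMap.convMul_apply, C.comul_one]
      simp [L, hl]
    have h2 := this (m - n - 1)
    rwa [show m - n - 1 + 1 = m - n by omega] at h2
  -- The matrix with first row (l, M) and second row zero is used so that a single algebra map out
  -- of the tensor algebra carries the convolution l^n * M = l^m in its upper right corner.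
  let θ' : C.carrier →ₗ[k] Matrix (Fin 2) (Fin 2) k :=
    (LinearMap.toSpanSingleton k _ (Matrix.single 0 0 1)) ∘ₗ l +
      (LinearMap.toSpanSingleton k _ (Matrix.single 0 1 1)) ∘ₗ M.ofConv
  have hθ' : Submodule.span k {(1 : C.carrier)} ≤ LinearMap.ker θ' := by
    rw [Submodule.span_singleton_le_iff_mem, LinearMap.mem_ker]
    simp [θ', hl, hM]
  let θ := (Submodule.span k {(1 : C.carrier)}).liftQ θ' hθ'
  have hθ : θ ∘ₗ (Submodule.span k {(1 : C.carrier)}).mkQ = θ' := Submodule.liftQ_mkQ _ _ _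
  have e00 : ∀ x, θ' x 0 0 = l x := fun x => by simp [θ', Matrix.single]
  have e01 : ∀ x, θ' x 0 1 = M.ofConv x := fun x => by simp [θ', Matrix.single]
  have e1 : ∀ x j, θ' x 1 j = 0 := fun x j => by simp [θ', Matrix.single]
  let Θ : ℕ → C.carrier →ₗ[k] Matrix (Fin 2) (Fin 2) k := fun j =>
    (TensorAlgebra.lift k θ).toLinearMap ∘ₗ C.iteratedReducedComul j
  have hΘ : ∀ j x, Θ (j + 1) x = LinearMap.mul' k _ (TensorProduct.map θ' (Θ j) (Coalgebra.comul x)) :=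
    fun j x => by
    have := LinearMap.congr_fun (lift_iteratedReducedComul (C := C) θ j) x
    rw [hθ] at this
    exact this
  have row1 : ∀ j x c, Θ (j + 1) x 1 c = 0 := by
    intro j x c
    rw [hΘ]
    generalize (Coalgebra.comul x : C.carrier ⊗[k] C.carrier) = z
    induction z with
    | zero => simp
    | add y z hy hz => rw [map_add, map_add, Matrix.add_apply, hy, hz, add_zero]
    | tmul a b =>
      rw [TensorProduct.map_tmul, LinearMap.mul'_apply, Matrix.mul_apply, Fin.sum_univ_two, e1, e1]
      simp
  have row0 : ∀ j x, Θ (j + 1) x 0 1 = (L ^ j * M).ofConv x := by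
    intro j
    induction j with
    | zero =>
      intro x
      have h0 : Θ 0 = Algebra.linearMap k _ ∘ₗ (Coalgebra.counit : C.carrier →ₗ[k] k) := lift_iteratedReducedComul_zero θ
      rw [hΘ, h0, pow_zero, one_mul, ← e01]
      have : LinearMap.mul' k _ ∘ₗ TensorProduct.map θ' (Algebra.linearMap k
          (Matrix (Fin 2) (Fin 2) k) ∘ₗ (Coalgebra.counit : C.carrier →ₗ[k] k)) = θ' ∘ₗ
          (TensorProduct.rid k C.carrier).toLinearMap ∘ₗ (Coalgebra.counit : C.carrier →ₗ[k] k).lTensor C.carrier := by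
        refine TensorProduct.ext' fun a b => ?_
        simp [Algebra.algebraMap_eq_smul_one]
      have h2 := LinearMap.congr_fun this (Coalgebra.comul x : C.carrier ⊗[k] C.carrier)
      simp only [LinearMap.comp_apply] at h2
      rw [h2]
      simp
    | succ j ih =>
      intro x
      rw [hΘ, pow_succ', mul_assoc, LinearMap.convMul_apply]
      generalize (Coalgebra.comul x : C.carrier ⊗[k] C.carrier) = z
      induction z with
      | zero => simp
      | add y z hy hz => rw [map_add, map_add, Matrix.add_apply, hy, hz, map_add, map_add]
      | tmul a b =>
        rw [TensorProduct.map_tmul, LinearMap.mul'_apply, Matrix.mul_apply, Fin.sum_univ_two, row1,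
          ih, e00]
        simp [L]
  have h3 := row0 n x
  have h4 : Θ (n + 1) x = 0 := by
    change TensorAlgebra.lift k θ (C.iteratedReducedComul (n + 1) x) = 0
    rw [hn, map_zero]
  rw [h4, ← pow_add, show n + (m - n) = m by omega] at h3
  exact h3.symm

end GrHopf

end

/-! ### Behaviour of conilpotent and of multiplicative Hopf algebras on perfect parts -/

noncomputable section

open GrAlg

namespace GrHopf

variable {k : Type u} [Field k] {C : GrHopf k} (p : ℕ) [Fact p.Prime] [CharP k p] [PerfectField k]

lemma red_eq_zero_of_isNilpotent (R : GrAlg k) [Module.Finite k R.carrier] {a : R.carrier}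
    (h : IsNilpotent ((R.red p).toAlgHom a)) : (R.red p).toAlgHom a = 0 := by
  have h1 : IsNilpotent (perfectProj k p R.zeroPart (R.toZeroPart a)) := by
    obtain ⟨n, hn⟩ := h
    exact ⟨n, Subtype.ext hn⟩
  have h2 := eq_zero_of_mem_perfectPart (k := k) p (perfectProj_mem p _) h1
  rw [red_apply, h2]
  rfl

/-- Conilpotent Hopf algebras have no nontrivial points on the perfect parts of algebras. -/
theorem IsConilpotent.redTrivial (hC : C.IsConilpotent) {R : FinGrAlg k} (f : DualCoalgHom R C) :
    f.RedTrivial p := by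
  set g := f.map (R.red p) with hg
  -- Pairing the point with `l` gives an element `a` of `R`. Its powers are given by the convolution
  -- powers of `l`, which are eventually zero, while `a` lies in the reduced perfect part; hence `a
  -- = 0`.
  have key : ∀ l : C.carrier →ₗ[k] k, l 1 = 0 → ∀ ξ, l (g.toLin ξ) = 0 := by
    intro l hl
    let a := rcontr l (elem g.toLin)
    have ha : ∀ ξ : Module.Dual k R.obj.carrier, ξ a = l (g.toLin ξ) := fun ξ => by
      rw [← lcontr_elem g.toLin ξ]; exact rcontr_lcontr _ _ _
    have hpow : ∀ n, ∀ ξ : Module.Dual k R.obj.carrier, ξ (a ^ n) =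
        ((WithConv.toConv l : WithConv (C.carrier →ₗ[k] k)) ^ n) (g.toLin ξ) := by
      intro n
      induction n with
      | zero =>
        intro ξ
        rw [pow_zero, pow_zero, LinearMap.convOne_apply, g.counit_apply]; rfl
      | succ n ih =>
        intro ξ
        rw [pow_succ', pow_succ', LinearMap.convMul_apply, g.comul_apply, ← LinearMap.comp_apply
          (TensorProduct.map _ _), ← TensorProduct.map_comp, ← dualComul_apply]
        congr 3
        · ext ξ; exact ha ξ
        · ext ξ; exact ih ξ
    let b := Module.finBasis k R.obj.carrier
    choose N hN using fun i => hC.exists_pow l hl (g.toLin (b.coord i))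
    have hnil : IsNilpotent a := by
      refine ⟨Finset.univ.sup N, b.repr.injective (Finsupp.ext fun i => ?_)⟩
      rw [map_zero, Finsupp.zero_apply]
      exact (hpow _ (b.coord i)).trans (hN i _ (Finset.le_sup (Finset.mem_univ i)))
    have hred : a = (R.obj.red p).toAlgHom (rcontr l (elem f.toLin)) := by
      have := rcontr_map l (R.obj.red p).toAlgHom.toLinearMap LinearMap.id (elem f.toLin)
      rw [DualCoalgHom.map_red_elem, LinearMap.comp_id] at this
      exact this
    have h0 : a = 0 := by
      rw [hred] at hnil ⊢
      exact red_eq_zero_of_isNilpotent p R.obj hnil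
    intro ξ
    rw [← ha, h0, map_zero]
  intro ξ
  -- All functionals that vanish on 1 vanish on this value, so it is a scalar, and the counit says
  -- which one.
  have hmem : g.toLin ξ ∈ Submodule.span k {(1 : C.carrier)} := by
    by_contra hn
    obtain ⟨l, h1, h2⟩ := Submodule.exists_le_ker_of_notMem hn
    exact h1 (key l (h2 (Submodule.mem_span_singleton_self _)) ξ)
  obtain ⟨c, hc⟩ := Submodule.mem_span_singleton.1 hmem
  have h3 := g.counit_apply ξ
  rw [← hc, map_smul, C.counit_one, smul_eq_mul, mul_one] at h3
  rw [← hc, h3]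

omit [PerfectField k] [CharP k p] [Fact p.Prime] in
lemma proj_eq_of_isUngraded (hC : C.IsUngraded) (x : C.carrier) : C.toGrAlg.proj 0 x = x := by
  have : C.toGrAlg.proj 0 = LinearMap.id := by
    refine C.toGrAlg.hom_ext_homogeneous fun n a ha => ?_
    by_cases hn : n = 0
    · subst hn; rw [C.toGrAlg.proj_of_mem ha]; rfl
    · rw [hC n hn, Submodule.mem_bot] at ha; simp [ha]
  rw [this]; rfl

omit [PerfectField k] [CharP k p] [Fact p.Prime] in
lemma comul_one_tmul {K : Type*} [Field K] [Algebra k K] (P Q : K ⊗[k] C.carrier →ₗ[K] K)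
    (x : C.carrier) : LinearMap.mul' K K (TensorProduct.map P Q (Coalgebra.comul
      ((1 : K) ⊗ₜ[k] x))) = LinearMap.mul' k K (TensorProduct.map
        (P.restrictScalars k ∘ₗ TensorProduct.mk k K C.carrier 1)
        (Q.restrictScalars k ∘ₗ TensorProduct.mk k K C.carrier 1) (Coalgebra.comul x)) := by
  rw [TensorProduct.comul_tmul]
  generalize (Coalgebra.comul x : C.carrier ⊗[k] C.carrier) = z
  induction z with
  | zero => simp
  | add y z hy hz => rw [TensorProduct.tmul_add, map_add, map_add, map_add, hy, hz, map_add, map_add]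
  | tmul a b => simp

lemma commute_map_proj_zero (R : GrAlg k) {B : Type*} [CommRing B] [Algebra k B]
    (x y : R.carrier ⊗[k] B) : Commute (TensorProduct.map (R.proj 0) LinearMap.id x)
      (TensorProduct.map (R.proj 0) LinearMap.id y) := by
  induction x with
  | zero => rw [map_zero]; exact Commute.zero_left _
  | add x x' hx hx' => rw [map_add]; exact hx.add_left hx'
  | tmul r b =>
    induction y with
    | zero => rw [map_zero]; exact Commute.zero_right _
    | add y y' hy hy' => rw [map_add]; exact hy.add_right hy'
    | tmul s c =>
      rw [TensorProduct.map_tmul, TensorProduct.map_tmul, commute_iff_eq,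
        Algebra.TensorProduct.tmul_mul_tmul, Algebra.TensorProduct.tmul_mul_tmul,
        R.comm_of_mem (R.proj_mem 0 r) (R.proj_mem 0 s), mul_comm (LinearMap.id b)]
      simp

/-- The difference t of two commuting idempotents satisfies t³ = t, so it is nilpotent only if it is
zero. -/
lemma eq_of_isIdempotent_of_isNilpotent {A : Type*} [Ring A] {a b : A} (ha : a * a = a)
    (hb : b * b = b) (h : Commute a b) (hn : IsNilpotent (a - b)) : a = b := by
  rw [← sub_eq_zero]
  have h3 : (a - b) ^ 3 = a - b := by
    have h1 : (a - b) ^ 3 = a * a * a - a * (a * b) - a * (b * a) + a * (b * b) - b * a * a +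
      b * (a * b) + b * b * a - b * b * b := by noncomm_ring
    have e1 : b * a = a * b := h.eq.symm
    have e2 : a * (a * b) = a * b := by rw [← mul_assoc, ha]
    have e3 : b * (a * b) = a * b := by rw [← mul_assoc, e1, mul_assoc, hb]
    rw [h1, ha, hb, e1, e2, e3, mul_assoc a b a, e1, e2, ha, hb]
    abel
  have h4 : ∀ n : ℕ, (a - b) ^ (3 ^ n) = a - b := by
    intro n
    induction n with
    | zero => simp
    | succ n ih => rw [pow_succ, pow_mul, ih, h3]
  obtain ⟨n, hn⟩ := hn
  rw [← h4 n]
  exact pow_eq_zero_of_le (Nat.lt_pow_self (by norm_num)).le hn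

/-- Ungraded Hopf algebras of multiplicative type only see the perfect parts of algebras. -/
theorem IsMultiplicative.redFixed (hC : C.IsUngraded) (hm : C.IsMultiplicative) {R : FinGrAlg k}
    (f : DualCoalgHom R C) : f.RedFixed p := by
  obtain ⟨K, _, _, _, Γ, _, e, -, -⟩ := hm
  -- The coefficient at a group element is idempotent for convolution. Pulled back to `C`, it turns
  -- every point of `C` into an idempotent of R ⊗ K.
  let c : Γ → MonoidAlgebra K Γ →ₗ[K] K := fun g =>
    Finsupp.lapply g ∘ₗ (MonoidAlgebra.coeffLinearEquiv K).toLinearMap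
  have hcP : ∀ g z, LinearMap.mul' K K (TensorProduct.map (c g) (c g) (Coalgebra.comul z)) = c g z := by
    intro g z
    induction z using MonoidAlgebra.induction_linear with
    | zero => simp
    | add y z hy hz => rw [map_add, map_add, map_add, hy, hz, map_add]
    | single h r =>
      classical
      have e1 : ∀ r, c g (MonoidAlgebra.single h r) = if h = g then r else 0 := fun r =>
        Finsupp.single_apply
      have e2 : ∀ r, c g (MonoidAlgebra.lsingle (R := K) h r) = if h = g then r else 0 := e1
      rw [MonoidAlgebra.comul_single, CommSemiring.comul_apply, TensorProduct.map_tmul,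
        TensorProduct.map_tmul, LinearMap.mul'_apply, e2, e2, e1]
      split_ifs <;> simp
  let P : Γ → K ⊗[k] C.carrier →ₗ[K] K := fun g => c g ∘ₗ e.toCoalgHom.toLinearMap
  have hP : ∀ g z, LinearMap.mul' K K (TensorProduct.map (P g) (P g) (Coalgebra.comul z)) = P g z := by
    intro g z
    rw [TensorProduct.map_comp, LinearMap.comp_apply]
    have := LinearMap.congr_fun e.toCoalgHom.map_comp_comul z
    simp only [LinearMap.comp_apply] at this
    rw [this, hcP]
    rfl
  let q : Γ → C.carrier →ₗ[k] K := fun g =>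
    (P g).restrictScalars k ∘ₗ TensorProduct.mk k K C.carrier 1
  have hq : ∀ g, LinearMap.mul' k K ∘ₗ TensorProduct.map (q g) (q g) ∘ₗ Coalgebra.comul = q g :=
    fun g => LinearMap.ext fun x => (comul_one_tmul (P g) (P g) x).symm.trans (hP g _)
  have idem : ∀ g (f : DualCoalgHom R C), elem (q g ∘ₗ f.toLin) * elem (q g ∘ₗ f.toLin) =
      elem (q g ∘ₗ f.toLin) := fun g f => by
    rw [← elem_dconv, ← f.comp_dconv, hq]
  have hproj : ∀ f : DualCoalgHom R C, f.toLin ∘ₗ (R.obj.proj 0).dualMap = f.toLin := fun f =>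
    LinearMap.ext fun ξ => by
      rw [LinearMap.comp_apply, ← proj_eq_of_isUngraded hC (f.toLin ξ), f.proj_apply]; rfl
  have hproj' : ∀ g (f : DualCoalgHom R C), TensorProduct.map (R.obj.proj 0) LinearMap.id
      (elem (q g ∘ₗ f.toLin)) = elem (q g ∘ₗ f.toLin) := fun g f => by
    rw [← elem_comp_dualMap, LinearMap.comp_assoc, hproj]
  have hred : ∀ g, TensorProduct.map (R.obj.red p).toAlgHom.toLinearMap LinearMap.id
      (elem (q g ∘ₗ f.toLin)) = elem (q g ∘ₗ (f.map (R.red p)).toLin) := fun g => by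
    rw [← elem_comp_dualMap]; rfl
  have hredred : (f.map (R.red p)).map (R.red p) = f.map (R.red p) := by
    refine DualCoalgHom.ext (LinearMap.ext fun ξ => ?_)
    rw [DualCoalgHom.map_apply, DualCoalgHom.map_apply, DualCoalgHom.map_apply]
    congr 1
    ext a
    exact congrArg ξ (congrArg (fun t : R.obj ⟶ R.obj => t.toAlgHom a) (R.obj.red_red p))
  -- Applying red to either idempotent gives the same element, so their difference is nilpotent;
  -- they commute because `C` only involves the degree zero part of `R`.
  have heq : ∀ g, elem (q g ∘ₗ f.toLin) = elem (q g ∘ₗ (f.map (R.red p)).toLin) := by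
    intro g
    refine eq_of_isIdempotent_of_isNilpotent (idem g f) (idem g _) ?_
      (isNilpotent_of_map_red p R.obj ?_)
    · rw [← hproj' g f, ← hproj' g (f.map (R.red p))]
      exact commute_map_proj_zero _ _ _
    · have : q g ∘ₗ ((f.map (R.red p)).toLin ∘ₗ (R.obj.red p).toAlgHom.toLinearMap.dualMap) =
        q g ∘ₗ (f.map (R.red p)).toLin := congrArg (q g ∘ₗ ·) (congrArg DualCoalgHom.toLin hredred)
      rw [map_sub, hred, ← elem_comp_dualMap, sub_eq_zero]
      exact congrArg elem this.symm
  refine DualCoalgHom.ext (LinearMap.ext fun ξ => ?_)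
  have h1 : ∀ g, q g ((f.map (R.red p)).toLin ξ) = q g (f.toLin ξ) := fun g =>
    (LinearMap.congr_fun (elem_injective (heq g)) ξ).symm
  have h2 : e ((1 : K) ⊗ₜ[k] (f.map (R.red p)).toLin ξ) = e ((1 : K) ⊗ₜ[k] f.toLin ξ) :=
    MonoidAlgebra.coeff_injective (Finsupp.ext h1)
  have h3 := e.injective h2
  exact Module.FaithfullyFlat.tensorProduct_mk_injective (A := k) (B := K) C.carrier h3

end GrHopf

end

/-! ### Grouplike elements from points over an algebraic closure -/

noncomputable section

open GrAlg

section Points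

variable {K : Type*} [Field K] [IsAlgClosed K]

/-- Residue fields of a finite algebra over an algebraically closed field are the field itself, so
every prime ideal is the kernel of a point. -/
lemma isNilpotent_of_forall_algHom {A : Type*} [CommRing A] [Algebra K A] [Module.Finite K A] {w : A}
    (h : ∀ φ : A →ₐ[K] K, φ w = 0) : IsNilpotent w := by
  rw [← mem_nilradical, nilradical_eq_sInf, Submodule.mem_sInf]
  intro (P : Ideal A) (hP : P.IsPrime)
  let e : K ≃ₐ[K] A ⧸ P := AlgEquiv.ofBijective (Algebra.ofId K (A ⧸ P))
    IsAlgClosed.algebraMap_bijective_of_isIntegral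
  have := h (e.symm.toAlgHom.comp (Ideal.Quotient.mkₐ K P))
  rw [← Ideal.Quotient.eq_zero_iff_mem]
  exact (map_eq_zero_iff e.symm e.symm.injective).1 this

variable {k : Type*} [Field k] (p : ℕ) [Fact p.Prime] [CharP k p] [PerfectField k] [Algebra k K]

/-- Functionals which only depend on the perfect part are combinations of points. -/
lemma mem_span_algHom {A : Type*} [CommRing A] [Algebra k A] [Module.Finite k A]
    (θ : A →ₗ[k] K) (hθ : θ ∘ₗ (perfectProj k p A).toLinearMap = θ) :
    θ ∈ Submodule.span K (Set.range (AlgHom.toLinearMap : (A →ₐ[k] K) → A →ₗ[k] K)) := by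
  haveI : CharP K p := charP_of_injective_algebraMap (algebraMap k K).injective p
  by_contra hn
  -- If θ were not a combination of points, some `Λ` would vanish on all points but not on θ.
  -- Precomposing with the perfect projection, `Λ` becomes the element `w` of the perfect part of K
  -- ⊗ A; every point kills `w`, so it is nilpotent, hence zero, which contradicts `Λ θ ≠ 0`.
  obtain ⟨Λ, h1, h2⟩ := Submodule.exists_le_ker_of_notMem hn
  let b := Module.finBasis k A
  let E : Fin _ → A →ₗ[k] K := fun i => Algebra.linearMap k K ∘ₗ b.coord i
  have hE : ∀ φ : A →ₗ[k] K, φ = ∑ i, φ (b i) • E i := fun φ => b.ext fun j => by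
    simp only [E, LinearMap.sum_apply, LinearMap.smul_apply, LinearMap.comp_apply,
      Module.Basis.coord_apply, Module.Basis.repr_self]
    rw [Finset.sum_eq_single j]
    · simp
    · intro i _ hij
      rw [Finsupp.single_eq_of_ne hij]
      simp
    · simp
  let w : K ⊗[k] A := ∑ i, Λ (E i) ⊗ₜ perfectProj k p A (b i)
  have hw : ∀ φ : A →ₗ[k] K, LinearMap.mul' k K (TensorProduct.map LinearMap.id φ w) =
      Λ (φ ∘ₗ (perfectProj k p A).toLinearMap) := fun φ => by
    conv_rhs => rw [hE (φ ∘ₗ _)]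
    simp only [w, map_sum, TensorProduct.map_tmul, LinearMap.mul'_apply, map_smul, smul_eq_mul,
      LinearMap.id_apply, LinearMap.comp_apply]
    exact Finset.sum_congr rfl fun i _ => mul_comm _ _
  have hmem : w ∈ perfectPart K p (K ⊗[k] A) := by
    refine Subalgebra.sum_mem _ fun i _ => ?_
    have : Λ (E i) ⊗ₜ[k] perfectProj k p A (b i) =
        Λ (E i) • ((1 : K) ⊗ₜ[k] perfectProj k p A (b i)) := by
      rw [TensorProduct.smul_tmul', smul_eq_mul, mul_one]
    rw [this]
    refine Subalgebra.smul_mem _ ?_ _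
    exact map_mem_perfectPart (k := k) p (Algebra.TensorProduct.includeRight : A →ₐ[k] K ⊗[k] A)
      (perfectProj_mem p (b i))
  have hnil : IsNilpotent w := by
    refine isNilpotent_of_forall_algHom (K := K) fun ψ => ?_
    let χ : A →ₐ[k] K := (ψ.restrictScalars k).comp Algebra.TensorProduct.includeRight
    have h3 : (ψ.restrictScalars k).toLinearMap =
        LinearMap.mul' k K ∘ₗ TensorProduct.map LinearMap.id χ.toLinearMap :=
      TensorProduct.ext' fun c a => by
        have : c ⊗ₜ[k] a = c • ((1 : K) ⊗ₜ[k] a) := by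
          rw [TensorProduct.smul_tmul', smul_eq_mul, mul_one]
        simp only [AlgHom.toLinearMap_apply, AlgHom.restrictScalars_apply, LinearMap.comp_apply,
          TensorProduct.map_tmul, LinearMap.mul'_apply]
        rw [this, map_smul]
        rfl
    have h4 := LinearMap.congr_fun h3 w
    refine h4.trans ((hw _).trans ?_)
    exact h2 (Submodule.subset_span ⟨χ.comp (perfectProj k p A), rfl⟩)
  have h0 := eq_zero_of_mem_perfectPart (k := K) p hmem hnil
  have h5 := hw θ
  rw [h0, map_zero, map_zero, hθ] at h5
  exact h1 h5.symm

end Points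

section GroupAlgebra

/-- Grouplike elements are always linearly independent, so as soon as they span, the map from their
group algebra is bijective. -/
lemma exists_equiv_monoidAlgebra {K A : Type u} [Field K] [CommRing A] [HopfAlgebra K A]
    (h : ⊤ ≤ Submodule.span K {a : A | IsGroupLikeElem K a}) :
    ∃ (Γ : Type u) (_ : CommGroup Γ) (e : A ≃ₗc[K] MonoidAlgebra K Γ),
      e 1 = 1 ∧ ∀ x y, e (x * y) = e x * e y := by
  let φ : MonoidAlgebra K (GroupLike K A) →ₐc[K] A := MonoidAlgebra.liftGroupLikeBialgHom
  have hφ : ∀ x, φ x = Finsupp.linearCombination K (GroupLike.val (R := K) (A := A))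
      (MonoidAlgebra.coeffLinearEquiv K x) := by
    intro x
    induction x using MonoidAlgebra.induction_linear with
    | zero => simp
    | add x y hx hy => rw [map_add, hx, hy, map_add, map_add]
    | single g r =>
      have : MonoidAlgebra.coeffLinearEquiv K (MonoidAlgebra.single g r) = Finsupp.single g r := rfl
      rw [this, Finsupp.linearCombination_single]
      simp [φ, MonoidAlgebra.liftGroupLikeBialgHom]
  have hb : Function.Bijective φ := by
    constructor
    · intro x y hxy
      rw [hφ, hφ] at hxy
      exact (MonoidAlgebra.coeffLinearEquiv K).injective (linearIndep_groupLikeVal hxy)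
    · intro a
      have ha := h (Submodule.mem_top (x := a))
      have : {a : A | IsGroupLikeElem K a} = Set.range (GroupLike.val (R := K) (A := A)) := by
        ext a
        exact ⟨fun h => ⟨⟨a, h⟩, rfl⟩, by rintro ⟨g, rfl⟩; exact g.2⟩
      rw [this, Finsupp.mem_span_range_iff_exists_finsupp] at ha
      obtain ⟨c, hc⟩ := ha
      refine ⟨(MonoidAlgebra.coeffLinearEquiv K).symm c, ?_⟩
      rw [hφ, LinearEquiv.apply_symm_apply]
      exact hc
  let E := BialgEquiv.ofBijective φ hb
  exact ⟨GroupLike K A, inferInstance, E.symm.toCoalgEquiv, map_one E.symm, map_mul E.symm⟩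

end GroupAlgebra

namespace GrHopf

variable {k : Type u} [Field k] {C : GrHopf k}

lemma one_mem_ungraded (hC : C.IsUngraded) (x : C.carrier) : x ∈ C.grading 0 := by
  rw [← proj_eq_of_isUngraded hC x]
  exact C.toGrAlg.proj_mem 0 x

/-- The commutative ring underlying an ungraded Hopf algebra. -/
abbrev commRing (hC : C.IsUngraded) : CommRing C.carrier :=
  { C.ring with
    mul_comm := fun a b => by
      have := C.graded_comm 0 0 a b (one_mem_ungraded hC a) (one_mem_ungraded hC b)
      simpa using this }

/-- An ungraded Hopf algebra as an ordinary Hopf algebra. -/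
abbrev hopfAlgebra (hC : C.IsUngraded) : @HopfAlgebra k C.carrier _ (commRing hC).toCommSemiring.toSemiring :=
  letI := commRing hC
  letI : Bialgebra k C.carrier := Bialgebra.mk' k C.carrier C.counit_one (C.counit_mul _ _)
    C.comul_one (by
      intro a b
      have h := C.comul_mul a b
      apply (GradedTensorProduct.of k C.grading C.grading).injective
      rw [h]
      generalize (Coalgebra.comul a : C.carrier ⊗[k] C.carrier) = x
      generalize (Coalgebra.comul b : C.carrier ⊗[k] C.carrier) = y
      induction x with
      | zero => simp
      | add x x' hx hx' => rw [map_add, add_mul, add_mul, map_add, hx, hx']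
      | tmul a b =>
        induction y with
        | zero => simp
        | add y y' hy hy' => rw [map_add, mul_add, mul_add, map_add, hy, hy']
        | tmul c d =>
          rw [Algebra.TensorProduct.tmul_mul_tmul]
          have := gradedTensor_mul C.toGrAlg C.toGrAlg a d (one_mem_ungraded hC b)
            (one_mem_ungraded hC c)
          simpa using this)
  { antipode := C.antipode
    mul_antipode_rTensor_comul := LinearMap.ext fun x => C.mul_antipode_left x
    mul_antipode_lTensor_comul := LinearMap.ext fun x => C.mul_antipode_right x }

lemma isMultiplicative_of_span (hC : C.IsUngraded) (K : Type u) [Field K] [Algebra k K]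
    [Algebra.IsAlgebraic k K]
    (h : ⊤ ≤ Submodule.span K {a : K ⊗[k] C.carrier | IsGroupLikeElem K a}) : C.IsMultiplicative := by
  letI := commRing hC
  letI := hopfAlgebra hC
  obtain ⟨Γ, i, e, h1, h2⟩ := exists_equiv_monoidAlgebra (K := K) (A := K ⊗[k] C.carrier) h
  exact ⟨K, inferInstance, inferInstance, inferInstance, Γ, i, e, h1, h2⟩

end GrHopf

namespace DualCoalgHom

variable {k : Type u} [Field k] {R : FinGrAlg k} {C : GrHopf k}

/-- An algebra homomorphism χ : R → K is a grouplike element of K ⊗ R^∨, and this is its image under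
the scalar extension of `f`. -/
lemma isGroupLikeElem {K : Type*} [Field K] [Algebra k K] (f : DualCoalgHom R C)
    (χ : R.obj.carrier →ₐ[k] K) :
    IsGroupLikeElem K (TensorProduct.map χ.toLinearMap LinearMap.id (elem f.toLin)) := by
  let b := Module.finBasis k R.obj.carrier
  have hγ : TensorProduct.map χ.toLinearMap LinearMap.id (elem f.toLin) =
      ∑ i, χ (b i) ⊗ₜ[k] f.toLin (b.coord i) := by
    simp only [elem, map_sum, TensorProduct.map_tmul, AlgHom.toLinearMap_apply,
      LinearMap.id_apply]
    rfl
  have hd : ∀ i, dualComul R.obj.carrier (b.coord i) =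
      ∑ j, ∑ l, b.coord i (b j * b l) • (b.coord j ⊗ₜ[k] b.coord l) := by
    intro i
    refine (eq_dualComul _ _ fun x y => ?_).symm
    have : ∀ x, x = ∑ j, b.coord j x • b j := fun x => (b.sum_repr x).symm
    conv_rhs => rw [this x, this y]
    simp only [map_sum, map_smul, TensorProduct.map_tmul, LinearMap.mul'_apply, Finset.sum_mul,
      Finset.mul_sum, smul_mul_smul_comm, smul_eq_mul]
    rw [Finset.sum_comm]
    refine Finset.sum_congr rfl fun j _ => Finset.sum_congr rfl fun l _ => ?_
    simp [Module.Dual.eval_apply]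
    ring
  rw [hγ]
  constructor
  · have : ∑ i, b.coord i 1 • b i = 1 := b.sum_repr 1
    rw [← map_one χ, ← this]
    simp only [map_sum, TensorProduct.counit_tmul, f.counit_apply, CommSemiring.counit_apply,
      map_smul]
  · let T := TensorProduct.AlgebraTensorModule.tensorTensorTensorComm k K k K K K C.carrier C.carrier
    have h1 : ∀ (c : K) (x : C.carrier), Coalgebra.comul (R := K) (c ⊗ₜ[k] x) =
      T ((1 ⊗ₜ c) ⊗ₜ (Coalgebra.comul x)) := fun c x => rfl
    have h2 : ∀ (c : K) (x y : C.carrier), T ((1 ⊗ₜ c) ⊗ₜ (x ⊗ₜ y)) = (1 ⊗ₜ x) ⊗ₜ (c ⊗ₜ y) :=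
      fun c x y => rfl
    have h3 : ∀ j l, ∑ i, b.coord i (b j * b l) • χ (b i) = χ (b j) * χ (b l) := fun j l => by
      rw [← map_mul χ]
      conv_rhs => rw [← b.sum_repr (b j * b l)]
      simp only [map_sum, map_smul]
      rfl
    have h4 : ∀ (r : k) (c : K) (z : C.carrier ⊗[k] C.carrier),
        ((1 : K) ⊗ₜ[K] c) ⊗ₜ[k] (r • z) = ((1 : K) ⊗ₜ[K] (r • c)) ⊗ₜ[k] z := fun r c z => by
      rw [TensorProduct.tmul_smul, TensorProduct.smul_tmul', TensorProduct.tmul_smul]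
    have h5 : ∀ (c d : K) (x y : C.carrier), ((1 : K) ⊗ₜ[k] x) ⊗ₜ[K] ((c * d) ⊗ₜ[k] y) =
        (c ⊗ₜ[k] x) ⊗ₜ[K] (d ⊗ₜ[k] y) := fun c d x y => by
      rw [← smul_eq_mul, ← TensorProduct.smul_tmul', TensorProduct.tmul_smul,
        TensorProduct.smul_tmul', TensorProduct.smul_tmul', smul_eq_mul, mul_one]
    simp only [map_sum, h1, f.comul_apply, hd, map_smul, TensorProduct.map_tmul,
      TensorProduct.tmul_sum, h4, h2]
    rw [Finset.sum_comm]
    simp only [TensorProduct.sum_tmul (R := K)]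
    conv_rhs => rw [Finset.sum_comm]
    refine Finset.sum_congr rfl fun j _ => ?_
    rw [Finset.sum_comm]
    refine Finset.sum_congr rfl fun l _ => ?_
    rw [← TensorProduct.tmul_sum, ← TensorProduct.sum_tmul, h3, h5]

variable (p : ℕ) [Fact p.Prime] [CharP k p] [PerfectField k]

/-- As `f` only sees the perfect part, `ξ` may be replaced by its composite with red. That composite
is a `K`-combination of points of the degree zero part, and each point yields a grouplike element.
-/
lemma one_tmul_mem_span {K : Type*} [Field K] [IsAlgClosed K] [Algebra k K] {f : DualCoalgHom R C}
    (hf : f.RedFixed p) (ξ : Module.Dual k R.obj.carrier) : (1 : K) ⊗ₜ[k] f.toLin ξ ∈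
      Submodule.span K {a : K ⊗[k] C.carrier | IsGroupLikeElem K a} := by
  let A := R.obj.zeroPart
  haveI : Module.Finite k A := (inferInstance : Module.Finite k (Subalgebra.toSubmodule A))
  let θ : A →ₗ[k] K := Algebra.linearMap k K ∘ₗ ξ ∘ₗ A.val.toLinearMap ∘ₗ
    (perfectProj k p A).toLinearMap
  have hθ := mem_span_algHom p θ (by
    refine LinearMap.ext fun a => ?_
    simp only [θ, LinearMap.comp_apply, AlgHom.toLinearMap_apply]
    rw [perfectProj_of_mem p (perfectProj_mem p a)])
  let Φ : (A →ₗ[k] K) →ₗ[K] K ⊗[k] C.carrier :=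
    { toFun φ := TensorProduct.map (φ ∘ₗ R.obj.toZeroPart.toLinearMap) LinearMap.id (elem f.toLin)
      map_add' φ ψ := by rw [LinearMap.add_comp, TensorProduct.map_add_left, LinearMap.add_apply]
      map_smul' c φ := by
        rw [elem]
        simp only [map_sum, TensorProduct.map_tmul, Finset.smul_sum, LinearMap.comp_apply,
          LinearMap.smul_apply, TensorProduct.smul_tmul', RingHom.id_apply] }
  have h1 : (1 : K) ⊗ₜ[k] f.toLin ξ = Φ θ := by
    have h2 : (R.obj.red p).toAlgHom.toLinearMap.dualMap ξ =
        ∑ i, (ξ ((R.obj.red p).toAlgHom (Module.finBasis k R.obj.carrier i))) •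
          (Module.finBasis k R.obj.carrier).coord i :=
      ((Module.finBasis k R.obj.carrier).sum_dual_apply_smul_coord _).symm
    have h3 : f.toLin ξ = f.toLin ((R.obj.red p).toAlgHom.toLinearMap.dualMap ξ) :=
      (congrArg (fun g : DualCoalgHom R C => g.toLin ξ) hf).symm
    rw [h3, h2]
    change _ = TensorProduct.map (θ ∘ₗ R.obj.toZeroPart.toLinearMap) LinearMap.id (elem f.toLin)
    simp only [elem, map_sum, map_smul, TensorProduct.map_tmul, TensorProduct.tmul_sum,
      TensorProduct.tmul_smul, TensorProduct.smul_tmul']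
    refine Finset.sum_congr rfl fun i _ => ?_
    rw [← Algebra.algebraMap_eq_smul_one]
    rfl
  rw [h1]
  have h2 := Submodule.apply_mem_span_image_of_mem_span Φ hθ
  refine Submodule.span_mono ?_ h2
  rintro _ ⟨_, ⟨χ, rfl⟩, rfl⟩
  exact f.isGroupLikeElem (χ.comp R.obj.toZeroPart)

end DualCoalgHom

namespace GrHopf

variable {k : Type u} [Field k] {C : GrHopf k} (p : ℕ) [Fact p.Prime] [CharP k p] [PerfectField k]

/-- The image of red lies in degree zero, so a homomorphism fixed by red has no values in other
degrees. -/
theorem isUngraded_of_redFixed (h : ∀ (R : FinGrAlg k) (f : DualCoalgHom R C), f.RedFixed p) :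
    C.IsUngraded := by
  intro n hn
  rw [eq_bot_iff]
  intro x hx
  obtain ⟨R, f, -, ξ, rfl⟩ := exists_dualCoalgHom x
  have h1 := h R f
  rw [← C.toGrAlg.proj_of_mem hx, ← h1, DualCoalgHom.proj_apply, DualCoalgHom.map_apply]
  have : (ξ ∘ₗ R.obj.proj n) ∘ₗ (R.red p).hom.toAlgHom.toLinearMap = 0 := by
    refine LinearMap.ext fun a => ?_
    have h2 : R.obj.proj n ((R.obj.red p).toAlgHom a) = 0 :=
      R.obj.proj_of_mem_ne (R.obj.red_mem p a) hn
    exact (congrArg ξ h2).trans (map_zero ξ)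
  rw [this, map_zero]
  exact Submodule.zero_mem _

theorem isMultiplicative_of_redFixed
    (h : ∀ (R : FinGrAlg k) (f : DualCoalgHom R C), f.RedFixed p) : C.IsMultiplicative := by
  refine isMultiplicative_of_span (isUngraded_of_redFixed p h) (AlgebraicClosure k) ?_
  rintro z -
  induction z with
  | zero => exact Submodule.zero_mem _
  | add x y hx hy => exact Submodule.add_mem _ hx hy
  | tmul c x =>
    obtain ⟨R, f, -, ξ, rfl⟩ := exists_dualCoalgHom x
    have := Submodule.smul_mem _ c (DualCoalgHom.one_tmul_mem_span p (K := AlgebraicClosure k) (h R f) ξ)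
    rwa [TensorProduct.smul_tmul', smul_eq_mul, mul_one] at this

end GrHopf

end

/-! ### Duals of tensor products and Koszul signs -/

noncomputable section

open GrAlg

section ExternalProduct

variable {k : Type u} [Field k]

lemma dualComul_eq_sum {R : Type u} [Ring R] [Algebra k R] [Module.Finite k R] {ι : Type*} [Fintype ι]
    (b : Module.Basis ι k R) (ξ : Module.Dual k R) :
    dualComul R ξ = ∑ i, ∑ j, ξ (b i * b j) • (b.coord i ⊗ₜ[k] b.coord j) := by
  refine (eq_dualComul _ _ fun x y => ?_).symm
  have : ∀ x, x = ∑ j, b.coord j x • b j := fun x => (b.sum_repr x).symm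
  conv_rhs => rw [this x, this y]
  simp only [map_sum, map_smul, TensorProduct.map_tmul, LinearMap.mul'_apply, Finset.sum_mul,
    Finset.mul_sum, smul_mul_smul_comm, smul_eq_mul]
  rw [Finset.sum_comm]
  refine Finset.sum_congr rfl fun j _ => Finset.sum_congr rfl fun l _ => ?_
  simp [Module.Dual.eval_apply]
  ring

lemma GrAlg.exists_basis_homogeneous (A : GrAlg k) [Module.Finite k A.carrier] :
    ∃ (ι : Type u) (_ : Fintype ι) (b : Module.Basis ι k A.carrier) (d : ι → ℕ),
      ∀ i, b i ∈ A.grading (d i) := by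
  classical
  let v : ∀ n, Module.Basis _ k (A.grading n) := fun n => Module.Basis.ofVectorSpace k (A.grading n)
  have h := DirectSum.Decomposition.isInternal A.grading
  exact ⟨_, FiniteDimensional.fintypeBasisIndex (h.collectedBasis v), h.collectedBasis v, fun i => i.1,
    fun i => h.collectedBasis_mem v i⟩

variable {A B : GrAlg k}

/-- The external product of functionals. -/
def extDual (ξ : Module.Dual k A.carrier) (η : Module.Dual k B.carrier) :
    Module.Dual k (tensor A B).carrier :=
  LinearMap.mul' k k ∘ₗ TensorProduct.map ξ η ∘ₗ (tmkEquiv A B).symm.toLinearMap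

lemma extDual_tmk (ξ : Module.Dual k A.carrier) (η : Module.Dual k B.carrier)
    (x : A.carrier ⊗[k] B.carrier) :
    extDual ξ η (tmk A B x) = LinearMap.mul' k k (TensorProduct.map ξ η x) :=
  congrArg (fun y => LinearMap.mul' k k (TensorProduct.map ξ η y))
    ((tmkEquiv A B).symm_apply_apply x)

lemma extDual_tmul (ξ : Module.Dual k A.carrier) (η : Module.Dual k B.carrier)
    (a : A.carrier) (b : B.carrier) : extDual ξ η (tmk A B (a ⊗ₜ b)) = ξ a * η b :=
  extDual_tmk ξ η _

lemma eq_extDual {ξ : Module.Dual k A.carrier} {η : Module.Dual k B.carrier}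
    {θ : Module.Dual k (tensor A B).carrier} (h : ∀ a b, θ (tmk A B (a ⊗ₜ b)) = ξ a * η b) :
    θ = extDual ξ η := by
  have : θ ∘ₗ tmk A B = extDual ξ η ∘ₗ tmk A B :=
    TensorProduct.ext' fun a b => (h a b).trans (extDual_tmul ξ η a b).symm
  refine LinearMap.ext fun x => ?_
  obtain ⟨x, rfl⟩ := tmk_surjective A B x
  exact LinearMap.congr_fun this x

variable (A B) in
/-- The dual of a tensor product is the tensor product of the duals. -/
def extEquiv [Module.Finite k A.carrier] [Module.Finite k B.carrier] :
    Module.Dual k A.carrier ⊗[k] Module.Dual k B.carrier ≃ₗ[k] Module.Dual k (tensor A B).carrier :=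
  (TensorProduct.dualDistribEquiv k A.carrier B.carrier).trans (tmkEquiv A B).symm.dualMap

lemma extEquiv_tmul [Module.Finite k A.carrier] [Module.Finite k B.carrier]
    (ξ : Module.Dual k A.carrier) (η : Module.Dual k B.carrier) :
    extEquiv A B (ξ ⊗ₜ η) = extDual ξ η := by
  refine eq_extDual fun a b => ?_
  change TensorProduct.dualDistribEquiv k A.carrier B.carrier (ξ ⊗ₜ η)
    ((tmkEquiv A B).symm (tmkEquiv A B (a ⊗ₜ b))) = _
  rw [LinearEquiv.symm_apply_apply]
  exact TensorProduct.dualDistrib_apply ξ η a b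

/-- The linear map out of the dual of a tensor product given by a pair of linear maps. -/
def extLin [Module.Finite k A.carrier] [Module.Finite k B.carrier] {V : Type*} [Ring V] [Algebra k V]
    (f : Module.Dual k A.carrier →ₗ[k] V) (g : Module.Dual k B.carrier →ₗ[k] V) :
    Module.Dual k (tensor A B).carrier →ₗ[k] V :=
  LinearMap.mul' k V ∘ₗ TensorProduct.map f g ∘ₗ (extEquiv A B).symm.toLinearMap

lemma extLin_extDual [Module.Finite k A.carrier] [Module.Finite k B.carrier] {V : Type*} [Ring V]
    [Algebra k V] (f : Module.Dual k A.carrier →ₗ[k] V) (g : Module.Dual k B.carrier →ₗ[k] V)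
    (ξ : Module.Dual k A.carrier) (η : Module.Dual k B.carrier) :
    extLin f g (extDual ξ η) = f ξ * g η := by
  rw [← extEquiv_tmul]
  change LinearMap.mul' k V (TensorProduct.map f g ((extEquiv A B).symm (extEquiv A B (ξ ⊗ₜ η)))) = _
  rw [LinearEquiv.symm_apply_apply]
  rfl

lemma extDual_hom_ext [Module.Finite k A.carrier] [Module.Finite k B.carrier] {V : Type*}
    [AddCommGroup V] [Module k V] {F F' : Module.Dual k (tensor A B).carrier →ₗ[k] V}
    (h : ∀ ξ η, F (extDual ξ η) = F' (extDual ξ η)) : F = F' := by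
  have : F ∘ₗ (extEquiv A B).toLinearMap = F' ∘ₗ (extEquiv A B).toLinearMap :=
    TensorProduct.ext' fun ξ η => by
      have := h ξ η
      rw [← extEquiv_tmul] at this
      exact this
  refine LinearMap.ext fun θ => ?_
  obtain ⟨z, rfl⟩ := (extEquiv A B).surjective θ
  exact LinearMap.congr_fun this z

instance [Module.Finite k A.carrier] [Module.Finite k B.carrier] :
    Module.Finite k (tensor A B).carrier := Module.Finite.equiv (tmkEquiv A B)

/-- The basis of a tensor product given by a pair of bases. -/
def tensorBasis {I J : Type*} (b : Module.Basis I k A.carrier) (c : Module.Basis J k B.carrier) :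
    Module.Basis (I × J) k (tensor A B).carrier := (b.tensorProduct c).map (tmkEquiv A B)

lemma tensorBasis_apply {I J : Type*} (b : Module.Basis I k A.carrier)
    (c : Module.Basis J k B.carrier) (x : I × J) :
    tensorBasis b c x = tmk A B (b x.1 ⊗ₜ c x.2) := by
  refine (Module.Basis.map_apply _ _ _).trans ?_
  rw [Module.Basis.tensorProduct_apply]
  rfl

lemma tensorBasis_coord {I J : Type*} (b : Module.Basis I k A.carrier)
    (c : Module.Basis J k B.carrier) (x : I × J) :
    (tensorBasis b c).coord x = extDual (b.coord x.1) (c.coord x.2) := by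
  classical
  refine (tensorBasis b c).ext fun y => ?_
  rw [Module.Basis.coord_apply, Module.Basis.repr_self, tensorBasis_apply, extDual_tmul,
    Module.Basis.coord_apply, Module.Basis.repr_self, Module.Basis.coord_apply,
    Module.Basis.repr_self, Finsupp.single_apply, Finsupp.single_apply, Finsupp.single_apply]
  by_cases h1 : y.1 = x.1 <;> by_cases h2 : y.2 = x.2 <;> simp [h1, h2, Prod.ext_iff]

lemma coord_comp_proj {I : Type*} {b : Module.Basis I k A.carrier} {d : I → ℕ}
    (hd : ∀ i, b i ∈ A.grading (d i)) (i : I) (n : ℕ) :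
    b.coord i ∘ₗ A.proj n = if d i = n then b.coord i else 0 := by
  refine b.ext fun j => ?_
  rw [LinearMap.comp_apply]
  by_cases hij : j = i
  · subst hij
    split_ifs with h
    · rw [← h, A.proj_of_mem (hd j)]
    · rw [A.proj_of_mem_ne (hd j) (Ne.symm h), map_zero, LinearMap.zero_apply]
  · have h0 : b.coord i (b j) = 0 := by
      rw [Module.Basis.coord_apply, Module.Basis.repr_self, Finsupp.single_eq_of_ne (Ne.symm hij)]
    have h1 : (if d i = n then b.coord i else 0) (b j) = 0 := by
      split_ifs
      · exact h0
      · rfl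
    rw [h1]
    by_cases h : d j = n
    · rw [← h, A.proj_of_mem (hd j), h0]
    · rw [A.proj_of_mem_ne (hd j) (Ne.symm h), map_zero]

/-- Preservation of degrees can be tested on the dual basis of a homogeneous basis. -/
lemma proj_comp_iff_coord {I : Type*} [Fintype I] {b : Module.Basis I k A.carrier} {d : I → ℕ}
    (hd : ∀ i, b i ∈ A.grading (d i)) {C : GrAlg k} {f : Module.Dual k A.carrier →ₗ[k] C.carrier} :
    (∀ n ξ, C.proj n (f ξ) = f (ξ ∘ₗ A.proj n)) ↔ ∀ i, f (b.coord i) ∈ C.grading (d i) := by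
  refine ⟨fun h i => ?_, fun h n ξ => ?_⟩
  · rw [C.mem_iff_proj, h, coord_comp_proj hd, if_pos rfl]
  · classical
    suffices C.proj n ∘ₗ f = f ∘ₗ (A.proj n).dualMap from LinearMap.congr_fun this ξ
    refine b.dualBasis.ext fun i => ?_
    rw [Module.Basis.coe_dualBasis, LinearMap.comp_apply, LinearMap.comp_apply,
      LinearMap.dualMap_apply', coord_comp_proj hd]
    split_ifs with hn
    · rw [← hn, C.proj_of_mem (h i)]
    · rw [C.proj_of_mem_ne (h i) (Ne.symm hn), map_zero]

lemma tensorBasis_mem {I J : Type*} {b : Module.Basis I k A.carrier} {d : I → ℕ}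
    (hd : ∀ i, b i ∈ A.grading (d i)) {c : Module.Basis J k B.carrier} {d' : J → ℕ}
    (hd' : ∀ i, c i ∈ B.grading (d' i)) (x : I × J) :
    tensorBasis b c x ∈ (tensor A B).grading (d x.1 + d' x.2) := by
  rw [tensorBasis_apply]
  exact tmk_tmul_mem A B (hd x.1) (hd' x.2)

lemma proj_comp_of_extDual [Module.Finite k A.carrier] [Module.Finite k B.carrier] {C : GrAlg k}
    {f : Module.Dual k A.carrier →ₗ[k] C.carrier} {g : Module.Dual k B.carrier →ₗ[k] C.carrier}
    (hf : ∀ n ξ, C.proj n (f ξ) = f (ξ ∘ₗ A.proj n))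
    (hg : ∀ n ξ, C.proj n (g ξ) = g (ξ ∘ₗ B.proj n))
    {F : Module.Dual k (tensor A B).carrier →ₗ[k] C.carrier}
    (hF : ∀ ξ η, F (extDual ξ η) = f ξ * g η) (n : ℕ) (ξ : Module.Dual k (tensor A B).carrier) :
    C.proj n (F ξ) = F (ξ ∘ₗ (tensor A B).proj n) := by
  obtain ⟨I, _, b, d, hd⟩ := A.exists_basis_homogeneous
  obtain ⟨J, _, c, d', hd'⟩ := B.exists_basis_homogeneous
  refine (proj_comp_iff_coord (tensorBasis_mem hd hd')).2 (fun x => ?_) n ξ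
  rw [tensorBasis_coord, hF]
  exact C.mul_mem ((proj_comp_iff_coord hd).1 hf _) ((proj_comp_iff_coord hd').1 hg _)

/-- Expand in homogeneous bases. The Koszul sign from multiplying in A ⊗ B on the left is the sign
from multiplying in C ⊗ C on the right, since both come from moving the second basis vector of one
pair past the first of the other. -/
lemma tmk_map_dualComul_extDual [Module.Finite k A.carrier] [Module.Finite k B.carrier] {C : GrAlg k}
    {f : Module.Dual k A.carrier →ₗ[k] C.carrier} {g : Module.Dual k B.carrier →ₗ[k] C.carrier}
    (hf : ∀ n ξ, C.proj n (f ξ) = f (ξ ∘ₗ A.proj n))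
    (hg : ∀ n ξ, C.proj n (g ξ) = g (ξ ∘ₗ B.proj n))
    {F : Module.Dual k (tensor A B).carrier →ₗ[k] C.carrier}
    (hF : ∀ ξ η, F (extDual ξ η) = f ξ * g η)
    (ξ : Module.Dual k A.carrier) (η : Module.Dual k B.carrier) :
    tmk C C (TensorProduct.map F F (dualComul (tensor A B).carrier (extDual ξ η))) =
      tmk C C (TensorProduct.map f f (dualComul A.carrier ξ)) *
        tmk C C (TensorProduct.map g g (dualComul B.carrier η)) := by
  obtain ⟨I, _, b, d, hd⟩ := A.exists_basis_homogeneous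
  obtain ⟨J, _, c, d', hd'⟩ := B.exists_basis_homogeneous
  rw [dualComul_eq_sum (tensorBasis b c), dualComul_eq_sum b, dualComul_eq_sum c]
  have key : ∀ x y : I × J, extDual ξ η (tensorBasis b c x * tensorBasis b c y) = (-1 : k) ^ (d' x.2 * d y.1) *
      (ξ (b x.1 * b y.1) * η (c x.2 * c y.2)) := fun x y => by
    have h1 : tensorBasis b c x * tensorBasis b c y = (-1 : k) ^ (d' x.2 * d y.1) •
        tmk A B ((b x.1 * b y.1) ⊗ₜ (c x.2 * c y.2)) := by
      rw [tensorBasis_apply, tensorBasis_apply]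
      exact tmk_mul A B _ _ (hd' x.2) (hd y.1)
    rw [h1, map_smul, smul_eq_mul]
    congr 1
    exact extDual_tmul _ _ _ _
  have key2 : ∀ x y : I × J, tmk C C (f (b.coord x.1) ⊗ₜ f (b.coord y.1)) *
      tmk C C (g (c.coord x.2) ⊗ₜ g (c.coord y.2)) = (-1 : k) ^ (d y.1 * d' x.2) •
        tmk C C ((f (b.coord x.1) * g (c.coord x.2)) ⊗ₜ (f (b.coord y.1) * g (c.coord y.2))) :=
    fun x y => tmk_mul C C _ _ ((proj_comp_iff_coord hd).1 hf y.1)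
      ((proj_comp_iff_coord hd').1 hg x.2)
  simp only [map_sum, map_smul, TensorProduct.map_tmul, tensorBasis_coord, hF, key, Fintype.sum_prod_type,
    Finset.sum_mul, Finset.mul_sum, smul_mul_smul_comm]
  rw [Finset.sum_comm (s := (Finset.univ : Finset I)) (t := (Finset.univ : Finset J))]
  refine Finset.sum_congr (M := (tensor C C).carrier) rfl fun j _ => ?_
  conv_rhs => rw [Finset.sum_comm (s := (Finset.univ : Finset J)) (t := (Finset.univ : Finset I))]
  refine Finset.sum_congr (M := (tensor C C).carrier) rfl fun i _ => ?_
  conv_rhs => rw [Finset.sum_comm (s := (Finset.univ : Finset J)) (t := (Finset.univ : Finset I))]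
  refine Finset.sum_congr (M := (tensor C C).carrier) rfl fun i' _ =>
    Finset.sum_congr (M := (tensor C C).carrier) rfl fun j' _ => ?_
  rw [key2 (i, j) (i', j'), smul_smul]
  congr 1
  ring

end ExternalProduct

end

/-! ### Operations on coalgebra homomorphisms out of duals -/

noncomputable section

open GrAlg

namespace GrHopf

variable {k : Type u} [Field k] {H H' : GrHopf k}

/-- Composition with the antipode gives a convolution left inverse of `f`, and cancelling it in f *
f = f leaves the unit. -/
lemma eq_triv_of_conv_self {B : GrAlg k} {f : H.toGrAlg ⟶ B} (hf : conv f f = f) : f = H.triv B := by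
  let F : WithConv (H.carrier →ₗ[k] B.carrier) := WithConv.toConv f.toAlgHom.toLinearMap
  let S : WithConv (H.carrier →ₗ[k] B.carrier) :=
    WithConv.toConv (f.toAlgHom.toLinearMap ∘ₗ H.antipode)
  have h1 : F * F = F := by
    refine WithConv.ofConv_injective (LinearMap.ext fun a => ?_)
    exact congrArg (fun g : H.toGrAlg ⟶ B => g.toAlgHom a) hf
  have h2 : S * F = 1 := by
    refine WithConv.ofConv_injective (LinearMap.ext fun a => ?_)
    have h3 : LinearMap.mul' k B.carrier ∘ₗ TensorProduct.map (f.toAlgHom.toLinearMap ∘ₗ H.antipode)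
        f.toAlgHom.toLinearMap = f.toAlgHom.toLinearMap ∘ₗ LinearMap.mul' k H.carrier ∘ₗ
          TensorProduct.map H.antipode LinearMap.id :=
      TensorProduct.ext' fun a b => (map_mul f.toAlgHom _ _).symm
    refine (LinearMap.congr_fun h3 (Coalgebra.comul a)).trans ?_
    refine (congrArg f.toAlgHom (H.mul_antipode_left a)).trans ?_
    exact f.toAlgHom.commutes _
  have h4 : F = 1 := by
    calc F = (S * F) * F := by rw [h2, one_mul]
      _ = 1 := by rw [mul_assoc, h1, h2]
  exact hom_ext' fun a => LinearMap.congr_fun (congrArg WithConv.ofConv h4) a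

/-- The composite is idempotent for convolution, hence trivial. So morphisms compatible with
coproducts need no separate condition on counits. -/
lemma IsComulHom.comp_triv {h : H.toGrAlg ⟶ H'.toGrAlg} (hh : IsComulHom h) (B : GrAlg k) :
    h ≫ H'.triv B = H.triv B :=
  eq_triv_of_conv_self (by rw [← hh.comp_conv, conv_triv])

lemma IsComulHom.counit {h : H.toGrAlg ⟶ H'.toGrAlg} (hh : IsComulHom h) (a : H.carrier) :
    (Coalgebra.counit (h.toAlgHom a) : k) = Coalgebra.counit a :=
  congrArg (fun g : H.toGrAlg ⟶ unitAlg k => g.toAlgHom a) (hh.comp_triv (unitAlg k))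

end GrHopf

namespace DualCoalgHom

variable {k : Type u} [Field k] {R S : FinGrAlg k} {C : GrHopf k}

/-- The product of homomorphisms of coalgebras, defined on the dual of the tensor product. -/
def prod (f : DualCoalgHom R C) (g : DualCoalgHom S C) : DualCoalgHom (FinGrAlg.tensor R S) C :=
  mk' (extLin (A := R.obj) (B := S.obj) f.toLin g.toLin)
    (proj_comp_of_extDual (A := R.obj) (B := S.obj) f.proj_apply g.proj_apply
      (extLin_extDual f.toLin g.toLin))
    (fun θ => by
      let F := extLin (A := R.obj) (B := S.obj) f.toLin g.toLin
      suffices Coalgebra.comul ∘ₗ F = TensorProduct.map F F ∘ₗ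
        dualComul (tensor R.obj S.obj).carrier from LinearMap.congr_fun this θ
      refine extDual_hom_ext (A := R.obj) (B := S.obj) fun ξ η => ?_
      apply tmk_injective C.toGrAlg C.toGrAlg
      refine Eq.trans ?_ (tmk_map_dualComul_extDual (A := R.obj) (B := S.obj) f.proj_apply
        g.proj_apply (F := F) (extLin_extDual f.toLin g.toLin) ξ η).symm
      have h1 : F (extDual ξ η) = f.toLin ξ * g.toLin η := extLin_extDual f.toLin g.toLin ξ η
      rw [LinearMap.comp_apply, h1, ← f.comul_apply, ← g.comul_apply]
      exact C.comul_mul _ _)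
    (fun θ => by
      let F := extLin (A := R.obj) (B := S.obj) f.toLin g.toLin
      suffices Coalgebra.counit ∘ₗ F = LinearMap.applyₗ (1 : (tensor R.obj S.obj).carrier) from
        LinearMap.congr_fun this θ
      refine extDual_hom_ext (A := R.obj) (B := S.obj) fun ξ η => ?_
      have h1 : F (extDual ξ η) = f.toLin ξ * g.toLin η := extLin_extDual f.toLin g.toLin ξ η
      rw [LinearMap.comp_apply, h1, C.counit_mul, f.counit_apply, g.counit_apply,
        LinearMap.applyₗ_apply_apply, ← tmk_one, extDual_tmul])

lemma prod_extDual (f : DualCoalgHom R C) (g : DualCoalgHom S C) (ξ : Module.Dual k R.obj.carrier)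
    (η : Module.Dual k S.obj.carrier) : (f.prod g).toLin (extDual ξ η) = f.toLin ξ * g.toLin η :=
  extLin_extDual f.toLin g.toLin ξ η

variable (R C) in
/-- The trivial homomorphism. -/
def trivial : DualCoalgHom R C :=
  mk' (dunit k R.obj.carrier C.carrier)
    (fun n ξ => by
      rw [dunit_apply, dunit_apply, map_smul]
      by_cases h : n = 0
      · subst h
        rw [C.toGrAlg.proj_of_mem C.toGrAlg.one_mem, LinearMap.comp_apply,
          R.obj.proj_of_mem R.obj.one_mem]
      · rw [C.toGrAlg.proj_of_mem_ne C.toGrAlg.one_mem h, LinearMap.comp_apply,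
          R.obj.proj_of_mem_ne R.obj.one_mem h, map_zero, zero_smul, smul_zero])
    (fun ξ => by
      rw [dunit_apply, map_smul, C.comul_one]
      have : TensorProduct.map (dunit k R.obj.carrier C.carrier) (dunit k R.obj.carrier C.carrier) =
          (LinearMap.toSpanSingleton k _ ((1 : C.carrier) ⊗ₜ[k] (1 : C.carrier))) ∘ₗ
          LinearMap.mul' k k ∘ₗ TensorProduct.map (Module.Dual.eval k R.obj.carrier 1)
            (Module.Dual.eval k R.obj.carrier 1) :=
        TensorProduct.ext' fun α β => by
          simp [dunit_apply, TensorProduct.smul_tmul_smul, Module.Dual.eval_apply, smul_smul, mul_comm, TensorProduct.smul_tmul']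
      rw [this, LinearMap.comp_apply, LinearMap.comp_apply, dualComul_apply, mul_one]
      rfl)
    (fun ξ => by rw [dunit_apply, map_smul, C.counit_one, smul_eq_mul, mul_one])

lemma trivial_apply (ξ : Module.Dual k R.obj.carrier) :
    (trivial R C).toLin ξ = ξ 1 • (1 : C.carrier) := rfl

/-- Postcomposition with a map of Hopf algebras. -/
def comp {C' : GrHopf k} (f : DualCoalgHom R C) (h : C.toGrAlg ⟶ C'.toGrAlg)
    (hh : GrHopf.IsComulHom h) : DualCoalgHom R C' :=
  mk' (h.toAlgHom.toLinearMap ∘ₗ f.toLin)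
    (fun n ξ => by
      rw [LinearMap.comp_apply, LinearMap.comp_apply, ← f.proj_apply]
      exact hom_proj h n (f.toLin ξ))
    (fun ξ => by
      rw [LinearMap.comp_apply, TensorProduct.map_comp, LinearMap.comp_apply, ← f.comul_apply]
      exact hh _)
    (fun ξ => by
      rw [LinearMap.comp_apply, ← f.counit_apply]
      exact GrHopf.IsComulHom.counit hh _)

end DualCoalgHom

end

/-! ### The idempotent endomorphism that splits off the multiplicative part -/

noncomputable section

open GrAlg

namespace DualCoalgHom

variable {k : Type u} [Field k] {R S : FinGrAlg k} {C : GrHopf k}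

/-- Two homomorphisms factor through a common injective one. -/
lemma exists_common (f : DualCoalgHom R C) (g : DualCoalgHom S C) :
    ∃ (A : FinGrAlg k) (h : DualCoalgHom A C) (φ : A ⟶ R) (ψ : A ⟶ S),
      Function.Injective h.toLin ∧ f = h.map φ ∧ g = h.map ψ := by
  obtain ⟨A, h, hinj, hr⟩ := GrHopf.exists_dualCoalgHom_range
    (f.isSubcoalg_range.sup g.isSubcoalg_range)
  obtain ⟨φ, hφ⟩ := exists_factor h hinj f (hr ▸ le_sup_left)
  obtain ⟨ψ, hψ⟩ := exists_factor h hinj g (hr ▸ le_sup_right)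
  exact ⟨A, h, φ, ψ, hinj, hφ, hψ⟩

end DualCoalgHom

namespace GrHopf

variable {k : Type u} [Field k] (p : ℕ) [Fact p.Prime] [CharP k p] [PerfectField k] {C : GrHopf k}

/-- Two presentations of the same element factor through a common injective coalgebra homomorphism,
where they have the same preimage, and naturality of red compares the results. Thus the restriction
along red is well defined on elements of `C`. -/
lemma map_red_congr {R S : FinGrAlg k} {f : DualCoalgHom R C} {g : DualCoalgHom S C}
    {ξ : Module.Dual k R.obj.carrier} {η : Module.Dual k S.obj.carrier}
    (h : f.toLin ξ = g.toLin η) :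
    (f.map (R.red p)).toLin ξ = (g.map (S.red p)).toLin η := by
  obtain ⟨A, h', φ, ψ, hinj, rfl, rfl⟩ := f.exists_common g
  have key : ∀ {R : FinGrAlg k} (φ : A ⟶ R) (ξ : Module.Dual k R.obj.carrier),
      ((h'.map φ).map (R.red p)).toLin ξ =
        (h'.map (A.red p)).toLin (ξ ∘ₗ φ.hom.toAlgHom.toLinearMap) := fun {R} φ ξ => by
    rw [DualCoalgHom.map_apply, DualCoalgHom.map_apply, DualCoalgHom.map_apply]
    congr 1
    refine LinearMap.ext fun a => congrArg ξ ?_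
    exact (congrArg (fun f : A.obj ⟶ R.obj => f.toAlgHom a) (red_natural p φ.hom)).symm
  rw [key, key]
  congr 1
  exact hinj h

omit [PerfectField k] in
lemma exists_eq_toLin (x : C.carrier) : ∃ (A : FinGrAlg k) (f : DualCoalgHom A C)
    (ξ : Module.Dual k A.obj.carrier), f.toLin ξ = x := by
  obtain ⟨A, f, -, ξ, h⟩ := exists_dualCoalgHom x
  exact ⟨A, f, ξ, h⟩

variable (C) in
/-- The underlying function of `redLin`. -/
def redFun (x : C.carrier) : C.carrier :=
  ((exists_eq_toLin x).choose_spec.choose.map ((exists_eq_toLin x).choose.red p)).toLin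
    (exists_eq_toLin x).choose_spec.choose_spec.choose

lemma redFun_apply {R : FinGrAlg k} (f : DualCoalgHom R C) (ξ : Module.Dual k R.obj.carrier) :
    C.redFun p (f.toLin ξ) = (f.map (R.red p)).toLin ξ :=
  map_red_congr p (exists_eq_toLin (f.toLin ξ)).choose_spec.choose_spec.choose_spec

omit [PerfectField k] in
lemma exists_pair (x y : C.carrier) : ∃ (A : FinGrAlg k) (f : DualCoalgHom A C)
    (ξ η : Module.Dual k A.obj.carrier), f.toLin ξ = x ∧ f.toLin η = y := by
  obtain ⟨A, f, ξ, rfl⟩ := exists_eq_toLin x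
  obtain ⟨B, g, η, rfl⟩ := exists_eq_toLin y
  obtain ⟨D, h, φ, ψ, -, rfl, rfl⟩ := f.exists_common g
  exact ⟨D, h, _, _, rfl, rfl⟩

variable (C) in
/-- The endomorphism of a Hopf algebra which on the level of coalgebra homomorphisms from `R^∨` is
restriction along the projection of `R` to its perfect part. -/
def redLin : C.carrier →ₗ[k] C.carrier where
  toFun := C.redFun p
  map_add' x y := by
    obtain ⟨A, f, ξ, η, rfl, rfl⟩ := exists_pair x y
    rw [← map_add, redFun_apply, redFun_apply, redFun_apply, map_add]
  map_smul' c x := by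
    obtain ⟨A, f, ξ, rfl⟩ := exists_eq_toLin x
    rw [← map_smul, redFun_apply, redFun_apply, map_smul, RingHom.id_apply]

lemma redLin_apply {R : FinGrAlg k} (f : DualCoalgHom R C) (ξ : Module.Dual k R.obj.carrier) :
    C.redLin p (f.toLin ξ) = (f.map (R.red p)).toLin ξ := redFun_apply p f ξ

lemma redLin_comp {R : FinGrAlg k} (f : DualCoalgHom R C) :
    C.redLin p ∘ₗ f.toLin = (f.map (R.red p)).toLin := LinearMap.ext (redLin_apply p f)

lemma redLin_one : C.redLin p 1 = 1 := by
  obtain ⟨ξ, hξ⟩ : ∃ ξ : Module.Dual k (FinGrAlg.unitAlg k).obj.carrier, ξ 1 = 1 :=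
    ⟨(LinearMap.id : k →ₗ[k] k), rfl⟩
  have h := redLin_apply p (DualCoalgHom.trivial (FinGrAlg.unitAlg k) C) ξ
  rw [DualCoalgHom.map_apply, DualCoalgHom.trivial_apply, DualCoalgHom.trivial_apply,
    LinearMap.comp_apply, AlgHom.toLinearMap_apply, map_one (FinGrAlg.red p _).hom.toAlgHom, hξ,
    one_smul] at h
  exact h

lemma red_tmk_tmul (A B : GrAlg k) [Module.Finite k A.carrier] [Module.Finite k B.carrier]
    (a : A.carrier) (b : B.carrier) : ((tensor A B).red p).toAlgHom (tmk A B (a ⊗ₜ b)) =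
      tmk A B ((A.red p).toAlgHom a ⊗ₜ (B.red p).toAlgHom b) := by
  rw [← tensorInl_mul_tensorInr, map_mul, ← tensorInl_mul_tensorInr]
  congr 1
  · exact (congrArg (fun f : A ⟶ tensor A B => f.toAlgHom a) (red_natural p (tensorInl A B))).symm
  · exact (congrArg (fun f : B ⟶ tensor A B => f.toAlgHom b) (red_natural p (tensorInr A B))).symm

/-- A product of two values is a value of the product homomorphism, defined on the dual of a tensor
product, and red respects tensor products by naturality along the two inclusions. -/
lemma redLin_mul (x y : C.carrier) : C.redLin p (x * y) = C.redLin p x * C.redLin p y := by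
  obtain ⟨A, f, ξ, rfl⟩ := exists_eq_toLin x
  obtain ⟨B, g, η, rfl⟩ := exists_eq_toLin y
  refine (congrArg (C.redLin p) (f.prod_extDual g ξ η).symm).trans
    ((redLin_apply p (f.prod g) _).trans ?_)
  rw [redLin_apply, redLin_apply, DualCoalgHom.map_apply, DualCoalgHom.map_apply]
  refine Eq.trans ?_ (f.prod_extDual g _ _)
  refine congrArg (f.prod g).toLin ?_
  refine eq_extDual fun a b => ?_
  refine (congrArg (extDual ξ η) (red_tmk_tmul p A.obj B.obj a b)).trans ?_
  exact extDual_tmul _ _ _ _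

variable (C) in
/-- The idempotent endomorphism of a Hopf algebra which splits off the part of multiplicative
type. -/
def redHom : C.toGrAlg ⟶ C.toGrAlg where
  toAlgHom := AlgHom.ofLinearMap (C.redLin p) (redLin_one p) (redLin_mul p)
  map_mem n x hx := by
    obtain ⟨A, f, ξ, rfl⟩ := exists_eq_toLin x
    change C.redLin p (f.toLin ξ) ∈ C.grading n
    have h : C.toGrAlg.proj n (C.redLin p (f.toLin ξ)) = C.redLin p (C.toGrAlg.proj n (f.toLin ξ)) := by
      rw [f.proj_apply, redLin_apply, redLin_apply, DualCoalgHom.proj_apply]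
    rw [C.toGrAlg.mem_iff_proj, h, C.toGrAlg.proj_of_mem hx]

lemma redHom_apply {R : FinGrAlg k} (f : DualCoalgHom R C) (ξ : Module.Dual k R.obj.carrier) :
    (C.redHom p).toAlgHom (f.toLin ξ) = (f.map (R.red p)).toLin ξ := redFun_apply p f ξ

lemma isComulHom_redHom : IsComulHom (C.redHom p) := by
  intro x
  obtain ⟨A, f, ξ, rfl⟩ := exists_eq_toLin x
  rw [redHom_apply, f.comul_apply, DualCoalgHom.comul_apply, ← redLin_comp, TensorProduct.map_comp]
  rfl

lemma redHom_natural {C' : GrHopf k} {h : C.toGrAlg ⟶ C'.toGrAlg} (hh : IsComulHom h) :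
    C.redHom p ≫ h = h ≫ C'.redHom p := by
  refine hom_ext' fun x => ?_
  obtain ⟨A, f, ξ, rfl⟩ := exists_eq_toLin x
  rw [GrAlg.comp_apply, GrAlg.comp_apply, redHom_apply]
  exact (redHom_apply p (f.comp h hh) ξ).symm

lemma map_red_map_red {R : FinGrAlg k} (f : DualCoalgHom R C) :
    (f.map (R.red p)).map (R.red p) = f.map (R.red p) := by
  refine DualCoalgHom.ext (LinearMap.ext fun ξ => ?_)
  rw [DualCoalgHom.map_apply, DualCoalgHom.map_apply, DualCoalgHom.map_apply]
  congr 1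
  ext a
  exact congrArg ξ (congrArg (fun t : R.obj ⟶ R.obj => t.toAlgHom a) (R.obj.red_red p))

lemma redHom_redHom : C.redHom p ≫ C.redHom p = C.redHom p := by
  refine hom_ext' fun x => ?_
  obtain ⟨A, f, ξ, rfl⟩ := exists_eq_toLin x
  rw [GrAlg.comp_apply, redHom_apply, redHom_apply, map_red_map_red]

omit [PerfectField k] in
/-- The transpose of the sign involution is the sign involution. -/
lemma tau_toLin {R : FinGrAlg k} (f : DualCoalgHom R C) (ξ : Module.Dual k R.obj.carrier) :
    C.toGrAlg.tau.toAlgHom (f.toLin ξ) = f.toLin (ξ ∘ₗ R.obj.tau.toAlgHom.toLinearMap) := by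
  obtain ⟨I, _, b, d, hd⟩ := R.obj.exists_basis_homogeneous
  suffices C.toGrAlg.tau.toAlgHom.toLinearMap ∘ₗ f.toLin =
    f.toLin ∘ₗ R.obj.tau.toAlgHom.toLinearMap.dualMap from LinearMap.congr_fun this ξ
  classical
  refine b.dualBasis.ext fun i => ?_
  have h1 : b.coord i ∘ₗ R.obj.tau.toAlgHom.toLinearMap = (-1 : k) ^ (d i) • b.coord i := by
    refine b.ext fun j => ?_
    rw [LinearMap.comp_apply, AlgHom.toLinearMap_apply, R.obj.tau_apply (hd j), map_smul,
      LinearMap.smul_apply]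
    by_cases hij : j = i
    · rw [hij]
    · rw [Module.Basis.coord_apply, Module.Basis.repr_self, Finsupp.single_eq_of_ne (Ne.symm hij)]
      simp
  rw [Module.Basis.coe_dualBasis, LinearMap.comp_apply, LinearMap.comp_apply,
    LinearMap.dualMap_apply', h1, map_smul]
  exact C.toGrAlg.tau_apply ((proj_comp_iff_coord hd).1 f.proj_apply i)

lemma redHom_tau : C.redHom p ≫ C.toGrAlg.tau = C.redHom p := by
  refine hom_ext' fun x => ?_
  obtain ⟨A, f, ξ, rfl⟩ := exists_eq_toLin x
  rw [GrAlg.comp_apply, redHom_apply, tau_toLin, DualCoalgHom.map_apply, DualCoalgHom.map_apply]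
  congr 1
  ext a
  exact congrArg ξ (congrArg (fun t : A.obj ⟶ A.obj => t.toAlgHom a) (A.obj.red_tau p))

/-! ### The dictionary -/

lemma isConilpotent_iff_redTrivial :
    C.IsConilpotent ↔ ∀ (R : FinGrAlg k) (f : DualCoalgHom R C), f.RedTrivial p :=
  ⟨fun h _ f => h.redTrivial p f, isConilpotent_of_redTrivial p⟩

lemma isUngraded_isMultiplicative_iff_redFixed : C.IsUngraded ∧ C.IsMultiplicative ↔
    ∀ (R : FinGrAlg k) (f : DualCoalgHom R C), f.RedFixed p :=
  ⟨fun h _ f => h.2.redFixed p h.1 f,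
    fun h => ⟨isUngraded_of_redFixed p h, isMultiplicative_of_redFixed p h⟩⟩

lemma redHom_eq_triv_iff : C.redHom p = C.triv C.toGrAlg ↔ C.IsConilpotent := by
  rw [isConilpotent_iff_redTrivial p]
  constructor
  · intro h R f ξ
    rw [← redHom_apply, h, triv_apply, f.counit_apply, Algebra.algebraMap_eq_smul_one]
  · intro h
    refine hom_ext' fun x => ?_
    obtain ⟨A, f, ξ, rfl⟩ := exists_eq_toLin x
    rw [redHom_apply, h A f, triv_apply, f.counit_apply, Algebra.algebraMap_eq_smul_one]

lemma redHom_eq_id_iff : C.redHom p = 𝟙 C.toGrAlg ↔ C.IsUngraded ∧ C.IsMultiplicative := by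
  rw [isUngraded_isMultiplicative_iff_redFixed p]
  constructor
  · intro h R f
    refine DualCoalgHom.ext (LinearMap.ext fun ξ => ?_)
    rw [← redHom_apply, h]
    rfl
  · intro h
    refine hom_ext' fun x => ?_
    obtain ⟨A, f, ξ, rfl⟩ := exists_eq_toLin x
    rw [redHom_apply, h A f]
    rfl

end GrHopf

end

/-! ### Invertibility of 2; the idempotent and the involution on affine groups -/

noncomputable section

open GrAlg

section Two

variable {E : Type*} [Category.{u} E] {G : E ⥤ AddCommGrpCat.{u}}

lemma isIso_iff_forall_bijective {G' : E ⥤ AddCommGrpCat.{u}} (φ : G ⟶ G') :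
    IsIso φ ↔ ∀ R, Function.Bijective (φ.app R) := by
  rw [NatTrans.isIso_iff_isIso_app]
  exact forall_congr' fun R => ConcreteCategory.isIso_iff_bijective _

lemma isIso_two_iff : IsIso (𝟙 G + 𝟙 G) ↔ ∀ R, Function.Bijective fun x : G.obj R => x + x :=
  isIso_iff_forall_bijective _

/-- If p^n = 2q + 1 kills an element, then 2(q + 1) fixes it, so multiplication by q + 1 undoes
doubling. -/
lemma bijective_two_of_torsion {A : Type*} [AddCommGroup A] {p : ℕ} (hp : Odd p)
    (h : ∀ x : A, ∃ n : ℕ, p ^ n • x = 0) : Function.Bijective fun x : A => x + x := by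
  have key : ∀ x : A, ∃ q : ℕ, (2 * q) • x = x := fun x => by
    obtain ⟨n, hn⟩ := h x
    obtain ⟨q, hq⟩ := (hp.pow (n := n))
    refine ⟨q + 1, ?_⟩
    rw [show 2 * (q + 1) = p ^ n + 1 by omega, add_nsmul, hn, one_nsmul, zero_add]
  constructor
  · intro x y (hxy : x + x = y + y)
    obtain ⟨q, hq⟩ := key (x - y)
    rw [← sub_eq_zero, ← hq, mul_comm, mul_nsmul', two_nsmul, sub_add_sub_comm, hxy, sub_self,
      nsmul_zero]
  · intro x
    obtain ⟨q, hq⟩ := key x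
    exact ⟨q • x, (two_nsmul _).symm.trans (by rw [← mul_nsmul', hq])⟩

end Two

namespace GrAlg

lemma isIso_of_bijective {k : Type u} [Field k] {A B : GrAlg k} (f : A ⟶ B)
    (hf : Function.Bijective f.toAlgHom) : IsIso f := by
  let e := AlgEquiv.ofBijective f.toAlgHom hf
  let g : B ⟶ A :=
    ⟨e.symm.toAlgHom, fun n b hb => by
      rw [A.mem_iff_proj]
      apply hf.1
      rw [← hom_proj]
      have : f.toAlgHom (e.symm b) = b := e.apply_symm_apply b
      exact (congrArg _ this).trans ((B.proj_of_mem hb).trans this.symm)⟩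
  exact ⟨g, hom_ext' fun a => e.symm_apply_apply a, hom_ext' fun b => e.apply_symm_apply b⟩

end GrAlg

namespace GrHopf

variable {k : Type u} [Field k] {H : GrHopf k}

variable (H) in
/-- The endomorphism of multiplication by a natural number. -/
def npow : ℕ → (H.toGrAlg ⟶ H.toGrAlg)
  | 0 => H.triv _
  | m + 1 => conv (npow m) (𝟙 _)

lemma RepBy.nsmul {E : Type*} [Category.{u} E] {ι : E ⥤ GrAlg k} {G : E ⥤ AddCommGrpCat.{u}}
    {e : ∀ R : E, G.obj R ≃ (H.toGrAlg ⟶ ι.obj R)} (he : RepBy e) (m : ℕ) (R : E) (x : G.obj R) :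
    e R (m • x) = H.npow m ≫ e R x := by
  induction m with
  | zero => rw [zero_nsmul, he.zero, npow, triv_comp]
  | succ m ih => rw [succ_nsmul, he.add, ih, npow, conv_comp, Category.id_comp]

/-- Multiplication by `m` on the group becomes the `m`-th power in R ⊗ B, so the rules for it reduce
to rules for powers in a ring. -/
lemma elem_npow {R : FinGrAlg k} (f : DualCoalgHom R H) {B : GrAlg k} (h : H.toGrAlg ⟶ B) (m : ℕ) :
    elem ((H.npow m ≫ h).toAlgHom.toLinearMap ∘ₗ f.toLin) =
      elem (h.toAlgHom.toLinearMap ∘ₗ f.toLin) ^ m := by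
  induction m with
  | zero =>
    rw [pow_zero, npow, triv_comp, ← elem_dunit]
    congr 1
    refine LinearMap.ext fun ξ => ?_
    rw [LinearMap.comp_apply, AlgHom.toLinearMap_apply, triv_apply, f.counit_apply, dunit_apply,
      Algebra.algebraMap_eq_smul_one]
  | succ m ih =>
    rw [pow_succ, ← ih, ← elem_dconv, npow, conv_comp, Category.id_comp, ← f.comp_dconv]
    rfl

lemma npow_apply_eq {R : FinGrAlg k} (f : DualCoalgHom R H) {m : ℕ}
    (h : elem f.toLin ^ m = elem f.toLin) (ξ : Module.Dual k R.obj.carrier) :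
    (H.npow m).toAlgHom (f.toLin ξ) = f.toLin ξ := by
  have h1 := elem_npow f (𝟙 H.toGrAlg) m
  rw [Category.comp_id] at h1
  exact LinearMap.congr_fun (elem_injective (h1.trans h)) ξ

lemma npow_comp_npow (a b : ℕ) : H.npow a ≫ H.npow b = H.npow (b * a) := by
  refine hom_ext' fun x => ?_
  obtain ⟨R, f, ξ, rfl⟩ := exists_eq_toLin x
  have h1 := elem_npow f (H.npow b) a
  have h2 := elem_npow f (𝟙 H.toGrAlg) b
  have h3 := elem_npow f (𝟙 H.toGrAlg) (b * a)
  rw [Category.comp_id] at h2 h3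
  rw [h2, ← pow_mul, ← h3] at h1
  exact LinearMap.congr_fun (elem_injective h1) ξ

/-- The group represented by `H` is, locally, killed by powers of `p`. -/
def IsPrimary (p : ℕ) (H : GrHopf k) : Prop :=
  ∀ (R : FinGrAlg k) (f : DualCoalgHom R H), ∃ n, elem f.toLin ^ p ^ n = 1

/-- On each finite piece some p^n = 2q + 1 acts trivially, so 2(q + 1) acts as the identity.
Bijectivity can be tested on elements, each of which lies in such a piece. -/
lemma IsPrimary.bijective_npow_two {p : ℕ} (hp : Odd p) (h : H.IsPrimary p) :
    Function.Bijective (H.npow 2).toAlgHom := by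
  have key : ∀ x, ∃ q, (H.npow (2 * q)).toAlgHom x = x := fun x => by
    obtain ⟨R, f, ξ, rfl⟩ := exists_eq_toLin x
    obtain ⟨n, hn⟩ := h R f
    obtain ⟨q, hq⟩ := (hp.pow (n := n))
    refine ⟨q + 1, npow_apply_eq f ?_ ξ⟩
    rw [show 2 * (q + 1) = p ^ n + 1 by omega, pow_succ, hn, one_mul]
  constructor
  · rw [injective_iff_map_eq_zero]
    intro x hx
    obtain ⟨q, hq⟩ := key x
    rw [← hq, mul_comm, ← npow_comp_npow, GrAlg.comp_apply, hx, map_zero]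
  · intro x
    obtain ⟨q, hq⟩ := key x
    exact ⟨(H.npow q).toAlgHom x, by rw [← GrAlg.comp_apply, npow_comp_npow, hq]⟩

lemma RepBy.isIso_two {E : Type*} [Category.{u} E] {ι : E ⥤ GrAlg k} {G : E ⥤ AddCommGrpCat.{u}}
    {e : ∀ R : E, G.obj R ≃ (H.toGrAlg ⟶ ι.obj R)} (he : RepBy e)
    (h : Function.Bijective (H.npow 2).toAlgHom) : IsIso (𝟙 G + 𝟙 G) := by
  haveI := isIso_of_bijective _ h
  rw [isIso_two_iff]
  intro R
  have h1 : ∀ x : G.obj R, x + x = (e R).symm (H.npow 2 ≫ e R x) := fun x => by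
    rw [← he.nsmul, two_nsmul, Equiv.symm_apply_apply]
  have h2 : (fun x : G.obj R => x + x) = (e R).symm ∘ (fun f => H.npow 2 ≫ f) ∘ e R := funext h1
  rw [h2]
  exact (e R).symm.bijective.comp (Function.Bijective.comp
    ⟨fun a b hab => (cancel_epi _).1 hab, fun a => ⟨inv (H.npow 2) ≫ a, by simp⟩⟩ (e R).bijective)

variable (p : ℕ) [Fact p.Prime] [CharP k p] [PerfectField k]

lemma IsConilpotent.isPrimary (h : H.IsConilpotent) : H.IsPrimary p := fun _ f =>
  (h.redTrivial p f).exists_pow_eq_one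

end GrHopf

section Affine

variable {k : Type u} [Field k] 

/-- The sign involution of a functor on graded algebras. -/
def affTau (G : GrAlg k ⥤ AddCommGrpCat.{u}) : G ⟶ G where
  app R := G.map R.tau
  naturality R S f := by rw [← G.map_comp, ← G.map_comp, tau_naturality]

lemma affTau_natural {G G' : GrAlg k ⥤ AddCommGrpCat.{u}} (φ : G ⟶ G') :
    affTau G ≫ φ = φ ≫ affTau G' := by
  ext R : 2
  exact φ.naturality R.tau

lemma affTau_affTau (G : GrAlg k ⥤ AddCommGrpCat.{u}) : affTau G ≫ affTau G = 𝟙 G := by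
  ext R : 2
  change G.map R.tau ≫ G.map R.tau = _
  rw [← G.map_comp, tau_tau, G.map_id]
  rfl

variable (p : ℕ) [Fact p.Prime] [CharP k p] [PerfectField k]

open Classical in
/-- The idempotent of an affine group which splits off the part of multiplicative type. -/
def affRed (G : GrAlg k ⥤ AddCommGrpCat.{u}) : G ⟶ G :=
  if h : isAffineGroup k G then
    (GrHopf.exists_repBy h).choose_spec.choose_spec.endo
      ((GrHopf.exists_repBy h).choose.redHom p) (GrHopf.isComulHom_redHom p)
  -- A default value; every statement about this endomorphism concerns affine `G`.
  else 0

open GrHopf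

variable {G G' : GrAlg k ⥤ AddCommGrpCat.{u}} {H : GrHopf k}
  {e : ∀ R : GrAlg k, G.obj R ≃ (H.toGrAlg ⟶ (𝟭 (GrAlg k)).obj R)}

/-- The definition uses a chosen representing Hopf algebra. Any two are related by a morphism
compatible with coproducts, and `redHom` is natural for these. -/
lemma GrHopf.RepBy.affRed_apply (he : RepBy e) (R : GrAlg k) (x : G.obj R) :
    e R ((affRed p G).app R x) = H.redHom p ≫ e R x := by
  have h : isAffineGroup k G := Represents.isAffine (represents_iff.2 ⟨e, he⟩)
  let H' := (exists_repBy h).choose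
  let e' := (exists_repBy h).choose_spec.choose
  have he' : RepBy e' := (exists_repBy h).choose_spec.choose_spec
  have h1 : ∀ R x, e' R ((affRed p G).app R x) = H'.redHom p ≫ e' R x := fun R x => by
    have : affRed p G = he'.endo (H'.redHom p) (isComulHom_redHom p) := dif_pos h
    rw [this, RepBy.endo_apply, Equiv.apply_symm_apply]
  obtain ⟨q, hq, hq'⟩ := he'.exists_hom he (𝟙 G)
  have h2 : ∀ R x, e R x = q ≫ e' R x := hq'
  rw [h2, h1, h2, ← Category.assoc, ← redHom_natural p hq, Category.assoc]

lemma GrHopf.RepBy.affTau_apply (he : RepBy e) (R : GrAlg k) (x : G.obj R) :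
    e R ((affTau G).app R x) = H.toGrAlg.tau ≫ e R x :=
  (he.natural R R R.tau x).trans (tau_naturality (e R x : H.toGrAlg ⟶ R))

/-- Endomorphisms of a represented functor are determined by the Hopf algebra. -/
lemma GrHopf.RepBy.endo_eq_iff (he : RepBy e) {φ ψ : G ⟶ G} {a b : H.toGrAlg ⟶ H.toGrAlg}
    (hφ : ∀ R x, e R (φ.app R x) = a ≫ e R x) (hψ : ∀ R x, e R (ψ.app R x) = b ≫ e R x) :
    φ = ψ ↔ a = b := by
  constructor
  · rintro rfl
    obtain ⟨x, hx⟩ := (e H.toGrAlg).surjective (𝟙 _)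
    have h1 := (hφ _ x).symm.trans (hψ _ x)
    rw [hx] at h1
    exact (Category.comp_id a).symm.trans (h1.trans (Category.comp_id b))
  · rintro rfl
    ext R x
    exact (e R).injective ((hφ R x).trans (hψ R x).symm)

lemma GrHopf.RepBy.id_app (R : GrAlg k) (x : G.obj R) :
    e R ((𝟙 G : G ⟶ G).app R x) = 𝟙 H.toGrAlg ≫ e R x := (Category.id_comp (e R x)).symm

lemma GrHopf.RepBy.zero_app (he : RepBy e) (R : GrAlg k) (x : G.obj R) :
    e R ((0 : G ⟶ G).app R x) = H.triv H.toGrAlg ≫ e R x :=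
  (he.zero R).trans (triv_comp H (e R x : H.toGrAlg ⟶ R)).symm

lemma affRed_natural (hG : isAffineGroup k G) (hG' : isAffineGroup k G') (φ : G ⟶ G') :
    affRed p G ≫ φ = φ ≫ affRed p G' := by
  obtain ⟨H, e, he⟩ := exists_repBy hG
  obtain ⟨H', e', he'⟩ := exists_repBy hG'
  obtain ⟨q, hq, hq'⟩ := he.exists_hom he' φ
  ext R x
  apply (e' R).injective
  change e' R (φ.app R ((affRed p G).app R x)) = e' R ((affRed p G').app R (φ.app R x))
  rw [hq', he.affRed_apply p, he'.affRed_apply p, hq', ← Category.assoc, ← redHom_natural p hq,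
    Category.assoc]

lemma affRed_affRed (hG : isAffineGroup k G) : affRed p G ≫ affRed p G = affRed p G := by
  obtain ⟨H, e, he⟩ := exists_repBy hG
  refine (he.endo_eq_iff (a := H.redHom p ≫ H.redHom p) (fun R x => ?_) (he.affRed_apply p)).2
    (redHom_redHom p)
  change e R ((affRed p G).app R ((affRed p G).app R x)) = _
  rw [he.affRed_apply p, he.affRed_apply p, Category.assoc]

lemma affRed_affTau (hG : isAffineGroup k G) : affRed p G ≫ affTau G = affRed p G := by
  obtain ⟨H, e, he⟩ := exists_repBy hG
  refine (he.endo_eq_iff (a := H.redHom p ≫ H.toGrAlg.tau) (fun R x => ?_) (he.affRed_apply p)).2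
    (redHom_tau p)
  change e R ((affTau G).app R ((affRed p G).app R x)) = _
  rw [he.affTau_apply, he.affRed_apply p, ← Category.assoc, ← tau_naturality]

omit [Fact p.Prime] [PerfectField k] in
lemma tau_eq_id_iff (hp : p ≠ 2) : H.toGrAlg.tau = 𝟙 _ ↔ H.IsEven := by
  constructor
  · intro h n hn
    rw [eq_bot_iff]
    intro a ha
    have h1 := H.toGrAlg.tau_apply ha
    rw [h, hn.neg_one_pow, neg_one_smul, GrAlg.id_apply, eq_neg_iff_add_eq_zero, ← two_smul k] at h1
    have h2 : (2 : k) ≠ 0 := Ring.two_ne_zero (by rwa [ringChar.eq k p])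
    exact (smul_eq_zero.1 h1).resolve_left h2
  · intro h
    suffices H.toGrAlg.tau.toAlgHom.toLinearMap = LinearMap.id from
      hom_ext' fun a => LinearMap.congr_fun this a
    refine H.toGrAlg.hom_ext_homogeneous fun n a ha => ?_
    rw [AlgHom.toLinearMap_apply, LinearMap.id_apply, H.toGrAlg.tau_apply ha]
    rcases Nat.even_or_odd n with hn | hn
    · rw [hn.neg_one_pow, one_smul]
    · rw [h n hn, Submodule.mem_bot] at ha
      rw [ha, smul_zero]

lemma isUnipotentAffine_iff (hp : p ≠ 2) :
    isUnipotentAffine k G ↔ isAffineGroup k G ∧ affRed p G = 0 ∧ affTau G = 𝟙 G := by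
  have key : ∀ (H : GrHopf k) (e : ∀ R : GrAlg k, G.obj R ≃ (H.toGrAlg ⟶ (𝟭 (GrAlg k)).obj R)),
      RepBy e → ((H.IsEven ∧ H.IsConilpotent) ↔ affRed p G = 0 ∧ affTau G = 𝟙 G) := by
    intro H e he
    rw [he.endo_eq_iff (he.affRed_apply p) he.zero_app, he.endo_eq_iff he.affTau_apply RepBy.id_app,
      redHom_eq_triv_iff, tau_eq_id_iff p hp, and_comm]
  constructor
  · rintro ⟨h, H, hH, h2⟩
    obtain ⟨e, he⟩ := represents_iff.1 hH
    exact ⟨h, (key H e he).1 h2⟩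
  · rintro ⟨h, h2⟩
    obtain ⟨H, e, he⟩ := exists_repBy h
    exact ⟨h, H, represents_iff.2 ⟨e, he⟩, (key H e he).2 h2⟩

lemma isMultiplicativeAffine_iff :
    isMultiplicativeAffine k G ↔ isAffineGroup k G ∧ affRed p G = 𝟙 G := by
  have key : ∀ (H : GrHopf k) (e : ∀ R : GrAlg k, G.obj R ≃ (H.toGrAlg ⟶ (𝟭 (GrAlg k)).obj R)),
      RepBy e → ((H.IsUngraded ∧ H.IsMultiplicative) ↔ affRed p G = 𝟙 G) := by
    intro H e he
    rw [he.endo_eq_iff (he.affRed_apply p) RepBy.id_app, redHom_eq_id_iff]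
  constructor
  · rintro ⟨h, H, hH, h2⟩
    obtain ⟨e, he⟩ := represents_iff.1 hH
    exact ⟨h, (key H e he).1 h2⟩
  · rintro ⟨h, h2⟩
    obtain ⟨H, e, he⟩ := exists_repBy h
    exact ⟨h, H, represents_iff.2 ⟨e, he⟩, (key H e he).2 h2⟩

lemma isIso_two_of_affRed_eq_zero (hp : Odd p) (hG : isAffineGroup k G) (h : affRed p G = 0) :
    IsIso (𝟙 G + 𝟙 G) := by
  obtain ⟨H, e, he⟩ := exists_repBy hG
  rw [he.endo_eq_iff (he.affRed_apply p) he.zero_app, redHom_eq_triv_iff] at h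
  exact he.isIso_two ((h.isPrimary p).bijective_npow_two hp)

end Affine

end

/-! ### Odd primitive elements and contractions dual to them -/

noncomputable section

open GrAlg

section Adjoin

variable {k : Type*} [Field k] {A : Type*} [Ring A] [Algebra k A]

lemma adjoin_induction_left {S : Set A} {M : Submodule k A} (h1 : 1 ∈ M)
    (hS : ∀ s ∈ S, ∀ x ∈ Algebra.adjoin k S, x ∈ M → s * x ∈ M) :
    Subalgebra.toSubmodule (Algebra.adjoin k S) ≤ M := by
  rw [Algebra.adjoin_eq_span, Submodule.span_le]
  intro x hx
  have : x ∈ Algebra.adjoin k S ∧ x ∈ M := by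
    induction hx using Submonoid.closure_induction_left with
    | one => exact ⟨Subalgebra.one_mem _, h1⟩
    | mul_left s hs y _ ih =>
      exact ⟨Subalgebra.mul_mem _ (Algebra.subset_adjoin hs) ih.1, hS s hs y ih.1 ih.2⟩
  exact this.2

/-- Since `b` anticommutes with the other generators and squares to zero, every word can be
rewritten with at most one `b`, placed in front. -/
lemma exists_of_mem_adjoin_insert {S : Set A} {b : A} (hb : b * b = 0)
    (hS : ∀ s ∈ S, s * b = -(b * s)) {x : A} (hx : x ∈ Algebra.adjoin k (insert b S)) :
    ∃ w ∈ Algebra.adjoin k S, ∃ w' ∈ Algebra.adjoin k S, x = w + b * w' := by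
  let E := Subalgebra.toSubmodule (Algebra.adjoin k S)
  have h : Subalgebra.toSubmodule (Algebra.adjoin k (insert b S)) ≤ E ⊔ E.map (LinearMap.mulLeft k b) := by
    refine adjoin_induction_left (Submodule.mem_sup_left (Subalgebra.one_mem _)) ?_
    rintro s hs _ - hx
    obtain ⟨w, hw, _, ⟨w', hw', rfl⟩, rfl⟩ := Submodule.mem_sup.1 hx
    rw [LinearMap.mulLeft_apply, mul_add]
    rcases hs with rfl | hs
    · rw [← mul_assoc, hb, zero_mul, add_zero]
      exact Submodule.mem_sup_right ⟨w, hw, rfl⟩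
    · have hs' := Algebra.subset_adjoin (R := k) hs
      refine Submodule.add_mem_sup (Subalgebra.mul_mem _ hs' hw) ⟨-(s * w'), ?_, ?_⟩
      · exact Subalgebra.neg_mem _ (Subalgebra.mul_mem _ hs' hw')
      · rw [LinearMap.mulLeft_apply, ← mul_assoc s, hS s hs, mul_neg, neg_mul, mul_assoc]
  obtain ⟨w, hw, _, ⟨w', hw', rfl⟩, h⟩ := Submodule.mem_sup.1 (h hx)
  exact ⟨w, hw, w', hw', h.symm⟩

lemma exists_finset_mem_adjoin {S : Set A} {x : A} (hx : x ∈ Algebra.adjoin k S) :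
    ∃ T : Finset A, ↑T ⊆ S ∧ x ∈ Algebra.adjoin k (T : Set A) := by
  classical
  have mono : ∀ {T T' : Finset A}, T ⊆ T' →
      Algebra.adjoin k (T : Set A) ≤ Algebra.adjoin k (T' : Set A) := fun h =>
    Algebra.adjoin_mono (Finset.coe_subset.2 h)
  induction hx using Algebra.adjoin_induction with
  | mem x hx => exact ⟨{x}, by simpa using hx, Algebra.subset_adjoin (by simp)⟩
  | algebraMap r => exact ⟨∅, by simp, Subalgebra.algebraMap_mem _ r⟩
  | add x y _ _ hx hy =>
    obtain ⟨T, hT, h⟩ := hx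
    obtain ⟨T', hT', h'⟩ := hy
    exact ⟨T ∪ T', by simp [hT, hT'], Subalgebra.add_mem _ (mono Finset.subset_union_left h)
      (mono Finset.subset_union_right h')⟩
  | mul x y _ _ hx hy =>
    obtain ⟨T, hT, h⟩ := hx
    obtain ⟨T', hT', h'⟩ := hy
    exact ⟨T ∪ T', by simp [hT, hT'], Subalgebra.mul_mem _ (mono Finset.subset_union_left h)
      (mono Finset.subset_union_right h')⟩

lemma exists_finset_le_adjoin {S : Set A} {V : Submodule k A} [Module.Finite k V]
    (hV : V ≤ Subalgebra.toSubmodule (Algebra.adjoin k S)) :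
    ∃ T : Finset A, ↑T ⊆ S ∧ V ≤ Subalgebra.toSubmodule (Algebra.adjoin k (T : Set A)) := by
  classical
  obtain ⟨t, ht⟩ := (Module.Finite.iff_fg.1 ‹_› : V.FG)
  have : ∀ x : t, ∃ T : Finset A, ↑T ⊆ S ∧ (x : A) ∈ Algebra.adjoin k (T : Set A) := fun x =>
    exists_finset_mem_adjoin (hV (ht ▸ Submodule.subset_span x.2))
  choose T hT hT' using this
  refine ⟨t.attach.biUnion T, by simpa using hT, ?_⟩
  rw [← ht, Submodule.span_le]
  intro x hx
  refine Algebra.adjoin_mono ?_ (hT' ⟨x, hx⟩)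
  exact Finset.coe_subset.2 (Finset.subset_biUnion_of_mem T (Finset.mem_attach t ⟨x, hx⟩))

end Adjoin

namespace GrAlg

variable {k : Type u} [Field k] (A : GrAlg k)

lemma mul_odd {m : ℕ} (hm : Odd m) {b : A.carrier} (hb : b ∈ A.grading m) (t : A.carrier) :
    t * b = b * A.tau.toAlgHom t := by
  suffices LinearMap.mulRight k b = LinearMap.mulLeft k b ∘ₗ A.tau.toAlgHom.toLinearMap from
    LinearMap.congr_fun this t
  refine A.hom_ext_homogeneous fun n a ha => ?_
  rw [LinearMap.mulRight_apply, LinearMap.comp_apply, AlgHom.toLinearMap_apply, A.tau_apply ha,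
    map_smul, LinearMap.mulLeft_apply, A.comm_of_mem ha hb, mul_comm n, pow_mul, hm.neg_one_pow]

lemma tensorInr_mul_tensorInl {m : ℕ} (hm : Odd m) {b : A.carrier} (hb : b ∈ A.grading m)
    (x : A.carrier) : (tensorInr A A).toAlgHom b * (tensorInl A A).toAlgHom x =
      (tensorInl A A).toAlgHom (A.tau.toAlgHom x) * (tensorInr A A).toAlgHom b := by
  have h1 := (tensor A A).mul_odd hm ((tensorInr A A).map_mem m b hb)
    ((tensorInl A A).toAlgHom (A.tau.toAlgHom x))
  rw [h1]
  congr 1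
  have h2 := congrArg (fun f : A ⟶ tensor A A => f.toAlgHom (A.tau.toAlgHom x))
    (tau_naturality (tensorInl A A))
  refine Eq.trans ?_ h2.symm
  have h3 : A.tau.toAlgHom (A.tau.toAlgHom x) = x :=
    congrArg (fun f : A ⟶ A => f.toAlgHom x) A.tau_tau
  exact (congrArg (tensorInl A A).toAlgHom h3).symm

end GrAlg

namespace GrHopf

variable {k : Type u} [Field k] {H : GrHopf k}

variable (H) in
/-- The homogeneous primitive elements of odd degree. -/
def oddPrim : Set H.carrier :=
  {v | (Coalgebra.comul v : H.carrier ⊗[k] H.carrier) = v ⊗ₜ[k] 1 + 1 ⊗ₜ[k] v ∧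
    ∃ m, Odd m ∧ v ∈ H.grading m}

/-- Multiply by b ⊗ 1 + 1 ⊗ b; moving the odd element `b` past a first tensor factor costs the sign
automorphism on that factor. -/
lemma comul_oddPrim_mul {b : H.carrier} (hb : b ∈ H.oddPrim) (w : H.carrier) :
    (Coalgebra.comul (b * w) : H.carrier ⊗[k] H.carrier) =
      TensorProduct.map (LinearMap.mulLeft k b) LinearMap.id (Coalgebra.comul w) +
      TensorProduct.map H.toGrAlg.tau.toAlgHom.toLinearMap (LinearMap.mulLeft k b)
        (Coalgebra.comul w) := by
  obtain ⟨hb, m, hm, hbm⟩ := hb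
  apply tmk_injective H.toGrAlg H.toGrAlg
  have h1 : tmk H.toGrAlg H.toGrAlg (Coalgebra.comul (b * w)) =
    tmk H.toGrAlg H.toGrAlg (Coalgebra.comul b) * tmk H.toGrAlg H.toGrAlg (Coalgebra.comul w) :=
      H.comul_mul b w
  rw [h1, hb, map_add]
  generalize (Coalgebra.comul w : H.carrier ⊗[k] H.carrier) = z
  induction z with
  | zero => simp
  | add y z hy hz => 
    simp only [map_add, mul_add] at hy hz ⊢
    rw [hy, hz]
    abel
  | tmul x y =>
    rw [TensorProduct.map_tmul, TensorProduct.map_tmul, ← tensorInl_apply, ← tensorInr_apply,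
      ← tensorInl_mul_tensorInr, map_add, add_mul, ← mul_assoc, ← mul_assoc,
      tensorInr_mul_tensorInl _ hm hbm, LinearMap.mulLeft_apply, LinearMap.mulLeft_apply,
      ← tensorInl_mul_tensorInr, ← tensorInl_mul_tensorInr, map_mul, map_mul, mul_assoc, mul_assoc, mul_assoc]
    rfl

lemma exists_homogeneous_of_mem_closure {S : Set H.carrier} (hS : S ⊆ H.oddPrim) {x : H.carrier}
    (hx : x ∈ Submonoid.closure S) : ∃ n, x ∈ H.grading n := by
  induction hx using Submonoid.closure_induction with
  | mem x hx => obtain ⟨-, m, -, h⟩ := hS hx; exact ⟨m, h⟩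
  | one => exact ⟨0, H.toGrAlg.one_mem⟩
  | mul x y _ _ hx hy =>
    obtain ⟨m, hm⟩ := hx
    obtain ⟨n, hn⟩ := hy
    exact ⟨m + n, H.toGrAlg.mul_mem hm hn⟩

lemma tau_oddPrim {s : H.carrier} (hs : s ∈ H.oddPrim) : H.toGrAlg.tau.toAlgHom s = -s := by
  obtain ⟨-, m, hm, h⟩ := hs
  rw [H.toGrAlg.tau_apply h, hm.neg_one_pow, neg_one_smul]

lemma tau_mem_adjoin {S : Set H.carrier} (hS : S ⊆ H.oddPrim) {x : H.carrier}
    (hx : x ∈ Algebra.adjoin k S) : H.toGrAlg.tau.toAlgHom x ∈ Algebra.adjoin k S := by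
  have : Algebra.adjoin k S ≤ (Algebra.adjoin k S).comap H.toGrAlg.tau.toAlgHom :=
    Algebra.adjoin_le fun s hs => by
      change H.toGrAlg.tau.toAlgHom s ∈ Algebra.adjoin k S
      rw [tau_oddPrim (hS hs)]
      exact Subalgebra.neg_mem _ (Algebra.subset_adjoin hs)
  exact this hx

/-- The formula for the coproduct of `s * x` shows that left multiplication by an odd primitive
generator preserves the stability conditions, so they hold for all words. -/
lemma isSubcoalg_adjoin {S : Set H.carrier} (hS : S ⊆ H.oddPrim) :
    H.IsSubcoalg (Subalgebra.toSubmodule (Algebra.adjoin k S)) := by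
  set E := Algebra.adjoin k S
  have key : ∀ x ∈ E, (∀ φ : H.carrier →ₗ[k] k,
      lcontr φ (Coalgebra.comul x : H.carrier ⊗[k] H.carrier) ∈ E) ∧
      ∀ φ : H.carrier →ₗ[k] k, rcontr φ (Coalgebra.comul x : H.carrier ⊗[k] H.carrier) ∈ E := by
    let M : Submodule k H.carrier := 
      { carrier := {x | (∀ φ : H.carrier →ₗ[k] k,
          lcontr φ (Coalgebra.comul x : H.carrier ⊗[k] H.carrier) ∈ E) ∧
          ∀ φ : H.carrier →ₗ[k] k, rcontr φ (Coalgebra.comul x : H.carrier ⊗[k] H.carrier) ∈ E}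
        zero_mem' := by simp [Subalgebra.zero_mem]
        add_mem' := fun ha hb => ⟨fun φ => by
          rw [map_add, map_add]; exact Subalgebra.add_mem _ (ha.1 φ) (hb.1 φ), fun φ => by
          rw [map_add, map_add]; exact Subalgebra.add_mem _ (ha.2 φ) (hb.2 φ)⟩
        smul_mem' := fun c x ha => ⟨fun φ => by
          rw [map_smul, map_smul]; exact Subalgebra.smul_mem _ (ha.1 φ) c, fun φ => by
          rw [map_smul, map_smul]; exact Subalgebra.smul_mem _ (ha.2 φ) c⟩ }
    refine adjoin_induction_left (M := M) ⟨fun φ => ?_, fun φ => ?_⟩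
      fun s hs x hxE hx => ⟨fun φ => ?_, fun φ => ?_⟩
    · rw [H.comul_one, lcontr_tmul]; exact Subalgebra.smul_mem _ (Subalgebra.one_mem _) _
    · rw [H.comul_one, rcontr_tmul]; exact Subalgebra.smul_mem _ (Subalgebra.one_mem _) _
    · rw [comul_oddPrim_mul (hS hs), map_add, lcontr_map, lcontr_map]
      exact Subalgebra.add_mem _ (hx.1 _) (Subalgebra.mul_mem _ (Algebra.subset_adjoin hs) (hx.1 _))
    · rw [comul_oddPrim_mul (hS hs), map_add, rcontr_map, rcontr_map]
      exact Subalgebra.add_mem _ (Subalgebra.mul_mem _ (Algebra.subset_adjoin hs) (hx.2 _))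
        (tau_mem_adjoin hS (hx.2 _))
  refine ⟨fun x hx => (key x hx).1, fun x hx => (key x hx).2, fun n x hx => ?_⟩
  suffices Subalgebra.toSubmodule E ≤ (Subalgebra.toSubmodule E).comap (H.toGrAlg.proj n) from this hx
  rw [Algebra.adjoin_eq_span, Submodule.span_le]
  intro x hx
  obtain ⟨m, hm⟩ := exists_homogeneous_of_mem_closure hS hx
  change H.toGrAlg.proj n x ∈ Submodule.span k (Submonoid.closure S : Set H.carrier)
  by_cases h : n = m
  · rw [h, H.toGrAlg.proj_of_mem hm]; exact Submodule.subset_span hx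
  · rw [H.toGrAlg.proj_of_mem_ne hm h]; exact Submodule.zero_mem _

/-- A functional supported in an odd degree commutes with all functionals up to the sign
involution. -/
lemma mul'_map_comul_odd {m : ℕ} (hm : Odd m) {l : H.carrier →ₗ[k] k}
    (hl : l ∘ₗ H.toGrAlg.proj m = l) (φ : H.carrier →ₗ[k] k) (x : H.carrier) :
    LinearMap.mul' k k (TensorProduct.map φ l (Coalgebra.comul x)) =
      LinearMap.mul' k k (TensorProduct.map l (φ ∘ₗ H.toGrAlg.tau.toAlgHom.toLinearMap)
        (Coalgebra.comul x)) := by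
  have h1 := congrArg (fun w => LinearMap.mul' k k (TensorProduct.map φ l
    ((GradedTensorProduct.of k H.grading H.grading).symm w))) (H.graded_cocomm x)
  simp only [LinearEquiv.symm_apply_apply] at h1
  rw [← h1]
  suffices LinearMap.mul' k k ∘ₗ TensorProduct.map φ l ∘ₗ
      (GradedTensorProduct.of k H.grading H.grading).symm.toLinearMap ∘ₗ
      (GradedTensorProduct.comm H.grading H.grading).toLinearMap ∘ₗ
      (GradedTensorProduct.of k H.grading H.grading).toLinearMap =
      LinearMap.mul' k k ∘ₗ TensorProduct.map l (φ ∘ₗ H.toGrAlg.tau.toAlgHom.toLinearMap) from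
    LinearMap.congr_fun this _
  refine H.toGrAlg.tensor_hom_ext H.toGrAlg fun i j a ha b hb => ?_
  refine (congrArg (fun w => LinearMap.mul' k k (TensorProduct.map φ l
    ((GradedTensorProduct.of k H.grading H.grading).symm w)))
    (gradedTensor_comm H.toGrAlg ha hb)).trans ?_
  rw [map_smul, map_smul, map_smul, LinearEquiv.symm_apply_apply, LinearMap.comp_apply,
    TensorProduct.map_tmul, TensorProduct.map_tmul, LinearMap.mul'_apply, LinearMap.mul'_apply,
    LinearMap.comp_apply, AlgHom.toLinearMap_apply, H.toGrAlg.tau_apply hb, map_smul, smul_eq_mul,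
    smul_eq_mul]
  by_cases h : m = i
  · subst h
    rw [mul_comm j m, pow_mul, hm.neg_one_pow]; ring
  · rw [← hl, LinearMap.comp_apply, H.toGrAlg.proj_of_mem_ne ha h]; simp

lemma lcontr_counit (x : H.carrier) :
    lcontr Coalgebra.counit (Coalgebra.comul x : H.carrier ⊗[k] H.carrier) = x := by
  rw [lcontr, LinearMap.comp_apply, Coalgebra.rTensor_counit_comul]
  simp

/-- The contraction with a suitable functional of odd degree behaves like a derivation dual to the
primitive element `b`. -/
lemma exists_contraction (h0 : ∀ a ∈ H.grading 0, ∃ c : k, a = c • 1) {S : Set H.carrier}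
    (hS : S ⊆ H.oddPrim) {b : H.carrier} (hb : b ∈ H.oddPrim) (hbS : b ∉ Algebra.adjoin k S) :
    ∃ l : H.carrier →ₗ[k] k, l 1 = 0 ∧ (∀ z : H.carrier ⊗[k] H.carrier,
        lcontr (l ∘ₗ H.toGrAlg.tau.toAlgHom.toLinearMap) z = -lcontr l z) ∧
      (∀ w ∈ Algebra.adjoin k S, lcontr l (Coalgebra.comul w : H.carrier ⊗[k] H.carrier) = 0) ∧
      (∀ w ∈ Algebra.adjoin k S, lcontr l (Coalgebra.comul (b * w) : H.carrier ⊗[k] H.carrier) = w) ∧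
      ∀ (φ : H.carrier →ₗ[k] k) (x : H.carrier),
        lcontr l (Coalgebra.comul (lcontr φ (Coalgebra.comul x : H.carrier ⊗[k] H.carrier)) :
          H.carrier ⊗[k] H.carrier) =
        lcontr (φ ∘ₗ H.toGrAlg.tau.toAlgHom.toLinearMap) (Coalgebra.comul
          (lcontr l (Coalgebra.comul x : H.carrier ⊗[k] H.carrier)) : H.carrier ⊗[k] H.carrier) := by
  have hE := isSubcoalg_adjoin hS
  obtain ⟨-, m, hm, hbm⟩ := id hb
  obtain ⟨l₀, h1, h2⟩ := Submodule.exists_le_ker_of_notMem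
    (p := Subalgebra.toSubmodule (Algebra.adjoin k S)) hbS
  -- A functional that separates `b` from the subalgebra is restricted to the degree of `b`, which
  -- makes it odd, and is scaled to take the value 1 at `b`.
  let l : H.carrier →ₗ[k] k := (l₀ b)⁻¹ • l₀ ∘ₗ H.toGrAlg.proj m
  have hl : l ∘ₗ H.toGrAlg.proj m = l := by
    ext x
    simp only [l, LinearMap.comp_apply, LinearMap.smul_apply]
    rw [H.toGrAlg.proj_of_mem (H.toGrAlg.proj_mem m x)]
  have hlE : ∀ w ∈ Algebra.adjoin k S, l w = 0 := fun w hw => by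
    have : l₀ (H.toGrAlg.proj m w) = 0 := h2 (hE.proj m w hw)
    simp only [l, LinearMap.comp_apply, LinearMap.smul_apply, this, smul_zero]
  have hlb : l b = 1 := by
    simp only [l, LinearMap.comp_apply, LinearMap.smul_apply, smul_eq_mul]
    rw [H.toGrAlg.proj_of_mem hbm, inv_mul_cancel₀ h1]
  have hE0 : ∀ w ∈ Algebra.adjoin k S,
      lcontr l (Coalgebra.comul w : H.carrier ⊗[k] H.carrier) = 0 := fun w hw => by
    rw [← Module.forall_dual_apply_eq_zero_iff k]
    intro φ
    rw [← rcontr_lcontr]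
    exact hlE _ (hE.right w hw φ)
  have e2 : l ∘ₗ H.toGrAlg.tau.toAlgHom.toLinearMap = -l := by
    refine H.toGrAlg.hom_ext_homogeneous fun n a ha => ?_
    rw [LinearMap.comp_apply, AlgHom.toLinearMap_apply, H.toGrAlg.tau_apply ha, map_smul,
      LinearMap.neg_apply]
    by_cases hn : m = n
    · rw [← hn, hm.neg_one_pow, neg_one_smul]
    · rw [← hl, LinearMap.comp_apply, H.toGrAlg.proj_of_mem_ne ha hn, map_zero, smul_zero, neg_zero]
  have e3 : ∀ z : H.carrier ⊗[k] H.carrier, lcontr (-l) z = -lcontr l z := fun z => by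
    rw [← neg_one_smul k l]
    induction z with
    | zero => simp
    | add x y hx hy => rw [map_add, hx, hy, map_add, neg_add]
    | tmul x y => simp
  refine ⟨l, hlE 1 (Subalgebra.one_mem _), fun z => e2 ▸ e3 z, hE0, fun w hw => ?_, fun φ x => ?_⟩
  -- For degree reasons `l (b * a)` only sees the degree zero part of `a`, which consists of
  -- scalars; so it is the counit.
  · have e1 : l ∘ₗ LinearMap.mulLeft k b = Coalgebra.counit := by
      refine H.toGrAlg.hom_ext_homogeneous fun n a ha => ?_
      rw [LinearMap.comp_apply, LinearMap.mulLeft_apply]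
      by_cases hn : n = 0
      · subst hn
        obtain ⟨c, rfl⟩ := h0 a ha
        rw [mul_smul_comm, mul_one, map_smul, map_smul, hlb, H.counit_one]
      · rw [H.counit_eq_zero n a ha hn, ← hl, LinearMap.comp_apply,
          H.toGrAlg.proj_of_mem_ne (H.toGrAlg.mul_mem hbm ha) (by omega), map_zero]
    rw [comul_oddPrim_mul hb, map_add, lcontr_map, lcontr_map, e1, e2, e3, hE0 w hw, neg_zero,
      map_zero, add_zero, lcontr_counit, LinearMap.id_apply]
  · rw [lcontr_coassoc, lcontr_coassoc]
    refine congrArg (fun f => lcontr f (Coalgebra.comul x : H.carrier ⊗[k] H.carrier)) ?_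
    exact LinearMap.ext fun y => mul'_map_comul_odd hm hl φ y

end GrHopf

end

/-! ### Hopf algebras on which the sign is the antipode are exterior algebras -/

noncomputable section

open GrAlg

namespace GrHopf

variable {k : Type u} [Field k] {H : GrHopf k}

lemma counit_of_prim {v : H.carrier}
    (hv : (Coalgebra.comul v : H.carrier ⊗[k] H.carrier) = v ⊗ₜ[k] 1 + 1 ⊗ₜ[k] v) :
    (Coalgebra.counit v : k) = 0 := by
  have h := lcontr_counit v
  rw [hv, map_add, lcontr_tmul, lcontr_tmul, H.counit_one, one_smul, add_eq_right] at h
  have := congrArg (Coalgebra.counit : H.carrier →ₗ[k] k) h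
  rwa [map_smul, H.counit_one, smul_eq_mul, mul_one, map_zero] at this

lemma tau_of_prim (hτ : conv H.toGrAlg.tau (𝟙 _) = H.triv H.toGrAlg) {v : H.carrier}
    (hv : (Coalgebra.comul v : H.carrier ⊗[k] H.carrier) = v ⊗ₜ[k] 1 + 1 ⊗ₜ[k] v) :
    H.toGrAlg.tau.toAlgHom v = -v := by
  have h := congrArg (fun f : H.toGrAlg ⟶ H.toGrAlg => f.toAlgHom v) hτ
  simp only [conv_apply, triv_apply, counit_of_prim hv, hv, map_add, TensorProduct.map_tmul,
    LinearMap.mul'_apply, AlgHom.toLinearMap_apply, map_one, mul_one, one_mul, zero_smul,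
    GrAlg.id_apply] at h
  exact eq_neg_of_add_eq_zero_left (h.trans (map_zero _))

lemma comul_proj_of_prim {v : H.carrier}
    (hv : (Coalgebra.comul v : H.carrier ⊗[k] H.carrier) = v ⊗ₜ[k] 1 + 1 ⊗ₜ[k] v) (n : ℕ) :
    (Coalgebra.comul (H.toGrAlg.proj n v) : H.carrier ⊗[k] H.carrier) =
      H.toGrAlg.proj n v ⊗ₜ[k] 1 + 1 ⊗ₜ[k] H.toGrAlg.proj n v := by
  rw [comul_proj, hv, map_add]
  suffices tensorProj H.toGrAlg H.toGrAlg n ∘ₗ ((TensorProduct.mk k H.carrier H.carrier).flip 1 +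
      TensorProduct.mk k H.carrier H.carrier 1) =
      ((TensorProduct.mk k H.carrier H.carrier).flip 1 + TensorProduct.mk k H.carrier H.carrier 1) ∘ₗ
        H.toGrAlg.proj n by
    simpa using LinearMap.congr_fun this v
  refine H.toGrAlg.hom_ext_homogeneous fun m a ha => ?_
  simp only [LinearMap.comp_apply, LinearMap.add_apply, LinearMap.flip_apply, TensorProduct.mk_apply,
    map_add]
  refine (congrArg₂ (· + ·) (tensorProj_tmul H.toGrAlg H.toGrAlg n ha H.toGrAlg.one_mem)
    (tensorProj_tmul H.toGrAlg H.toGrAlg n H.toGrAlg.one_mem ha)).trans ?_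
  by_cases h : n = m
  · subst h
    rw [H.toGrAlg.proj_of_mem ha, if_pos (add_zero n), if_pos (zero_add n)]
  · rw [H.toGrAlg.proj_of_mem_ne ha h, if_neg (by omega), if_neg (by omega)]
    simp

/-- On primitive elements the antipode is -1, whereas the sign automorphism is 1 in even degrees; as
2 is invertible, the even components vanish. -/
lemma mem_span_oddPrim (h2 : (2 : k) ≠ 0) (hτ : conv H.toGrAlg.tau (𝟙 _) = H.triv H.toGrAlg)
    {v : H.carrier}
    (hv : (Coalgebra.comul v : H.carrier ⊗[k] H.carrier) = v ⊗ₜ[k] 1 + 1 ⊗ₜ[k] v) :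
    v ∈ Submodule.span k H.oddPrim := by
  refine H.toGrAlg.mem_iSup_of_forall fun n => ?_
  have hn := comul_proj_of_prim hv n
  rcases Nat.even_or_odd n with h | h
  · have h1 := tau_of_prim hτ hn
    rw [H.toGrAlg.tau_apply (H.toGrAlg.proj_mem n v), h.neg_one_pow, one_smul,
      eq_neg_iff_add_eq_zero, ← two_smul k, smul_eq_zero_iff_right h2] at h1
    rw [h1]
    exact Submodule.zero_mem _
  · exact Submodule.subset_span ⟨hn, n, h, H.toGrAlg.proj_mem n v⟩

lemma comul_of_mem_span_oddPrim {v : H.carrier} (hv : v ∈ Submodule.span k H.oddPrim) :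
    (Coalgebra.comul v : H.carrier ⊗[k] H.carrier) = v ⊗ₜ[k] 1 + 1 ⊗ₜ[k] v := by
  induction hv using Submodule.span_induction with
  | mem x hx => exact hx.1
  | zero => simp
  | add x y _ _ hx hy =>
    rw [map_add, hx, hy, TensorProduct.add_tmul, TensorProduct.tmul_add]; abel
  | smul c x _ hx =>
    rw [map_smul, hx, smul_add, TensorProduct.smul_tmul', TensorProduct.tmul_smul]

lemma mul_of_mem_span_oddPrim {v : H.carrier} (hv : v ∈ Submodule.span k H.oddPrim)
    (t : H.carrier) : t * v = v * H.toGrAlg.tau.toAlgHom t := by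
  induction hv using Submodule.span_induction with
  | mem x hx => obtain ⟨-, m, hm, h⟩ := hx; exact H.toGrAlg.mul_odd hm h t
  | zero => simp
  | add x y _ _ hx hy => rw [mul_add, hx, hy, add_mul]
  | smul c x _ hx => rw [mul_smul_comm, hx, smul_mul_assoc]

lemma tau_of_mem_span_oddPrim {v : H.carrier} (hv : v ∈ Submodule.span k H.oddPrim) :
    H.toGrAlg.tau.toAlgHom v = -v := by
  induction hv using Submodule.span_induction with
  | mem x hx => exact tau_oddPrim hx
  | zero => simp
  | add x y _ _ hx hy => rw [map_add, hx, hy, neg_add]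
  | smul c x _ hx => rw [map_smul, hx, smul_neg]

lemma mul_self_of_mem_span_oddPrim (h2 : (2 : k) ≠ 0) {v : H.carrier}
    (hv : v ∈ Submodule.span k H.oddPrim) : v * v = 0 := by
  have := mul_of_mem_span_oddPrim hv v
  rwa [tau_of_mem_span_oddPrim hv, mul_neg, eq_neg_iff_add_eq_zero, ← two_smul k,
    smul_eq_zero_iff_right h2] at this

lemma oddPrim_mul_comm {s : H.carrier} (hs : s ∈ H.oddPrim) {b : H.carrier} (hb : b ∈ H.oddPrim) :
    s * b = -(b * s) := by
  rw [mul_of_mem_span_oddPrim (Submodule.subset_span hb), tau_oddPrim hs, mul_neg]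

/-- An element whose reduced coproduct has its second factors in a subalgebra generated by
finitely many odd primitive elements is itself generated by odd primitive elements. -/
lemma mem_adjoin_oddPrim_of_lcontr (h2 : (2 : k) ≠ 0)
    (hτ : conv H.toGrAlg.tau (𝟙 _) = H.triv H.toGrAlg)
    (h0 : ∀ a ∈ H.grading 0, ∃ c : k, a = c • 1) (S : Finset H.carrier) (hS : ↑S ⊆ H.oddPrim)
    (x : H.carrier) (hx : ∀ φ : H.carrier →ₗ[k] k,
      lcontr φ (Coalgebra.comul x : H.carrier ⊗[k] H.carrier) - φ 1 • x ∈
        Algebra.adjoin k (S : Set H.carrier)) :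
    x ∈ Algebra.adjoin k H.oddPrim := by
  classical
  induction S using Finset.induction_on generalizing x with
  | empty =>
    rw [Finset.coe_empty, Algebra.adjoin_empty] at hx
    -- Base case: the discrepancy is a scalar, determined by applying the counit. Consequently x
    -- minus its counit is primitive.
    have h1 : ∀ φ : H.carrier →ₗ[k] k, lcontr φ (Coalgebra.comul x : H.carrier ⊗[k] H.carrier) =
        φ 1 • x + (φ x - φ 1 * Coalgebra.counit x) • 1 := fun φ => by
      obtain ⟨c, hc⟩ := Algebra.mem_bot.1 (hx φ)
      rw [Algebra.algebraMap_eq_smul_one, eq_sub_iff_add_eq'] at hc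
      have h3 := congrArg (Coalgebra.counit : H.carrier →ₗ[k] k) hc
      have h4 : rcontr Coalgebra.counit (Coalgebra.comul x : H.carrier ⊗[k] H.carrier) = x := by
        rw [rcontr, LinearMap.comp_apply, Coalgebra.lTensor_counit_comul]; simp
      rw [← rcontr_lcontr, h4, map_add, map_smul, map_smul, H.counit_one, smul_eq_mul, smul_eq_mul,
        mul_one] at h3
      rw [← hc, ← h3, add_sub_cancel_left]
    have h3 : (Coalgebra.comul x : H.carrier ⊗[k] H.carrier) =
        x ⊗ₜ 1 + 1 ⊗ₜ x - (Coalgebra.counit x : k) • (1 ⊗ₜ 1) := by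
      rw [← sub_eq_zero]
      refine eq_zero_of_lcontr fun φ => ?_
      rw [map_sub, map_sub, map_add, map_smul, h1 φ, lcontr_tmul, lcontr_tmul, lcontr_tmul, sub_smul,
        smul_smul, mul_comm]
      abel
    have h4 : x - (Coalgebra.counit x : k) • 1 ∈ Submodule.span k H.oddPrim := by
      refine mem_span_oddPrim h2 hτ ?_
      rw [map_sub, map_smul, H.comul_one, h3, TensorProduct.sub_tmul, TensorProduct.tmul_sub,
        TensorProduct.tmul_smul, ← TensorProduct.smul_tmul']
      abel
    have h5 := Algebra.span_le_adjoin k H.oddPrim h4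
    rw [← sub_add_cancel x ((Coalgebra.counit x : k) • 1)]
    exact Subalgebra.add_mem _ h5 (Subalgebra.smul_mem _ (Subalgebra.one_mem _) _)
  | insert b S _ ih =>
    rw [Finset.coe_insert, Set.insert_subset_iff] at hS
    rw [Finset.coe_insert] at hx
    obtain ⟨hb, hS⟩ := hS
    by_cases hbS : b ∈ Algebra.adjoin k (S : Set H.carrier)
    · exact ih hS x fun φ =>
        Algebra.adjoin_le (Set.insert_subset hbS Algebra.subset_adjoin) (hx φ)
    obtain ⟨l, hl1, hlτ, hD0, hDb, hDφ⟩ := exists_contraction h0 hS hb hbS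
    -- The contraction reads off the coefficient of `b`; if it vanishes, `b` is not needed to
    -- express `y`.
    have key : ∀ y ∈ Algebra.adjoin k (insert b (S : Set H.carrier)),
        lcontr l (Coalgebra.comul y : H.carrier ⊗[k] H.carrier) = 0 →
        y ∈ Algebra.adjoin k (S : Set H.carrier) := fun y hy h => by
      obtain ⟨w, hw, w', hw', rfl⟩ := exists_of_mem_adjoin_insert
        (mul_self_of_mem_span_oddPrim h2 (Submodule.subset_span hb))
        (fun s hs => oddPrim_mul_comm (hS hs) hb) hy
      rw [map_add, map_add, hD0 w hw, hDb w' hw', zero_add] at h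
      rwa [h, mul_zero, add_zero]
    set e := lcontr l (Coalgebra.comul x : H.carrier ⊗[k] H.carrier) with he
    have heS : e ∈ Algebra.adjoin k (insert b (S : Set H.carrier)) := by
      have := hx l
      rwa [hl1, zero_smul, sub_zero] at this
    -- Contraction by an odd functional anticommutes with itself, so its square is zero because 2 is
    -- invertible.
    have hDe : lcontr l (Coalgebra.comul e : H.carrier ⊗[k] H.carrier) = 0 := by
      have := hDφ l x
      rwa [← he, hlτ, eq_neg_iff_add_eq_zero, ← two_smul k, smul_eq_zero_iff_right h2] at this
    have he' := key e heS hDe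
    have hbe : b * e ∈ Algebra.adjoin k (insert b (S : Set H.carrier)) :=
      Subalgebra.mul_mem _ (Algebra.subset_adjoin (Set.mem_insert _ _)) heS
    -- Subtracting `b * e` annihilates the contraction by `l`. The corrected element then satisfies
    -- the hypothesis for the smaller set `S`.
    have hx1 : lcontr l (Coalgebra.comul (x - b * e) : H.carrier ⊗[k] H.carrier) = 0 := by
      rw [map_sub, map_sub, hDb e he', ← he, sub_self]
    have := ih hS (x - b * e) fun φ => key _ ?_ ?_
    · rw [← sub_add_cancel x (b * e)]
      refine Subalgebra.add_mem _ this (Subalgebra.mul_mem _ (Algebra.subset_adjoin hb) ?_)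
      exact Algebra.adjoin_mono hS he'
    · have h1 := (isSubcoalg_adjoin (Set.insert_subset hb hS)).left _ hbe φ
      rw [map_sub, map_sub, smul_sub, sub_sub_sub_comm]
      exact Subalgebra.sub_mem _ (hx φ) (Subalgebra.sub_mem _ h1 (Subalgebra.smul_mem _ hbe _))
    · rw [map_sub, map_sub, map_smul, map_smul, hDφ, hx1]
      simp

/-- By induction on the degree, the second factors of Δx - 1 ⊗ x are generated by odd primitives.
They span a finite-dimensional space, so finitely many primitives suffice and
`mem_adjoin_oddPrim_of_lcontr` applies. -/
lemma adjoin_oddPrim_eq_top (h2 : (2 : k) ≠ 0)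
    (hτ : conv H.toGrAlg.tau (𝟙 _) = H.triv H.toGrAlg)
    (h0 : ∀ a ∈ H.grading 0, ∃ c : k, a = c • 1) : Algebra.adjoin k H.oddPrim = ⊤ := by
  refine Algebra.eq_top_iff.2 fun x => H.toGrAlg.homogeneous_induction
    (Subalgebra.toSubmodule (Algebra.adjoin k H.oddPrim)) (fun n => ?_) x
  induction n using Nat.strong_induction_on with
  | _ n ih =>
    intro x hx
    -- Replacing the first factor a by a - ε(a) removes its degree zero part, which leaves second
    -- factors of degree less than `n`.
    let T : H.carrier ⊗[k] H.carrier →ₗ[k] H.carrier ⊗[k] H.carrier := TensorProduct.map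
      (LinearMap.id - LinearMap.toSpanSingleton k H.carrier 1 ∘ₗ Coalgebra.counit) LinearMap.id
    have hT : ∀ a b : H.carrier, T (a ⊗ₜ b) = a ⊗ₜ b - (Coalgebra.counit a : k) • (1 ⊗ₜ b) :=
      fun a b => by
        simp [T, TensorProduct.sub_tmul, TensorProduct.smul_tmul']
    have h1 : T (Coalgebra.comul x) = Coalgebra.comul x - 1 ⊗ₜ x := by
      have : T = LinearMap.id - TensorProduct.mk k H.carrier H.carrier 1 ∘ₗ lcontr Coalgebra.counit := by
        refine TensorProduct.ext' fun a b => ?_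
        rw [hT]; simp
      rw [this, LinearMap.sub_apply, LinearMap.comp_apply, lcontr_counit]
      rfl
    have h3 : lspan (T (Coalgebra.comul x)) ≤
        Subalgebra.toSubmodule (Algebra.adjoin k H.oddPrim) := fun y hy => by
      obtain ⟨φ, rfl⟩ := mem_lspan.1 hy
      suffices tensorGrading H.toGrAlg H.toGrAlg n ≤
        (Subalgebra.toSubmodule (Algebra.adjoin k H.oddPrim)).comap (lcontr φ ∘ₗ T) from
          this (H.comul_mem n x hx)
      refine tensorGrading_le _ _ fun i j hij a ha b hb => ?_
      change lcontr φ (T (a ⊗ₜ b)) ∈ Subalgebra.toSubmodule (Algebra.adjoin k H.oddPrim)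
      rw [hT]
      by_cases hi : i = 0
      · subst hi
        obtain ⟨c, rfl⟩ := h0 a ha
        rw [map_smul, H.counit_one, smul_eq_mul, mul_one, TensorProduct.smul_tmul', sub_self, map_zero]
        exact Submodule.zero_mem _
      · rw [H.counit_eq_zero i a ha hi, zero_smul, sub_zero, lcontr_tmul]
        exact Submodule.smul_mem _ _ (ih j (by omega) b hb)
    haveI := lspan_finite (T (Coalgebra.comul x))
    obtain ⟨S, hS, hle⟩ := exists_finset_le_adjoin h3
    refine mem_adjoin_oddPrim_of_lcontr h2 hτ h0 S hS x fun φ => hle (mem_lspan.2 ⟨φ, ?_⟩)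
    rw [h1, map_sub, lcontr_tmul]

/-- Induct on the finite set: if w + b w' maps to zero, contraction by the functional dual to `b`
shows that w' maps to zero, and then so does w. The first assertion is carried along because it
keeps each new `b` outside the subalgebra generated by the previous elements, as the contraction
requires. -/
lemma injective_lift_adjoin (h2 : (2 : k) ≠ 0) (h0 : ∀ a ∈ H.grading 0, ∃ c : k, a = c • 1)
    (F : ExteriorAlgebra k (Submodule.span k H.oddPrim) →ₐ[k] H.carrier)
    (hF : ∀ v, F (ExteriorAlgebra.ι k v) = v)
    (T : Finset (Submodule.span k H.oddPrim)) (hT : ∀ v ∈ T, (v : H.carrier) ∈ H.oddPrim)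
    (hli : LinearIndepOn k id (T : Set (Submodule.span k H.oddPrim))) :
    (∀ v : Submodule.span k H.oddPrim, (v : H.carrier) ∈
      Algebra.adjoin k (Subtype.val '' (T : Set (Submodule.span k H.oddPrim))) →
      v ∈ Submodule.span k (T : Set (Submodule.span k H.oddPrim))) ∧
    ∀ y ∈ Algebra.adjoin k (ExteriorAlgebra.ι k '' (T : Set (Submodule.span k H.oddPrim))),
      F y = 0 → y = 0 := by
  classical
  have hcz : ∀ c : k, algebraMap k H.carrier c = 0 → c = 0 := fun c hc => by
    have := congrArg (Coalgebra.counit : H.carrier →ₗ[k] k) hc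
    rwa [Algebra.algebraMap_eq_smul_one, map_smul, H.counit_one, smul_eq_mul, mul_one, map_zero] at this
  induction T using Finset.induction_on with
  | empty =>
    simp only [Finset.coe_empty, Set.image_empty, Algebra.adjoin_empty]
    refine ⟨fun v hv => ?_, fun y hy h => ?_⟩
    · obtain ⟨c, hc⟩ := Algebra.mem_bot.1 hv
      have h1 := counit_of_prim (comul_of_mem_span_oddPrim v.2)
      rw [← hc, Algebra.algebraMap_eq_smul_one, map_smul, H.counit_one, smul_eq_mul, mul_one] at h1
      rw [h1, map_zero] at hc
      rw [show v = 0 from Subtype.ext hc.symm]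
      exact Submodule.zero_mem _
    · obtain ⟨c, rfl⟩ := Algebra.mem_bot.1 hy
      rw [AlgHom.commutes] at h
      rw [hcz c h, map_zero]
  | insert b T hbT ih =>
    simp only [Finset.coe_insert, Set.image_insert_eq] at hli ⊢
    rw [linearIndepOn_id_insert (by simpa using hbT)] at hli
    obtain ⟨ih1, ih2⟩ := ih (fun v hv => hT v (Finset.mem_insert_of_mem hv)) hli.1
    have hb := hT b (Finset.mem_insert_self b T)
    have hS : Subtype.val '' (T : Set (Submodule.span k H.oddPrim)) ⊆ H.oddPrim := by
      rintro _ ⟨v, hv, rfl⟩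
      exact hT v (Finset.mem_insert_of_mem hv)
    have hbS : (b : H.carrier) ∉
        Algebra.adjoin k (Subtype.val '' (T : Set (Submodule.span k H.oddPrim))) := fun h =>
      hli.2 (ih1 b h)
    obtain ⟨l, hl1, -, hD0, hDb, -⟩ := exists_contraction h0 hS hb hbS
    have hFT : ∀ w ∈ Algebra.adjoin k (ExteriorAlgebra.ι k '' (T : Set (Submodule.span k H.oddPrim))),
        F w ∈ Algebra.adjoin k (Subtype.val '' (T : Set (Submodule.span k H.oddPrim))) := by
      intro w hw
      have h1 : F '' (ExteriorAlgebra.ι k '' (T : Set (Submodule.span k H.oddPrim))) =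
          Subtype.val '' (T : Set (Submodule.span k H.oddPrim)) := by
        rw [Set.image_image]; simp only [hF]
      rw [← h1, ← AlgHom.map_adjoin]
      exact ⟨w, hw, rfl⟩
    refine ⟨fun v hv => ?_, fun y hy h => ?_⟩
    · obtain ⟨w, hw, w', hw', h⟩ := exists_of_mem_adjoin_insert
        (mul_self_of_mem_span_oddPrim h2 b.2) (fun s hs => oddPrim_mul_comm (hS hs) hb) hv
      have h1 : lcontr l (Coalgebra.comul (v : H.carrier) : H.carrier ⊗[k] H.carrier) = w' := by
        rw [h, map_add, map_add, hD0 w hw, hDb w' hw', zero_add]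
      rw [comul_of_mem_span_oddPrim v.2, map_add, lcontr_tmul, lcontr_tmul, hl1, zero_smul,
        add_zero] at h1
      rw [← h1, mul_smul_comm, mul_one, ← sub_eq_iff_eq_add] at h
      have h3 := ih1 (v - l v • b) (by simpa [h] using hw)
      rw [← sub_add_cancel v (l v • b)]
      exact Submodule.add_mem _ (Submodule.span_mono (Set.subset_insert _ _) h3)
        (Submodule.smul_mem _ _ (Submodule.subset_span (Set.mem_insert _ _)))
    · obtain ⟨w, hw, w', hw', rfl⟩ := exists_of_mem_adjoin_insert (ExteriorAlgebra.ι_sq_zero b) (by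
        rintro _ ⟨s, -, rfl⟩
        exact eq_neg_of_add_eq_zero_left (ExteriorAlgebra.ι_add_mul_swap s b)) hy
      rw [map_add, map_mul, hF] at h
      have h1 := congrArg (fun x => lcontr l (Coalgebra.comul x : H.carrier ⊗[k] H.carrier)) h
      simp only [map_add, map_zero] at h1
      rw [hD0 _ (hFT w hw), hDb _ (hFT w' hw'), zero_add] at h1
      rw [h1, mul_zero, add_zero] at h
      rw [ih2 w' hw' h1, ih2 w hw h, mul_zero, add_zero]

/-- A Hopf algebra with trivial degree zero part, on which the sign involution is the antipode, is
an exterior algebra on odd primitive generators. -/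
theorem isOddExterior_of_conv_tau (h2 : (2 : k) ≠ 0)
    (hτ : conv H.toGrAlg.tau (𝟙 _) = H.triv H.toGrAlg)
    (h0 : ∀ a ∈ H.grading 0, ∃ c : k, a = c • 1) : H.IsOddExterior := by
  classical
  refine ⟨Submodule.span k H.oddPrim, Submodule.span_le.2 fun v hv => ?_,
    fun v => comul_of_mem_span_oddPrim, fun v => mul_self_of_mem_span_oddPrim h2 v.2, ?_⟩
  · obtain ⟨-, m, hm, h⟩ := id hv
    exact Submodule.mem_iSup_of_mem m (Submodule.mem_iSup_of_mem hm ⟨Submodule.subset_span hv, h⟩)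
  set F := ExteriorAlgebra.lift k ⟨(Submodule.span k H.oddPrim).subtype,
    fun v => mul_self_of_mem_span_oddPrim h2 v.2⟩
  have hF : ∀ v, F (ExteriorAlgebra.ι k v) = v := fun v => ExteriorAlgebra.lift_ι_apply k _ _ v
  constructor
  · rw [injective_iff_map_eq_zero]
    intro y hy
    -- A basis of the generating space is chosen among the homogeneous odd primitives; a given `y`
    -- involves only finitely many of its members.
    obtain ⟨B, hB, hspan, hli⟩ := exists_linearIndependent k
      (Subtype.val ⁻¹' H.oddPrim : Set (Submodule.span k H.oddPrim))
    rw [Submodule.span_span_coe_preimage] at hspan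
    have htop : y ∈ Algebra.adjoin k (ExteriorAlgebra.ι k '' B) := by
      have : Algebra.adjoin k (ExteriorAlgebra.ι k '' B) = ⊤ := by
        rw [← CliffordAlgebra.adjoin_range_ι, ← Algebra.adjoin_span, ← Submodule.map_span, hspan,
          Submodule.map_top]
        rfl
      rw [this]; trivial
    obtain ⟨T', hT', hy'⟩ := exists_finset_mem_adjoin htop
    obtain ⟨T, hT, rfl⟩ := Finset.subset_set_image_iff.1 hT'
    rw [Finset.coe_image] at hy'
    exact (injective_lift_adjoin h2 h0 F hF T (fun v hv => hB (hT hv))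
      (LinearIndepOn.mono hli hT)).2 y hy' hy
  · rw [← AlgHom.range_eq_top, eq_top_iff, ← adjoin_oddPrim_eq_top h2 hτ h0]
    exact Algebra.adjoin_le fun v hv => ⟨ExteriorAlgebra.ι k ⟨v, Submodule.subset_span hv⟩, hF _⟩

end GrHopf

end

/-! ### Characterisation of odd affine groups -/

noncomputable section

open GrAlg

namespace GrAlg

variable {k : Type u} [Field k]

lemma tau_comp_deg0 (A : GrAlg k) : A.tau ≫ A.deg0 = A.deg0 := by
  rw [← tau_naturality]
  refine hom_ext' fun a => ?_
  rw [GrAlg.comp_apply, deg0_apply, A.tau_apply (A.proj_mem 0 a), pow_zero, one_smul]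

end GrAlg

namespace GrHopf

variable {k : Type u} [Field k] {H : GrHopf k}

lemma IsOddExterior.adjoin_eq_top (h : H.IsOddExterior) : Algebra.adjoin k H.oddPrim = ⊤ := by
  obtain ⟨V, hV, hprim, hsq, hbij⟩ := h
  have hV' : V ≤ Submodule.span k H.oddPrim := fun v hv => by
    refine (hV.trans (iSup₂_le fun m hm => ?_)) hv
    exact fun w hw => Submodule.subset_span ⟨hprim w hw.1, m, hm, hw.2⟩
  rw [eq_top_iff, ← AlgHom.range_eq_top _ |>.2 hbij.2, ← Algebra.map_top,
    ← CliffordAlgebra.adjoin_range_ι, AlgHom.map_adjoin]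
  refine Algebra.adjoin_le ?_
  rintro _ ⟨_, ⟨v, rfl⟩, rfl⟩
  have h1 : ExteriorAlgebra.lift k ⟨V.subtype, hsq⟩ (ExteriorAlgebra.ι k v) = v :=
    ExteriorAlgebra.lift_ι_apply k _ _ v
  change ExteriorAlgebra.lift k ⟨V.subtype, hsq⟩ (ExteriorAlgebra.ι k v) ∈ Algebra.adjoin k H.oddPrim
  rw [h1]
  exact Algebra.span_le_adjoin k _ (hV' v.2)

lemma IsOddExterior.hom_ext (h : H.IsOddExterior) {B : GrAlg k} {f g : H.toGrAlg ⟶ B}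
    (hfg : ∀ v ∈ H.oddPrim, f.toAlgHom v = g.toAlgHom v) : f = g := by
  have : f.toAlgHom = g.toAlgHom :=
    AlgHom.ext_of_adjoin_eq_top h.adjoin_eq_top hfg
  exact hom_ext' fun a => by rw [this]

lemma conv_oddPrim {B : GrAlg k} (f g : H.toGrAlg ⟶ B) {v : H.carrier} (hv : v ∈ H.oddPrim) :
    (conv f g).toAlgHom v = f.toAlgHom v + g.toAlgHom v := by
  rw [conv_apply, hv.1]
  simp

lemma triv_oddPrim (B : GrAlg k) {v : H.carrier} (hv : v ∈ H.oddPrim) :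
    (H.triv B).toAlgHom v = 0 := by
  rw [triv_apply, counit_of_prim hv.1, map_zero]

lemma npow_oddPrim {v : H.carrier} (hv : v ∈ H.oddPrim) (m : ℕ) :
    (H.npow m).toAlgHom v = m • v := by
  induction m with
  | zero => rw [npow, triv_oddPrim _ hv, zero_nsmul]
  | succ m ih => rw [npow, conv_oddPrim _ _ hv, ih, GrAlg.id_apply, succ_nsmul]

lemma IsOddExterior.conv_tau (h : H.IsOddExterior) :
    conv H.toGrAlg.tau (𝟙 _) = H.triv H.toGrAlg :=
  h.hom_ext fun v hv => by
    rw [conv_oddPrim _ _ hv, triv_oddPrim _ hv, tau_oddPrim hv, GrAlg.id_apply, neg_add_cancel]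

lemma npow_apply_eq_triv {R : FinGrAlg k} (f : DualCoalgHom R H) {m : ℕ} (h : elem f.toLin ^ m = 1)
    (ξ : Module.Dual k R.obj.carrier) :
    (H.npow m).toAlgHom (f.toLin ξ) = (H.triv H.toGrAlg).toAlgHom (f.toLin ξ) := by
  have h1 := elem_npow f (𝟙 H.toGrAlg) m
  have h2 := elem_npow f (𝟙 H.toGrAlg) 0
  rw [Category.comp_id] at h1 h2
  exact LinearMap.congr_fun (elem_injective (h1.trans (h.trans ((pow_zero _).symm.trans h2.symm)))) ξ

variable (p : ℕ) [CharP k p]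

lemma IsOddExterior.npow_eq_triv (h : H.IsOddExterior) : H.npow p = H.triv H.toGrAlg :=
  h.hom_ext fun v hv => by
    rw [npow_oddPrim hv, triv_oddPrim _ hv, ← Nat.cast_smul_eq_nsmul k, CharP.cast_eq_zero, zero_smul]

lemma IsOddExterior.isPrimary (h : H.IsOddExterior) : H.IsPrimary p := fun R f => by
  refine ⟨1, ?_⟩
  have h1 := elem_npow f (𝟙 H.toGrAlg) p
  rw [h.npow_eq_triv p] at h1
  rw [pow_one]
  exact h1.symm.trans ((elem_npow f (𝟙 H.toGrAlg) 0).trans (pow_zero _))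

end GrHopf

section Affine

open GrHopf

variable {k : Type u} [Field k] [PerfectField k] {G : GrAlg k ⥤ AddCommGrpCat.{u}} {H : GrHopf k}
  {e : ∀ R : GrAlg k, G.obj R ≃ (H.toGrAlg ⟶ (𝟭 (GrAlg k)).obj R)}

lemma GrHopf.RepBy.affTau_eq_neg_iff (he : RepBy e) :
    affTau G = -𝟙 G ↔ conv H.toGrAlg.tau (𝟙 _) = H.triv H.toGrAlg := by
  rw [← add_eq_zero_iff_eq_neg]
  refine he.endo_eq_iff (fun R x => ?_) he.zero_app
  refine (he.add R _ x).trans ?_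
  rw [he.affTau_apply, conv_comp, Category.id_comp]

variable (p : ℕ) [Fact p.Prime] [CharP k p]

lemma isOddAffine_iff (hp : Odd p) :
    isOddAffine k G ↔ isAffineGroup k G ∧ affTau G = -𝟙 G ∧ IsIso (𝟙 G + 𝟙 G) := by
  constructor
  · rintro ⟨h, H, hH, h2⟩
    obtain ⟨e, he⟩ := represents_iff.1 hH
    exact ⟨h, he.affTau_eq_neg_iff.2 h2.conv_tau,
      he.isIso_two ((h2.isPrimary p).bijective_npow_two hp)⟩
  · rintro ⟨h, hτ, h2⟩
    obtain ⟨H, e, he⟩ := exists_repBy h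
    refine ⟨h, H, represents_iff.2 ⟨e, he⟩, isOddExterior_of_conv_tau ?_
      (he.affTau_eq_neg_iff.1 hτ) fun a ha => ⟨Coalgebra.counit a, ?_⟩⟩
    · refine Ring.two_ne_zero ?_
      rw [ringChar.eq k p]
      rintro rfl
      exact absurd hp (by decide)
    -- The point given by the projection to degree zero is fixed by τ and also negated by it, so its
    -- double is zero. It is therefore the trivial point, which means that the degree zero part of
    -- `H` consists of scalars.
    obtain ⟨x, hx⟩ := (e H.toGrAlg).surjective H.toGrAlg.deg0
    have h3 : (affTau G).app _ x = x := (e _).injective (by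
      rw [he.affTau_apply, hx]; exact H.toGrAlg.tau_comp_deg0)
    have h4 : x + x = 0 + 0 := by
      have : x = -x := h3.symm.trans (congrArg (fun φ : G ⟶ G => φ.app _ x) hτ)
      rw [add_zero]
      exact add_eq_zero_iff_eq_neg.2 this
    have h5 : x = 0 := (isIso_two_iff.1 h2 H.toGrAlg).1 h4
    rw [h5, he.zero] at hx
    have h6 := congrArg (fun f : H.toGrAlg ⟶ H.toGrAlg => f.toAlgHom a) hx
    have h7 := triv_apply (H := H) H.toGrAlg a
    rw [← Algebra.algebraMap_eq_smul_one]
    refine Eq.trans ?_ (h7.symm.trans h6).symm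
    rw [deg0_apply, H.toGrAlg.proj_of_mem ha]

end Affine

end

/-! ### Sub-Hopf algebras and the quotient groups they represent -/

noncomputable section

open GrAlg

namespace GrAlg

variable {k : Type u} [Field k]

lemma eq_of_comp_injective {A B C : GrAlg k} {j : B ⟶ C} (hj : Function.Injective j.toAlgHom)
    {f g : A ⟶ B} (h : f ≫ j = g ≫ j) : f = g :=
  hom_ext' fun a => hj (congrArg (fun φ : A ⟶ C => φ.toAlgHom a) h)

lemma exists_factor_of_injective {A B C : GrAlg k} (j : A ⟶ B)
    (hj : Function.Injective j.toAlgHom) (f : C ⟶ B) (h : ∀ c, ∃ a, j.toAlgHom a = f.toAlgHom c) :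
    ∃ g : C ⟶ A, g ≫ j = f := by
  let q : C.carrier →ₐ[k] A.carrier := (AlgEquiv.ofInjective j.toAlgHom hj).symm.toAlgHom.comp
    (f.toAlgHom.codRestrict j.toAlgHom.range h)
  have hq : ∀ c, j.toAlgHom (q c) = f.toAlgHom c := fun c =>
    congrArg Subtype.val ((AlgEquiv.ofInjective j.toAlgHom hj).apply_symm_apply _)
  refine ⟨⟨q, fun n c hc => ?_⟩, hom_ext' hq⟩
  rw [A.mem_iff_proj]
  apply hj
  rw [← hom_proj, hq, B.proj_of_mem (f.map_mem n c hc)]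

/-- The tensor product of two morphisms. -/
def tensorMap {A B A' B' : GrAlg k} (f : A ⟶ A') (g : B ⟶ B') : tensor A B ⟶ tensor A' B' :=
  tensorDesc (f ≫ tensorInl A' B') (g ≫ tensorInr A' B')

lemma tensorMap_tmk {A B A' B' : GrAlg k} (f : A ⟶ A') (g : B ⟶ B') (z : A.carrier ⊗[k] B.carrier) :
    (tensorMap f g).toAlgHom (tmk A B z) =
      tmk A' B' (TensorProduct.map f.toAlgHom.toLinearMap g.toAlgHom.toLinearMap z) := by
  suffices (tensorMap f g).toAlgHom.toLinearMap ∘ₗ tmk A B =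
      tmk A' B' ∘ₗ TensorProduct.map f.toAlgHom.toLinearMap g.toAlgHom.toLinearMap from
    LinearMap.congr_fun this z
  refine TensorProduct.ext' fun a b => ?_
  exact tensorInl_mul_tensorInr A' B' (f.toAlgHom a) (g.toAlgHom b)

lemma tensorMap_injective {A B A' B' : GrAlg k} {f : A ⟶ A'} {g : B ⟶ B'}
    (hf : Function.Injective f.toAlgHom) (hg : Function.Injective g.toAlgHom) :
    Function.Injective (tensorMap f g).toAlgHom := by
  intro x y h
  obtain ⟨x, rfl⟩ := tmk_surjective A B x
  obtain ⟨y, rfl⟩ := tmk_surjective A B y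
  rw [tensorMap_tmk, tensorMap_tmk] at h
  exact congrArg _ (TensorProduct.map_injective_of_flat_flat f.toAlgHom.toLinearMap
    g.toAlgHom.toLinearMap hf hg (tmk_injective A' B' h))

@[simp] lemma tensorInl_map {A B A' B' : GrAlg k} (f : A ⟶ A') (g : B ⟶ B') :
    tensorInl A B ≫ tensorMap f g = f ≫ tensorInl A' B' := tensorInl_desc _ _

@[simp] lemma tensorInr_map {A B A' B' : GrAlg k} (f : A ⟶ A') (g : B ⟶ B') :
    tensorInr A B ≫ tensorMap f g = g ≫ tensorInr A' B' := tensorInr_desc _ _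

lemma tensorMap_comp {A A' A'' B B' B'' : GrAlg k} (f : A ⟶ A') (g : B ⟶ B') (f' : A' ⟶ A'')
    (g' : B' ⟶ B'') : tensorMap f g ≫ tensorMap f' g' = tensorMap (f ≫ f') (g ≫ g') :=
  tensor_hom_ext' (by rw [← Category.assoc]; simp) (by rw [← Category.assoc]; simp)

@[simp] lemma tensorMap_desc {A B A' B' C : GrAlg k} (f : A ⟶ A') (g : B ⟶ B') (a : A' ⟶ C)
    (b : B' ⟶ C) : tensorMap f g ≫ tensorDesc a b = tensorDesc (f ≫ a) (g ≫ b) := by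
  rw [tensorMap, tensorDesc_comp, Category.assoc, Category.assoc, tensorInl_desc, tensorInr_desc]

end GrAlg

namespace GrHopf

variable {k : Type u} [Field k] {H : GrHopf k} {G : GrAlg k ⥤ AddCommGrpCat.{u}}
  {e : ∀ R : GrAlg k, G.obj R ≃ (H.toGrAlg ⟶ (𝟭 (GrAlg k)).obj R)}

lemma RepBy.conv_assoc (he : RepBy e) {B : GrAlg k} (f g h : H.toGrAlg ⟶ B) :
    conv (conv f g) h = conv f (conv g h) := by
  obtain ⟨x, rfl⟩ := (e B).surjective f
  obtain ⟨y, rfl⟩ := (e B).surjective g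
  obtain ⟨z, rfl⟩ := (e B).surjective h
  have h1 := he.add B (x + y) z
  rw [add_assoc, he.add, he.add, he.add] at h1
  exact h1.symm

lemma RepBy.conv_comm (he : RepBy e) {B : GrAlg k} (f g : H.toGrAlg ⟶ B) : conv f g = conv g f := by
  obtain ⟨x, rfl⟩ := (e B).surjective f
  obtain ⟨y, rfl⟩ := (e B).surjective g
  have h1 := he.add B x y
  rw [add_comm, he.add] at h1
  exact h1.symm

/-- The antipode of a Hopf algebra representing a group-valued functor. -/
def RepBy.negHom (he : RepBy e) : H.toGrAlg ⟶ H.toGrAlg := (he.exists_hom he (-𝟙 G)).choose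

lemma RepBy.isComulHom_negHom (he : RepBy e) : IsComulHom he.negHom :=
  (he.exists_hom he (-𝟙 G)).choose_spec.1

lemma RepBy.conv_negHom (he : RepBy e) : conv he.negHom (𝟙 _) = H.triv H.toGrAlg := by
  obtain ⟨x, hx⟩ := (e H.toGrAlg).surjective (𝟙 _)
  have h1 : e H.toGrAlg (-x) = he.negHom :=
    ((he.exists_hom he (-𝟙 G)).choose_spec.2 H.toGrAlg x).trans
      ((congrArg (he.negHom ≫ ·) hx).trans (Category.comp_id he.negHom))
  have h2 := he.add _ (-x) x
  rw [neg_add_cancel, he.zero] at h2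
  exact ((congrArg₂ conv h1.symm hx.symm).trans h2.symm)

section Sub

variable {S S' : Subalgebra k H.carrier} (hS : H.IsSubcoalg (Subalgebra.toSubmodule S))
  (hS' : H.IsSubcoalg (Subalgebra.toSubmodule S'))

/-- A homogeneous subbialgebra as a graded algebra. -/
abbrev subAlg : GrAlg k := GrAlg.sub H.toGrAlg S hS.proj

lemma exists_subComulHom : ∃ Δ : subAlg hS ⟶ tensor (subAlg hS) (subAlg hS),
    Δ ≫ tensorMap (subIncl H.toGrAlg S hS.proj) (subIncl H.toGrAlg S hS.proj) =
      subIncl H.toGrAlg S hS.proj ≫ H.comulHom := by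
  refine exists_factor_of_injective _ (tensorMap_injective (subIncl_injective _ _ _)
    (subIncl_injective _ _ _)) _ fun c => ?_
  obtain ⟨w, hw⟩ := hS.comul_mem (subIncl_mem H.toGrAlg S hS.proj c)
  exact ⟨tmk (subAlg hS) (subAlg hS) w, (tensorMap_tmk (subIncl H.toGrAlg S hS.proj)
    (subIncl H.toGrAlg S hS.proj) w).trans (congrArg (tmk H.toGrAlg H.toGrAlg) hw)⟩

/-- The comultiplication of a homogeneous subbialgebra. -/
def subComulHom : subAlg hS ⟶ tensor (subAlg hS) (subAlg hS) := (exists_subComulHom hS).choose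

lemma subComulHom_map :
    subComulHom hS ≫ tensorMap (subIncl H.toGrAlg S hS.proj) (subIncl H.toGrAlg S hS.proj) =
      subIncl H.toGrAlg S hS.proj ≫ H.comulHom := (exists_subComulHom hS).choose_spec

lemma subIncl_conv {B : GrAlg k} (f g : H.toGrAlg ⟶ B) :
    subIncl H.toGrAlg S hS.proj ≫ conv f g = subComulHom hS ≫ tensorDesc
      (subIncl H.toGrAlg S hS.proj ≫ f) (subIncl H.toGrAlg S hS.proj ≫ g) := by
  rw [conv, ← Category.assoc, ← subComulHom_map, Category.assoc, tensorMap_desc]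

/-- The inclusion of homogeneous subbialgebras. -/
def subInclusion (h : S ≤ S') : subAlg hS ⟶ subAlg hS' :=
  subLift _ _ _ (subIncl H.toGrAlg S hS.proj) fun x => h x.2

lemma subComulHom_inclusion (h : S ≤ S') :
    subComulHom hS ≫ tensorMap (subInclusion hS hS' h) (subInclusion hS hS' h) =
      subInclusion hS hS' h ≫ subComulHom hS' := by
  refine eq_of_comp_injective (tensorMap_injective (subIncl_injective H.toGrAlg S' hS'.proj)
    (subIncl_injective H.toGrAlg S' hS'.proj)) ?_
  rw [Category.assoc, Category.assoc, subComulHom_map, tensorMap_comp]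
  exact subComulHom_map hS

variable (he : RepBy e) (hn : ∀ x ∈ S, he.negHom.toAlgHom x ∈ S)

include hn in
lemma exists_subNegHom : ∃ s : subAlg hS ⟶ subAlg hS,
    s ≫ subIncl H.toGrAlg S hS.proj = subIncl H.toGrAlg S hS.proj ≫ he.negHom :=
  ⟨subLift _ _ _ (subIncl H.toGrAlg S hS.proj ≫ he.negHom) fun x => hn _ (subIncl_mem H.toGrAlg S hS.proj x), rfl⟩

/-- The group structure on the points of a homogeneous sub-Hopf algebra. -/
@[reducible] def subGroup (B : GrAlg k) : AddCommGroup (subAlg hS ⟶ B) :=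
  letI i := subIncl H.toGrAlg S hS.proj
  letI : Add (subAlg hS ⟶ B) := ⟨fun f g => subComulHom hS ≫ tensorDesc f g⟩
  letI : Zero (subAlg hS ⟶ B) := ⟨i ≫ H.triv B⟩
  letI : Neg (subAlg hS ⟶ B) := ⟨fun f => (exists_subNegHom hS he hn).choose ≫ f⟩
  have hi : Function.Injective i.toAlgHom := subIncl_injective _ _ _
  have nat : ∀ {C D : GrAlg k} (f g : subAlg hS ⟶ C) (h : C ⟶ D),
      subComulHom hS ≫ tensorDesc (f ≫ h) (g ≫ h) = (subComulHom hS ≫ tensorDesc f g) ≫ h :=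
    fun f g h => by rw [Category.assoc, tensorDesc_comp]
  { AddGroup.ofLeftAxioms
      (fun f g h => by
        change subComulHom hS ≫ tensorDesc (subComulHom hS ≫ tensorDesc f g) h =
          subComulHom hS ≫ tensorDesc f (subComulHom hS ≫ tensorDesc g h)
        let K := subAlg hS
        let a := tensorInl K (tensor K K)
        let b := tensorInl K K ≫ tensorInr K (tensor K K)
        let c := tensorInr K K ≫ tensorInr K (tensor K K)
        let q := tensorDesc f (tensorDesc g h)
        -- Associativity is proved for the universal triple of points, where it can be tested after
        -- the injection into H ⊗ (H ⊗ H), and then specialised along `q`.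
        have key : subComulHom hS ≫ tensorDesc (subComulHom hS ≫ tensorDesc a b) c =
            subComulHom hS ≫ tensorDesc a (subComulHom hS ≫ tensorDesc b c) := by
          refine eq_of_comp_injective (tensorMap_injective hi (tensorMap_injective hi hi)) ?_
          rw [← nat, ← nat, ← nat, ← nat]
          have ha : a ≫ tensorMap i (tensorMap i i) = i ≫ tensorInl _ _ := tensorInl_map _ _
          have hb : b ≫ tensorMap i (tensorMap i i) = i ≫ tensorInl _ _ ≫ tensorInr _ _ := by
            rw [Category.assoc, tensorInr_map, ← Category.assoc, tensorInl_map, Category.assoc]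
          have hc : c ≫ tensorMap i (tensorMap i i) = i ≫ tensorInr _ _ ≫ tensorInr _ _ := by
            rw [Category.assoc, tensorInr_map, ← Category.assoc, tensorInr_map, Category.assoc]
          rw [ha, hb, hc, ← subIncl_conv, ← subIncl_conv, ← subIncl_conv, ← subIncl_conv,
            he.conv_assoc]
        have ha : a ≫ q = f := tensorInl_desc _ _
        have hb : b ≫ q = g := by rw [Category.assoc, tensorInr_desc, tensorInl_desc]
        have hc : c ≫ q = h := by rw [Category.assoc, tensorInr_desc, tensorInr_desc]
        have := congrArg (· ≫ q) key
        simp only [← nat, ha, hb, hc] at this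
        exact this)
      (fun f => by
        change subComulHom hS ≫ tensorDesc (i ≫ H.triv B) f = f
        have key : subComulHom hS ≫ tensorDesc (i ≫ H.triv _) (𝟙 _) = 𝟙 (subAlg hS) := by
          refine eq_of_comp_injective hi ?_
          rw [← nat, Category.assoc, triv_comp, Category.id_comp]
          have := subIncl_conv hS (H.triv H.toGrAlg) (𝟙 _)
          rw [triv_conv, Category.comp_id] at this
          exact this.symm
        have := congrArg (· ≫ f) key
        simp only [← nat, Category.assoc, triv_comp, Category.id_comp] at this
        exact this)
      (fun f => by
        let s := (exists_subNegHom hS he hn).choose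
        have hs : s ≫ i = i ≫ he.negHom := (exists_subNegHom hS he hn).choose_spec
        change subComulHom hS ≫ tensorDesc (s ≫ f) f = i ≫ H.triv B
        have key : subComulHom hS ≫ tensorDesc s (𝟙 _) = i ≫ H.triv (subAlg hS) := by
          refine eq_of_comp_injective hi ?_
          rw [← nat, Category.assoc, triv_comp, Category.id_comp, hs, ← he.conv_negHom,
            subIncl_conv, Category.comp_id]
        have := congrArg (· ≫ f) key
        simp only [← nat, Category.assoc, triv_comp, Category.id_comp] at this
        exact this) with
    add_comm := fun f g => by
      change subComulHom hS ≫ tensorDesc f g = subComulHom hS ≫ tensorDesc g f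
      let a := tensorInl (subAlg hS) (subAlg hS)
      let b := tensorInr (subAlg hS) (subAlg hS)
      have key : subComulHom hS ≫ tensorDesc a b = subComulHom hS ≫ tensorDesc b a := by
        refine eq_of_comp_injective (tensorMap_injective hi hi) ?_
        rw [← nat, ← nat, tensorInl_map, tensorInr_map, ← subIncl_conv, ← subIncl_conv, he.conv_comm]
      have := congrArg (· ≫ tensorDesc f g) key
      simp only [← nat] at this
      rwa [tensorInl_desc, tensorInr_desc] at this }

/-- The affine group represented by a homogeneous sub-Hopf algebra. -/
def subFunctor : GrAlg k ⥤ AddCommGrpCat.{u} where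
  obj B := letI := subGroup hS he hn B; AddCommGrpCat.of (subAlg hS ⟶ B)
  map {B C} f := letI := subGroup hS he hn B; letI := subGroup hS he hn C
    AddCommGrpCat.ofHom (AddMonoidHom.mk' (fun x : subAlg hS ⟶ B => x ≫ f) fun x y => by
      change (subComulHom hS ≫ tensorDesc x y) ≫ f = subComulHom hS ≫ tensorDesc (x ≫ f) (y ≫ f)
      rw [Category.assoc, tensorDesc_comp])
  map_id B := ConcreteCategory.hom_ext _ _ fun x => Category.comp_id (X := subAlg hS) x
  map_comp f g := ConcreteCategory.hom_ext _ _ fun x =>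
    (Category.assoc (W := subAlg hS) x f g).symm

lemma isAffineGroup_subFunctor : isAffineGroup k (subFunctor hS he hn) :=
  ⟨subAlg hS, ⟨⟨fun {R} => Equiv.refl _, fun f x => rfl⟩⟩⟩

/-- The projection of a represented functor to the one represented by a sub-Hopf algebra. -/
def subRestrict : G ⟶ subFunctor hS he hn where
  app B := letI := subGroup hS he hn B
    AddCommGrpCat.ofHom (AddMonoidHom.mk' (fun x : G.obj B => subIncl H.toGrAlg S hS.proj ≫ e B x)
      fun x y => (congrArg _ (he.add B x y)).trans (subIncl_conv hS _ _))
  naturality B C f := by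
    ext x
    exact (congrArg (subIncl H.toGrAlg S hS.proj ≫ ·) (he.natural B C f x)).trans
      (Category.assoc _ (e B x : H.toGrAlg ⟶ B) f).symm

/-- The restriction between functors represented by sub-Hopf algebras. -/
def subRes (hn' : ∀ x ∈ S', he.negHom.toAlgHom x ∈ S') (h : S ≤ S') :
    subFunctor hS' he hn' ⟶ subFunctor hS he hn where
  app B := letI := subGroup hS he hn B; letI := subGroup hS' he hn' B
    AddCommGrpCat.ofHom (AddMonoidHom.mk' (fun x : subAlg hS' ⟶ B => subInclusion hS hS' h ≫ x)
      fun x y => by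
        change subInclusion hS hS' h ≫ subComulHom hS' ≫ tensorDesc x y =
          subComulHom hS ≫ tensorDesc (subInclusion hS hS' h ≫ x) (subInclusion hS hS' h ≫ y)
        rw [← Category.assoc, ← subComulHom_inclusion, Category.assoc, tensorMap_desc])
  naturality B C f := by
    ext x
    exact (Category.assoc (subInclusion hS hS' h) (x : subAlg hS' ⟶ B) f).symm

lemma subRestrict_res (hn' : ∀ x ∈ S', he.negHom.toAlgHom x ∈ S') (h : S ≤ S') :
    subRestrict hS' he hn' ≫ subRes hS hS' he hn hn' h = subRestrict hS he hn := by
  ext B x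
  rfl

lemma subRes_self (h : S ≤ S) : subRes hS hS he hn hn h = 𝟙 _ := by
  ext B x
  exact Category.id_comp (X := subAlg hS) x

lemma subRes_comp {S'' : Subalgebra k H.carrier} (hS'' : H.IsSubcoalg (Subalgebra.toSubmodule S''))
    (hn' : ∀ x ∈ S', he.negHom.toAlgHom x ∈ S') (hn'' : ∀ x ∈ S'', he.negHom.toAlgHom x ∈ S'')
    (h : S ≤ S') (h' : S' ≤ S'') :
    subRes hS' hS'' he hn' hn'' h' ≫ subRes hS hS' he hn hn' h =
      subRes hS hS'' he hn hn'' (h.trans h') := by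
  ext B x
  exact (Category.assoc (subInclusion hS hS' h) (subInclusion hS' hS'' h') (x : subAlg hS'' ⟶ B)).symm

/-- Every point is the image of the universal one, so it is enough that `m` kills the latter. After
the inclusion into `H` it becomes the restriction to `S` of the universal point of `G`, on which `m`
is trivial by `hm`. -/
lemma nsmul_subFunctor (m : ℕ)
    (hm : ∀ x ∈ S, (H.npow m).toAlgHom x = (H.triv H.toGrAlg).toAlgHom x) {B : GrAlg k}
    (f : (subFunctor hS he hn).obj B) : m • f = 0 := by
  let i := subIncl H.toGrAlg S hS.proj
  let F := subFunctor hS he hn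
  let one : F.obj (subAlg hS) := 𝟙 (subAlg hS)
  obtain ⟨x, hx⟩ := (e H.toGrAlg).surjective (𝟙 _)
  let r := (subRestrict hS he hn).app H.toGrAlg
  have h1 : F.map i one = r x := (Category.id_comp i).trans
    ((Category.comp_id i).symm.trans (congrArg (i ≫ ·) hx.symm))
  have h2 : r (m • x) = r 0 := by
    have h3 : e H.toGrAlg (m • x) = H.npow m :=
      (he.nsmul m _ x).trans ((congrArg (H.npow m ≫ ·) hx).trans (Category.comp_id (H.npow m)))
    refine (congrArg (i ≫ ·) h3).trans (Eq.trans ?_ (congrArg (i ≫ ·) (he.zero _)).symm)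
    exact hom_ext' fun x => hm _ (subIncl_mem H.toGrAlg S hS.proj x)
  have h4 : m • one = 0 := by
    refine eq_of_comp_injective (subIncl_injective H.toGrAlg S hS.proj) ?_
    change F.map i (m • one) = F.map i 0
    rw [map_nsmul, map_zero, h1, ← map_nsmul, h2, map_zero]
  have h5 : f = F.map f one := (Category.id_comp (X := subAlg hS) f).symm
  rw [h5, ← map_nsmul, h4, map_zero]

end Sub

end GrHopf

end

/-! ### Affine groups with values in pro-p-groups -/

noncomputable section

open GrAlg

namespace GrHopf

variable {k : Type u} [Field k] {H : GrHopf k}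

lemma IsComulHom.comp_npow {H H' : GrHopf k} {h : H.toGrAlg ⟶ H'.toGrAlg} (hh : IsComulHom h)
    (h1 : h ≫ H'.triv H'.toGrAlg = H.triv H'.toGrAlg) (m : ℕ) :
    h ≫ H'.npow m = H.npow m ≫ h := by
  induction m with
  | zero => rw [npow, npow, h1, triv_comp]
  | succ m ih => rw [npow, npow, hh.comp_conv, conv_comp, ih, Category.comp_id, Category.id_comp]

variable (H) in
/-- The subalgebra representing the largest quotient group killed by `q`. -/
def powKer (q : ℕ) : Subalgebra k H.carrier :=
  AlgHom.equalizer (H.comulHom ≫ tensorMap (𝟙 _) (H.npow q)).toAlgHom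
    (tensorInl H.toGrAlg H.toGrAlg).toAlgHom

/-- The definition says x(g + q h) = x(g): these are the functions invariant under translation by
multiples of `q`. Contraction makes this a condition on the second factors of the coproduct. -/
lemma mem_powKer {q : ℕ} {x : H.carrier} : x ∈ H.powKer q ↔ ∀ φ : H.carrier →ₗ[k] k,
    (H.npow q).toAlgHom (lcontr φ (Coalgebra.comul x : H.carrier ⊗[k] H.carrier)) = φ x • 1 := by
  have h1 : x ∈ H.powKer q ↔ TensorProduct.map LinearMap.id (H.npow q).toAlgHom.toLinearMap
      (Coalgebra.comul x) = x ⊗ₜ[k] (1 : H.carrier) := by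
    rw [powKer, AlgHom.mem_equalizer, GrAlg.comp_apply, comulHom_apply, tensorMap_tmk,
      tensorInl_apply]
    exact (tmk_injective H.toGrAlg H.toGrAlg).eq_iff
  rw [h1]
  constructor
  · intro h φ
    have := lcontr_map φ LinearMap.id (H.npow q).toAlgHom.toLinearMap (Coalgebra.comul x)
    rw [h, lcontr_tmul, LinearMap.comp_id] at this
    exact this.symm
  · intro h
    rw [← sub_eq_zero]
    refine eq_zero_of_lcontr fun φ => ?_
    rw [map_sub, lcontr_map, lcontr_tmul, LinearMap.comp_id, ← h φ]
    exact sub_self _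

lemma isSubcoalg_powKer (q : ℕ) : H.IsSubcoalg (Subalgebra.toSubmodule (H.powKer q)) := by
  have hproj : ∀ n, ∀ x ∈ Subalgebra.toSubmodule (H.powKer q),
      H.toGrAlg.proj n x ∈ Subalgebra.toSubmodule (H.powKer q) := fun n x hx => by
    change _ = _
    refine (hom_proj _ n x).symm.trans (Eq.trans ?_ (hom_proj _ n x))
    exact congrArg _ hx
  have hleft : ∀ x ∈ Subalgebra.toSubmodule (H.powKer q), ∀ φ : H.carrier →ₗ[k] k,
      lcontr φ (Coalgebra.comul x : H.carrier ⊗[k] H.carrier) ∈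
        Subalgebra.toSubmodule (H.powKer q) := fun x hx φ => by
    refine mem_powKer.2 fun χ => ?_
    rw [lcontr_coassoc, mem_powKer.1 hx, LinearMap.comp_apply, LinearMap.comp_apply, mul'_map_eq]
  exact ⟨hleft, fun x hx => rcontr_comm hproj (hleft x hx) (H.graded_cocomm x), hproj⟩

lemma npow_apply_of_mem_powKer {q : ℕ} {x : H.carrier} (hx : x ∈ H.powKer q) :
    (H.npow q).toAlgHom x = (H.triv H.toGrAlg).toAlgHom x := by
  have := mem_powKer.1 hx Coalgebra.counit
  rw [lcontr_counit] at this
  rw [this, triv_apply, Algebra.algebraMap_eq_smul_one]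

lemma npow_apply_mul_eq_triv {q c : ℕ} {x : H.carrier} {a : k}
    (hx : (H.npow q).toAlgHom x = a • 1) : (H.npow (c * q)).toAlgHom x = a • 1 := by
  rw [← npow_comp_npow, GrAlg.comp_apply, hx, map_smul, map_one]

lemma powKer_mono {q q' : ℕ} (h : q ∣ q') : H.powKer q ≤ H.powKer q' := by
  obtain ⟨c, rfl⟩ := h
  intro x hx
  rw [mem_powKer] at hx ⊢
  intro φ
  rw [mul_comm]
  exact npow_apply_mul_eq_triv (hx φ)

lemma rcontr_counit (x : H.carrier) :
    rcontr Coalgebra.counit (Coalgebra.comul x : H.carrier ⊗[k] H.carrier) = x := by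
  rw [rcontr, LinearMap.comp_apply, Coalgebra.lTensor_counit_comul]
  simp

lemma exists_uniform {p : ℕ} (h : ∀ x : H.carrier, ∃ n,
    (H.npow (p ^ n)).toAlgHom x = (Coalgebra.counit x : k) • 1) (V : Submodule k H.carrier)
    [Module.Finite k V] :
    ∃ n, ∀ x ∈ V, (H.npow (p ^ n)).toAlgHom x = (Coalgebra.counit x : k) • 1 := by
  classical
  obtain ⟨t, ht⟩ := (Module.Finite.iff_fg.1 ‹_› : V.FG)
  choose n hn using h
  refine ⟨t.sup n, ?_⟩
  have : V ≤ LinearMap.eqLocus (H.npow (p ^ t.sup n)).toAlgHom.toLinearMap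
      (LinearMap.toSpanSingleton k H.carrier 1 ∘ₗ Coalgebra.counit) := by
    rw [← ht, Submodule.span_le]
    intro x hx
    obtain ⟨c, hc⟩ := pow_dvd_pow p (Finset.le_sup (f := n) hx)
    change (H.npow (p ^ t.sup n)).toAlgHom x = (Coalgebra.counit x : k) • 1
    rw [hc, mul_comm]
    exact npow_apply_mul_eq_triv (hn x)
  exact fun x hx => this hx

lemma isPrimary_iff {p : ℕ} : H.IsPrimary p ↔ ∀ x : H.carrier, ∃ n,
    (H.npow (p ^ n)).toAlgHom x = (Coalgebra.counit x : k) • 1 := by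
  constructor
  · intro h x
    obtain ⟨R, f, ξ, rfl⟩ := exists_eq_toLin x
    obtain ⟨n, hn⟩ := h R f
    refine ⟨n, ?_⟩
    rw [npow_apply_eq_triv f hn, triv_apply, Algebra.algebraMap_eq_smul_one]
  · intro h R f
    obtain ⟨n, hn⟩ := exists_uniform h (LinearMap.range f.toLin)
    refine ⟨n, ?_⟩
    have h1 := elem_npow f (𝟙 H.toGrAlg) (p ^ n)
    have h2 := elem_npow f (𝟙 H.toGrAlg) 0
    refine h1.symm.trans (Eq.trans (congrArg elem (LinearMap.ext fun ξ => ?_)) (h2.trans (pow_zero _)))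
    refine (hn _ ⟨ξ, rfl⟩).trans ?_
    refine Eq.trans (Algebra.algebraMap_eq_smul_one _).symm ?_
    exact (triv_apply (H := H) H.toGrAlg (f.toLin ξ)).symm

/-- The second factors of the coproduct span a finite-dimensional space, on which one power of `p`
acts trivially. -/
lemma IsPrimary.exists_mem_powKer {p : ℕ} (h : H.IsPrimary p) (x : H.carrier) :
    ∃ n, x ∈ H.powKer (p ^ n) := by
  haveI := lspan_finite (Coalgebra.comul x : H.carrier ⊗[k] H.carrier)
  obtain ⟨n, hn⟩ := exists_uniform (isPrimary_iff.1 h)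
    (lspan (Coalgebra.comul x : H.carrier ⊗[k] H.carrier))
  refine ⟨n, mem_powKer.2 fun φ => ?_⟩
  rw [hn _ (mem_lspan.2 ⟨φ, rfl⟩), ← rcontr_lcontr, rcontr_counit]

variable {G : GrAlg k ⥤ AddCommGrpCat.{u}}
  {e : ∀ R : GrAlg k, G.obj R ≃ (H.toGrAlg ⟶ (𝟭 (GrAlg k)).obj R)}

lemma RepBy.triv_of_hom {H H' : GrHopf k} {G' : GrAlg k ⥤ AddCommGrpCat.{u}}
    {e : ∀ R : GrAlg k, G.obj R ≃ (H.toGrAlg ⟶ (𝟭 (GrAlg k)).obj R)} (he : RepBy e)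
    {e' : ∀ R : GrAlg k, G'.obj R ≃ (H'.toGrAlg ⟶ (𝟭 (GrAlg k)).obj R)} (he' : RepBy e')
    {φ : G ⟶ G'} {h : H'.toGrAlg ⟶ H.toGrAlg} (hφ : ∀ R x, e' R (φ.app R x) = h ≫ e R x)
    (B : GrAlg k) : h ≫ H.triv B = H'.triv B :=
  (congrArg (h ≫ ·) (he.zero B)).symm.trans ((hφ B 0).symm.trans
    ((congrArg (e' B) (map_zero (φ.app B).hom)).trans (he'.zero B)))

lemma RepBy.negHom_mem_powKer (he : RepBy e) {q : ℕ} {x : H.carrier} (hx : x ∈ H.powKer q) :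
    he.negHom.toAlgHom x ∈ H.powKer q := by
  rw [mem_powKer] at hx ⊢
  intro φ
  have h1 := he.triv_of_hom he (he.exists_hom he (-𝟙 G)).choose_spec.2 H.toGrAlg
  have h2 := he.isComulHom_negHom.comp_npow h1 q
  rw [he.isComulHom_negHom x, lcontr_map]
  have h3 := congrArg (fun f : H.toGrAlg ⟶ H.toGrAlg => f.toAlgHom
    (lcontr (φ ∘ₗ he.negHom.toAlgHom.toLinearMap) (Coalgebra.comul x : H.carrier ⊗[k] H.carrier))) h2
  refine h3.trans ?_
  rw [GrAlg.comp_apply, hx, map_smul, map_one]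
  rfl

end GrHopf

section PAdic

open GrHopf

variable {k : Type u} [Field k] {H : GrHopf k} {G : GrAlg k ⥤ AddCommGrpCat.{u}}
  {e : ∀ R : GrAlg k, G.obj R ≃ (H.toGrAlg ⟶ (𝟭 (GrAlg k)).obj R)} (p : ℕ)

/-- The inverse system of the quotients of a represented functor killed by powers of `p`. -/
def powDiagram (he : RepBy e) : (ULift.{u} ℕ)ᵒᵖ ⥤ GrAlg k ⥤ AddCommGrpCat.{u} where
  obj n := subFunctor (isSubcoalg_powKer (p ^ n.unop.down)) he fun _ => he.negHom_mem_powKer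
  map {m n} f := subRes _ _ he _ _ (powKer_mono (pow_dvd_pow p f.unop.le))
  map_id n := subRes_self _ he _ _
  map_comp f g := (subRes_comp _ _ he _ _ _ _ _ _).symm

/-- The projections of a represented functor to its quotients killed by powers of `p`. -/
def powCone (he : RepBy e) : Cone (powDiagram p he) where
  pt := G
  π := 
    { app := fun n => subRestrict _ he _
      naturality := fun m n f => (Category.id_comp _).trans (subRestrict_res _ _ he _ _ _).symm }

lemma isLimit_of_bijective {J : Type u} [SmallCategory J] {D : J ⥤ GrAlg k ⥤ AddCommGrpCat.{u}}
    (c : Cone D)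
    (h : ∀ B, Function.Bijective (Types.sectionOfCone (((evaluation _ AddCommGrpCat.{u}).obj B ⋙
      forget AddCommGrpCat.{u}).mapCone c))) : Nonempty (IsLimit c) :=
  ⟨evaluationJointlyReflectsLimits c fun B => isLimitOfReflects (forget AddCommGrpCat.{u})
    (((Types.isLimit_iff_bijective_sectionOfCone _).2 (h B)).some :)⟩

/-- `H` is the increasing union of its sub-Hopf algebras `powKer (p ^ n)`, so the group is the
inverse limit of quotients killed by p^n. -/
lemma isPAdicAffineGroup_of_isPrimary (he : RepBy e) (h : H.IsPrimary p) :
    isPAdicAffineGroup k p G := by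
  have hG : isAffineGroup k G := Represents.isAffine (represents_iff.2 ⟨e, he⟩)
  refine ⟨hG, (ULift.{u} ℕ)ᵒᵖ, inferInstance, inferInstance, powDiagram p he, powCone p he,
    fun n => isAffineGroup_subFunctor _ _ _, fun n B x => ⟨n.unop.down,
      nsmul_subFunctor _ _ _ _ (fun y hy => npow_apply_of_mem_powKer hy) x⟩,
    isLimit_of_bijective _ fun B => ⟨fun x y hxy => ?_, fun s => ?_⟩, ⟨Iso.refl _⟩⟩
  · refine (e B).injective (hom_ext' fun a => ?_)
    obtain ⟨n, hn⟩ := h.exists_mem_powKer a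
    have h1 := congrArg (fun s => s.1 (Opposite.op (ULift.up n))) hxy
    exact congrArg (fun f : subAlg (isSubcoalg_powKer (H := H) (p ^ n)) ⟶ B =>
      f.toAlgHom ⟨a, hn⟩) h1
  · let f : ∀ n : ℕ, subAlg (isSubcoalg_powKer (H := H) (p ^ n)) ⟶ B :=
      fun n => s.1 (Opposite.op (ULift.up n))
    have hf : ∀ {m n : ℕ} (hmn : m ≤ n),
        subInclusion _ _ (powKer_mono (pow_dvd_pow p hmn)) ≫ f n = f m := fun {m n} hmn =>
      s.2 (homOfLE (show ULift.up m ≤ ULift.up n from hmn)).op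
    have dir : Directed (· ≤ ·) fun n => H.powKer (p ^ n) :=
      Monotone.directed_le fun m n hmn => powKer_mono (pow_dvd_pow p hmn)
    have hf' : ∀ (m n : ℕ) (hmn : H.powKer (p ^ m) ≤ H.powKer (p ^ n)),
        (f m).toAlgHom = (f n).toAlgHom.comp (Subalgebra.inclusion hmn) := fun m n hmn => by
      rcases le_total m n with hl | hl
      · exact congrArg Hom.toAlgHom (hf hl).symm
      · refine AlgHom.ext fun (x : H.powKer (p ^ m)) => ?_
        exact congrArg (fun g : subAlg (isSubcoalg_powKer (H := H) (p ^ n)) ⟶ B =>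
          g.toAlgHom ⟨x, hmn x.2⟩) (hf hl)
    have htop : (⊤ : Subalgebra k H.carrier) ≤ ⨆ n, H.powKer (p ^ n) := fun x _ => by
      obtain ⟨n, hn⟩ := h.exists_mem_powKer x
      exact le_iSup (fun n => H.powKer (p ^ n)) n hn
    -- A compatible family of points of the quotients is glued to an algebra homomorphism on the
    -- union.
    let F : H.carrier →ₐ[k] B.carrier := (Subalgebra.iSupLift (fun n => H.powKer (p ^ n)) dir
      (fun n => (f n).toAlgHom) hf' ⊤ htop).comp Subalgebra.topEquiv.symm.toAlgHom
    have hF : ∀ (n : ℕ) (x : H.carrier) (hx : x ∈ H.powKer (p ^ n)),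
        F x = (f n).toAlgHom ⟨x, hx⟩ := fun n x hx =>
      Subalgebra.iSupLift_inclusion (fun n => H.powKer (p ^ n)) (dir := dir)
        (f := fun n => (f n).toAlgHom) (hf := hf') (hT := htop) ⟨x, hx⟩ le_top
    let g : H.toGrAlg ⟶ B := ⟨F, fun m a ha => by
      obtain ⟨n, hn⟩ := h.exists_mem_powKer a
      rw [hF n a hn]
      exact (f n).map_mem m ⟨a, hn⟩ ha⟩
    refine ⟨(e B).symm g, Subtype.ext (funext fun n => ?_)⟩
    refine (congrArg (subIncl H.toGrAlg _ (isSubcoalg_powKer (H := H) (p ^ n.unop.down)).proj ≫ ·)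
      ((e B).apply_symm_apply g)).trans ?_
    exact hom_ext' fun x => hF _ _ x.2

/-- Let U be the subalgebra of elements trivialised by some p^n. Each component in the limit of the
universal point is torsion, so it lifts to U; the limit glues the lifts to a point over U. Hence the
identity of `H` factors through U, and U is all of `H`. -/
lemma isPrimary_of_isPAdicAffineGroup (he : RepBy e) (h : isPAdicAffineGroup k p G) :
    H.IsPrimary p := by
  obtain ⟨hG, J, _, _, D, c, hD, htor, ⟨hc⟩, ⟨i⟩⟩ := h
  let U : Subalgebra k H.carrier := ⨆ n, AlgHom.equalizer (H.npow (p ^ n)).toAlgHom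
    (H.triv H.toGrAlg).toAlgHom
  have mono : Monotone fun n => AlgHom.equalizer (H.npow (p ^ n)).toAlgHom
      (H.triv H.toGrAlg).toAlgHom := fun m n hmn x hx => by
    obtain ⟨c, hc⟩ := pow_dvd_pow p hmn
    rw [AlgHom.mem_equalizer, triv_apply, Algebra.algebraMap_eq_smul_one] at hx ⊢
    rw [hc, mul_comm]
    exact npow_apply_mul_eq_triv hx
  have memU : ∀ x, x ∈ U ↔ ∃ n, (H.npow (p ^ n)).toAlgHom x = (H.triv H.toGrAlg).toAlgHom x :=
    fun x => by
      rw [← SetLike.mem_coe, Subalgebra.coe_iSup_of_directed mono.directed_le, Set.mem_iUnion]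
      rfl
  have hU : ∀ n, ∀ x ∈ U, H.toGrAlg.proj n x ∈ U := fun n x hx => by
    obtain ⟨m, hm⟩ := (memU x).1 hx
    refine (memU _).2 ⟨m, ?_⟩
    rw [← hom_proj, hm, hom_proj]
  let K := GrAlg.sub H.toGrAlg U hU
  let ι : K ⟶ H.toGrAlg := subIncl H.toGrAlg U hU
  obtain ⟨u, hu⟩ := (e H.toGrAlg).surjective (𝟙 _)
  let v : c.pt.obj H.toGrAlg := i.inv.app _ u
  have hinj : ∀ j, Function.Injective ((D.obj j).map ι) := fun j x y hxy => by
    obtain ⟨H', e', he'⟩ := exists_repBy (hD j)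
    refine (e' K).injective (eq_of_comp_injective (subIncl_injective H.toGrAlg U hU) ?_)
    exact (he'.natural _ _ ι x).symm.trans ((congrArg _ hxy).trans (he'.natural _ _ ι y))
  -- The component is a morphism `h` of Hopf algebras and is killed by some p^n; since `h` commutes
  -- with multiplication by p^n, its image lies in `U`.
  have hex : ∀ j, ∃ y : (D.obj j).obj K, (D.obj j).map ι y = (c.π.app j).app _ v := fun j => by
    obtain ⟨H', e', he'⟩ := exists_repBy (hD j)
    obtain ⟨h, hh, hφ⟩ := he.exists_hom he' (i.inv ≫ c.π.app j)
    have hφu : e' H.toGrAlg ((c.π.app j).app _ v) = h :=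
      (hφ _ u).trans ((congrArg (h ≫ ·) hu).trans (Category.comp_id h))
    have hmem : ∀ b, h.toAlgHom b ∈ U := fun b => by
      obtain ⟨n, hn⟩ := htor j H.toGrAlg ((c.π.app j).app _ v)
      have h1 := he'.nsmul (p ^ n) _ ((c.π.app j).app H.toGrAlg v)
      rw [hn, he'.zero, hφu] at h1
      have h3 := he.triv_of_hom he' hφ H.toGrAlg
      have h2 := hh.comp_npow h3 (p ^ n)
      refine (memU _).2 ⟨n, ?_⟩
      exact congrArg (fun f : H'.toGrAlg ⟶ H.toGrAlg => f.toAlgHom b) (h2.trans (h1.symm.trans h3.symm))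
    refine ⟨(e' K).symm (subLift H.toGrAlg U hU h hmem), (e' H.toGrAlg).injective ?_⟩
    refine (he'.natural _ _ ι _).trans ?_
    rw [Equiv.apply_symm_apply, hφu]
    rfl
  choose y hy using hex
  let P : GrAlg k → _ := fun B => (evaluation _ AddCommGrpCat.{u}).obj B ⋙ forget AddCommGrpCat.{u}
  have hbij := fun B => (Types.isLimit_iff_bijective_sectionOfCone _).1
    ⟨(isLimitOfPreserves (P B) hc : _)⟩
  -- Existence in the limit over `K` produces the glued point, and uniqueness over `H` will identify
  -- its image with the universal point.
  obtain ⟨z, hz⟩ := (hbij K).2 ⟨y, fun {j j'} f => hinj j' (by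
    have h1 := congrArg (fun φ => φ.hom (y j)) ((D.map f).naturality ι)
    refine h1.symm.trans ?_
    have h2 := congrArg (fun φ : c.pt ⟶ D.obj j' => φ.app _ v) (c.w f)
    exact ((congrArg ((D.map f).app _) (hy j)).trans h2).trans (hy j').symm)⟩
  have hz' : c.pt.map ι z = v := (hbij H.toGrAlg).1 (Subtype.ext (funext fun j => by
    have h1 := congrArg (fun φ => φ.hom z) ((c.π.app j).naturality ι)
    refine h1.trans ?_
    exact (congrArg ((D.obj j).map ι) (congrArg (fun s => s.1 j) hz)).trans (hy j)))
  have h1 : e K (i.hom.app _ z) ≫ ι = 𝟙 _ := by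
    refine (he.natural _ _ ι _).symm.trans (Eq.trans (congrArg _ ?_) hu)
    have h2 := congrArg (fun φ => φ.hom z) (i.hom.naturality ι)
    refine h2.symm.trans ((congrArg (i.hom.app _) hz').trans ?_)
    exact congrArg (fun φ : G ⟶ G => φ.app _ u) i.inv_hom_id
  refine isPrimary_iff.2 fun x => ?_
  have hx : x ∈ U := by
    have h2 := congrArg (fun f : H.toGrAlg ⟶ H.toGrAlg => f.toAlgHom x) h1
    rw [GrAlg.id_apply] at h2
    rw [← h2]
    exact subIncl_mem H.toGrAlg U hU _
  obtain ⟨n, hn⟩ := (memU x).1 hx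
  exact ⟨n, hn.trans ((triv_apply (H := H) H.toGrAlg x).trans (Algebra.algebraMap_eq_smul_one _))⟩

end PAdic

end

/-! ### Closure of pro-p affine groups and the two affine splittings -/

noncomputable section

open GrAlg GrHopf

namespace GrHopf

variable {k : Type u} [Field k] {H H' : GrHopf k} {p : ℕ}

/-- The elements killed by a power of `p`. -/
abbrev IsPrimaryElem (p : ℕ) (x : H.carrier) : Prop :=
  ∃ n, (H.npow (p ^ n)).toAlgHom x = (Coalgebra.counit x : k) • 1

lemma IsPrimaryElem.map {h : H.toGrAlg ⟶ H'.toGrAlg} (hh : IsComulHom h)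
    (h1 : h ≫ H'.triv H'.toGrAlg = H.triv H'.toGrAlg) {x : H.carrier} (hx : IsPrimaryElem p x) :
    IsPrimaryElem p (h.toAlgHom x) := by
  obtain ⟨n, hn⟩ := hx
  refine ⟨n, ?_⟩
  have h2 := congrArg (fun f : H.toGrAlg ⟶ H'.toGrAlg => f.toAlgHom x) (hh.comp_npow h1 (p ^ n))
  have h3 := congrArg (fun f : H.toGrAlg ⟶ H'.toGrAlg => f.toAlgHom x) h1
  rw [GrAlg.comp_apply, triv_apply, triv_apply, Algebra.algebraMap_eq_smul_one,
    Algebra.algebraMap_eq_smul_one] at h3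
  refine h2.trans ?_
  rw [h3, GrAlg.comp_apply, hn, map_smul, map_one]

lemma isPrimaryElem_conv {f g : H.toGrAlg ⟶ H'.toGrAlg} (hf : ∀ x, IsPrimaryElem p (f.toAlgHom x))
    (hg : ∀ x, IsPrimaryElem p (g.toAlgHom x)) (x : H.carrier) :
    IsPrimaryElem p ((conv f g).toAlgHom x) := by
  have key : ∀ {y : H'.carrier} {m n : ℕ}, m ≤ n →
      (H'.npow (p ^ m)).toAlgHom y = (Coalgebra.counit y : k) • 1 →
      (H'.npow (p ^ n)).toAlgHom y = (Coalgebra.counit y : k) • 1 := fun {y m n} hmn h => by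
    obtain ⟨c, hc⟩ := pow_dvd_pow p hmn
    rw [hc, mul_comm]
    exact npow_apply_mul_eq_triv h
  rw [conv_apply]
  generalize (Coalgebra.comul x : H.carrier ⊗[k] H.carrier) = z
  induction z with
  | zero => exact ⟨0, by simp⟩
  | add a b ha hb =>
    obtain ⟨m, hm⟩ := ha
    obtain ⟨n, hn⟩ := hb
    refine ⟨max m n, ?_⟩
    simp only [map_add, add_smul]
    rw [key (le_max_left m n) hm, key (le_max_right m n) hn]
  | tmul a b =>
    obtain ⟨m, hm⟩ := hf a
    obtain ⟨n, hn⟩ := hg b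
    refine ⟨max m n, ?_⟩
    rw [TensorProduct.map_tmul, LinearMap.mul'_apply, map_mul, H'.counit_mul]
    refine (congrArg₂ (· * ·) (key (le_max_left m n) hm) (key (le_max_right m n) hn)).trans ?_
    rw [smul_mul_smul_comm, one_mul]
    rfl

end GrHopf

section Affine

variable {k : Type u} [Field k] (p : ℕ)

/-- Every element of the Hopf algebra of the retract is an image of an element of the larger one,
and being trivialised by a power of `p` is preserved by Hopf algebra maps. -/
lemma isPAdicAffineGroup_of_retract {G G' : GrAlg k ⥤ AddCommGrpCat.{u}} (i : G' ⟶ G) (r : G ⟶ G')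
    (hir : i ≫ r = 𝟙 G') (hG : isPAdicAffineGroup k p G) : isPAdicAffineGroup k p G' := by
  obtain ⟨H, e, he⟩ := exists_repBy hG.1
  obtain ⟨H', e', he'⟩ := exists_repBy (isAffineGroup_of_retract i r hir hG.1)
  have hp := isPrimary_iff.1 (isPrimary_of_isPAdicAffineGroup p he hG)
  obtain ⟨a, ha, ha'⟩ := he'.exists_hom he i
  obtain ⟨b, hb, hb'⟩ := he.exists_hom he' r
  have hab : b ≫ a = 𝟙 _ := by
    obtain ⟨x, hx⟩ := (e' H'.toGrAlg).surjective (𝟙 _)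
    have h1 := hb' _ (i.app _ x)
    rw [ha', hx] at h1
    refine Eq.trans ?_ (h1.symm.trans ((congrArg (e' _) ?_).trans hx))
    · exact (congrArg (b ≫ ·) (Category.comp_id a)).symm
    · exact congrArg (fun φ : G' ⟶ G' => φ.app _ x) hir
  refine isPAdicAffineGroup_of_isPrimary p he' (isPrimary_iff.2 fun x => ?_)
  have h1 := IsPrimaryElem.map ha (he'.triv_of_hom he ha' _) (hp (b.toAlgHom x))
  have h2 := congrArg (fun f : H'.toGrAlg ⟶ H'.toGrAlg => f.toAlgHom x) hab
  rw [GrAlg.comp_apply, GrAlg.id_apply] at h2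
  rwa [h2] at h1

/-- The identity of the product's Hopf algebra is the convolution of two endomorphisms that factor
through those of the factors. -/
lemma isPAdicAffineGroup_prod {G G' : GrAlg k ⥤ AddCommGrpCat.{u}} (hG : isPAdicAffineGroup k p G)
    (hG' : isPAdicAffineGroup k p G') : isPAdicAffineGroup k p (G ⨯ G') := by
  obtain ⟨H, e, he⟩ := exists_repBy hG.1
  obtain ⟨H', e', he'⟩ := exists_repBy hG'.1
  obtain ⟨T, d, hd⟩ := exists_repBy (isAffineGroup_prod hG.1 hG'.1)
  have hp := isPrimary_iff.1 (isPrimary_of_isPAdicAffineGroup p he hG)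
  have hp' := isPrimary_iff.1 (isPrimary_of_isPAdicAffineGroup p he' hG')
  obtain ⟨a, ha, ha'⟩ := hd.exists_hom he (prod.fst : G ⨯ G' ⟶ G)
  obtain ⟨a₁, -, ha₁⟩ := he.exists_hom hd (prod.lift (𝟙 G) 0)
  obtain ⟨b, hb, hb'⟩ := hd.exists_hom he' (prod.snd : G ⨯ G' ⟶ G')
  obtain ⟨b₁, -, hb₁⟩ := he'.exists_hom hd (prod.lift 0 (𝟙 G'))
  have hid : 𝟙 (G ⨯ G') = prod.fst ≫ prod.lift (𝟙 G) 0 + prod.snd ≫ prod.lift 0 (𝟙 G') := by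
    refine Limits.prod.hom_ext ?_ ?_ <;>
      simp [-prod.comp_lift, Preadditive.add_comp, prod.lift_fst, prod.lift_snd]
  have hconv : conv (a₁ ≫ a) (b₁ ≫ b) = 𝟙 T.toGrAlg := by
    obtain ⟨x, hx⟩ := (d T.toGrAlg).surjective (𝟙 _)
    have h1 := congrArg (fun φ : G ⨯ G' ⟶ G ⨯ G' => d _ (φ.app _ x)) hid
    refine Eq.trans ?_ (h1.symm.trans hx)
    refine Eq.trans ?_ (hd.add _ _ _).symm
    refine (congrArg₂ conv ((ha₁ _ _).trans ?_) ((hb₁ _ _).trans ?_)).symm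
    · exact congrArg (a₁ ≫ ·) ((ha' _ x).trans ((congrArg (a ≫ ·) hx).trans (Category.comp_id a)))
    · exact congrArg (b₁ ≫ ·) ((hb' _ x).trans ((congrArg (b ≫ ·) hx).trans (Category.comp_id b)))
  refine isPAdicAffineGroup_of_isPrimary p hd (isPrimary_iff.2 fun x => ?_)
  have h1 := isPrimaryElem_conv (p := p) (f := a₁ ≫ a) (g := b₁ ≫ b)
    (fun y => IsPrimaryElem.map ha (hd.triv_of_hom he ha' _) (hp (a₁.toAlgHom y)))
    (fun y => IsPrimaryElem.map hb (hd.triv_of_hom he' hb' _) (hp' (b₁.toAlgHom y))) x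
  rwa [hconv, GrAlg.id_apply] at h1

variable [Fact p.Prime] [CharP k p] [PerfectField k]

lemma isOddAffine_le_isPAdicAffineGroup : isOddAffine k ≤ isPAdicAffineGroup k p := by
  rintro G ⟨-, H, hH, h⟩
  obtain ⟨e, he⟩ := represents_iff.1 hH
  exact isPAdicAffineGroup_of_isPrimary p he (h.isPrimary p)

lemma isUnipotentAffine_le_isPAdicAffineGroup : isUnipotentAffine k ≤ isPAdicAffineGroup k p := by
  rintro G ⟨-, H, hH, -, h⟩
  obtain ⟨e, he⟩ := represents_iff.1 hH
  exact isPAdicAffineGroup_of_isPrimary p he (h.isPrimary p)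

theorem splitsAs_isAffineGroup (hp : 2 < p) : SplitsAs (isAffineGroup k) (isOddAffine k)
    (isUnipotentAffine k) (isMultiplicativeAffine k) := by
  have hodd : Odd p := (Fact.out : p.Prime).odd_of_ne_two hp.ne'
  exact splitsAs_of_idempotent (isAffineGroup k) _ _ _ (affRed p) affTau
    (fun _ _ f hX hY => affRed_natural p hX hY f) (fun _ _ f => affTau_natural f)
    (fun _ hX => affRed_affRed p hX) affTau_affTau (fun _ hX => affRed_affTau p hX)
    (fun _ => isOddAffine_iff p hodd) (fun _ => isUnipotentAffine_iff p hp.ne')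
    (fun _ => isMultiplicativeAffine_iff p) (fun _ hX => isIso_two_of_affRed_eq_zero p hodd hX)
    (fun _ _ i r hir hX => isAffineGroup_of_retract i r hir hX)
    (fun _ _ hX hY => isAffineGroup_prod hX hY)

theorem splitsAs_isPAdicAffineGroup (hp : 2 < p) : SplitsAs (isPAdicAffineGroup k p)
    (isOddAffine k) (isUnipotentAffine k) (isPAdicMultiplicativeAffine k p) := by
  have hodd : Odd p := (Fact.out : p.Prime).odd_of_ne_two hp.ne'
  refine splitsAs_of_idempotent (isPAdicAffineGroup k p) _ _ _ (affRed p) affTau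
    (fun _ _ f hX hY => affRed_natural p hX.1 hY.1 f) (fun _ _ f => affTau_natural f)
    (fun _ hX => affRed_affRed p hX.1) affTau_affTau (fun _ hX => affRed_affTau p hX.1)
    (fun X => ⟨fun h => ⟨isOddAffine_le_isPAdicAffineGroup p X h, ((isOddAffine_iff p hodd).1 h).2⟩,
      fun h => (isOddAffine_iff p hodd).2 ⟨h.1.1, h.2⟩⟩)
    (fun X => ⟨fun h => ⟨isUnipotentAffine_le_isPAdicAffineGroup p X h,
      ((isUnipotentAffine_iff p hp.ne').1 h).2⟩,
      fun h => (isUnipotentAffine_iff p hp.ne').2 ⟨h.1.1, h.2⟩⟩)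
    (fun X => ⟨fun h => ⟨h.2, ((isMultiplicativeAffine_iff p).1 h.1).2⟩,
      fun h => ⟨(isMultiplicativeAffine_iff p).2 ⟨h.1.1, h.2⟩, h.1⟩⟩)
    (fun _ hX => isIso_two_of_affRed_eq_zero p hodd hX.1)
    (fun _ _ i r hir hX => isPAdicAffineGroup_of_retract p i r hir hX)
    (fun _ _ hX hY => isPAdicAffineGroup_prod p hX hY)

end Affine

end

/-! ### The colimit of duals attached to a formal group -/

noncomputable section

open GrAlg GrHopf

variable {k : Type u} [Field k]

/-- The dual of a morphism of finite-dimensional algebras. -/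
abbrev FinGrAlg.dualMap {R S : FinGrAlg k} (h : R ⟶ S) :
    Module.Dual k S.obj.carrier →ₗ[k] Module.Dual k R.obj.carrier :=
  h.hom.toAlgHom.toLinearMap.dualMap

lemma FinGrAlg.exists_image {R S : FinGrAlg k} (q : R ⟶ S) : ∃ (B : FinGrAlg k) (π : R ⟶ B)
    (i : B ⟶ S), π ≫ i = q ∧ Function.Surjective π.hom.toAlgHom ∧
      Function.Injective i.hom.toAlgHom := by
  have hS : ∀ n, ∀ a ∈ q.hom.toAlgHom.range, S.obj.proj n a ∈ q.hom.toAlgHom.range := by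
    rintro n _ ⟨a, rfl⟩
    exact ⟨R.obj.proj n a, (hom_proj q.hom n a).symm⟩
  refine ⟨⟨GrAlg.sub S.obj q.hom.toAlgHom.range hS, inferInstanceAs
    (Module.Finite k (Subalgebra.toSubmodule q.hom.toAlgHom.range))⟩,
    ObjectProperty.homMk (subLift S.obj q.hom.toAlgHom.range hS q.hom fun b => ⟨b, rfl⟩),
    ObjectProperty.homMk (subIncl S.obj q.hom.toAlgHom.range hS), rfl, ?_,
    subIncl_injective S.obj q.hom.toAlgHom.range hS⟩
  rintro ⟨_, a, rfl⟩
  exact ⟨a, rfl⟩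

/-- The space `C` dual to a pro-finite-dimensional algebra which represents the functor `G`,
with the linear maps `R^∨ → C` which correspond to the points in `G(R)`. -/
structure FormalDual (G : FinGrAlg k ⥤ AddCommGrpCat.{u}) where
  C : Type u
  [grp : AddCommGroup C]
  [mod : Module k C]
  f : ∀ {R : FinGrAlg k}, G.obj R → (Module.Dual k R.obj.carrier →ₗ[k] C)
  nat : ∀ {R S : FinGrAlg k} (h : R ⟶ S) (x : G.obj R), f (G.map h x) = f x ∘ₗ FinGrAlg.dualMap h
  surj : ∀ c, ∃ (R : FinGrAlg k) (x : G.obj R) (ξ : Module.Dual k R.obj.carrier), f x ξ = c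
  desc : ∀ {M : Type u} [AddCommGroup M] [Module k M]
    (φ : ∀ {R : FinGrAlg k}, G.obj R → (Module.Dual k R.obj.carrier →ₗ[k] M)),
    (∀ {R S : FinGrAlg k} (h : R ⟶ S) (x : G.obj R), φ (G.map h x) = φ x ∘ₗ FinGrAlg.dualMap h) →
    ∃ Φ : C →ₗ[k] M, ∀ {R : FinGrAlg k} (x : G.obj R), Φ ∘ₗ f x = φ x
  inj : ∀ {R : FinGrAlg k} (x : G.obj R), ∃ (B : FinGrAlg k) (z : G.obj B) (h : B ⟶ R),
    G.map h z = x ∧ Function.Injective (f z)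
  dir : ∀ {R S : FinGrAlg k} (x : G.obj R) (y : G.obj S), ∃ (T : FinGrAlg k) (z : G.obj T)
    (h : T ⟶ R) (h' : T ⟶ S), G.map h z = x ∧ G.map h' z = y

/-- Present the underlying functor as a filtered colimit of functors represented by algebras R_i,
and let C be the colimit of the dual spaces R_i^∨. -/
theorem exists_formalDual {G : FinGrAlg k ⥤ AddCommGrpCat.{u}} (hG : isFormalGroup k G) :
    Nonempty (FormalDual G) := by
  classical
  obtain ⟨I, F, ι, hι⟩ := hG.nonempty_presentation
  let R : I → FinGrAlg k := fun i => (F.obj i).unop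
  let q : ∀ {i j : I}, (i ⟶ j) → (R j ⟶ R i) := fun a => (F.map a).unop
  let g : ∀ i, G.obj (R i) := fun i => (ι.app i).app (Opposite.op (Opposite.op (R i))) (𝟙 (F.obj i))
  have hcol := fun S : FinGrAlg k => isColimitOfPreserves
    ((evaluation _ (Type u)).obj (Opposite.op (Opposite.op S) : (FinGrAlg k)ᵒᵖᵒᵖ)) hι
  have hval : ∀ (i : I) (S : FinGrAlg k) (h : R i ⟶ S),
      (ι.app i).app (Opposite.op (Opposite.op S)) h.op = G.map h (g i) := fun i S h => by
    have h1 := congrArg (fun φ => φ (𝟙 (F.obj i))) ((ι.app i).naturality (X := Opposite.op (F.obj i)) h.op.op)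
    refine Eq.trans ?_ h1
    exact congrArg ((ι.app i).app (Opposite.op (Opposite.op S))) (Category.comp_id h.op).symm
  -- Filtered colimits of sets elementwise: every point comes from some `g i`, and (by `fact2`) two
  -- such descriptions of one point agree at a later stage.
  have fact1 : ∀ {S : FinGrAlg k} (x : G.obj S), ∃ (i : I) (h : R i ⟶ S), G.map h (g i) = x :=
    fun {S} x => by
      obtain ⟨i, y, hy⟩ := Types.jointly_surjective _ (hcol S) x
      exact ⟨i, Quiver.Hom.unop y, (hval i S (Quiver.Hom.unop y)).symm.trans hy⟩
  have fact2 : ∀ {S : FinGrAlg k} {i i' : I} (h : R i ⟶ S) (h' : R i' ⟶ S),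
      G.map h (g i) = G.map h' (g i') →
      ∃ (j : I) (a : i ⟶ j) (b : i' ⟶ j), q a ≫ h = q b ≫ h' := fun {S i i'} h h' hh => by
    obtain ⟨j, a, b, hab⟩ := (Types.FilteredColimit.isColimit_eq_iff _ (hcol S) (i := i) (j := i')
      (xi := h.op) (xj := h'.op)).1 ((hval i S h).trans (hh.trans (hval i' S h').symm))
    exact ⟨j, a, b, Quiver.Hom.op_inj hab⟩
  have hq : ∀ {i j : I} (a : i ⟶ j), G.map (q a) (g j) = g i := fun {i j} a => by
    refine (hval j (R i) (q a)).symm.trans ?_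
    have h1 := congrArg (fun φ => φ.app (Opposite.op (Opposite.op (R i))) (𝟙 (F.obj i))) (ι.naturality a)
    refine Eq.trans ?_ h1
    exact congrArg ((ι.app j).app (Opposite.op (Opposite.op (R i)))) (Category.id_comp (F.map a)).symm
  let M : I ⥤ ModuleCat.{u} k :=
    { obj := fun i => ModuleCat.of k (Module.Dual k (R i).obj.carrier)
      map := fun a => ModuleCat.ofHom (FinGrAlg.dualMap (q a))
      map_id := fun i => by
        have : q (𝟙 i) = 𝟙 _ := congrArg Quiver.Hom.unop (F.map_id i)
        rw [this]; rfl
      map_comp := fun a b => by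
        have : q (a ≫ b) = q b ≫ q a := congrArg Quiver.Hom.unop (F.map_comp a b)
        rw [this]; rfl }
  let κ : ∀ i, Module.Dual k (R i).obj.carrier →ₗ[k] (colimit M : ModuleCat k) :=
    fun i => (colimit.ι M i).hom
  have hκ : ∀ {i j : I} (a : i ⟶ j), κ j ∘ₗ FinGrAlg.dualMap (q a) = κ i := fun a =>
    congrArg ModuleCat.Hom.hom (colimit.w M a)
  choose i h hi using @fact1
  let f : ∀ {S : FinGrAlg k}, G.obj S → (Module.Dual k S.obj.carrier →ₗ[k] (colimit M : ModuleCat k)) :=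
    fun x => κ (i x) ∘ₗ FinGrAlg.dualMap (h x)
  have hf : ∀ {S : FinGrAlg k} (j : I) (l : R j ⟶ S),
      f (G.map l (g j)) = κ j ∘ₗ FinGrAlg.dualMap l := fun {S} j l => by
    obtain ⟨n, a, b, hab⟩ := fact2 _ _ (hi (G.map l (g j)))
    change κ _ ∘ₗ _ = _
    rw [← hκ a, ← hκ b, LinearMap.comp_assoc, LinearMap.comp_assoc]
    exact congrArg (fun m => κ n ∘ₗ FinGrAlg.dualMap m) hab
  have hfg : ∀ j, f (g j) = κ j := fun j => by
    have := hf j (𝟙 (R j))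
    rw [G.map_id] at this
    exact this
  have nat : ∀ {S T : FinGrAlg k} (l : S ⟶ T) (x : G.obj S),
      f (G.map l x) = f x ∘ₗ FinGrAlg.dualMap l := fun {S T} l x => by
    have h1 := hf (i x) (h x ≫ l)
    rw [G.map_comp, AddCommGrpCat.comp_apply, hi] at h1
    exact h1
  refine ⟨⟨(colimit M : ModuleCat k), f, nat, fun c => ?_, fun {N} _ _ φ hφ => ?_, fun {S} x => ?_,
    fun {S T} x y => ?_⟩⟩
  · obtain ⟨j, ξ, hξ⟩ := Concrete.colimit_exists_rep M c
    exact ⟨R j, g j, ξ, (LinearMap.congr_fun (hfg j) ξ).trans hξ⟩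
  · let s : Cocone M :=
      { pt := ModuleCat.of k N
        ι := 
          { app := fun j => ModuleCat.ofHom (φ (g j))
            naturality := fun j j' a => by
              refine ModuleCat.hom_ext ?_
              have h1 := hφ (q a) (g j')
              rw [hq] at h1
              exact h1.symm } }
    refine ⟨(colimit.desc M s).hom, fun {S} x => ?_⟩
    have h1 : (colimit.desc M s).hom ∘ₗ κ (i x) = φ (g (i x)) :=
      congrArg ModuleCat.Hom.hom (colimit.ι_desc s (i x))
    have h2 := hφ (h x) (g (i x))
    rw [hi, ← h1] at h2
    exact h2.symm
  -- The kernel of R_i^∨ → C is finite-dimensional, so it dies at one later stage `j`. Replacing R_i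
  -- by the image of R_j → R_i makes the map from its dual injective.
  · have hker : ∀ t : Finset (Module.Dual k (R (i x)).obj.carrier), (∀ ξ ∈ t, κ (i x) ξ = 0) →
        ∃ (j : I) (a : i x ⟶ j), ∀ ξ ∈ t, FinGrAlg.dualMap (q a) ξ = 0 := fun t => by
      induction t using Finset.induction_on with
      | empty => exact fun _ => ⟨i x, 𝟙 _, by simp⟩
      | insert η t _ ih =>
        intro ht
        obtain ⟨j, a, ha⟩ := ih fun ξ hξ => ht ξ (Finset.mem_insert_of_mem hξ)
        have h1 : κ j (FinGrAlg.dualMap (q a) η) = 0 :=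
          (LinearMap.congr_fun (hκ a) η).trans (ht η (Finset.mem_insert_self _ _))
        obtain ⟨j', b, hb⟩ := Concrete.colimit_rep_eq_zero k M j _ h1
        have hab : q (a ≫ b) = q b ≫ q a := congrArg Quiver.Hom.unop (F.map_comp a b)
        have hcomp : ∀ ξ, FinGrAlg.dualMap (q (a ≫ b)) ξ =
            FinGrAlg.dualMap (q b) (FinGrAlg.dualMap (q a) ξ) := fun ξ => by rw [hab]; rfl
        refine ⟨j', a ≫ b, fun ξ hξ => ?_⟩
        rw [hcomp]
        rcases Finset.mem_insert.1 hξ with rfl | hξ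
        · exact hb
        · rw [ha ξ hξ, map_zero]
    obtain ⟨t, ht⟩ := (Module.Finite.iff_fg.1 inferInstance : (LinearMap.ker (κ (i x))).FG)
    obtain ⟨j, a, ha⟩ := hker t fun ξ hξ => by
      have : ξ ∈ LinearMap.ker (κ (i x)) := ht ▸ Submodule.subset_span hξ
      exact this
    have ha' : LinearMap.ker (κ (i x)) ≤ LinearMap.ker (FinGrAlg.dualMap (q a)) := by
      rw [← ht, Submodule.span_le]; exact ha
    obtain ⟨B, π, e, hπe, hπ, he⟩ := FinGrAlg.exists_image (q a)
    refine ⟨B, G.map π (g j), e ≫ h x, ?_, ?_⟩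
    · rw [← AddCommGrpCat.comp_apply, ← G.map_comp, ← Category.assoc, hπe, G.map_comp,
        AddCommGrpCat.comp_apply, hq, hi]
    · rw [hf, injective_iff_map_eq_zero]
      intro β hβ
      obtain ⟨α, rfl⟩ := LinearMap.dualMap_surjective_of_injective (f := e.hom.toAlgHom.toLinearMap) he β
      have h1 : FinGrAlg.dualMap π (FinGrAlg.dualMap e α) = FinGrAlg.dualMap (q a) α := by
        rw [← hπe]; rfl
      have h2 : κ (i x) α = 0 := by
        rw [← hκ a, LinearMap.comp_apply, ← h1]; exact hβ
      have h3 : FinGrAlg.dualMap π (FinGrAlg.dualMap e α) = 0 := h1.trans (ha' h2)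
      exact LinearMap.dualMap_injective_of_surjective (f := π.hom.toAlgHom.toLinearMap) hπ (h3.trans (map_zero _).symm)
  · let j := IsFiltered.max (i x) (i y)
    let a := IsFiltered.leftToMax (i x) (i y)
    let b := IsFiltered.rightToMax (i x) (i y)
    refine ⟨R j, g j, q a ≫ h x, q b ≫ h y, ?_, ?_⟩
    · rw [G.map_comp, AddCommGrpCat.comp_apply, hq, hi]
    · rw [G.map_comp, AddCommGrpCat.comp_apply, hq, hi]

end

/-! ### The graded algebra structure on the dual of a formal group -/

noncomputable section

open GrAlg GrHopf

namespace GrAlg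

variable {k : Type u} [Field k] {A B C : GrAlg k} (ξ : Module.Dual k A.carrier)
  (η : Module.Dual k B.carrier) (ζ : Module.Dual k C.carrier)

lemma extDual_inl_mul_inr (a : A.carrier) (b : B.carrier) : extDual ξ η
    ((tensorInl A B).toAlgHom a * (tensorInr A B).toAlgHom b) = ξ a * η b := by
  rw [tensorInl_mul_tensorInr, extDual_tmul]

lemma extDual_assoc (t : (tensor A B).carrier) (u : C.carrier) : extDual ξ (extDual η ζ)
    ((tensorDesc (tensorInl A (tensor B C)) (tensorInl B C ≫ tensorInr A (tensor B C))).toAlgHom t *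
      (tensorInr B C ≫ tensorInr A (tensor B C)).toAlgHom u) = extDual ξ η t * ζ u := by
  obtain ⟨t, rfl⟩ := tmk_surjective A B t
  induction t with
  | zero => simp only [map_zero, zero_mul]
  | add t t' ht ht' => simp only [map_add, add_mul] at ht ht' ⊢; rw [ht, ht']
  | tmul a b =>
    rw [tensorDesc_tmul, mul_assoc, GrAlg.comp_apply, GrAlg.comp_apply, ← map_mul,
      extDual_inl_mul_inr, extDual_inl_mul_inr, extDual_tmul, mul_assoc]

lemma extDual_eq_zero {i j n : ℕ} (hij : i + j = n) {ξ : Module.Dual k A.carrier}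
    {η : Module.Dual k B.carrier} (hξ : ∀ m ≠ i, ∀ a ∈ A.grading m, ξ a = 0)
    (hη : ∀ m ≠ j, ∀ b ∈ B.grading m, η b = 0) :
    ∀ m ≠ n, ∀ t ∈ (tensor A B).grading m, extDual ξ η t = 0 := by
  intro m hm t ht
  obtain ⟨t, rfl⟩ := tmk_surjective A B t
  have h1 : t ∈ LinearMap.ker (extDual ξ η ∘ₗ tmk A B) := by
    refine tensorGrading_le A B (fun i' j' h a ha b hb => ?_) ((tmk_mem A B).1 ht)
    refine (extDual_tmul ξ η a b).trans ?_
    by_cases hi : i' = i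
    · rw [hη j' (by omega) b hb, mul_zero]
    · rw [hξ i' hi a ha, zero_mul]
  exact h1

lemma extDual_inr_mul_inl {i j : ℕ} {ξ : Module.Dual k A.carrier} {η : Module.Dual k B.carrier}
    (hξ : ∀ m ≠ i, ∀ a ∈ A.grading m, ξ a = 0) (hη : ∀ m ≠ j, ∀ b ∈ B.grading m, η b = 0)
    (a : A.carrier) (b : B.carrier) : ((-1 : k) ^ (i * j) • extDual η ξ)
      ((tensorInr B A).toAlgHom a * (tensorInl B A).toAlgHom b) = ξ a * η b := by
  refine LinearMap.congr_fun (LinearMap.congr_fun (?_ : ((LinearMap.mul k (tensor B A).carrier).compr₂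
    ((-1 : k) ^ (i * j) • extDual η ξ)).compl₁₂ (tensorInr B A).toAlgHom.toLinearMap
    (tensorInl B A).toAlgHom.toLinearMap = (LinearMap.mul k k).compl₁₂ ξ η) a) b
  refine A.hom_ext_homogeneous fun m a ha => B.hom_ext_homogeneous fun n b hb => ?_
  change (-1 : k) ^ (i * j) • extDual η ξ ((tensorInr B A).toAlgHom a *
    (tensorInl B A).toAlgHom b) = ξ a * η b
  rw [(tensor B A).comm_of_mem ((tensorInr B A).map_mem _ _ ha) ((tensorInl B A).map_mem _ _ hb),
    map_smul, extDual_inl_mul_inr, smul_smul, mul_comm (η b)]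
  by_cases hm : m = i
  · by_cases hn : n = j
    · rw [hm, hn, ← mul_pow, neg_one_mul, neg_neg, one_pow, one_smul]
    · rw [hη n hn b hb, mul_zero, smul_zero]
  · rw [hξ m hm a ha, zero_mul, smul_zero]

end GrAlg

namespace FinGrAlg

variable {k : Type u} [Field k]

/-- The inclusion of the first factor of a tensor product. -/
def inl (R S : FinGrAlg k) : R ⟶ tensor R S := ObjectProperty.homMk (tensorInl R.obj S.obj)

/-- The inclusion of the second factor of a tensor product. -/
def inr (R S : FinGrAlg k) : S ⟶ tensor R S := ObjectProperty.homMk (tensorInr R.obj S.obj)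

/-- The morphism out of a tensor product given by a pair of morphisms. -/
def desc {R S T : FinGrAlg k} (f : R ⟶ T) (g : S ⟶ T) : tensor R S ⟶ T :=
  ObjectProperty.homMk (tensorDesc f.hom g.hom)

/-- The unit morphism. -/
def unit (R : FinGrAlg k) : unitAlg k ⟶ R := ObjectProperty.homMk (unitHom R.obj)

lemma inl_desc {R S T : FinGrAlg k} (f : R ⟶ T) (g : S ⟶ T) : inl R S ≫ desc f g = f :=
  ObjectProperty.hom_ext _ (tensorInl_desc f.hom g.hom)

lemma inr_desc {R S T : FinGrAlg k} (f : R ⟶ T) (g : S ⟶ T) : inr R S ≫ desc f g = g :=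
  ObjectProperty.hom_ext _ (tensorInr_desc f.hom g.hom)

end FinGrAlg

namespace FormalDual

variable {k : Type u} [Field k] {G : FinGrAlg k ⥤ AddCommGrpCat.{u}} (d : FormalDual G)

attribute [instance] grp mod

lemma nat_apply {R S : FinGrAlg k} (h : R ⟶ S) (x : G.obj R) (ξ : Module.Dual k S.obj.carrier) :
    d.f (G.map h x) ξ = d.f x (ξ ∘ₗ h.hom.toAlgHom.toLinearMap) :=
  LinearMap.congr_fun (d.nat h x) ξ

lemma hom_ext {M : Type*} [AddCommGroup M] [Module k M] {Φ Ψ : d.C →ₗ[k] M}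
    (h : ∀ {R : FinGrAlg k} (x : G.obj R) ξ, Φ (d.f x ξ) = Ψ (d.f x ξ)) : Φ = Ψ := by
  refine LinearMap.ext fun c => ?_
  obtain ⟨R, x, ξ, rfl⟩ := d.surj c
  exact h x ξ

/-- The external sum of two points. -/
def box {R S : FinGrAlg k} (x : G.obj R) (y : G.obj S) : G.obj (FinGrAlg.tensor R S) :=
  G.map (FinGrAlg.inl R S) x + G.map (FinGrAlg.inr R S) y

lemma map_box {R S T : FinGrAlg k} (x : G.obj R) (y : G.obj S) (f : R ⟶ T) (g : S ⟶ T) :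
    G.map (FinGrAlg.desc f g) (box x y) = G.map f x + G.map g y := by
  rw [box, map_add, ← AddCommGrpCat.comp_apply, ← AddCommGrpCat.comp_apply, ← G.map_comp,
    ← G.map_comp, FinGrAlg.inl_desc, FinGrAlg.inr_desc]

/-- The value of a sum of two points at θ depends only on the bilinear form (a, b) ↦ θ(f(a) g(b)).
Unit, associativity and commutativity of the product all reduce to comparing such forms. -/
lemma f_add {R S T : FinGrAlg k} (x : G.obj R) (y : G.obj S) (f : R ⟶ T) (g : S ⟶ T)
    {θ : Module.Dual k T.obj.carrier} {ξ : Module.Dual k R.obj.carrier}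
    {η : Module.Dual k S.obj.carrier}
    (h : ∀ a b, θ (f.hom.toAlgHom a * g.hom.toAlgHom b) = ξ a * η b) :
    d.f (G.map f x + G.map g y) θ = d.f (box x y) (extDual ξ η) := by
  rw [← map_box, nat_apply]
  exact congrArg (d.f (box x y)) (eq_extDual h)

/-- The product is dual to addition of points, and the universal property of `C` is used once in
each variable. -/
theorem exists_mul : ∃ m : d.C →ₗ[k] d.C →ₗ[k] d.C, ∀ {R S : FinGrAlg k} (x : G.obj R)
    (y : G.obj S) ξ η, m (d.f x ξ) (d.f y η) = d.f (box x y) (extDual ξ η) := by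
  let B : ∀ {R S : FinGrAlg k} (x : G.obj R) (y : G.obj S), Module.Dual k R.obj.carrier →ₗ[k]
      Module.Dual k S.obj.carrier →ₗ[k] d.C := fun {R S} x y =>
    TensorProduct.curry (d.f (box x y) ∘ₗ (extEquiv R.obj S.obj).toLinearMap)
  have hB : ∀ {R S : FinGrAlg k} (x : G.obj R) (y : G.obj S) ξ η,
      B x y ξ η = d.f (box x y) (extDual ξ η) := fun x y ξ η =>
    congrArg (d.f (box x y)) (extEquiv_tmul ξ η)
  have h1 : ∀ {R : FinGrAlg k} (x : G.obj R), ∃ Φ : d.C →ₗ[k] Module.Dual k R.obj.carrier →ₗ[k] d.C,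
      ∀ {S : FinGrAlg k} (y : G.obj S), Φ ∘ₗ d.f y = (B x y).flip := fun {R} x =>
    d.desc (fun y => (B x y).flip) fun {S T} h y => LinearMap.ext fun η => LinearMap.ext fun ξ => by
      change B x (G.map h y) ξ η = B x y ξ _
      rw [hB, hB]
      refine (congrArg (fun z => d.f z (extDual ξ η)) ?_).trans
        (d.f_add x y (FinGrAlg.inl R T) (h ≫ FinGrAlg.inr R T)
          (η := η ∘ₗ h.hom.toAlgHom.toLinearMap) fun a b =>
          extDual_inl_mul_inr ξ η a (h.hom.toAlgHom b))
      rw [G.map_comp]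
      rfl
  choose Φ hΦ using @h1
  have hΦ' : ∀ {R S : FinGrAlg k} (x : G.obj R) (y : G.obj S) ξ η,
      Φ x (d.f y η) ξ = d.f (box x y) (extDual ξ η) := fun x y ξ η =>
    (LinearMap.congr_fun (LinearMap.congr_fun (hΦ x y) η) ξ).trans (hB x y ξ η)
  obtain ⟨m, hm⟩ := d.desc (fun x => (Φ x).flip) fun {R T} h x => by
    refine LinearMap.ext fun ξ => d.hom_ext fun {S} y η => ?_
    change Φ (G.map h x) (d.f y η) ξ = Φ x (d.f y η) _
    rw [hΦ', hΦ']
    refine (congrArg (fun z => d.f z (extDual ξ η)) ?_).trans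
      (d.f_add x y (h ≫ FinGrAlg.inl T S) (FinGrAlg.inr T S)
        (ξ := ξ ∘ₗ h.hom.toAlgHom.toLinearMap) fun a b => extDual_inl_mul_inr ξ η (h.hom.toAlgHom a) b)
    rw [G.map_comp]
    rfl
  exact ⟨m, fun x y ξ η => (LinearMap.congr_fun (LinearMap.congr_fun (hm x) ξ) _).trans (hΦ' x y ξ η)⟩

/-- The multiplication on the dual of a formal group. -/
def mul : d.C →ₗ[k] d.C →ₗ[k] d.C := d.exists_mul.choose

lemma f_add' {R S T : FinGrAlg k} (x : G.obj R) (y : G.obj S) (f : R ⟶ T) (g : S ⟶ T)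
    {θ : Module.Dual k T.obj.carrier} {ξ : Module.Dual k R.obj.carrier}
    {η : Module.Dual k S.obj.carrier}
    (h : ∀ a b, θ (f.hom.toAlgHom a * g.hom.toAlgHom b) = ξ a * η b) :
    d.mul (d.f x ξ) (d.f y η) = d.f (G.map f x + G.map g y) θ :=
  (d.exists_mul.choose_spec x y ξ η).trans (d.f_add x y f g h).symm

lemma mul_apply {R S : FinGrAlg k} (x : G.obj R) (y : G.obj S) (ξ : Module.Dual k R.obj.carrier)
    (η : Module.Dual k S.obj.carrier) :
    d.mul (d.f x ξ) (d.f y η) = d.f (box x y) (extDual ξ η) := d.exists_mul.choose_spec x y ξ η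

/-- The unit of the dual of a formal group. -/
def one : d.C := d.f (0 : G.obj (FinGrAlg.unitAlg k)) (LinearMap.id : k →ₗ[k] k)

lemma unit_add_map {R : FinGrAlg k} (x : G.obj R) :
    G.map (FinGrAlg.unit R) 0 + G.map (𝟙 R) x = x := by simp

lemma f_zero {R : FinGrAlg k} (ξ : Module.Dual k R.obj.carrier) :
    d.f (0 : G.obj R) ξ = ξ 1 • d.one := by
  refine Eq.trans ?_ (map_smul (d.f (0 : G.obj (FinGrAlg.unitAlg k))) (ξ 1) (LinearMap.id : k →ₗ[k] k))
  rw [← map_zero (G.map (FinGrAlg.unit R)).hom]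
  refine (d.nat_apply (FinGrAlg.unit R) 0 ξ).trans (congrArg _ (LinearMap.ext ?_))
  have h : ∀ c : k, ξ (algebraMap k R.obj.carrier c) = ξ 1 * c := fun c => by
    rw [Algebra.algebraMap_eq_smul_one, map_smul, smul_eq_mul, mul_comm]
  exact h

lemma one_mul (c : d.C) : d.mul d.one c = c := by
  obtain ⟨R, x, ξ, rfl⟩ := d.surj c
  refine (d.f_add' 0 x (FinGrAlg.unit R) (𝟙 R) (θ := ξ)
    fun (a : k) b => (congrArg ξ (Algebra.smul_def a b).symm).trans (map_smul ξ a b)).trans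
    (congrArg (fun z => d.f z ξ) (unit_add_map x))

lemma mul_one (c : d.C) : d.mul c d.one = c := by
  obtain ⟨R, x, ξ, rfl⟩ := d.surj c
  have h : ∀ a (b : k), ξ (a * algebraMap k R.obj.carrier b) = ξ a * b := fun a b => by
    rw [← Algebra.commutes, ← Algebra.smul_def, map_smul, smul_eq_mul, mul_comm]
  exact (d.f_add' x 0 (𝟙 R) (FinGrAlg.unit R) (θ := ξ) (ξ := ξ) (η := (LinearMap.id : k →ₗ[k] k)) h).trans
    (congrArg (fun z => d.f z ξ) ((add_comm _ _).trans (unit_add_map x)))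

lemma mul_assoc (a b c : d.C) : d.mul (d.mul a b) c = d.mul a (d.mul b c) := by
  obtain ⟨R, x, ξ, rfl⟩ := d.surj a
  obtain ⟨S, y, η, rfl⟩ := d.surj b
  obtain ⟨U, z, ζ, rfl⟩ := d.surj c
  let f1 := FinGrAlg.inl R (FinGrAlg.tensor S U)
  let i := FinGrAlg.inr R (FinGrAlg.tensor S U)
  let f2 := FinGrAlg.inl S U ≫ i
  let f3 := FinGrAlg.inr S U ≫ i
  rw [mul_apply, mul_apply]
  refine (d.f_add' (box x y) z (FinGrAlg.desc f1 f2) f3 (θ := extDual ξ (extDual η ζ)) ?_).trans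
    (Eq.trans ?_ (d.f_add' x (box y z) f1 i 
      (extDual_inl_mul_inr ξ (extDual η ζ))).symm)
  · exact extDual_assoc ξ η ζ
  · rw [map_box]
    refine congrArg (fun w => d.f w _) ((add_assoc _ _ _).trans (congrArg (G.map f1 x + ·) ?_))
    rw [box, map_add, ← AddCommGrpCat.comp_apply, ← AddCommGrpCat.comp_apply, ← G.map_comp,
      ← G.map_comp]

theorem exists_proj (n : ℕ) : ∃ P : d.C →ₗ[k] d.C, ∀ {R : FinGrAlg k} (x : G.obj R) ξ,
    P (d.f x ξ) = d.f x (ξ ∘ₗ R.obj.proj n) := by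
  obtain ⟨P, hP⟩ := d.desc (fun {R} x => d.f x ∘ₗ (R.obj.proj n).dualMap) fun {R S} h x => by
    refine LinearMap.ext fun ξ => (d.nat_apply h x _).trans (congrArg (d.f x) ?_)
    exact LinearMap.ext fun a => congrArg ξ (hom_proj h.hom n a)
  exact ⟨P, fun x => LinearMap.congr_fun (hP x)⟩

/-- The projection to the part of degree `n`. -/
def proj (n : ℕ) : d.C →ₗ[k] d.C := (d.exists_proj n).choose

lemma proj_f (n : ℕ) {R : FinGrAlg k} (x : G.obj R) (ξ : Module.Dual k R.obj.carrier) :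
    d.proj n (d.f x ξ) = d.f x (ξ ∘ₗ R.obj.proj n) := (d.exists_proj n).choose_spec x ξ

/-- The part of degree `n` of the dual of a formal group. -/
def deg (n : ℕ) : Submodule k d.C := LinearMap.eqLocus (d.proj n) LinearMap.id

lemma f_mem_deg {n : ℕ} {R : FinGrAlg k} (x : G.obj R) {ξ : Module.Dual k R.obj.carrier}
    (h : ∀ m ≠ n, ∀ a ∈ R.obj.grading m, ξ a = 0) : d.f x ξ ∈ d.deg n := by
  refine (d.proj_f n x ξ).trans (congrArg (d.f x) ?_)
  refine R.obj.hom_ext_homogeneous fun m a ha => ?_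
  by_cases hm : m = n
  · subst hm; exact congrArg ξ (R.obj.proj_of_mem ha)
  · rw [LinearMap.comp_apply, R.obj.proj_of_mem_ne ha (Ne.symm hm), map_zero, h m hm a ha]

lemma exists_of_mem_deg {n : ℕ} {c : d.C} (h : c ∈ d.deg n) : ∃ (R : FinGrAlg k) (x : G.obj R)
    (ξ : Module.Dual k R.obj.carrier), d.f x ξ = c ∧ ∀ m ≠ n, ∀ a ∈ R.obj.grading m, ξ a = 0 := by
  obtain ⟨R, x, ξ, rfl⟩ := d.surj c
  refine ⟨R, x, ξ ∘ₗ R.obj.proj n, (d.proj_f n x ξ).symm.trans h, fun m hm a ha => ?_⟩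
  rw [LinearMap.comp_apply, R.obj.proj_of_mem_ne ha (Ne.symm hm), map_zero]

lemma mul_comm_deg {i j : ℕ} {a b : d.C} (ha : a ∈ d.deg i) (hb : b ∈ d.deg j) :
    d.mul a b = (-1 : k) ^ (i * j) • d.mul b a := by
  obtain ⟨R, x, ξ, rfl, hξ⟩ := d.exists_of_mem_deg ha
  obtain ⟨S, y, η, rfl, hη⟩ := d.exists_of_mem_deg hb
  refine (d.f_add' x y (FinGrAlg.inr S R) (FinGrAlg.inl S R)
    (θ := (-1 : k) ^ (i * j) • extDual η ξ) fun r s => ?_).trans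
    ((map_smul (d.f (R := FinGrAlg.tensor S R) _) _ (extDual η ξ)).trans
    (congrArg ((-1 : k) ^ (i * j) • ·) ((congrArg (fun z : G.obj (FinGrAlg.tensor S R) => d.f z (extDual η ξ)) (add_comm _ _)).trans
      (d.mul_apply y x η ξ).symm)))
  exact extDual_inr_mul_inl hξ hη r s

/-- The dual of a formal group as a graded algebra. -/
def alg : GrAlg k :=
  letI ring : Ring d.C :=
    { d.grp with
      mul := fun a b => d.mul a b
      one := d.one
      mul_assoc := d.mul_assoc
      one_mul := d.one_mul
      mul_one := d.mul_one
      zero_mul := fun a => LinearMap.map_zero₂ d.mul a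
      mul_zero := fun a => map_zero (d.mul a)
      left_distrib := fun a b c => map_add (d.mul a) b c
      right_distrib := fun a b c => LinearMap.map_add₂ d.mul a b c }
  letI algebra : Algebra k d.C := Algebra.ofModule (fun r a b => LinearMap.map_smul₂ d.mul r a b)
    fun r a b => map_smul (d.mul a) r b
  { carrier := d.C
    grading := d.deg
    graded := gradedAlgebraOfProj d.deg
      (d.f_mem_deg 0 fun m hm a ha => eq_zero_of_mem_unitAlg hm ha)
      (fun i j a b ha hb => by
        obtain ⟨R, x, ξ, rfl, hξ⟩ := d.exists_of_mem_deg ha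
        obtain ⟨S, y, η, rfl, hη⟩ := d.exists_of_mem_deg hb
        have : d.mul (d.f x ξ) (d.f y η) ∈ d.deg (i + j) := by
          rw [mul_apply]
          exact d.f_mem_deg _ (extDual_eq_zero rfl hξ hη)
        exact this)
      d.proj (fun _ _ h => h)
      (fun m n a ha h => by
        obtain ⟨R, x, ξ, rfl, hξ⟩ := d.exists_of_mem_deg ha
        rw [proj_f]
        refine (congrArg (d.f x) (R.obj.hom_ext_homogeneous fun l a hl => ?_)).trans (map_zero (d.f x))
        by_cases hlm : m = l
        · subst hlm; rw [LinearMap.comp_apply, R.obj.proj_of_mem hl, hξ m h a hl]; rfl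
        · rw [LinearMap.comp_apply, R.obj.proj_of_mem_ne hl hlm, map_zero]; rfl)
      (fun c => by
        obtain ⟨R, x, ξ, rfl⟩ := d.surj c
        obtain ⟨N, hN⟩ := R.obj.exists_forall_sum_proj ⊤
        have : ξ = ∑ m ∈ Finset.range N, ξ ∘ₗ R.obj.proj m := by
          refine LinearMap.ext fun a => ?_
          rw [LinearMap.sum_apply]
          conv_lhs => rw [← hN _ le_rfl a trivial, map_sum]
          rfl
        rw [this, map_sum]
        refine Submodule.sum_mem _ fun m _ => Submodule.mem_iSup_of_mem m (d.f_mem_deg x ?_)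
        intro l hl a ha
        rw [LinearMap.comp_apply, R.obj.proj_of_mem_ne ha (Ne.symm hl), map_zero])
    graded_comm := fun i j a b ha hb => by
      have h := d.mul_comm_deg ha hb
      refine Eq.trans (b := (-1 : k) ^ (i * j) • (b * a)) h ?_
      rw [Algebra.smul_def]
      simp }

end FormalDual

end

/-! ### The Hopf algebra structure and Cartier duality -/

noncomputable section

open GrAlg GrHopf

lemma sum_coord_mul {k R ι : Type*} [Field k] [Ring R] [Algebra k R] [Fintype ι]
    (b : Module.Basis ι k R) (ξ : Module.Dual k R) (x y : R) :
    ∑ i, ξ (b i * y) * b.coord i x = ξ (x * y) := by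
  conv_rhs => rw [← b.sum_repr x, Finset.sum_mul, map_sum]
  exact Finset.sum_congr rfl fun i _ => by
    rw [smul_mul_assoc, map_smul, smul_eq_mul, mul_comm, Module.Basis.coord_apply]

lemma sum_mul_coord {k R ι : Type*} [Field k] [Ring R] [Algebra k R] [Fintype ι]
    (b : Module.Basis ι k R) (ξ : Module.Dual k R) (x y : R) :
    ∑ i, ξ (x * b i) * b.coord i y = ξ (x * y) := by
  conv_rhs => rw [← b.sum_repr y, Finset.mul_sum, map_sum]
  exact Finset.sum_congr rfl fun i _ => by
    rw [mul_smul_comm, map_smul, smul_eq_mul, mul_comm, Module.Basis.coord_apply]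

lemma dualComul_id (k : Type u) [Field k] : dualComul k (LinearMap.id : k →ₗ[k] k) =
    LinearMap.id ⊗ₜ LinearMap.id :=
  (eq_dualComul (R := k) _ _ fun a b => by simp [Module.Dual.eval_apply]).symm

/-- For a graded-commutative algebra, multiplication is itself a morphism A ⊗ A → A, and the
coproduct of the dual is its transpose. -/
lemma extEquiv_dualComul {k : Type u} [Field k] {A : GrAlg k} [Module.Finite k A.carrier]
    (ξ : Module.Dual k A.carrier) :
    extEquiv A A (dualComul A.carrier ξ) = ξ ∘ₗ (tensorDesc (𝟙 A) (𝟙 A)).toAlgHom.toLinearMap := by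
  refine LinearMap.ext fun t => ?_
  obtain ⟨t, rfl⟩ := tmk_surjective A A t
  refine (congrArg (TensorProduct.dualDistribEquiv k A.carrier A.carrier (dualComul A.carrier ξ))
    ((tmkEquiv A A).symm_apply_apply t)).trans ?_
  refine (LinearMap.congr_fun (LinearEquiv.apply_symm_apply
    (TensorProduct.dualDistribEquiv k A.carrier A.carrier) ((LinearMap.mul' k A.carrier).dualMap ξ)) t).trans ?_
  refine congrArg ξ (Eq.trans ?_ (tensorDesc_apply (𝟙 A) (𝟙 A) t).symm)
  exact congrArg _ (LinearMap.congr_fun (TensorProduct.map_id (R := k)).symm t)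

namespace FormalDual

variable {k : Type u} [Field k] {G : FinGrAlg k ⥤ AddCommGrpCat.{u}} (d : FormalDual G)

/-- The linear map which corresponds to a point, with values in the graded algebra. -/
def fa {R : FinGrAlg k} (x : G.obj R) : Module.Dual k R.obj.carrier →ₗ[k] d.alg.carrier :=
  d.f x

lemma fa_mul {R S : FinGrAlg k} (x : G.obj R) (y : G.obj S) (ξ : Module.Dual k R.obj.carrier)
    (η : Module.Dual k S.obj.carrier) :
    d.fa x ξ * d.fa y η = d.fa (box x y) (extDual ξ η) := d.mul_apply x y ξ η

lemma fa_zero {R : FinGrAlg k} (ξ : Module.Dual k R.obj.carrier) :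
    d.fa (0 : G.obj R) ξ = ξ 1 • 1 := d.f_zero ξ

lemma fa_mem {n : ℕ} {R : FinGrAlg k} (x : G.obj R) {ξ : Module.Dual k R.obj.carrier}
    (h : ∀ m ≠ n, ∀ a ∈ R.obj.grading m, ξ a = 0) : d.fa x ξ ∈ d.alg.grading n := d.f_mem_deg x h

lemma fa_coord_mem {R : FinGrAlg k} (x : G.obj R) {I : Type*} [Fintype I]
    {b : Module.Basis I k R.obj.carrier} {e : I → ℕ} (he : ∀ i, b i ∈ R.obj.grading (e i)) (i : I) :
    d.fa x (b.coord i) ∈ d.alg.grading (e i) :=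
  d.fa_mem x fun m hm a ha => by
    have h := LinearMap.congr_fun (coord_comp_proj he i m) a
    rw [LinearMap.comp_apply, R.obj.proj_of_mem ha, if_neg (Ne.symm hm)] at h
    exact h

lemma proj_fa {R : FinGrAlg k} (x : G.obj R) (n : ℕ) (ξ : Module.Dual k R.obj.carrier) :
    d.alg.proj n (d.fa x ξ) = d.fa x (ξ ∘ₗ R.obj.proj n) := by
  obtain ⟨I, _, b, e, he⟩ := R.obj.exists_basis_homogeneous
  exact (proj_comp_iff_coord he).2 (d.fa_coord_mem x he) n ξ

lemma fa_surj (c : d.alg.carrier) : ∃ (R : FinGrAlg k) (x : G.obj R) (ξ : Module.Dual k R.obj.carrier),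
    d.fa x ξ = c := d.surj c

/-- The sum of two points of `R` is their external sum on R ⊗ R pushed forward along the
multiplication of `R`. -/
lemma fa_add {R : FinGrAlg k} (x y : G.obj R) (ξ : Module.Dual k R.obj.carrier) :
    d.fa (x + y) ξ = LinearMap.mul' k d.alg.carrier
      (TensorProduct.map (d.fa x) (d.fa y) (dualComul R.obj.carrier ξ)) := by
  have h1 : G.map (FinGrAlg.desc (𝟙 R) (𝟙 R)) (box x y) = x + y :=
    (map_box x y _ _).trans (by simp)
  have h2 := d.nat_apply (FinGrAlg.desc (𝟙 R) (𝟙 R)) (box x y) ξ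
  rw [h1] at h2
  refine h2.trans ((congrArg (d.f (box x y)) (extEquiv_dualComul ξ).symm).trans ?_)
  refine LinearMap.congr_fun (TensorProduct.ext' fun ξ η => ?_ : d.fa (box x y) ∘ₗ
    (extEquiv R.obj R.obj).toLinearMap = LinearMap.mul' k d.alg.carrier ∘ₗ
      TensorProduct.map (d.fa x) (d.fa y)) (dualComul R.obj.carrier ξ)
  exact (congrArg (d.f (box x y)) (extEquiv_tmul ξ η)).trans (d.fa_mul x y ξ η).symm

theorem exists_comul : ∃ D : d.alg.carrier →ₗ[k] d.alg.carrier ⊗[k] d.alg.carrier,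
    ∀ {R : FinGrAlg k} (x : G.obj R) ξ,
      D (d.fa x ξ) = TensorProduct.map (d.fa x) (d.fa x) (dualComul R.obj.carrier ξ) := by
  obtain ⟨D, hD⟩ := d.desc (M := d.alg.carrier ⊗[k] d.alg.carrier)
    (fun {R} x => TensorProduct.map (d.fa x) (d.fa x) ∘ₗ dualComul R.obj.carrier) fun {R S} h x => by
      refine LinearMap.ext fun ξ => ?_
      have h1 : d.fa (G.map h x) = d.fa x ∘ₗ FinGrAlg.dualMap h := d.nat h x
      rw [h1, TensorProduct.map_comp]
      exact congrArg (TensorProduct.map (d.fa x) (d.fa x)) (map_dualComul h.hom.toAlgHom ξ)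
  exact ⟨D, fun x ξ => LinearMap.congr_fun (hD x) ξ⟩

theorem exists_counit : ∃ ε : d.alg.carrier →ₗ[k] k, ∀ {R : FinGrAlg k} (x : G.obj R) ξ,
    ε (d.fa x ξ) = ξ 1 := by
  obtain ⟨ε, hε⟩ := d.desc (M := k) (fun _ => LinearMap.applyₗ 1) fun {R S} h x =>
    LinearMap.ext fun ξ => congrArg ξ (map_one h.hom.toAlgHom).symm
  exact ⟨ε, fun x ξ => LinearMap.congr_fun (hε x) ξ⟩

theorem exists_antipode : ∃ s : d.alg.carrier →ₗ[k] d.alg.carrier, ∀ {R : FinGrAlg k} (x : G.obj R),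
    s ∘ₗ d.fa x = d.fa (-x) :=
  d.desc (fun x => d.f (-x)) fun {R S} h x => by rw [← d.nat h (-x), map_neg]

/-- The dual of a formal group as a coalgebra. -/
@[reducible] def coalg : Coalgebra k d.alg.carrier := by
  have hsum : ∀ {R : FinGrAlg k} (x : G.obj R) (ξ : Module.Dual k R.obj.carrier),
      d.exists_comul.choose (d.fa x ξ) = ∑ i, ∑ j,
        ξ (Module.finBasis k R.obj.carrier i * Module.finBasis k R.obj.carrier j) •
        (d.fa x ((Module.finBasis k R.obj.carrier).coord i) ⊗ₜ
          d.fa x ((Module.finBasis k R.obj.carrier).coord j)) := fun {R} x ξ => by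
    rw [d.exists_comul.choose_spec, dualComul_eq_sum (Module.finBasis k R.obj.carrier)]
    simp only [map_sum, map_smul, TensorProduct.map_tmul]
  refine
    { comul := d.exists_comul.choose
      counit := d.exists_counit.choose
      coassoc := ?_
      rTensor_counit_comp_comul := ?_
      lTensor_counit_comp_comul := ?_ }
  · refine LinearMap.ext fun c => ?_
    obtain ⟨R, x, ξ, rfl⟩ := d.fa_surj c
    let b := Module.finBasis k R.obj.carrier
    simp only [LinearMap.comp_apply, hsum, map_sum, map_smul, LinearMap.rTensor_tmul,
      LinearMap.lTensor_tmul, TensorProduct.sum_tmul, TensorProduct.tmul_sum, LinearEquiv.coe_coe,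
      TensorProduct.tmul_smul, ← TensorProduct.smul_tmul', TensorProduct.assoc_tmul, Finset.smul_sum,
      smul_smul]
    have h1 : ∀ l m j, ∑ i, ξ (b i * b j) * b.coord i (b l * b m) = ξ (b l * (b m * b j)) :=
      fun l m j => (sum_coord_mul b ξ _ _).trans (congrArg ξ (_root_.mul_assoc _ _ _))
    have h2 : ∀ l m j, ∑ i, ξ (b l * b i) * b.coord i (b m * b j) = ξ (b l * (b m * b j)) :=
      fun l m j => sum_mul_coord b ξ _ _
    -- Both iterated coproducts are the transpose of the triple product, expanded in the basis.
    trans ∑ l, ∑ m, ∑ j, ξ (b l * (b m * b j)) •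
      (d.fa x (b.coord l) ⊗ₜ[k] (d.fa x (b.coord m) ⊗ₜ[k] d.fa x (b.coord j)))
    · simp only [← h1, Finset.sum_smul]
      rw [Finset.sum_comm, Finset.sum_congr rfl fun j _ => Finset.sum_comm, Finset.sum_comm]
      refine Finset.sum_congr rfl fun l _ => ?_
      rw [Finset.sum_congr rfl fun j _ => Finset.sum_comm, Finset.sum_comm]
    · simp only [← h2, Finset.sum_smul]
      refine Finset.sum_congr rfl fun l _ => ?_
      rw [Finset.sum_congr rfl fun m _ => Finset.sum_comm, Finset.sum_comm]
  · refine LinearMap.ext fun c => ?_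
    obtain ⟨R, x, ξ, rfl⟩ := d.fa_surj c
    let b := Module.finBasis k R.obj.carrier
    simp only [LinearMap.comp_apply, hsum, map_sum, map_smul, LinearMap.rTensor_tmul,
      d.exists_counit.choose_spec]
    have h1 : ∀ j, ∑ i, ξ (b i * b j) * b.coord i 1 = ξ (b j) := fun j => by
      rw [sum_coord_mul, _root_.one_mul]
    rw [Finset.sum_comm]
    have h3 : ∀ i j, ξ (b i * b j) • (b.coord i 1 ⊗ₜ[k] d.fa x (b.coord j)) =
        (ξ (b i * b j) * b.coord i 1) • (1 ⊗ₜ[k] d.fa x (b.coord j)) := fun i j => by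
      rw [mul_smul, TensorProduct.smul_tmul' (b.coord i 1), smul_eq_mul, _root_.mul_one]
    simp only [b] at h1 h3
    simp only [h3, ← Finset.sum_smul, h1]
    simp only [← TensorProduct.tmul_smul, ← map_smul, ← TensorProduct.tmul_sum, ← map_sum]
    exact congrArg (fun η => 1 ⊗ₜ[k] d.fa x η) (b.sum_dual_apply_smul_coord ξ)
  · refine LinearMap.ext fun c => ?_
    obtain ⟨R, x, ξ, rfl⟩ := d.fa_surj c
    let b := Module.finBasis k R.obj.carrier
    simp only [LinearMap.comp_apply, hsum, map_sum, map_smul, LinearMap.lTensor_tmul,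
      d.exists_counit.choose_spec]
    have h1 : ∀ j, ∑ i, ξ (b j * b i) * b.coord i 1 = ξ (b j) := fun j => by
      rw [sum_mul_coord, _root_.mul_one]
    have h3 : ∀ i j, ξ (b i * b j) • (d.fa x (b.coord i) ⊗ₜ[k] b.coord j 1) =
        (ξ (b i * b j) * b.coord j 1) • (d.fa x (b.coord i) ⊗ₜ[k] 1) := fun i j => by
      rw [mul_smul, ← TensorProduct.tmul_smul (b.coord j 1), smul_eq_mul, _root_.mul_one]
    simp only [b] at h1 h3
    simp only [h3, ← Finset.sum_smul, h1]
    simp only [TensorProduct.smul_tmul', ← map_smul, ← TensorProduct.sum_tmul, ← map_sum]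
    exact congrArg (fun η => d.fa x η ⊗ₜ[k] 1) (b.sum_dual_apply_smul_coord ξ)

lemma comul_fa {R : FinGrAlg k} (x : G.obj R) (ξ : Module.Dual k R.obj.carrier) :
    d.coalg.comul (d.fa x ξ) =
      TensorProduct.map (d.fa x) (d.fa x) (dualComul R.obj.carrier ξ) :=
  d.exists_comul.choose_spec x ξ

lemma counit_fa {R : FinGrAlg k} (x : G.obj R) (ξ : Module.Dual k R.obj.carrier) :
    d.coalg.counit (d.fa x ξ) = ξ 1 := d.exists_counit.choose_spec x ξ

/-- The antipode of the dual of a formal group. -/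
def anti : d.alg.carrier →ₗ[k] d.alg.carrier := d.exists_antipode.choose

lemma anti_comp {R : FinGrAlg k} (x : G.obj R) : d.anti ∘ₗ d.fa x = d.fa (-x) :=
  d.exists_antipode.choose_spec x

/-- The dual of a formal group as a graded Hopf algebra. -/
def hopf : GrHopf k where
  toGrAlg := d.alg
  coalgebra := d.coalg
  comul_mem n c hc := by
    obtain ⟨R, x, ξ, rfl, hξ⟩ := d.exists_of_mem_deg hc
    obtain ⟨I, _, b, e, he⟩ := R.obj.exists_basis_homogeneous
    refine (?_ : d.coalg.comul (d.fa x ξ) ∈ tensorGrading d.alg d.alg n)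
    rw [comul_fa, dualComul_eq_sum b]
    simp only [map_sum, map_smul, TensorProduct.map_tmul]
    refine Submodule.sum_mem _ fun i _ => Submodule.sum_mem _ fun j _ => ?_
    by_cases h : e i + e j = n
    · rw [← h]
      exact Submodule.smul_mem _ _ (tmul_mem_tensorGrading d.alg d.alg (d.fa_coord_mem x he i)
        (d.fa_coord_mem x he j))
    · rw [hξ _ h _ (R.obj.mul_mem (he i) (he j)), zero_smul]
      exact Submodule.zero_mem _
  counit_eq_zero n c hc hn := by
    obtain ⟨R, x, ξ, rfl, hξ⟩ := d.exists_of_mem_deg hc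
    exact (d.counit_fa x ξ).trans (hξ 0 hn.symm 1 R.obj.one_mem)
  comul_one := by
    refine (d.comul_fa 0 _).trans ((congrArg _ (dualComul_id k)).trans ?_)
    rfl
  comul_mul a b := by
    obtain ⟨R, x, ξ, rfl⟩ := d.fa_surj a
    obtain ⟨S, y, η, rfl⟩ := d.fa_surj b
    rw [fa_mul, comul_fa, comul_fa]
    refine (congrArg (tmk d.alg d.alg) (d.comul_fa (box x y) (extDual ξ η))).trans ?_
    exact tmk_map_dualComul_extDual (d.proj_fa x) (d.proj_fa y)
      (fun ξ η => (d.fa_mul x y ξ η).symm) ξ η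
  counit_one := d.counit_fa 0 _
  counit_mul a b := by
    obtain ⟨R, x, ξ, rfl⟩ := d.fa_surj a
    obtain ⟨S, y, η, rfl⟩ := d.fa_surj b
    rw [fa_mul, counit_fa, counit_fa]
    refine (d.counit_fa (box x y) (extDual ξ η)).trans ?_
    exact (congrArg (extDual ξ η) (tmk_one R.obj S.obj).symm).trans (extDual_tmul ξ η 1 1)
  graded_cocomm c := by
    obtain ⟨R, x, ξ, rfl⟩ := d.fa_surj c
    obtain ⟨I, _, b, e, he⟩ := R.obj.exists_basis_homogeneous
    refine (comm_of_eq_desc d.alg _).trans (?_ : _ = tmk d.alg d.alg (d.coalg.comul (d.fa x ξ)))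
    rw [comul_fa, dualComul_eq_sum b]
    simp only [map_sum, map_smul, TensorProduct.map_tmul]
    refine Finset.sum_comm.trans (Finset.sum_congr rfl fun i _ => Finset.sum_congr rfl fun j _ => ?_)
    have h := fun m => d.fa_coord_mem x he m
    rw [tensorDesc_tmul, (tensor d.alg d.alg).comm_of_mem ((tensorInr d.alg d.alg).map_mem _ _ (h j))
      ((tensorInl d.alg d.alg).map_mem _ _ (h i)), tensorInl_mul_tensorInr,
      R.obj.comm_of_mem (he j) (he i), map_smul, smul_smul, smul_eq_mul, mul_right_comm, ← mul_pow,
      neg_one_mul, neg_neg, one_pow, _root_.one_mul]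
  antipode := d.anti
  antipode_mem n c hc := by
    obtain ⟨R, x, ξ, rfl, hξ⟩ := d.exists_of_mem_deg hc
    exact (LinearMap.congr_fun (d.anti_comp x) ξ).symm ▸ d.fa_mem (-x) hξ
  mul_antipode_left c := by
    obtain ⟨R, x, ξ, rfl⟩ := d.fa_surj c
    rw [comul_fa, counit_fa, ← LinearMap.comp_apply (TensorProduct.map _ _), ← TensorProduct.map_comp,
      anti_comp, LinearMap.id_comp, ← fa_add, neg_add_cancel, fa_zero, Algebra.algebraMap_eq_smul_one]
  mul_antipode_right c := by
    obtain ⟨R, x, ξ, rfl⟩ := d.fa_surj c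
    rw [comul_fa, counit_fa, ← LinearMap.comp_apply (TensorProduct.map _ _), ← TensorProduct.map_comp,
      anti_comp, LinearMap.id_comp, ← fa_add, add_neg_cancel, fa_zero, Algebra.algebraMap_eq_smul_one]

/-- The homomorphism of coalgebras which corresponds to a point. -/
def hom {R : FinGrAlg k} (x : G.obj R) : DualCoalgHom R d.hopf :=
  DualCoalgHom.mk' (d.fa x) (d.proj_fa x) (d.comul_fa x) (d.counit_fa x)

lemma hom_map {R S : FinGrAlg k} (h : R ⟶ S) (x : G.obj R) : d.hom (G.map h x) = (d.hom x).map h :=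
  DualCoalgHom.ext (d.nat h x)

/-- Two points are pushed forward from a single point `w` for which `d.f w` is injective; equal
homomorphisms then force the two algebra morphisms to agree. -/
lemma hom_injective (R : FinGrAlg k) : Function.Injective (d.hom : G.obj R → _) := by
  intro x y hxy
  obtain ⟨T, z, h, h', rfl, rfl⟩ := d.dir x y
  obtain ⟨B, w, l, rfl, hw⟩ := d.inj z
  have h1 : d.f (G.map h (G.map l w)) = d.f (G.map h' (G.map l w)) :=
    congrArg DualCoalgHom.toLin hxy
  rw [d.nat, d.nat, d.nat, d.nat] at h1
  have h2 : l ≫ h = l ≫ h' := by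
    refine ObjectProperty.hom_ext _ (hom_ext' fun a => ?_)
    refine (Module.evalEquiv k R.obj.carrier).injective (LinearMap.ext fun ξ => ?_)
    exact LinearMap.congr_fun (hw (LinearMap.congr_fun h1 ξ)) a
  rw [← AddCommGrpCat.comp_apply, ← AddCommGrpCat.comp_apply, ← G.map_comp, ← G.map_comp, h2]

lemma exists_le_range (N : Submodule k d.C) (hN : N.FG) : ∃ (B : FinGrAlg k) (z : G.obj B),
    Function.Injective (d.f z) ∧ N ≤ LinearMap.range (d.f z) := by
  refine Submodule.fg_induction (motive := fun N _ => ∃ (B : FinGrAlg k) (z : G.obj B),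
    Function.Injective (d.f z) ∧ N ≤ LinearMap.range (d.f z)) (fun c => ?_) ?_ N hN
  · obtain ⟨R, x, ξ, rfl⟩ := d.surj c
    obtain ⟨B, z, h, rfl, hz⟩ := d.inj x
    refine ⟨B, z, hz, (Submodule.span_singleton_le_iff_mem _ _).2 ⟨FinGrAlg.dualMap h ξ, ?_⟩⟩
    rw [d.nat]; rfl
  · rintro N N' - - ⟨R, x, -, hx⟩ ⟨S, y, -, hy⟩
    obtain ⟨T, z, h, h', rfl, rfl⟩ := d.dir x y
    obtain ⟨B, w, l, rfl, hw⟩ := d.inj z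
    rw [← AddCommGrpCat.comp_apply, ← G.map_comp, d.nat] at hx hy
    exact ⟨B, w, hw, sup_le (hx.trans (LinearMap.range_comp_le_range _ _))
      (hy.trans (LinearMap.range_comp_le_range _ _))⟩

/-- For surjectivity, the finite-dimensional range of a homomorphism lies in that of some injective
`d.f z`, and `DualCoalgHom.exists_factor` turns the inclusion into a morphism of algebras. -/
theorem isCartierDual : IsCartierDual G d.hopf := by
  refine ⟨fun R => Equiv.ofBijective d.hom ⟨d.hom_injective R, fun φ => ?_⟩,
    fun R S h x => d.nat h x, fun R x y => d.fa_add x y⟩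
  obtain ⟨B, z, hz, hφ⟩ := d.exists_le_range (LinearMap.range φ.toLin)
    (Module.Finite.iff_fg.1 (Module.Finite.range φ.toLin))
  obtain ⟨h, rfl⟩ := DualCoalgHom.exists_factor (d.hom z) hz φ hφ
  exact ⟨G.map h z, d.hom_map h z⟩

end FormalDual

theorem exists_isCartierDual {k : Type u} [Field k] {G : FinGrAlg k ⥤ AddCommGrpCat.{u}}
    (hG : isFormalGroup k G) : ∃ C, IsCartierDual G C :=
  (exists_formalDual hG).elim fun d => ⟨d.hopf, d.isCartierDual⟩

end

noncomputable section

open GrAlg GrHopf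

/-! ## Closure properties of formal groups -/

/-- A retract is the colimit of the sequence X → X → X → ⋯ whose transition maps are the idempotent
`r ≫ i`. In particular ind-objects are closed under retracts. -/
lemma prop_of_retract {D : Type*} [Category D] (P : ObjectProperty D)
    [P.IsClosedUnderColimitsOfShape (AsSmall.{u} ℕ)] {X Y : D} (i : Y ⟶ X) (r : X ⟶ Y)
    (hir : i ≫ r = 𝟙 Y) (hX : P X) : P Y := by
  classical
  have he : (r ≫ i) ≫ r ≫ i = r ≫ i := by
    rw [Category.assoc, ← Category.assoc i, hir, Category.id_comp]
  let F : ℕ ⥤ D :=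
    { obj := fun _ => X
      -- Only the trivial step is the identity; all proper steps are the idempotent, which is
      -- compatible with composition.
      map := fun {m n} _ => if m = n then 𝟙 X else r ≫ i
      map_id := fun _ => if_pos rfl
      map_comp := fun {l m n} f g => by
        have h1 := leOfHom f
        have h2 := leOfHom g
        by_cases hlm : l = m
        · subst hlm; simp
        · by_cases hmn : m = n
          · subst hmn; simp
          · rw [if_neg hlm, if_neg hmn, if_neg (by omega), he] }
  let c : Cocone (AsSmall.down ⋙ F) :=
    { pt := Y
      ι :=
        { app := fun _ => r
          naturality := fun m n f => by
            refine Eq.trans ?_ (Category.comp_id r).symm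
            change (if _ then 𝟙 X else r ≫ i) ≫ r = r
            split_ifs
            · exact Category.id_comp r
            · rw [Category.assoc, hir, Category.comp_id] } }
  let z : AsSmall.{u} ℕ := AsSmall.up.obj 0
  refine P.prop_of_isColimit (c := c)
    { desc := fun s => i ≫ s.ι.app z
      fac := fun s j => ?_
      uniq := fun s m hm => ?_ } fun _ => hX
  · have h1 : ∀ l n : ℕ, ∀ h : l < n, (r ≫ i) ≫ s.ι.app (AsSmall.up.obj n) =
        s.ι.app (AsSmall.up.obj l) := fun l n h => by
      have := s.w (AsSmall.up.map (homOfLE h.le))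
      change (if l = n then 𝟙 X else r ≫ i) ≫ _ = _ at this
      rwa [if_neg h.ne] at this
    obtain ⟨j, rfl⟩ : ∃ n : ℕ, j = AsSmall.up.obj n := ⟨AsSmall.down.obj j, rfl⟩
    change r ≫ i ≫ s.ι.app (AsSmall.up.obj 0) = _
    rw [← h1 0 (j + 1) (by omega), ← Category.assoc, ← Category.assoc (r ≫ i), he, h1 j _ (by omega)]
  · rw [← hm z, ← Category.assoc]
    exact ((congrArg (· ≫ m) hir).trans (Category.id_comp m)).symm

section Formal

variable {k : Type u} [Field k] {G G' : FinGrAlg k ⥤ AddCommGrpCat.{u}}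

lemma isFormalGroup_of_retract (i : G' ⟶ G) (r : G ⟶ G') (hir : i ≫ r = 𝟙 G')
    (hG : isFormalGroup k G) : isFormalGroup k G' :=
  prop_of_retract (IsIndObject (C := (FinGrAlg k)ᵒᵖ))
    (Functor.whiskerLeft (unopUnop (FinGrAlg k)) (Functor.whiskerRight i (forget _)))
    (Functor.whiskerLeft (unopUnop (FinGrAlg k)) (Functor.whiskerRight r (forget _)))
    (by rw [← Functor.whiskerLeft_comp, ← Functor.whiskerRight_comp, hir]; rfl) hG

instance : HasBinaryCoproducts (FinGrAlg k) :=
  haveI : ∀ R S : FinGrAlg k, HasColimit (pair R S) := fun R S =>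
    ⟨⟨BinaryCofan.mk (FinGrAlg.inl R S) (FinGrAlg.inr R S),
      BinaryCofan.isColimitMk (fun s => FinGrAlg.desc s.inl s.inr) (fun s => FinGrAlg.inl_desc _ _)
      (fun s => FinGrAlg.inr_desc _ _) fun s m h1 h2 => ObjectProperty.hom_ext _ (tensor_hom_ext'
        ((congrArg (·.hom) (h1.trans (FinGrAlg.inl_desc s.inl s.inr).symm)))
        ((congrArg (·.hom) (h2.trans (FinGrAlg.inr_desc s.inl s.inr).symm))))⟩⟩
  hasBinaryCoproducts_of_hasColimit_pair _

/-- Finite-dimensional graded algebras have binary coproducts, so their opposite category has binary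
products, and ind-objects inherit these. -/
lemma isFormalGroup_prod (hG : isFormalGroup k G) (hG' : isFormalGroup k G') :
    isFormalGroup k (G ⨯ G') := by
  haveI : HasLimitsOfShape (Discrete (ULift.{u} WalkingPair)) (FinGrAlg k)ᵒᵖ :=
    hasLimitsOfShape_of_equivalence (Discrete.equivalence Equiv.ulift.symm)
  let Φ := (Functor.whiskeringLeft _ _ AddCommGrpCat.{u}).obj (unopUnop (FinGrAlg k)) ⋙
    (Functor.whiskeringRight _ _ _).obj (forget AddCommGrpCat.{u})
  have h := mapIsLimitOfPreservesOfIsLimit Φ _ _ (prodIsProd G G')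
  refine ObjectProperty.prop_of_isLimit (IsIndObject (C := (FinGrAlg k)ᵒᵖ))
    (h.whiskerEquivalence (Discrete.equivalence (Equiv.ulift.{u} (α := WalkingPair)))) ?_
  rintro ⟨⟨_ | _⟩⟩
  · exact hG
  · exact hG'

/-- The endomorphism of a functor given by a natural endomorphism of its argument. -/
def actBy (a : 𝟭 (FinGrAlg k) ⟶ 𝟭 (FinGrAlg k)) (G : FinGrAlg k ⥤ AddCommGrpCat.{u}) : G ⟶ G where
  app R := G.map (a.app R)
  naturality R S f := by
    rw [← G.map_comp, ← G.map_comp]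
    exact congrArg G.map (a.naturality f)

lemma actBy_natural (a : 𝟭 (FinGrAlg k) ⟶ 𝟭 (FinGrAlg k)) (φ : G ⟶ G') :
    actBy a G ≫ φ = φ ≫ actBy a G' := by
  ext R : 2
  exact φ.naturality (a.app R)

lemma actBy_comp (a b : 𝟭 (FinGrAlg k) ⟶ 𝟭 (FinGrAlg k)) :
    actBy a G ≫ actBy b G = actBy (a ≫ b) G := by
  ext R : 2
  exact (G.map_comp _ _).symm

variable (k) in
/-- The sign involution as a natural transformation. -/
def tauNat : 𝟭 (FinGrAlg k) ⟶ 𝟭 (FinGrAlg k) where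
  app R := ObjectProperty.homMk R.obj.tau
  naturality R S f := ObjectProperty.hom_ext _ (tau_naturality f.hom)

lemma hom_eq_iff {φ ψ : G ⟶ G} : φ = ψ ↔ ∀ R (x : G.obj R), φ.app R x = ψ.app R x :=
  ⟨fun h _ _ => h ▸ rfl, fun h => by ext R x; exact h R x⟩

lemma IsCartierDual.exists_equiv {C : GrHopf k} (h : IsCartierDual G C) :
    ∃ e : ∀ R : FinGrAlg k, G.obj R ≃ DualCoalgHom R C,
      (∀ (R S : FinGrAlg k) (f : R ⟶ S) (x : G.obj R), e S (G.map f x) = (e R x).map f) ∧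
      (∀ R, e R 0 = DualCoalgHom.trivial R C) ∧
      ∀ (R : FinGrAlg k) (x y : G.obj R),
        (e R (x + y)).toLin = dconv (e R x).toLin (e R y).toLin := by
  obtain ⟨e, h1, h2⟩ := h
  have h3 : ∀ (R : FinGrAlg k) (x y : G.obj R),
      (e R (x + y)).toLin = dconv (e R x).toLin (e R y).toLin := fun R x y => LinearMap.ext (h2 R x y)
  refine ⟨e, fun R S f x => DualCoalgHom.ext (h1 R S f x), fun R => ?_, h3⟩
  have h4 := h3 R 0 ((e R).symm (DualCoalgHom.trivial R C))
  rw [zero_add, Equiv.apply_symm_apply] at h4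
  refine DualCoalgHom.ext (elem_injective ?_)
  rw [h4, elem_dconv]
  exact ((mul_one _).symm.trans (congrArg (elem (e R 0).toLin * ·) elem_dunit.symm))

variable {C : GrHopf k} {e : ∀ R : FinGrAlg k, G.obj R ≃ DualCoalgHom R C}

lemma actBy_eq_id_iff (hn : ∀ (R S : FinGrAlg k) (f : R ⟶ S) (x : G.obj R),
    e S (G.map f x) = (e R x).map f) (a : 𝟭 (FinGrAlg k) ⟶ 𝟭 (FinGrAlg k)) :
    actBy a G = 𝟙 G ↔ ∀ R (f : DualCoalgHom R C), f.map (a.app R) = f := by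
  rw [hom_eq_iff]
  refine forall_congr' fun R => ⟨fun h f => ?_, fun h x => ?_⟩
  · obtain ⟨x, rfl⟩ := (e R).surjective f
    exact (hn _ _ _ _).symm.trans (congrArg (e R) (h x))
  · exact (e R).injective ((hn _ _ _ _).trans (h _))

lemma map_tau_iff {p : ℕ} [CharP k p] (hp : p ≠ 2) :
    (∀ R (f : DualCoalgHom R C), f.map ((tauNat k).app R) = f) ↔ C.IsEven := by
  rw [← tau_eq_id_iff p hp]
  constructor
  · intro h
    refine hom_ext' fun x => ?_
    obtain ⟨A, f, ξ, rfl⟩ := exists_eq_toLin x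
    exact (tau_toLin f ξ).trans (congrArg (fun g : DualCoalgHom A C => g.toLin ξ) (h A f))
  · intro h R f
    refine DualCoalgHom.ext (LinearMap.ext fun ξ => (tau_toLin f ξ).symm.trans ?_)
    rw [h]; rfl

variable (p : ℕ) [Fact p.Prime] [CharP k p] [PerfectField k]

variable (k) in
/-- The projection to the perfect part as a natural transformation. -/
def redNat : 𝟭 (FinGrAlg k) ⟶ 𝟭 (FinGrAlg k) where
  app R := R.red p
  naturality R S f := ObjectProperty.hom_ext _ (red_natural p f.hom).symm

lemma actBy_red_eq_zero_iff (hn : ∀ (R S : FinGrAlg k) (f : R ⟶ S) (x : G.obj R),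
    e S (G.map f x) = (e R x).map f) (h0 : ∀ R, e R 0 = DualCoalgHom.trivial R C) :
    actBy (redNat k p) G = 0 ↔ C.IsConilpotent := by
  rw [hom_eq_iff, isConilpotent_iff_redTrivial p]
  refine forall_congr' fun R => ⟨fun h f ξ => ?_, fun h x => (e R).injective ?_⟩
  · obtain ⟨x, rfl⟩ := (e R).surjective f
    rw [← hn]
    have h1 : e R (G.map (R.red p) x) = DualCoalgHom.trivial R C := (congrArg (e R) (h x)).trans (h0 R)
    rw [h1]; rfl
  · exact (hn _ _ _ _).trans (Eq.trans
      (b := DualCoalgHom.trivial R C) (DualCoalgHom.ext (LinearMap.ext fun ξ => h (e R x) ξ)) (h0 R).symm)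

lemma isConnectedFormal_iff (hp : p ≠ 2) : isConnectedFormal k G ↔
    isFormalGroup k G ∧ actBy (redNat k p) G = 0 ∧ actBy (tauNat k) G = 𝟙 G := by
  constructor
  · rintro ⟨h, C, hC, h1, h2⟩
    obtain ⟨e, hn, h0, -⟩ := hC.exists_equiv
    exact ⟨h, (actBy_red_eq_zero_iff p hn h0).2 h2,
      (actBy_eq_id_iff hn (tauNat k)).2 ((map_tau_iff hp).2 h1)⟩
  · rintro ⟨h, h1, h2⟩
    obtain ⟨C, hC⟩ := exists_isCartierDual h
    obtain ⟨e, hn, h0, -⟩ := hC.exists_equiv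
    exact ⟨h, C, hC, (map_tau_iff hp).1 ((actBy_eq_id_iff hn (tauNat k)).1 h2),
      (actBy_red_eq_zero_iff p hn h0).1 h1⟩

lemma isEtaleFormal_iff : isEtaleFormal k G ↔
    isFormalGroup k G ∧ actBy (redNat k p) G = 𝟙 G := by
  constructor
  · rintro ⟨h, C, hC, h1⟩
    obtain ⟨e, hn, -, -⟩ := hC.exists_equiv
    exact ⟨h, (actBy_eq_id_iff hn (redNat k p)).2 ((isUngraded_isMultiplicative_iff_redFixed p).1 h1)⟩
  · rintro ⟨h, h1⟩
    obtain ⟨C, hC⟩ := exists_isCartierDual h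
    obtain ⟨e, hn, -, -⟩ := hC.exists_equiv
    exact ⟨h, C, hC, (isUngraded_isMultiplicative_iff_redFixed p).2
      fun R f => (actBy_eq_id_iff hn (redNat k p)).1 h1 R f⟩

/-- In R ⊗ C the points are unipotent elements, so each is killed by a power of the odd prime `p`.
-/
lemma isIso_two_of_actBy_red_eq_zero (hp : Odd p) (hG : isFormalGroup k G)
    (h : actBy (redNat k p) G = 0) : IsIso (𝟙 G + 𝟙 G) := by
  obtain ⟨C, hC⟩ := exists_isCartierDual hG
  obtain ⟨e, hn, h0, ha⟩ := hC.exists_equiv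
  refine isIso_two_iff.2 fun R => bijective_two_of_torsion hp fun x => ?_
  have h1 : ∀ m : ℕ, elem (e R (m • x)).toLin = elem (e R x).toLin ^ m := fun m => by
    induction m with
    | zero => rw [zero_nsmul, h0, pow_zero]; exact elem_dunit
    | succ m ih => rw [succ_nsmul, ha, elem_dconv, ih, pow_succ]
  obtain ⟨n, h2⟩ := ((isConilpotent_iff_redTrivial p).1
    ((actBy_red_eq_zero_iff p hn h0).1 h) R (e R x)).exists_pow_eq_one
  have h3 : elem (e R (p ^ n • x)).toLin = elem (e R 0).toLin := by
    rw [h1, h2, h0]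
    exact elem_dunit.symm
  exact ⟨n, (e R).injective (DualCoalgHom.ext (elem_injective h3))⟩

end Formal

end

noncomputable section

open GrAlg GrHopf

/-! ## Odd formal groups -/

section Odd

variable {k : Type u} [Field k]

/-- Adding one odd primitive `b` to a finite-dimensional subalgebra E gives at most E + bE. -/
lemma GrHopf.finite_adjoin_oddPrim {H : GrHopf k} (h2 : (2 : k) ≠ 0) (s : Finset H.carrier) :
    Module.Finite k (Subalgebra.toSubmodule (Algebra.adjoin k (↑s ∩ H.oddPrim))) := by
  classical
  rw [Module.Finite.iff_fg]
  induction s using Finset.induction_on with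
  | empty =>
    rw [Finset.coe_empty, Set.empty_inter, Algebra.adjoin_empty, Algebra.toSubmodule_bot,
      Submodule.one_eq_span]
    exact Submodule.fg_span_singleton _
  | insert b s _ ih =>
    rw [Finset.coe_insert]
    by_cases hb : b ∈ H.oddPrim
    · rw [Set.insert_inter_of_mem hb]
      refine Submodule.FG.of_le (ih.sup (ih.map (LinearMap.mulLeft k b))) fun x hx => ?_
      obtain ⟨w, hw, w', hw', rfl⟩ := exists_of_mem_adjoin_insert
        (mul_self_of_mem_span_oddPrim h2 (Submodule.subset_span hb))
        (fun t ht => oddPrim_mul_comm ht.2 hb) hx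
      exact Submodule.add_mem_sup hw ⟨w', hw', rfl⟩
    · rwa [Set.insert_inter_of_notMem hb]

variable (k) in
/-- The projection to the part of degree zero as a natural transformation. -/
def deg0Hom (R : FinGrAlg k) : R ⟶ R := ObjectProperty.homMk R.obj.deg0

/-- The degree zero part of a point is fixed by τ and also negated by it, so its double vanishes. -/
lemma eq_zero_of_deg0 {F : FinGrAlg k ⥤ AddCommGrpCat.{u}} (hτ : actBy (tauNat k) F = -𝟙 F)
    (h2 : ∀ R (x : F.obj R), x + x = 0 → x = 0) {R : FinGrAlg k} (x : F.obj R) :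
    F.map (deg0Hom k R) x = 0 := by
  refine h2 R _ (add_eq_zero_iff_eq_neg.2 (Eq.trans ?_ (hom_eq_iff.1 hτ R _)))
  have h : deg0Hom k R ≫ (tauNat k).app R = deg0Hom k R :=
    ObjectProperty.hom_ext _ ((tau_naturality _).trans R.obj.tau_comp_deg0)
  exact (congrArg (fun f => F.map f x) h.symm).trans
    (congrArg (fun φ => φ.hom x) (F.map_comp (deg0Hom k R) ((tauNat k).app R)))

/-- Because `H` is finite-dimensional, it is itself a test algebra; the universal point exists and
the argument for affine groups applies to it. -/
lemma GrHopf.RepBy.isOddExterior {F : FinGrAlg k ⥤ AddCommGrpCat.{u}} {H : GrHopf k}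
    [Module.Finite k H.carrier] {e : ∀ R, F.obj R ≃ (H.toGrAlg ⟶ (isFiniteGrAlg k).ι.obj R)}
    (he : RepBy e) (hk : (2 : k) ≠ 0) (hτ : actBy (tauNat k) F = -𝟙 F)
    (h2 : ∀ R (x : F.obj R), x + x = 0 → x = 0) : H.IsOddExterior := by
  let R : FinGrAlg k := ⟨H.toGrAlg, ‹_›⟩
  obtain ⟨x, hx⟩ := (e R).surjective (𝟙 H.toGrAlg)
  have hid : ∀ f : R ⟶ R, e R (F.map f x) = f.hom := fun f =>
    (he.natural R R f x).trans ((congrArg (· ≫ f.hom) hx).trans (Category.id_comp f.hom))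
  refine isOddExterior_of_conv_tau hk ?_ fun a ha => ⟨Coalgebra.counit a, ?_⟩
  · let t : R ⟶ R := (tauNat k).app R
    have h1 : F.map t x + x = 0 := add_eq_zero_iff_eq_neg.2 (hom_eq_iff.1 hτ R x)
    refine Eq.trans ?_ ((he.add R _ _).symm.trans ((congrArg (e R) h1).trans (he.zero R)))
    exact congrArg₂ conv (hid _).symm hx.symm
  · have h1 := (hid (deg0Hom k R)).symm.trans
      ((congrArg (e R) (eq_zero_of_deg0 hτ h2 x)).trans (he.zero R))
    have h3 := congrArg (fun f : H.toGrAlg ⟶ H.toGrAlg => f.toAlgHom a) h1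
    rw [← Algebra.algebraMap_eq_smul_one, ← triv_apply (H := H) H.toGrAlg a]
    refine Eq.trans ?_ h3
    exact ((H.toGrAlg.deg0_apply a).trans (H.toGrAlg.proj_of_mem ha)).symm

variable {G : FinGrAlg k ⥤ AddCommGrpCat.{u}}

/-- The subfunctor given by subgroups of the values. -/
def subgroupFunctor (S : ∀ R, AddSubgroup (G.obj R))
    (hS : ∀ {R T} (f : R ⟶ T), ∀ x ∈ S R, G.map f x ∈ S T) : FinGrAlg k ⥤ AddCommGrpCat.{u} where
  obj R := AddCommGrpCat.of (S R)
  map {R T} f := AddCommGrpCat.ofHom (AddMonoidHom.mk' (fun x : S R => (⟨G.map f x, hS f x x.2⟩ : S T))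
    fun x y => Subtype.ext (map_add (G.map f).hom x.1 y.1))
  map_id R := ConcreteCategory.hom_ext _ _ fun x => Subtype.ext (congrArg (fun φ => φ.hom x.1) (G.map_id R))
  map_comp f g := ConcreteCategory.hom_ext _ _ fun x => Subtype.ext
    (congrArg (fun φ => φ.hom x.1) (G.map_comp f g))

/-- Filtered colimits of abelian groups are computed on underlying sets, so a directed family of
subgroups covering each value has `G` as colimit. -/
theorem exists_isColimit_subgroupFunctor {J : Type u} [SmallCategory J] [IsFiltered J]
    (S : J → ∀ R, AddSubgroup (G.obj R))
    (hS : ∀ j {R T} (f : R ⟶ T), ∀ x ∈ S j R, G.map f x ∈ S j T)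
    (hmono : ∀ {i j} (_ : i ⟶ j) R, S i R ≤ S j R) (hsurj : ∀ R x, ∃ j, x ∈ S j R) :
    ∃ (D : J ⥤ FinGrAlg k ⥤ AddCommGrpCat.{u}) (c : Cocone D),
      (∀ j, D.obj j = subgroupFunctor (S j) (hS j)) ∧ Nonempty (IsColimit c) ∧ Nonempty (c.pt ≅ G) := by
  let D : J ⥤ FinGrAlg k ⥤ AddCommGrpCat.{u} :=
    { obj := fun j => subgroupFunctor (S j) (hS j)
      map := fun {i j} f =>
        { app := fun R => AddCommGrpCat.ofHom (AddSubgroup.inclusion (hmono f R))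
          naturality := fun _ _ _ => rfl }
      map_id := fun _ => rfl
      map_comp := fun _ _ => rfl }
  let c : Cocone D :=
    { pt := G
      ι :=
        { app := fun j =>
            { app := fun R => AddCommGrpCat.ofHom (S j R).subtype
              naturality := fun _ _ _ => rfl }
          naturality := fun _ _ _ => rfl } }
  refine ⟨D, c, fun _ => rfl, ⟨evaluationJointlyReflectsColimits c fun R => ?_⟩, ⟨Iso.refl G⟩⟩
  haveI := reflectsColimit_of_reflectsIsomorphisms (D ⋙ (evaluation _ AddCommGrpCat.{u}).obj R)
    (forget AddCommGrpCat.{u})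
  refine isColimitOfReflects (forget AddCommGrpCat.{u}) (Types.FilteredColimit.isColimitOf _ _ ?_ ?_)
  · intro x
    obtain ⟨j, hj⟩ := hsurj R x
    exact ⟨j, (⟨x, hj⟩ : S j R), rfl⟩
  · intro i j x y hxy
    refine ⟨IsFiltered.max i j, IsFiltered.leftToMax i j, IsFiltered.rightToMax i j, Subtype.ext ?_⟩
    exact hxy

section Points

variable {C : GrHopf k} {e : ∀ R : FinGrAlg k, G.obj R ≃ DualCoalgHom R C}
  (hn : ∀ (R S : FinGrAlg k) (f : R ⟶ S) (x : G.obj R), e S (G.map f x) = (e R x).map f)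
  (h0 : ∀ R, e R 0 = DualCoalgHom.trivial R C)
  (ha : ∀ (R : FinGrAlg k) (x y : G.obj R),
    (e R (x + y)).toLin = dconv (e R x).toLin (e R y).toLin)
  (hτ : actBy (tauNat k) G = -𝟙 G) (A : Subalgebra k C.carrier)

include hn hτ in
lemma neg_toLin {R : FinGrAlg k} (x : G.obj R) :
    e R (-x) = (e R x).map ((tauNat k).app R) :=
  (congrArg (e R) (hom_eq_iff.1 hτ R x).symm).trans (hn _ _ _ _)

include hn h0 ha hτ in
lemma conv_tau_of_actBy : conv C.toGrAlg.tau (𝟙 _) = C.triv C.toGrAlg := by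
  refine hom_ext' fun c => ?_
  obtain ⟨R, f, ξ, rfl⟩ := exists_eq_toLin c
  obtain ⟨x, rfl⟩ := (e R).surjective f
  rw [conv_apply, triv_apply, (e R x).counit_apply, Algebra.algebraMap_eq_smul_one]
  refine (LinearMap.congr_fun ((e R x).comp_dconv _ _) ξ).trans ?_
  have h1 : C.toGrAlg.tau.toAlgHom.toLinearMap ∘ₗ (e R x).toLin = (e R (-x)).toLin := by
    rw [neg_toLin hn hτ]
    exact LinearMap.ext fun ξ => tau_toLin (e R x) ξ
  rw [h1]
  refine (LinearMap.congr_fun (ha R (-x) x).symm ξ).trans ?_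
  rw [neg_add_cancel, h0]
  rfl

/-- The points which factor through a subalgebra of the dual Hopf algebra. -/
def ptsIn (R : FinGrAlg k) : AddSubgroup (G.obj R) where
  carrier := {x | LinearMap.range (e R x).toLin ≤ Subalgebra.toSubmodule A}
  zero_mem' := by
    rintro _ ⟨ξ, rfl⟩
    rw [h0]
    exact Subalgebra.smul_mem A A.one_mem (ξ 1)
  add_mem' := by
    rintro x y hx hy _ ⟨ξ, rfl⟩
    rw [ha]
    change LinearMap.mul' k C.carrier (TensorProduct.map _ _ (dualComul R.obj.carrier ξ)) ∈ A
    generalize dualComul R.obj.carrier ξ = z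
    induction z with
    | zero => simp
    | add z z' hz hz' => rw [map_add, map_add]; exact A.add_mem hz hz'
    | tmul η ζ => exact A.mul_mem (hx ⟨η, rfl⟩) (hy ⟨ζ, rfl⟩)
  neg_mem' := by
    rintro x hx _ ⟨ξ, rfl⟩
    rw [neg_toLin hn hτ]
    exact hx ⟨_, rfl⟩

lemma map_mem_ptsIn {R T : FinGrAlg k} (f : R ⟶ T) (x : G.obj R) (hx : x ∈ ptsIn hn h0 ha hτ A R) :
    G.map f x ∈ ptsIn hn h0 ha hτ A T := by
  rintro _ ⟨ξ, rfl⟩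
  rw [hn]
  exact hx ⟨_, rfl⟩

/-- The finite-dimensional subalgebra, being a subcoalgebra, is the image of the dual of an algebra
`B`. Points with values in it factor through this dual, hence are morphisms out of `B`. -/
theorem exists_represents_ptsIn (hA : C.IsSubcoalg (Subalgebra.toSubmodule A))
    [Module.Finite k (Subalgebra.toSubmodule A)] : ∃ H : GrHopf k, Module.Finite k H.carrier ∧
      H.Represents (isFiniteGrAlg k).ι
        (subgroupFunctor (ptsIn hn h0 ha hτ A) (map_mem_ptsIn hn h0 ha hτ A)) := by
  obtain ⟨⟨B, hB⟩, g, hg, hr⟩ := exists_dualCoalgHom_range hA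
  let F := subgroupFunctor (ptsIn hn h0 ha hτ A) (map_mem_ptsIn hn h0 ha hτ A)
  let m : ∀ R : FinGrAlg k, (B ⟶ R.obj) → F.obj R := fun R φ =>
    ⟨(e R).symm (g.map (ObjectProperty.homMk φ)), by
      rintro _ ⟨ξ, rfl⟩
      rw [Equiv.apply_symm_apply, ← hr]
      exact ⟨_, rfl⟩⟩
  have hm : ∀ R, Function.Bijective (m R) := fun R => by
    constructor
    · intro φ ψ h
      have h1 := congrArg DualCoalgHom.toLin ((e R).symm.injective (congrArg Subtype.val h))
      refine hom_ext' fun b => (Module.evalEquiv k R.obj.carrier).injective (LinearMap.ext fun ξ => ?_)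
      exact LinearMap.congr_fun (hg (LinearMap.congr_fun h1 ξ)) b
    · rintro ⟨x, hx⟩
      obtain ⟨φ, hφ⟩ := DualCoalgHom.exists_factor g hg (e R x) (hx.trans hr.ge)
      exact ⟨φ.hom, Subtype.ext ((Equiv.symm_apply_eq _).2 hφ.symm)⟩
  let E : ∀ R, F.obj R ≃ (B ⟶ R.obj) := fun R => (Equiv.ofBijective _ (hm R)).symm
  have hE : ∀ R T (f : R ⟶ T) (x : F.obj R), E T (F.map f x) = E R x ≫ f.hom := fun R T f x => by
    obtain ⟨φ, rfl⟩ := (hm R).2 x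
    rw [show E R (m R φ) = φ from Equiv.ofBijective_symm_apply_apply _ (hm R) φ]
    refine (Equiv.symm_apply_eq _).2 (Subtype.ext ((Equiv.symm_apply_eq _).2 ?_).symm)
    change _ = e T (G.map f ((e R).symm _))
    rw [hn, Equiv.apply_symm_apply]
    rfl
  obtain ⟨H, rfl, h⟩ := exists_hopf_of_points B (isFiniteGrAlg k) hB (FinGrAlg.unitAlg k).property
    (fun T T' hT hT' => (FinGrAlg.tensor ⟨T, hT⟩ ⟨T', hT'⟩).property)
    (fun T hT => F.obj ⟨T, hT⟩) (fun _ _ => inferInstance) (fun T hT => E ⟨T, hT⟩)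
    (fun T T' hT hT' f => F.map (X := ⟨T, hT⟩) (Y := ⟨T', hT'⟩) (ObjectProperty.homMk f))
    (fun T T' hT hT' f x y => map_add (F.map (X := ⟨T, hT⟩) (Y := ⟨T', hT'⟩)
      (ObjectProperty.homMk f)).hom x y)
    (fun T T' hT hT' f x => hE ⟨T, hT⟩ ⟨T', hT'⟩ (ObjectProperty.homMk f) x)
  exact ⟨H, hB, E, hE, fun R x y a => h R.obj R.property x y a⟩

end Points

/-- The Cartier dual is generated by odd primitives. Finitely many of them generate a
finite-dimensional sub-Hopf algebra, and the corresponding represented subgroups exhaust `G`, since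
each point has finite-dimensional range. -/
lemma isOddFormal_of_actBy (hk : (2 : k) ≠ 0) (hG : isFormalGroup k G)
    (hτ : actBy (tauNat k) G = -𝟙 G) (h2 : ∀ R (x : G.obj R), x + x = 0 → x = 0) :
    isOddFormal k G := by
  classical
  obtain ⟨C, hC⟩ := exists_isCartierDual hG
  obtain ⟨e, hn, h0, ha⟩ := hC.exists_equiv
  have htop : Algebra.adjoin k C.oddPrim = ⊤ := by
    refine adjoin_oddPrim_eq_top hk (conv_tau_of_actBy hn h0 ha hτ) fun c hc => ?_
    obtain ⟨R, f, ξ, rfl⟩ := exists_eq_toLin c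
    obtain ⟨x, rfl⟩ := (e R).surjective f
    refine ⟨ξ 1, ?_⟩
    have h1 := (hn _ _ (deg0Hom k R) x).symm.trans
      ((congrArg (e R) (eq_zero_of_deg0 hτ h2 x)).trans (h0 R))
    have h3 := congrArg (fun f : DualCoalgHom R C => f.toLin ξ) h1
    refine (C.toGrAlg.mem_iff_proj.1 hc).symm.trans (((e R x).proj_apply 0 ξ).trans (Eq.trans ?_ h3))
    exact congrArg (e R x).toLin (LinearMap.ext fun a => congrArg ξ (R.obj.deg0_apply a).symm)
  -- Intersecting with the odd primitives allows all finite subsets as indices, which form a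
  -- directed set.
  let A : Finset C.carrier → Subalgebra k C.carrier := fun s => Algebra.adjoin k (↑s ∩ C.oddPrim)
  obtain ⟨D, c, hD, hc, hi⟩ := exists_isColimit_subgroupFunctor
    (fun s => ptsIn hn h0 ha hτ (A s)) (fun s {R T} f x => map_mem_ptsIn hn h0 ha hτ (A s) f x)
    (fun {s t} f R x (hx : LinearMap.range (e R x).toLin ≤ Subalgebra.toSubmodule (A s)) =>
      show LinearMap.range (e R x).toLin ≤ Subalgebra.toSubmodule (A t) from
      fun y hy => Algebra.adjoin_mono (Set.inter_subset_inter_left _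
        (Finset.coe_subset.2 (leOfHom f))) (hx hy))
    (fun R x => by
      obtain ⟨T, hT, hx⟩ := exists_finset_le_adjoin (k := k) (S := C.oddPrim)
        (V := LinearMap.range (e R x).toLin) (htop ▸ le_top)
      refine ⟨T, hx.trans (Algebra.adjoin_mono (Set.subset_inter subset_rfl hT))⟩)
  refine ⟨hG, _, _, inferInstance, D, c, fun s => ?_, hc, hi⟩
  haveI := finite_adjoin_oddPrim (H := C) hk s
  obtain ⟨H, hH, hr⟩ := exists_represents_ptsIn hn h0 ha hτ (A s) (isSubcoalg_adjoin Set.inter_subset_right)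
  rw [hD]
  obtain ⟨E, hE⟩ := represents_iff.1 hr
  refine ⟨H, hH, hr, hE.isOddExterior hk ?_ fun R x hx => ?_⟩
  · exact hom_eq_iff.2 fun R x => Subtype.ext (hom_eq_iff.1 hτ R x.1)
  · exact Subtype.ext (h2 R x.1 (congrArg Subtype.val hx))

end Odd

end

/-! ### The splitting of formal groups -/

noncomputable section

open GrAlg GrHopf

section Formal

variable {k : Type u} [Field k] (p : ℕ) [Fact p.Prime] [CharP k p]
  {G : FinGrAlg k ⥤ AddCommGrpCat.{u}}

/-- Transfers the identities τ + 1 = 0 and p = 0 from the finite exterior pieces to their filtered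
colimit. -/
lemma eq_zero_of_isColimit {E J : Type*} [Category E] [Category J] [Preadditive E] {D : J ⥤ E}
    {c : Cocone D} (hc : IsColimit c) {X : E} (i : c.pt ≅ X) (α : ∀ Y : E, Y ⟶ Y)
    (hα : ∀ {Y Z : E} (f : Y ⟶ Z), α Y ≫ f = f ≫ α Z) (h : ∀ j, α (D.obj j) = 0) : α X = 0 := by
  have h1 : α c.pt = 0 := hc.hom_ext fun j => by rw [← hα, h, zero_comp, comp_zero]
  rw [← i.inv_hom_id_assoc (α X), ← hα, h1, zero_comp, comp_zero]

omit [Fact p.Prime] [CharP k p] in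
lemma nsmul_id_app (R : FinGrAlg k) (x : G.obj R) : (p • 𝟙 G : G ⟶ G).app R x = p • x := by
  rw [NatTrans.app_nsmul]
  rfl

omit [Fact p.Prime] in
lemma isOddFormal_iff (hp : Odd p) : isOddFormal k G ↔
    isFormalGroup k G ∧ actBy (tauNat k) G = -𝟙 G ∧ IsIso (𝟙 G + 𝟙 G) := by
  constructor
  · rintro ⟨h, J, _, _, D, c, hD, ⟨hc⟩, ⟨i⟩⟩
    refine ⟨h, eq_neg_of_add_eq_zero_left
      (eq_zero_of_isColimit hc i (fun X => actBy (tauNat k) X + 𝟙 X) (fun f => ?_) fun j => ?_),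
      isIso_two_iff.2 fun R => bijective_two_of_torsion hp fun x => ⟨1, ?_⟩⟩
    · rw [Preadditive.add_comp, Preadditive.comp_add, actBy_natural, Category.id_comp,
        Category.comp_id]
    · obtain ⟨H, -, hH, h2⟩ := hD j
      obtain ⟨e, he⟩ := represents_iff.1 hH
      refine hom_eq_iff.2 fun R x => (e R).injective ?_
      refine (he.add R _ _).trans (Eq.trans ?_ (he.zero R).symm)
      have h3 : e R ((actBy (tauNat k) (D.obj j)).app R x) = H.toGrAlg.tau ≫ e R x :=
        (he.natural R R ((tauNat k).app R) x).trans (tau_naturality (e R x))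
      refine (congrArg₂ conv h3 (Category.id_comp (e R x)).symm).trans ?_
      rw [← conv_comp, h2.conv_tau, triv_comp]
    -- Exterior groups on primitive generators are killed by `p` itself, which is why the exponent 1
    -- was chosen.
    · have h1 : p • 𝟙 G = 0 := eq_zero_of_isColimit hc i (fun X => p • 𝟙 X)
        (fun f => by rw [Preadditive.nsmul_comp, Preadditive.comp_nsmul, Category.id_comp,
          Category.comp_id]) fun j => by
        obtain ⟨H, -, hH, h2⟩ := hD j
        obtain ⟨e, he⟩ := represents_iff.1 hH
        refine hom_eq_iff.2 fun R x => (e R).injective ?_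
        refine Eq.trans ?_ (he.zero R).symm
        refine (congrArg (e R) (nsmul_id_app p R x)).trans ((he.nsmul p R x).trans ?_)
        rw [h2.npow_eq_triv p, triv_comp]
      rw [pow_one]
      exact (nsmul_id_app p R x).symm.trans (hom_eq_iff.1 h1 R x)
  · rintro ⟨h, hτ, h2⟩
    refine isOddFormal_of_actBy (Ring.two_ne_zero ?_) h hτ fun R x hx =>
      (isIso_two_iff.1 h2 R).1 (hx.trans (add_zero 0).symm)
    rw [ringChar.eq k p]
    rintro rfl
    exact absurd hp (by decide)

variable [PerfectField k]

theorem splitsAs_isFormalGroup (hp : 2 < p) : SplitsAs (isFormalGroup k) (isOddFormal k)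
    (isConnectedFormal k) (isEtaleFormal k) := by
  have hodd : Odd p := (Fact.out : p.Prime).odd_of_ne_two hp.ne'
  have h1 : redNat k p ≫ redNat k p = redNat k p := by
    exact NatTrans.ext (funext fun R => ObjectProperty.hom_ext _ (R.obj.red_red p))
  have h2 : tauNat k ≫ tauNat k = 𝟙 _ := by
    exact NatTrans.ext (funext fun R => ObjectProperty.hom_ext _ R.obj.tau_tau)
  have h3 : redNat k p ≫ tauNat k = redNat k p := by
    exact NatTrans.ext (funext fun R => ObjectProperty.hom_ext _ (R.obj.red_tau p))
  have h4 : ∀ G : FinGrAlg k ⥤ AddCommGrpCat.{u}, actBy (𝟙 _) G = 𝟙 G := fun G =>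
    hom_eq_iff.2 fun R x => congrArg (fun φ => φ.hom x) (G.map_id R)
  exact splitsAs_of_idempotent (isFormalGroup k) _ _ _ (actBy (redNat k p)) (actBy (tauNat k))
    (fun _ _ f _ _ => actBy_natural _ f) (fun _ _ f => actBy_natural _ f)
    (fun _ _ => by rw [actBy_comp, h1]) (fun _ => by rw [actBy_comp, h2, h4])
    (fun _ _ => by rw [actBy_comp, h3])
    (fun _ => isOddFormal_iff p hodd) (fun _ => isConnectedFormal_iff p hp.ne')
    (fun _ => isEtaleFormal_iff p) (fun _ hX => isIso_two_of_actBy_red_eq_zero p hodd hX)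
    (fun _ _ i r hir hX => isFormalGroup_of_retract i r hir hX)
    (fun _ _ hX hY => isFormalGroup_prod hX hY)

end Formal

end

theorem mainTheorem7 (k : Type u) [Field k] [PerfectField k] (p : ℕ) [Fact p.Prime] [CharP k p]
    (hp : 2 < p) :
    SplitsAs (isAffineGroup k) (isOddAffine k) (isUnipotentAffine k) (isMultiplicativeAffine k) ∧
    SplitsAs (isPAdicAffineGroup k p) (isOddAffine k) (isUnipotentAffine k)
      (isPAdicMultiplicativeAffine k p) ∧
    SplitsAs (isFormalGroup k) (isOddFormal k) (isConnectedFormal k) (isEtaleFormal k) :=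
  ⟨splitsAs_isAffineGroup p hp, splitsAs_isPAdicAffineGroup p hp, splitsAs_isFormalGroup p hp⟩
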